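/- Let $F$ and $G$ be arbitrary probability distributions on $(0,\infty)$ (they may have atoms, also common ones), let $T_1,T_2,\dots$ be i.i.d. with law $F$ and $C_1,C_2,\dots$ i.i.d. with law $G$, the sequence $(T_i)$ being independent of $(C_i)$, and put $X_i=\min(T_i,C_i)$, $\Delta_i=\mathbf 1_{\{T_i\le C_i\}}$. Write $S=1-F$, $1-H=(1-G)S$ (so $H$ is the law of $X_i$), $\Lambda(dx)=F(dx)/S(x-)$, and $I_H=\{t>0:H(t-)<1\}$, an interval with right end point $\tau\le\infty$. Below, $\int_0^\tau$ denotes integration over $I_H$ and $\int_x^\tau$ integration over $I_H\cap(x,\infty)$. For a sample of size $n$ let $X_{[1:n]}\le\dots\le X_{[n:n]}$ be the ordered times with censoring indicators $\Delta_{[i:n]}$ (among equal times the uncensored ones come first), and let $\widehat F_n=\sum_{i=1}^n W_i\,\delta_{X_{[i:n]}}$ be the Kaplan--Meier estimator, with weights $$W_i=\frac{\Delta_{[i:n]}}{n}\prod_{j=1}^{i-1}\Bigl(1+\frac{1-\Delta_{[j:n]}}{n-j}\Bigr).$$ Let $K:(0,\infty)^2\to\mathbb R$ be measurable and symmetric,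 and define $$\beta=\int_0^\tau\!\!\int_0^\tau K(x,y)\,d(\widehat F_n-F)(x)\,d(\widehat F_n-F)(y),$$ $$K'(x,y)=K(x,y)-\int_x^\tau K(s,y)\frac{dF(s)}{S(x)}-\int_y^\tau K(x,t)\frac{dF(t)}{S(y)}+\int_x^\tau\!\!\int_y^\tau K(s,t)\frac{dF(t)}{S(y)}\frac{dF(s)}{S(x)}$$ (a term with a vanishing denominator is read as $0$), and, for $(x,r),(x',r')\in I_H\times\{0,1\}$, $$J((x,r),(x',r'))=\int_0^\tau\!\!\int_0^\tau\frac{K'(s,t)}{(1-G(s-))(1-G(t-))}\,dm_{x,r}(s)\,dm_{x',r'}(t),\qquad dm_{x,r}(s)=r\,\delta_x(ds)-\mathbf 1_{\{s\le x\}}\,d\Lambda(s).$$ Assume $$\int_0^\tau\!\!\int_0^\tau\frac{K(x,y)^2}{(1-G(x-))(1-G(y-))}\,dF(x)\,dF(y)<\infty\qquad\text{and}\qquad\int_0^\tau\frac{|K'(x,x)|\,S(x)}{1-H(x-)}\,dF(x)<\infty .$$ **Theorem.** Almost surely, the double integrals defining $\beta$ (for every $n$) and $J((X_i,\Delta_i),(X_j,\Delta_j))$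 (for all $i,j$) converge absolutely, and, as $n\to\infty$, $$\beta=\frac1{n^2}\sum_{i=1}^n\sum_{j=1}^nJ((X_i,\Delta_i),(X_j,\Delta_j))+o_p(n^{-1}),$$ that is, $n\bigl(\beta-n^{-2}\sum_{i,j=1}^nJ((X_i,\Delta_i),(X_j,\Delta_j))\bigr)\to0$ in probability. -/

import Mathlib

open MeasureTheory ProbabilityTheory Filter Set

open scoped ENNReal Topology

namespace KaplanMeier

noncomputable section

/-! ### Right-censored data

`F` is the law of the survival times, `G` the law of the censoring times, both on `(0, ∞)`. -/

/-- `1 - ν(x)`, the survival function of a probability distribution `ν` on the line. -/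
def surv (ν : Measure ℝ) (x : ℝ) : ℝ := ν.real (Ioi x)

/-- `1 - ν(x-)`, the left limit at `x` of the survival function of `ν`. -/
def survLeft (ν : Measure ℝ) (x : ℝ) : ℝ := ν.real (Ici x)

/-- The law `H` of `min(T, C)` for independent `T ∼ F` and `C ∼ G`. -/
def obsLaw (F G : Measure ℝ) : Measure ℝ := (F.prod G).map (fun p => min p.1 p.2)

/-- `I_H = {t > 0 : H(t-) < 1}`. An integral from `0` to `τ = sup {t : 1 - H(t) > 0}` is
an integral over `I_H`, which is `(0, τ]` if `H` has an atom at `τ` and `(0, τ)` otherwise. -/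
def obsRange (F G : Measure ℝ) : Set ℝ := {t | 0 < t ∧ obsLaw F G (Iio t) < 1}

/-- The cumulative hazard measure `dΛ(t) = dF(t) / (1 - F(t-))` on `(0, ∞)`. -/
def hazard (F : Measure ℝ) : Measure ℝ :=
  (F.restrict (Ioi 0)).withDensity (fun t => (F (Ici t))⁻¹)

/-- The observed time `X = min(T, C)`. -/
def obsTime (t c : ℝ) : ℝ := min t c

/-- The censoring indicator `Δ`, equal to `1` if `T ≤ C` and to `0` otherwise. -/
def obsInd (t c : ℝ) : ℝ := if t ≤ c then 1 else 0

/-! ### The Kaplan-Meier estimator of a sample `(x i, δ i)`, `i : Fin n` -/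

/-- The permutation that sorts the sample by increasing time; among equal times the
uncensored observations (`δ = 1`) come before the censored ones (`δ = 0`). -/
def order {n : ℕ} (x δ : Fin n → ℝ) : Equiv.Perm (Fin n) :=
  Tuple.sort (fun i => toLex (x i, 1 - δ i))

/-- The Kaplan-Meier weight of the `i`-th ordered observation. Positions are counted from `0`
here, so position `j` is the `(j + 1)`-st order statistic. -/
def weight {n : ℕ} (x δ : Fin n → ℝ) (i : Fin n) : ℝ :=
  δ (order x δ i) / n *
    ∏ j ∈ Finset.Iio i, (1 + (1 - δ (order x δ j)) / ((n : ℝ) - ((j : ℕ) + 1)))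

/-- The Kaplan-Meier estimator as a measure: it puts the mass `W_i` at the `i`-th order
statistic. -/
def estimator {n : ℕ} (x δ : Fin n → ℝ) : Measure ℝ :=
  ∑ i, ENNReal.ofReal (weight x δ i) • Measure.dirac (x (order x δ i))

/-! ### The second-order error and the kernel of its V-statistic representation -/

/-- The integral of `f` with respect to the difference `μ - ν` of two measures. -/
def integralDiff (μ ν : Measure ℝ) (f : ℝ → ℝ) : ℝ := (∫ x, f x ∂μ) - ∫ x, f x ∂ν

/-- `β = ∫₀^τ ∫₀^τ K(x, y) d(F̂ - F)(x) d(F̂ - F)(y)`, with `F̂` the Kaplan-Meier estimator of the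
sample `(x i, δ i)`. -/
def secondOrderError (K : ℝ → ℝ → ℝ) (F G : Measure ℝ) {n : ℕ} (x δ : Fin n → ℝ) : ℝ :=
  integralDiff ((estimator x δ).restrict (obsRange F G)) (F.restrict (obsRange F G)) fun v =>
    integralDiff ((estimator x δ).restrict (obsRange F G)) (F.restrict (obsRange F G)) fun u =>
      K u v

/-- The part of `I_H` strictly to the right of `x`: the domain of an integral from `x` to `τ`. -/
def obsTail (F G : Measure ℝ) (x : ℝ) : Set ℝ := obsRange F G ∩ Ioi x

/-- The kernel `K' = A₁ A₂ K`, where `(A g)(x) = g(x) - S(x)⁻¹ ∫_x^τ g dF` is the forward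
operator and `S = 1 - F`. -/
def forwardKernel (K : ℝ → ℝ → ℝ) (F G : Measure ℝ) (x y : ℝ) : ℝ :=
  K x y - (∫ s in obsTail F G x, K s y ∂F) / surv F x
    - (∫ t in obsTail F G y, K x t ∂F) / surv F y
    + (∫ s in obsTail F G x, ∫ t in obsTail F G y, K s t ∂F ∂F) / (surv F x * surv F y)

/-- The integrability condition of the degenerate regime (scaling factor `n`). -/
def DegenerateCondition (K : ℝ → ℝ → ℝ) (F G : Measure ℝ) : Prop :=
  (∫⁻ y in obsRange F G, ∫⁻ x in obsRange F G,
      ENNReal.ofReal (K x y ^ 2 / (survLeft G x * survLeft G y)) ∂F ∂F) < ∞ ∧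
  (∫⁻ x in obsRange F G,
      ENNReal.ofReal (|forwardKernel K F G x x| * surv F x / survLeft (obsLaw F G) x) ∂F) < ∞

/-- The positive part `r δ_x` of `dm_{x,r}` on `I_H`. -/
def jumpPart (F G : Measure ℝ) (p : ℝ × ℝ) : Measure ℝ :=
  (ENNReal.ofReal p.2 • Measure.dirac p.1).restrict (obsRange F G)

/-- The negative part `1_{s ≤ x} dΛ(s)` of `dm_{x,r}` on `I_H`. -/
def compensatorPart (F G : Measure ℝ) (p : ℝ × ℝ) : Measure ℝ :=
  (hazard F).restrict (obsRange F G ∩ Iic p.1)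

/-- The integrand `K'(s, t) / ((1 - G(s-)) (1 - G(t-)))`. -/
def weightedKernel (K : ℝ → ℝ → ℝ) (F G : Measure ℝ) (s t : ℝ) : ℝ :=
  forwardKernel K F G s t / (survLeft G s * survLeft G t)

/-- `J((x,r),(x',r')) = ∫₀^τ ∫₀^τ K'(s,t) / ((1 - G(s-)) (1 - G(t-))) dm_{x,r}(s) dm_{x',r'}(t)`,
where `dm_{x,r}(s) = r δ_x(s) - 1_{s ≤ x} dΛ(s)`. -/
def vKernel (K : ℝ → ℝ → ℝ) (F G : Measure ℝ) (p q : ℝ × ℝ) : ℝ :=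
  integralDiff (jumpPart F G q) (compensatorPart F G q) fun t =>
    integralDiff (jumpPart F G p) (compensatorPart F G p) fun s => weightedKernel K F G s t

end

end KaplanMeier

set_option linter.unusedSectionVars false

namespace KaplanMeier

noncomputable section

/-! ### Compensated counting integrals of one observation -/

/-! Write N for the counting measure of the events of a sample, Y(s) for the number at risk, M for N
minus its compensator ∫ Y dΛ, and q(s) = Ŝ(s-)/Y(s) for the Kaplan–Meier mass of an event at s
(`weight_eq_kmJump`). Let A be the forward operator, x the largest observation and R = Ŝ(x)/S(x).
Integration by parts for A gives a pathwise Duhamel identity (`integralDiff_kmMeasure`): ∫ g d(F̂ -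
F) = ∫ q·Ag dM - R ∫_{(x,∞)} g dF. Used in both variables (`integralDiff_integralDiff_kmMeasure`),
it writes β as the double integral of q(s) q(t) K'(s,t) with respect to M, plus two terms that only
see K beyond x. The V-statistic is the same double integral with nq replaced by its limit 1/(1 -
G(s-)). Hence n times the error consists of two double integrals in which one factor is the weight
error nq - 1/(1 - G(s-)), and of two tail terms (`RegularSample.remainder_eq`).

The double integrals are handled by exact moment computations. A process is predictable if, up to
the time of observation j, it does not depend on that observation. Resampling one coordinate then
shows that compensated integrals have mean zero (`IsHazard.integral_mart_predictable`), and an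
isometry and its Fatou extension follow (`IsHazard.lintegral_sampleInt_sq_le`). A double integral is
split into s < t, t < s and s = t. The first two are iterated predictable integrals, bounded in L²
by an energy of K'². The diagonal belongs to a positive random measure and is bounded in L¹ by
|K'(t,t)| (`IsHazard.lintegral_diag_le`). These are the two integrability conditions of the theorem.

The first condition concerns K and not K'. It passes to K' because A is an L² contraction: for one
uncensored T, g(T) - E g(T) = ∫ Ag dM, so the isometry computes a variance. The contraction survives
the increasing weight 1/(1 - G(s-)) by a layer-cake argument (`lintegral_weight_forward_sq_le`).

The weights are controlled by maximal inequalities. Both Y/(n(1 - H(s-))) and Ŝ/S are limits of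
martingales indexed by time, so with high probability they are bounded by a constant, and uniformly
close to 1 where 1 - H(s-) ≥ a. Where 1 - H(s-) < a the weight error is only bounded, but the energy
there is small. `Controlled` packs these bounds. Cutting a process to the controlled times keeps it
predictable and makes it deterministically dominated.

For the tail terms, S(x)(1 - G(x)) ≤ ℓ/n with high probability, and a Cauchy–Schwarz inequality with
weight 1/(1 - G(t-)) gains exactly the powers of n that are needed. Finally the constants c and ℓ
are chosen first, then a, then n. -/

/-- An observation: a time and the indicator of an event. -/
abbrev Obs := ℝ × Bool

/-- The probability that an observation is still at risk at `s`. -/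
def riskProb (μ : Measure Obs) (s : ℝ) : ℝ≥0∞ := μ {z | s ≤ z.1}

/-- `Λ` is the hazard measure of the events under the law `μ`. -/
def IsHazard (μ : Measure Obs) (Λ : Measure ℝ) : Prop :=
  (μ.restrict {z | z.2 = true}).map Prod.fst = Λ.withDensity (riskProb μ)

/-- The integral of `f` with respect to the compensated counting measure of the observation. -/
def mart (Λ : Measure ℝ) (f : ℝ → ℝ) (z : Obs) : ℝ :=
  (if z.2 then f z.1 else 0) - ∫ s in Iic z.1, f s ∂Λ

/-- The mass at `t` of the compensated counting measure of the observation. -/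
def martAtom (Λ : Measure ℝ) (z : Obs) (t : ℝ) : ℝ :=
  (if z.2 ∧ z.1 = t then 1 else 0) - if t ≤ z.1 then Λ.real {t} else 0

lemma antitone_riskProb (μ : Measure Obs) : Antitone (riskProb μ) :=
  fun _ _ h => measure_mono fun _ hz => le_trans h hz

lemma measurable_riskProb (μ : Measure Obs) : Measurable (riskProb μ) :=
  (antitone_riskProb μ).measurable

lemma riskProb_le_one (μ : Measure Obs) [IsProbabilityMeasure μ] (s : ℝ) : riskProb μ s ≤ 1 :=
  prob_le_one

lemma riskProb_ne_top (μ : Measure Obs) [IsProbabilityMeasure μ] (s : ℝ) : riskProb μ s ≠ ∞ :=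
  measure_ne_top _ _

lemma measurableSet_snd_true : MeasurableSet {z : Obs | z.2 = true} :=
  measurable_snd (measurableSet_singleton true)

section Single

variable {μ : Measure Obs} [IsProbabilityMeasure μ] {Λ : Measure ℝ} [SFinite Λ]

lemma IsHazard.lintegral_eq (h : IsHazard μ Λ) {f : ℝ → ℝ≥0∞} (hf : Measurable f) :
    ∫⁻ z in {z : Obs | z.2 = true}, f z.1 ∂μ = ∫⁻ s, riskProb μ s * f s ∂Λ := by
  rw [← lintegral_map hf measurable_fst, h,
    lintegral_withDensity_eq_lintegral_mul _ (measurable_riskProb μ) hf]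
  rfl

lemma IsHazard.integral_eq (h : IsHazard μ Λ) {f : ℝ → ℝ} (hf : Measurable f) :
    ∫ z, (if z.2 then f z.1 else 0) ∂μ = ∫ s, (riskProb μ s).toReal * f s ∂Λ := by
  have h1 : (fun z : Obs => if z.2 then f z.1 else 0)
      = {z : Obs | z.2 = true}.indicator (fun z => f z.1) := by
    ext z; simp [indicator]
  rw [h1, integral_indicator measurableSet_snd_true,
    ← integral_map (φ := Prod.fst) measurable_fst.aemeasurable hf.aestronglyMeasurable, h,
    integral_withDensity_eq_integral_toReal_smul (measurable_riskProb μ)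
      (Eventually.of_forall fun s => (riskProb_ne_top μ s).lt_top)]
  rfl

/-- Markov's inequality, since the risk probability integrates against `Λ` to the probability of an
event. It makes `Λ` finite on level sets of the risk probability although `Λ` may be infinite. -/
lemma IsHazard.mul_measure_le (h : IsHazard μ Λ) (c : ℝ≥0∞) : c * Λ {s | c ≤ riskProb μ s} ≤ 1 := by
  refine (mul_meas_ge_le_lintegral (measurable_riskProb μ) c).trans ?_
  have := h.lintegral_eq (f := fun _ => 1) measurable_const
  simp only [mul_one, lintegral_const, one_mul] at this
  rw [← this]
  simpa using prob_le_one (μ := μ)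

lemma IsHazard.measure_level_lt_top (h : IsHazard μ Λ) {c : ℝ≥0∞} (hc : c ≠ 0) :
    Λ {s | c ≤ riskProb μ s} < ∞ := by
  by_contra hcon
  have := h.mul_measure_le c
  rw [not_lt_top_iff.mp hcon, ENNReal.mul_top hc] at this
  simp at this

/-- If the exceptional set were charged, it would contain a compact set of positive measure. That
compact set lies in [a,∞) for its least point a, where ν[a,∞) = 0. -/
lemma ae_measure_Ici_pos (ν : Measure ℝ) [IsFiniteMeasure ν] : ∀ᵐ x ∂ν, 0 < ν (Ici x) := by
  have hanti : Antitone fun x => ν (Ici x) := fun a b hab => measure_mono (Ici_subset_Ici.2 hab)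
  have hm : MeasurableSet {x | ν (Ici x) = 0} := hanti.measurable (measurableSet_singleton 0)
  rw [ae_iff]
  simp only [not_lt, nonpos_iff_eq_zero]
  by_contra hne
  obtain ⟨K, hKs, hK, hpos⟩ := hm.exists_lt_isCompact (pos_iff_ne_zero.2 hne)
  have hKne : K.Nonempty := by
    rcases K.eq_empty_or_nonempty with rfl | h
    · simp at hpos
    · exact h
  obtain ⟨a, haK, ha⟩ := hK.exists_isLeast hKne
  have h1 : ν K ≤ ν (Ici a) := measure_mono fun x hx => ha hx
  rw [hKs haK] at h1
  exact absurd hpos (not_lt.2 h1)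

lemma ae_riskProb_pos : ∀ᵐ z ∂μ, 0 < riskProb μ z.1 := by
  have : IsProbabilityMeasure (μ.map Prod.fst) :=
    Measure.isProbabilityMeasure_map measurable_fst.aemeasurable
  have := ae_of_ae_map measurable_fst.aemeasurable (ae_measure_Ici_pos (μ.map Prod.fst))
  filter_upwards [this] with z hz
  rwa [Measure.map_apply measurable_fst measurableSet_Ici] at hz

lemma IsHazard.measure_Iic_lt_top (h : IsHazard μ Λ) {x : ℝ} (hx : 0 < riskProb μ x) :
    Λ (Iic x) < ∞ :=
  (measure_mono fun _ hs => antitone_riskProb μ hs).trans_lt (h.measure_level_lt_top hx.ne')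

lemma IsHazard.riskProb_mul_singleton (h : IsHazard μ Λ) (s : ℝ) :
    riskProb μ s * Λ {s} = μ {z | z.2 = true ∧ z.1 = s} := by
  have h1 := congrArg (fun ν => ν {s}) h
  simp only [Measure.map_apply measurable_fst (measurableSet_singleton s),
    withDensity_apply _ (measurableSet_singleton s), lintegral_singleton] at h1
  rw [← h1, Measure.restrict_apply (measurable_fst (measurableSet_singleton s))]
  congr 1
  ext z
  simp [and_comm]

/-- The hazard of an atom is at most `1`, and bounded away from `1` where later observations
have positive probability. -/
lemma IsHazard.singleton_bound (h : IsHazard μ Λ) {s x : ℝ} (hsx : s < x) :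
    (riskProb μ x).toReal ≤ 1 - Λ.real {s} ∨ riskProb μ x = 0 := by
  by_cases hx : riskProb μ x = 0
  · exact Or.inr hx
  left
  have hs : 0 < riskProb μ s := (pos_iff_ne_zero.2 hx).trans_le (antitone_riskProb μ hsx.le)
  have hfin : Λ {s} ≠ ∞ := ((measure_mono (by simp)).trans_lt (h.measure_Iic_lt_top hs)).ne
  -- An event at s and survival up to x > s are disjoint, and both imply being at risk at s.
  have h1 : riskProb μ s * Λ {s} + riskProb μ x ≤ riskProb μ s := by
    rw [h.riskProb_mul_singleton, riskProb, riskProb, ← measure_union]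
    · apply measure_mono
      rintro z (⟨-, hz⟩ | hz)
      · exact hz.ge
      · exact hsx.le.trans hz
    · rw [Set.disjoint_left]
      rintro z ⟨-, rfl⟩ hz
      exact absurd hz (not_le.2 hsx)
    · exact measurable_fst measurableSet_Ici
  have h2 := ENNReal.toReal_mono (riskProb_ne_top μ s) h1
  rw [ENNReal.toReal_add (ENNReal.mul_ne_top (riskProb_ne_top μ s) hfin) (riskProb_ne_top μ x),
    ENNReal.toReal_mul] at h2
  have h3 : (riskProb μ s).toReal ≤ 1 := ENNReal.toReal_mono (by simp) (riskProb_le_one μ s)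
  have h4 : 0 < (riskProb μ s).toReal := ENNReal.toReal_pos hs.ne' (riskProb_ne_top μ s)
  have h5 : 0 ≤ (riskProb μ x).toReal := ENNReal.toReal_nonneg
  change _ ≤ 1 - (Λ {s}).toReal
  set a := (riskProb μ s).toReal
  set b := (Λ {s}).toReal
  -- As a ≤ 1, this yields riskProb x ≤ a(1 - b) ≤ 1 - b.
  have h6 : a * (1 - b) ≥ (riskProb μ x).toReal := by linarith
  nlinarith [mul_nonneg (sub_nonneg.2 h3) (by nlinarith : (0:ℝ) ≤ 1 - b)]

lemma IsHazard.singleton_le_one (h : IsHazard μ Λ) {s : ℝ} (hs : 0 < riskProb μ s) :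
    Λ.real {s} ≤ 1 := by
  have hfin : Λ {s} ≠ ∞ := ((measure_mono (by simp)).trans_lt (h.measure_Iic_lt_top hs)).ne
  have h1 : riskProb μ s * Λ {s} ≤ riskProb μ s := by
    rw [h.riskProb_mul_singleton]
    apply measure_mono
    rintro z ⟨-, hz⟩
    exact hz.ge
  have h2 := ENNReal.toReal_mono (riskProb_ne_top μ s) h1
  rw [ENNReal.toReal_mul] at h2
  have h4 : 0 < (riskProb μ s).toReal := ENNReal.toReal_pos hs.ne' (riskProb_ne_top μ s)
  exact (mul_le_iff_le_one_right h4).1 h2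

/-- The atom at s is the measure of a section of the diagonal, so measurability of sections applies.
-/
lemma measurable_measureReal_singleton : Measurable fun s : ℝ => Λ.real {s} := by
  have h : Measurable fun s : ℝ => Λ (Prod.mk s ⁻¹' {q : ℝ × ℝ | q.2 = q.1}) :=
    measurable_measure_prodMk_left (measurableSet_eq_fun measurable_snd measurable_fst)
  have h2 : ∀ s : ℝ, Prod.mk s ⁻¹' {q : ℝ × ℝ | q.2 = q.1} = {s} := by intro s; ext; simp
  simp only [h2] at h
  exact h.ennreal_toReal

/-! ### Bounded integrands with a support of finite hazard -/

/-- `g` is bounded and supported in a set of finite hazard. -/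
def BddSupp (Λ : Measure ℝ) (c : ℝ) (B : Set ℝ) : Prop := 0 ≤ c ∧ MeasurableSet B ∧ Λ B ≠ ∞

lemma BddSupp.integrable {c : ℝ} {B : Set ℝ} (hB : BddSupp Λ c B) :
    Integrable (B.indicator fun _ => c) Λ :=
  (integrable_indicator_iff hB.2.1).2 (integrableOn_const hB.2.2)

lemma BddSupp.integrable_of_le {c : ℝ} {B : Set ℝ} (hB : BddSupp Λ c B) {f : ℝ → ℝ}
    (hf : AEStronglyMeasurable f Λ) (hfB : ∀ s, |f s| ≤ B.indicator (fun _ => c) s) :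
    Integrable f Λ :=
  hB.integrable.mono' hf (Eventually.of_forall fun s => hfB s)

lemma BddSupp.abs_le {c : ℝ} {B : Set ℝ} (hB : BddSupp Λ c B) {f : ℝ → ℝ}
    (hfB : ∀ s, |f s| ≤ B.indicator (fun _ => c) s) (s : ℝ) : |f s| ≤ c :=
  (hfB s).trans (indicator_le_self' (fun _ _ => hB.1) s)

lemma BddSupp.abs_mart_le {c : ℝ} {B : Set ℝ} (hB : BddSupp Λ c B) {f : ℝ → ℝ}
    (hfB : ∀ s, |f s| ≤ B.indicator (fun _ => c) s) (z : Obs) :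
    |mart Λ f z| ≤ c + c * Λ.real B := by
  have h1 : |if z.2 then f z.1 else 0| ≤ c := by
    split_ifs
    · exact hB.abs_le hfB _
    · simpa using hB.1
  have h2 : |∫ s in Iic z.1, f s ∂Λ| ≤ c * Λ.real B := by
    calc |∫ s in Iic z.1, f s ∂Λ| ≤ ∫ s in Iic z.1, B.indicator (fun _ => c) s ∂Λ :=
          (Real.norm_eq_abs _).symm.trans_le
            (norm_integral_le_of_norm_le hB.integrable.integrableOn (Eventually.of_forall hfB))
      _ ≤ ∫ s, B.indicator (fun _ => c) s ∂Λ :=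
          setIntegral_le_integral hB.integrable
            (Eventually.of_forall fun s => indicator_nonneg (fun _ _ => hB.1) s)
      _ = c * Λ.real B := by
          rw [integral_indicator hB.2.1, setIntegral_const, smul_eq_mul, mul_comm]
  exact (abs_sub _ _).trans (add_le_add h1 h2)

/-- A compensated counting integral with a deterministic integrand has mean zero. -/
lemma IsHazard.integral_mart (h : IsHazard μ Λ) {c : ℝ} {B : Set ℝ} (hB : BddSupp Λ c B)
    {f : ℝ → ℝ} (hf : Measurable f) (hfB : ∀ s, |f s| ≤ B.indicator (fun _ => c) s) :
    ∫ z, mart Λ f z ∂μ = 0 := by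
  have hfint := hB.integrable_of_le hf.aestronglyMeasurable hfB
  -- Fubini over {s ≤ z.1}: the compensator has mean ∫ riskProb·f dΛ, which is also the mean of the
  -- jump term.
  have hprod : Integrable (fun q : Obs × ℝ => (Iic q.1.1).indicator f q.2) (μ.prod Λ) := by
    refine (hfint.norm.comp_snd μ).mono' ?_ (Eventually.of_forall fun q => norm_indicator_le_norm_self _ _)
    have hs : MeasurableSet {q : Obs × ℝ | q.2 ≤ q.1.1} :=
      measurableSet_le measurable_snd (measurable_fst.comp measurable_fst)
    exact ((hf.comp measurable_snd).indicator hs).aestronglyMeasurable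
  have h2 : ∀ z : Obs, ∫ s in Iic z.1, f s ∂Λ = ∫ s, (Iic z.1).indicator f s ∂Λ :=
    fun z => (integral_indicator measurableSet_Iic).symm
  have hint1 : Integrable (fun z : Obs => if z.2 then f z.1 else 0) μ := by
    refine Integrable.of_bound (C := c) ?_ (Eventually.of_forall fun z => ?_)
    · exact (Measurable.ite measurableSet_snd_true (hf.comp measurable_fst)
        measurable_const).aestronglyMeasurable
    · split_ifs
      · exact hB.abs_le hfB _
      · simpa using hB.1
  unfold mart
  rw [integral_sub hint1 (by simpa only [h2] using hprod.integral_prod_left), h.integral_eq hf]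
  simp only [h2]
  rw [integral_integral_swap hprod, sub_eq_zero]
  congr 1
  ext s
  have h3 : ∀ z : Obs, (Iic z.1).indicator f s = {z : Obs | s ≤ z.1}.indicator (fun _ => f s) z := by
    intro z; simp [indicator]
  simp only [h3]
  rw [integral_indicator (s := {z : Obs | s ≤ z.1}) (measurable_fst measurableSet_Ici), setIntegral_const, smul_eq_mul]
  rfl

end Single

/-! ### Double integrals with respect to differences of measures -/

section DoubleDiff

variable {μ₁ ν₁ μ₂ ν₂ : Measure ℝ} [SFinite μ₁] [SFinite ν₁] [SFinite μ₂] [SFinite ν₂]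

/-- The integral of `f` with respect to the product of `μ₁ - ν₁` and `μ₂ - ν₂`. -/
def doubleDiff (μ₁ ν₁ μ₂ ν₂ : Measure ℝ) (f : ℝ × ℝ → ℝ) : ℝ :=
  (∫ q, f q ∂(μ₁.prod μ₂)) - (∫ q, f q ∂(ν₁.prod μ₂))
    - ((∫ q, f q ∂(μ₁.prod ν₂)) - ∫ q, f q ∂(ν₁.prod ν₂))

/-- Integrability for the sums of the measures expresses absolute convergence of the double integral
for the differences. -/
lemma integrable_add_prod_iff {f : ℝ × ℝ → ℝ} :
    Integrable f ((μ₁ + ν₁).prod (μ₂ + ν₂)) ↔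
      (Integrable f (μ₁.prod μ₂) ∧ Integrable f (ν₁.prod μ₂)) ∧
        (Integrable f (μ₁.prod ν₂) ∧ Integrable f (ν₁.prod ν₂)) := by
  rw [Measure.prod_add, Measure.add_prod, Measure.add_prod, integrable_add_measure,
    integrable_add_measure, integrable_add_measure]

lemma doubleDiff_add {f g : ℝ × ℝ → ℝ} (hf : Integrable f ((μ₁ + ν₁).prod (μ₂ + ν₂)))
    (hg : Integrable g ((μ₁ + ν₁).prod (μ₂ + ν₂))) :
    doubleDiff μ₁ ν₁ μ₂ ν₂ (fun q => f q + g q)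
      = doubleDiff μ₁ ν₁ μ₂ ν₂ f + doubleDiff μ₁ ν₁ μ₂ ν₂ g := by
  rw [integrable_add_prod_iff] at hf hg
  unfold doubleDiff
  rw [integral_add hf.1.1 hg.1.1, integral_add hf.1.2 hg.1.2, integral_add hf.2.1 hg.2.1,
    integral_add hf.2.2 hg.2.2]
  ring

lemma integralDiff_integralDiff_right {f : ℝ → ℝ → ℝ}
    (hf : Integrable (Function.uncurry f) ((μ₁ + ν₁).prod (μ₂ + ν₂))) :
    integralDiff μ₂ ν₂ (fun y => integralDiff μ₁ ν₁ fun x => f x y)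
      = doubleDiff μ₁ ν₁ μ₂ ν₂ (Function.uncurry f) := by
  rw [integrable_add_prod_iff] at hf
  obtain ⟨⟨h1, h2⟩, h3, h4⟩ := hf
  simp only [integralDiff, doubleDiff]
  have e1 := integral_sub h1.integral_prod_right h2.integral_prod_right
  have e2 := integral_sub h3.integral_prod_right h4.integral_prod_right
  simp only [Function.uncurry] at e1 e2
  rw [e1, e2,
    integral_prod_symm _ h1, integral_prod_symm _ h2, integral_prod_symm _ h3,
    integral_prod_symm _ h4]
  rfl

lemma integralDiff_integralDiff_left {f : ℝ → ℝ → ℝ}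
    (hf : Integrable (Function.uncurry f) ((μ₁ + ν₁).prod (μ₂ + ν₂))) :
    integralDiff μ₁ ν₁ (fun x => integralDiff μ₂ ν₂ fun y => f x y)
      = doubleDiff μ₁ ν₁ μ₂ ν₂ (Function.uncurry f) := by
  rw [integrable_add_prod_iff] at hf
  obtain ⟨⟨h1, h2⟩, h3, h4⟩ := hf
  simp only [integralDiff, doubleDiff]
  have e1 := integral_sub h1.integral_prod_left h3.integral_prod_left
  have e2 := integral_sub h2.integral_prod_left h4.integral_prod_left
  simp only [Function.uncurry] at e1 e2
  rw [e1, e2,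
    integral_prod _ h1, integral_prod _ h2, integral_prod _ h3,
    integral_prod _ h4]
  simp only [Function.uncurry]
  ring

lemma integralDiff_swap {f : ℝ → ℝ → ℝ}
    (hf : Integrable (Function.uncurry f) ((μ₁ + ν₁).prod (μ₂ + ν₂))) :
    integralDiff μ₂ ν₂ (fun y => integralDiff μ₁ ν₁ fun x => f x y)
      = integralDiff μ₁ ν₁ (fun x => integralDiff μ₂ ν₂ fun y => f x y) :=
  (integralDiff_integralDiff_right hf).trans (integralDiff_integralDiff_left hf).symm

end DoubleDiff

/-- The jump of the counting measure of an observation. -/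
def jumpMeasure (z : Obs) : Measure ℝ := if z.2 then Measure.dirac z.1 else 0

/-- The total variation bound of the compensated counting measure of an observation. -/
def totalMeasure (Λ : Measure ℝ) (z : Obs) : Measure ℝ := jumpMeasure z + Λ.restrict (Iic z.1)

instance (z : Obs) : IsFiniteMeasure (jumpMeasure z) := by
  unfold jumpMeasure; split_ifs <;> infer_instance

instance (Λ : Measure ℝ) [SFinite Λ] (z : Obs) : SFinite (totalMeasure Λ z) := by
  unfold totalMeasure; infer_instance

lemma integral_jumpMeasure (f : ℝ → ℝ) (z : Obs) :
    ∫ s, f s ∂(jumpMeasure z) = if z.2 then f z.1 else 0 := by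
  unfold jumpMeasure
  split_ifs <;> simp

lemma mart_eq_integralDiff (Λ : Measure ℝ) (f : ℝ → ℝ) (z : Obs) :
    mart Λ f z = integralDiff (jumpMeasure z) (Λ.restrict (Iic z.1)) f := by
  rw [integralDiff, integral_jumpMeasure, mart]

lemma integrable_jumpMeasure (f : ℝ → ℝ) (z : Obs) : Integrable f (jumpMeasure z) := by
  unfold jumpMeasure
  split_ifs
  · exact integrable_dirac (by simp)
  · exact integrable_zero_measure

/-- A jump carries no integrability condition, so only the compensator matters. -/
lemma integrable_totalMeasure {Λ : Measure ℝ} {f : ℝ → ℝ} {z : Obs} :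
    Integrable f (totalMeasure Λ z) ↔ IntegrableOn f (Iic z.1) Λ := by
  rw [totalMeasure, integrable_add_measure]
  exact ⟨fun h => h.2, fun h => ⟨integrable_jumpMeasure f z, h⟩⟩

section Mart

variable {Λ : Measure ℝ} [SFinite Λ]

lemma mart_add {f g : ℝ → ℝ} {z : Obs} (hf : IntegrableOn f (Iic z.1) Λ)
    (hg : IntegrableOn g (Iic z.1) Λ) :
    mart Λ (fun s => f s + g s) z = mart Λ f z + mart Λ g z := by
  unfold mart
  rw [integral_add hf hg]
  split_ifs <;> ring

lemma mart_const_mul (c : ℝ) (f : ℝ → ℝ) (z : Obs) :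
    mart Λ (fun s => c * f s) z = c * mart Λ f z := by
  unfold mart
  rw [integral_const_mul]
  split_ifs <;> ring

lemma mart_congr {f g : ℝ → ℝ} {z : Obs} (h : ∀ s ≤ z.1, f s = g s) : mart Λ f z = mart Λ g z := by
  unfold mart
  rw [h z.1 le_rfl, setIntegral_congr_fun measurableSet_Iic fun s hs => h s hs]

lemma mart_finset_sum {κ : Type*} (A : Finset κ) {f : κ → ℝ → ℝ} {z : Obs}
    (hf : ∀ i ∈ A, IntegrableOn (f i) (Iic z.1) Λ) :
    mart Λ (fun s => ∑ i ∈ A, f i s) z = ∑ i ∈ A, mart Λ (f i) z := by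
  unfold mart
  rw [integral_finsetSum A hf, Finset.sum_sub_distrib]
  split_ifs <;> simp

lemma mart_singleton (k : ℝ → ℝ) (z : Obs) (t : ℝ) :
    mart Λ (({t} : Set ℝ).indicator k) z = k t * martAtom Λ z t := by
  have h1 : ∫ s in Iic z.1, ({t} : Set ℝ).indicator k s ∂Λ
      = k t * if t ≤ z.1 then Λ.real {t} else 0 := by
    rw [setIntegral_indicator (measurableSet_singleton t)]
    by_cases ht : t ≤ z.1
    · rw [show Iic z.1 ∩ {t} = {t} from inter_eq_right.2 (by simpa using ht), if_pos ht,
        integral_singleton, smul_eq_mul, mul_comm]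
    · rw [show Iic z.1 ∩ {t} = ∅ by ext; simp; intro h1 h2; exact ht (h2 ▸ h1), if_neg ht]
      simp
  unfold mart martAtom
  rw [h1, mul_sub]
  congr 1
  by_cases h2 : z.2 = true <;> by_cases h3 : z.1 = t <;> simp [h2, h3]

lemma measurable_mart {α : Type*} [MeasurableSpace α] {f : ℝ → α → ℝ}
    (hf : Measurable (Function.uncurry f)) {z : α → Obs} (hz : Measurable z) :
    Measurable fun a => mart Λ (fun s => f s a) (z a) := by
  unfold mart
  refine Measurable.sub (Measurable.ite (hz measurableSet_snd_true)
    (hf.comp ((measurable_fst.comp hz).prodMk measurable_id)) measurable_const) ?_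
  have h2 : ∀ a, ∫ s in Iic (z a).1, f s a ∂Λ = ∫ s, (Iic (z a).1).indicator (fun s => f s a) s ∂Λ :=
    fun a => (integral_indicator measurableSet_Iic).symm
  simp only [h2]
  have hm : Measurable fun q : α × ℝ => (Iic (z q.1).1).indicator (fun s => f s q.1) q.2 := by
    have hs : MeasurableSet {q : α × ℝ | q.2 ≤ (z q.1).1} :=
      measurableSet_le measurable_snd (measurable_fst.comp (hz.comp measurable_fst))
    exact (hf.comp measurable_swap).indicator hs
  exact hm.stronglyMeasurable.integral_prod_right.measurable

lemma measurable_martAtom {α : Type*} [MeasurableSpace α] {z : α → Obs} (hz : Measurable z)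
    {t : α → ℝ} (ht : Measurable t) : Measurable fun a => martAtom Λ (z a) (t a) := by
  unfold martAtom
  refine Measurable.sub (Measurable.ite ?_ measurable_const measurable_const)
    (Measurable.ite (measurableSet_le ht (measurable_fst.comp hz))
      (measurable_measureReal_singleton.comp ht) measurable_const)
  exact (hz measurableSet_snd_true).inter (measurableSet_eq_fun (measurable_fst.comp hz) ht)

/-- A double compensated integral, split into the parts below, above and on the diagonal. -/
lemma mart_mart_split {k : ℝ → ℝ → ℝ} {z z' : Obs}
    (hk : Integrable (Function.uncurry k) ((totalMeasure Λ z).prod (totalMeasure Λ z'))) :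
    mart Λ (fun t => mart Λ (fun s => k s t) z) z'
      = mart Λ (fun t => mart Λ ((Iio t).indicator fun s => k s t) z) z'
        + mart Λ (fun s => mart Λ ((Iio s).indicator fun t => k s t) z') z
        + mart Λ (fun t => k t t * martAtom Λ z t) z' := by
  -- The three pieces live on s < t, t < s and s = t. The second one is integrated in the other
  -- order, so that in both off-diagonal parts the inner variable is the earlier one.
  set k1 : ℝ → ℝ → ℝ := fun s t => (Iio t).indicator (fun s => k s t) s
  set k2 : ℝ → ℝ → ℝ := fun s t => (Iio s).indicator (fun t => k s t) t
  set k3 : ℝ → ℝ → ℝ := fun s t => ({t} : Set ℝ).indicator (fun s => k s t) s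
  have h1 : Integrable (Function.uncurry k1) ((totalMeasure Λ z).prod (totalMeasure Λ z')) :=
    hk.indicator (s := {q : ℝ × ℝ | q.1 < q.2}) (measurableSet_lt measurable_fst measurable_snd)
  have h2 : Integrable (Function.uncurry k2) ((totalMeasure Λ z).prod (totalMeasure Λ z')) :=
    hk.indicator (s := {q : ℝ × ℝ | q.2 < q.1}) (measurableSet_lt measurable_snd measurable_fst)
  have h3 : Integrable (Function.uncurry k3) ((totalMeasure Λ z).prod (totalMeasure Λ z')) :=
    hk.indicator (s := {q : ℝ × ℝ | q.1 = q.2}) (measurableSet_eq_fun measurable_fst measurable_snd)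
  have hsum : Function.uncurry k = fun q => (Function.uncurry k1 q + Function.uncurry k2 q)
      + Function.uncurry k3 q := by
    ext ⟨s, t⟩
    simp only [Function.uncurry, k1, k2, k3, indicator, mem_Iio, mem_singleton_iff]
    rcases lt_trichotomy s t with h | h | h
    · simp [h, h.not_gt, h.ne]
    · simp [h]
    · simp [h, h.not_gt, h.ne']
  have hdiag : ∀ t, k t t * martAtom Λ z t = mart Λ (({t} : Set ℝ).indicator fun s => k s t) z :=
    fun t => (mart_singleton (fun s => k s t) z t).symm
  simp only [hdiag]
  simp only [mart_eq_integralDiff]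
  have e0 := integralDiff_integralDiff_right hk
  have e1 := integralDiff_integralDiff_right h1
  have e2 := integralDiff_integralDiff_left h2
  have e3 := integralDiff_integralDiff_right h3
  have e4 := doubleDiff_add (h1.add h2) h3
  have e5 := doubleDiff_add h1 h2
  simp only [Pi.add_apply] at e4
  rw [hsum] at e0
  erw [e4, e5] at e0
  rw [e0, ← e1, ← e2, ← e3]

end Mart

/-! ### Samples of independent observations -/

section Sample

variable {ι : Type*} [Fintype ι] [DecidableEq ι]
variable {μ : Measure Obs} [IsProbabilityMeasure μ] {Λ : Measure ℝ} [SFinite Λ]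

/-- Replacing one coordinate by an independent copy preserves the product law. This plays the role
of conditioning on the other observations. -/
lemma measurePreserving_update (j : ι) :
    MeasurePreserving (fun q : (ι → Obs) × Obs => Function.update q.1 j q.2)
      ((Measure.pi fun _ : ι => μ).prod μ) (Measure.pi fun _ : ι => μ) := by
  have hm : Measurable (fun q : (ι → Obs) × Obs => Function.update q.1 j q.2) := by
    refine measurable_pi_iff.2 fun i => ?_
    by_cases h : i = j
    · subst h; simpa using measurable_snd
    · simp only [Function.update_of_ne h]
      exact (measurable_pi_apply i).comp measurable_fst
  refine ⟨hm, (Measure.pi_eq fun s hs => ?_).symm⟩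
  rw [Measure.map_apply hm (MeasurableSet.univ_pi hs)]
  have : (fun q : (ι → Obs) × Obs => Function.update q.1 j q.2) ⁻¹' univ.pi s
      = (univ.pi (Function.update s j univ)) ×ˢ s j := by
    ext ⟨ω, z⟩
    simp only [mem_preimage, mem_univ_pi, mem_prod]
    constructor
    · intro h
      refine ⟨fun i => ?_, by simpa using h j⟩
      by_cases hi : i = j
      · subst hi; simp
      · simpa [Function.update_of_ne hi] using h i
    · rintro ⟨h1, h2⟩ i
      by_cases hi : i = j
      · subst hi; simpa using h2
      · simpa [Function.update_of_ne hi] using h1 i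
  rw [this, Measure.prod_prod, Measure.pi_pi, ← Finset.mul_prod_erase Finset.univ _ (Finset.mem_univ j),
    ← Finset.mul_prod_erase Finset.univ (fun i => μ (s i)) (Finset.mem_univ j)]
  simp only [Function.update_self, measure_univ, one_mul]
  rw [mul_comm]
  congr 1
  refine Finset.prod_congr rfl fun i hi => ?_
  rw [Function.update_of_ne (Finset.ne_of_mem_erase hi)]

lemma integral_update (j : ι) {Φ : (ι → Obs) → ℝ} (hΦ : Integrable Φ (Measure.pi fun _ => μ)) :
    ∫ ω, Φ ω ∂(Measure.pi fun _ => μ)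
      = ∫ ω, ∫ z, Φ (Function.update ω j z) ∂μ ∂(Measure.pi fun _ => μ) := by
  have h := measurePreserving_update (μ := μ) j
  have h2 : Integrable (fun q : (ι → Obs) × Obs => Φ (Function.update q.1 j q.2))
      ((Measure.pi fun _ : ι => μ).prod μ) := h.integrable_comp_of_integrable hΦ
  rw [← integral_prod _ h2]
  nth_rewrite 1 [← h.map_eq]
  exact integral_map h.measurable.aemeasurable (by rw [h.map_eq]; exact hΦ.aestronglyMeasurable)

/-- Before the time of observation `j`, the process does not depend on that observation. -/
def PredictableAt (j : ι) (f : ℝ → (ι → Obs) → ℝ) : Prop :=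
  ∀ s ω z, s ≤ (ω j).1 → s ≤ z.1 → f s (Function.update ω j z) = f s ω

/-- A process that is predictable in each observation. -/
def Predictable (f : ℝ → (ι → Obs) → ℝ) : Prop := ∀ j, PredictableAt j f

lemma BddSupp.integrable_mart {c : ℝ} {B : Set ℝ} (hB : BddSupp Λ c B)
    {f : ℝ → (ι → Obs) → ℝ} (hf : Measurable (Function.uncurry f))
    (hfB : ∀ s ω, |f s ω| ≤ B.indicator (fun _ => c) s) (j : ι) :
    Integrable (fun ω => mart Λ (fun s => f s ω) (ω j)) (Measure.pi fun _ => μ) :=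
  Integrable.of_bound (measurable_mart hf (measurable_pi_apply j)).aestronglyMeasurable _
    (Eventually.of_forall fun ω => hB.abs_mart_le (fun s => hfB s ω) (ω j))

/-- Leave-one-out: a compensated integral of a predictable process has mean zero. -/
lemma IsHazard.integral_mart_predictable (h : IsHazard μ Λ) {c : ℝ} {B : Set ℝ}
    (hB : BddSupp Λ c B) {f : ℝ → (ι → Obs) → ℝ} (hf : Measurable (Function.uncurry f))
    (hfB : ∀ s ω, |f s ω| ≤ B.indicator (fun _ => c) s) {j : ι} (hp : PredictableAt j f) :
    ∫ ω, mart Λ (fun s => f s ω) (ω j) ∂(Measure.pi fun _ => μ) = 0 := by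
  rw [integral_update j (hB.integrable_mart hf hfB j)]
  have hinner : ∀ ω : ι → Obs, ∫ z, mart Λ (fun s => f s (Function.update ω j z))
      (Function.update ω j z j) ∂μ = 0 := by
    intro ω
    -- For s up to the resampled time, predictability allows observation j to be placed at s itself.
    -- With the other observations fixed, the integrand is then a deterministic function of s.
    have h1 : ∀ z, mart Λ (fun s => f s (Function.update ω j z)) (Function.update ω j z j)
        = mart Λ (fun s => f s (Function.update ω j (s, true))) z := by
      intro z
      rw [Function.update_self]
      refine mart_congr fun s hs => ?_
      have := hp s (Function.update ω j (s, true)) z (by simp) hs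
      rwa [Function.update_idem] at this
    simp only [h1]
    refine h.integral_mart hB ?_ fun s => hfB _ _
    exact hf.comp (measurable_id.prodMk ((measurable_update ω).comp
      (measurable_id.prodMk measurable_const)))
  simp only [hinner, integral_zero]

end Sample

/-! ### Second moments of predictable integrals with bounded integrands -/

section Sample

variable {ι : Type*} [Fintype ι] [DecidableEq ι]
variable {μ : Measure Obs} [IsProbabilityMeasure μ] {Λ : Measure ℝ} [SFinite Λ]

/-- The integral of `f` with respect to the compensated counting measure of a sample. -/
def sampleInt (Λ : Measure ℝ) (f : ℝ → ℝ) (ω : ι → Obs) : ℝ := ∑ i, mart Λ f (ω i)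

/-- The mass at `t` of the compensated counting measure of a sample. -/
def sampleAtom (Λ : Measure ℝ) (ω : ι → Obs) (t : ℝ) : ℝ := ∑ i, martAtom Λ (ω i) t

/-- The number of observations at risk at `s`. -/
def riskCount (ω : ι → Obs) (s : ℝ) : ℝ := ∑ i, if s ≤ (ω i).1 then 1 else 0

lemma riskCount_nonneg (ω : ι → Obs) (s : ℝ) : 0 ≤ riskCount ω s :=
  Finset.sum_nonneg fun i _ => by split_ifs <;> norm_num

lemma measurable_riskCount : Measurable fun q : ℝ × (ι → Obs) => riskCount q.2 q.1 :=
  Finset.measurable_sum _ fun i _ => Measurable.ite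
    (measurableSet_le measurable_fst (measurable_fst.comp ((measurable_pi_apply i).comp measurable_snd)))
    measurable_const measurable_const

lemma measurable_sampleInt {α : Type*} [MeasurableSpace α] {f : ℝ → α → ℝ}
    (hf : Measurable (Function.uncurry f)) {z : α → ι → Obs} (hz : Measurable z) :
    Measurable fun a => sampleInt Λ (fun s => f s a) (z a) :=
  Finset.measurable_sum _ fun i _ => measurable_mart hf ((measurable_pi_apply i).comp hz)

lemma measurable_sampleAtom {α : Type*} [MeasurableSpace α] {z : α → ι → Obs} (hz : Measurable z)
    {t : α → ℝ} (ht : Measurable t) : Measurable fun a => sampleAtom Λ (z a) (t a) :=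
  Finset.measurable_sum _ fun i _ => measurable_martAtom ((measurable_pi_apply i).comp hz) ht

lemma sum_lintegral_Iic (ω : ι → Obs) {g : ℝ → ℝ} (hg : Measurable g) :
    ∑ j, ∫⁻ s in Iic (ω j).1, ENNReal.ofReal (g s) ∂Λ
      = ∫⁻ s, ENNReal.ofReal (riskCount ω s * g s) ∂Λ := by
  have h1 : ∀ s, ENNReal.ofReal (riskCount ω s * g s)
      = ∑ j, (Iic (ω j).1).indicator (fun s => ENNReal.ofReal (g s)) s := by
    intro s
    rw [ENNReal.ofReal_mul (riskCount_nonneg ω s), riskCount,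
      ENNReal.ofReal_sum_of_nonneg fun i _ => by split_ifs <;> norm_num, Finset.sum_mul]
    refine Finset.sum_congr rfl fun j _ => ?_
    by_cases h : s ≤ (ω j).1 <;> simp [h]
  simp only [h1]
  rw [lintegral_finsetSum _ fun j _ => hg.ennreal_ofReal.indicator measurableSet_Iic]
  refine Finset.sum_congr rfl fun j _ => ?_
  rw [lintegral_indicator measurableSet_Iic]

/-- For one observation the jump of N is 0 or 1, hence dM·ΔM = (1 - 2ΔΛ) dM + (1 - ΔΛ) dΛ on s ≤
z.1. The first term will have mean zero and the second is the variance. -/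
lemma mart_mul_martAtom_self {f : ℝ → ℝ} {z : Obs} (hf : IntegrableOn f (Iic z.1) Λ)
    (hf' : IntegrableOn (fun t => f t * Λ.real {t}) (Iic z.1) Λ) :
    mart Λ (fun t => f t * martAtom Λ z t) z
      = mart Λ (fun t => f t * (1 - 2 * Λ.real {t})) z
        + ∫ t in Iic z.1, f t * (1 - Λ.real {t}) ∂Λ := by
  have h1 : ∫ t in Iic z.1, f t * martAtom Λ z t ∂Λ
      = (if z.2 then f z.1 * Λ.real {z.1} else 0) - ∫ t in Iic z.1, f t * Λ.real {t} ∂Λ := by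
    have e1 : ∀ t ∈ Iic z.1, f t * martAtom Λ z t
        = ({z.1} : Set ℝ).indicator (fun t => if z.2 then f t else 0) t - f t * Λ.real {t} := by
      intro t ht
      simp only [martAtom, if_pos (show t ≤ z.1 from ht)]
      by_cases h2 : z.2 = true <;> by_cases h3 : t = z.1
      · subst h3; simp [h2]; ring
      · simp [h2, h3, Ne.symm h3]
      · simp [h2]
      · simp [h2, h3]
    rw [setIntegral_congr_fun measurableSet_Iic e1, integral_sub _ hf',
      setIntegral_indicator (measurableSet_singleton _),
      show Iic z.1 ∩ {z.1} = {z.1} from inter_eq_right.2 (by simp), integral_singleton]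
    · congr 1
      split_ifs <;> simp [mul_comm]
    · by_cases hz : z.2 = true
      · simp only [hz, if_true]
        exact hf.indicator (measurableSet_singleton _)
      · simp [hz]
  have h2 : ∫ t in Iic z.1, f t * (1 - 2 * Λ.real {t}) ∂Λ
      = (∫ t in Iic z.1, f t ∂Λ) - 2 * ∫ t in Iic z.1, f t * Λ.real {t} ∂Λ := by
    rw [← integral_const_mul, ← integral_sub hf (hf'.const_mul 2)]
    congr 1; ext t; ring
  have h3 : ∫ t in Iic z.1, f t * (1 - Λ.real {t}) ∂Λ
      = (∫ t in Iic z.1, f t ∂Λ) - ∫ t in Iic z.1, f t * Λ.real {t} ∂Λ := by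
    rw [← integral_sub hf hf']
    congr 1; ext t; ring
  unfold mart
  rw [h1, h2, h3]
  by_cases hz : z.2 = true
  · simp [hz, martAtom]; ring
  · simp [hz]; ring

lemma BddSupp.real_singleton_le {c : ℝ} {B : Set ℝ} (hB : BddSupp Λ c B) {t : ℝ} (ht : t ∈ B) :
    Λ.real {t} ≤ Λ.real B :=
  measureReal_mono (by simpa using ht) hB.2.2

lemma BddSupp.mul {c d : ℝ} {B : Set ℝ} (hB : BddSupp Λ c B) (hd : 0 ≤ d) : BddSupp Λ (c * d) B :=
  ⟨mul_nonneg hB.1 hd, hB.2⟩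

lemma abs_mul_le_indicator {c d : ℝ} {B : Set ℝ} {a b t : ℝ}
    (ha : |a| ≤ B.indicator (fun _ => c) t) (hc : 0 ≤ c) (hb : t ∈ B → |b| ≤ d) :
    |a * b| ≤ B.indicator (fun _ => c * d) t := by
  by_cases ht : t ∈ B
  · rw [indicator_of_mem ht] at ha ⊢
    rw [abs_mul]
    exact mul_le_mul ha (hb ht) (abs_nonneg _) hc
  · rw [indicator_of_notMem ht] at ha ⊢
    rw [abs_mul, le_antisymm ha (abs_nonneg _), zero_mul]

lemma abs_martAtom_le (z : Obs) (t : ℝ) : |martAtom Λ z t| ≤ 1 + Λ.real {t} := by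
  unfold martAtom
  have := measureReal_nonneg (μ := Λ) (s := {t})
  split_ifs <;> rw [abs_le] <;> constructor <;> linarith

/-- The mean of the diagonal part of a double integral. -/
lemma IsHazard.integral_diag_bdd (h : IsHazard μ Λ) {c : ℝ} {B : Set ℝ} (hB : BddSupp Λ c B)
    {f : ℝ → (ι → Obs) → ℝ} (hf : Measurable (Function.uncurry f))
    (hfB : ∀ s ω, |f s ω| ≤ B.indicator (fun _ => c) s) (hp : Predictable f) (i j : ι) :
    ∫ ω, mart Λ (fun t => f t ω * martAtom Λ (ω i) t) (ω j) ∂(Measure.pi fun _ => μ)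
      = if i = j then
          ∫ ω, ∫ t in Iic (ω j).1, f t ω * (1 - Λ.real {t}) ∂Λ ∂(Measure.pi fun _ => μ)
        else 0 := by
  have hd : (0:ℝ) ≤ Λ.real B := measureReal_nonneg
  split_ifs with hij
  · subst hij
    have hb1 : ∀ s ω, |f s ω * (1 - 2 * Λ.real {s})|
        ≤ B.indicator (fun _ => c * (1 + 2 * Λ.real B)) s := fun s ω =>
      abs_mul_le_indicator (hfB s ω) hB.1 fun hs => by
        have h1 := hB.real_singleton_le hs
        have h2 := measureReal_nonneg (μ := Λ) (s := {s})
        rw [abs_le]; constructor <;> linarith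
    have hb2 : ∀ s ω, |f s ω * (1 - Λ.real {s})|
        ≤ B.indicator (fun _ => c * (1 + Λ.real B)) s := fun s ω =>
      abs_mul_le_indicator (hfB s ω) hB.1 fun hs => by
        have h1 := hB.real_singleton_le hs
        have h2 := measureReal_nonneg (μ := Λ) (s := {s})
        rw [abs_le]; constructor <;> linarith
    have hb3 : ∀ s ω, |f s ω * Λ.real {s}| ≤ B.indicator (fun _ => c * Λ.real B) s := fun s ω =>
      abs_mul_le_indicator (hfB s ω) hB.1 fun hs => by
        rw [abs_of_nonneg measureReal_nonneg]; exact hB.real_singleton_le hs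
    have hms : Measurable fun q : ℝ × (ι → Obs) => Λ.real {q.1} :=
      measurable_measureReal_singleton.comp measurable_fst
    have hsec : ∀ {g : ℝ → (ι → Obs) → ℝ}, Measurable (Function.uncurry g) → ∀ ω,
        Measurable fun s => g s ω := fun hg ω => hg.comp (measurable_id.prodMk measurable_const)
    have hm1 : Measurable (Function.uncurry fun s ω => f s ω * (1 - 2 * Λ.real {s})) :=
      hf.mul (measurable_const.sub (hms.const_mul 2))
    have hm2 : Measurable (Function.uncurry fun s (ω : ι → Obs) => f s ω * (1 - Λ.real {s})) :=
      hf.mul (measurable_const.sub hms)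
    have hm3 : Measurable (Function.uncurry fun s (ω : ι → Obs) => f s ω * Λ.real {s}) := hf.mul hms
    have hb2' := hB.mul (d := 1 + Λ.real B) (by positivity)
    have hb1' := hB.mul (d := 1 + 2 * Λ.real B) (by positivity)
    have heq : ∀ ω : ι → Obs, mart Λ (fun t => f t ω * martAtom Λ (ω i) t) (ω i)
        = mart Λ (fun t => f t ω * (1 - 2 * Λ.real {t})) (ω i)
          + ∫ t in Iic (ω i).1, f t ω * (1 - Λ.real {t}) ∂Λ := fun ω =>
      mart_mul_martAtom_self
        (hB.integrable_of_le (hsec hf ω).aestronglyMeasurable fun s => hfB s ω).integrableOn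
        ((hB.mul hd).integrable_of_le (hsec hm3 ω).aestronglyMeasurable fun s => hb3 s ω).integrableOn
    have hi2 : Integrable (fun ω : ι → Obs => ∫ t in Iic (ω i).1, f t ω * (1 - Λ.real {t}) ∂Λ)
        (Measure.pi fun _ => μ) := by
      have e := hb2'.integrable_mart (μ := μ) hm2 hb2 i
      have e2 : Integrable (fun ω : ι → Obs => if (ω i).2 then f (ω i).1 ω * (1 - Λ.real {(ω i).1})
          else 0) (Measure.pi fun _ => μ) := by
        refine Integrable.of_bound (C := c * (1 + Λ.real B)) ?_ (Eventually.of_forall fun ω => ?_)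
        · exact (Measurable.ite ((measurable_pi_apply i) measurableSet_snd_true)
            (hm2.comp ((measurable_fst.comp (measurable_pi_apply i)).prodMk measurable_id))
            measurable_const).aestronglyMeasurable
        · split_ifs
          · exact hb2'.abs_le (fun s => hb2 s ω) _
          · simpa using hb2'.1
      refine (e2.sub e).congr (Eventually.of_forall fun ω => ?_)
      simp only [mart, Pi.sub_apply]
      ring
    simp only [heq]
    rw [integral_add (hb1'.integrable_mart hm1 hb1 i) hi2,
      h.integral_mart_predictable hb1' hm1 hb1, zero_add]
    intro s ω z h1 h2
    simp only [hp i s ω z h1 h2]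
  -- For i ≠ j the atom of observation i does not involve observation j, so the integrand is
  -- predictable at j.
  · refine h.integral_mart_predictable (hB.mul (d := 1 + Λ.real B) (by positivity))
      (f := fun t ω => f t ω * martAtom Λ (ω i) t) ?_ ?_ ?_
    · exact hf.mul (measurable_martAtom ((measurable_pi_apply i).comp measurable_snd) measurable_fst)
    · intro s ω
      refine abs_mul_le_indicator (hfB s ω) hB.1 fun hs => ?_
      exact (abs_martAtom_le _ _).trans (by linarith [hB.real_singleton_le hs])
    · intro s ω z h1 h2
      simp only [hp j s ω z h1 h2, Function.update_of_ne hij]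

/-- The restriction to s < t makes the inner integral predictable at j, so the outer integral is
centred. This includes i = j: as long as t is at most its time, the observation has not jumped
before t, and the inner integral is just minus the compensator on (-∞,t). -/
lemma IsHazard.integral_offDiag_bdd (h : IsHazard μ Λ) {c : ℝ} {B : Set ℝ} (hB : BddSupp Λ c B)
    {f : ℝ → (ι → Obs) → ℝ} (hf : Measurable (Function.uncurry f))
    (hfB : ∀ s ω, |f s ω| ≤ B.indicator (fun _ => c) s) (hp : Predictable f) (i j : ι) :
    Integrable (fun ω => mart Λ (fun t => mart Λ ((Iio t).indicator fun s => f s ω * f t ω) (ω i)) (ω j))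
      (Measure.pi fun _ => μ) ∧
    ∫ ω, mart Λ (fun t => mart Λ ((Iio t).indicator fun s => f s ω * f t ω) (ω i)) (ω j)
      ∂(Measure.pi fun _ => μ) = 0 := by
  set g : ℝ → (ι → Obs) → ℝ :=
    fun t ω => f t ω * mart Λ ((Iio t).indicator fun s => f s ω) (ω i) with hg
  have e : ∀ t ω, mart Λ ((Iio t).indicator fun s => f s ω * f t ω) (ω i) = g t ω := by
    intro t ω
    rw [hg]
    simp only
    rw [← mart_const_mul]
    congr 1
    ext s
    by_cases hs : s < t <;> simp [hs, mul_comm]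
  have hd : 0 ≤ c + c * Λ.real B := add_nonneg hB.1 (mul_nonneg hB.1 measureReal_nonneg)
  have hgB : ∀ s ω, |g s ω| ≤ B.indicator (fun _ => c * (c + c * Λ.real B)) s := by
    intro t ω
    refine abs_mul_le_indicator (hfB t ω) hB.1 fun _ => hB.abs_mart_le (fun s => ?_) _
    by_cases hs : s < t
    · rw [indicator_of_mem (show s ∈ Iio t from hs)]; exact hfB s ω
    · rw [indicator_of_notMem (show s ∉ Iio t from hs), abs_zero]
      exact indicator_nonneg (fun _ _ => hB.1) s
  have hgm : Measurable (Function.uncurry g) := by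
    refine hf.mul (measurable_mart (f := fun s (q : ℝ × (ι → Obs)) => (Iio q.1).indicator (fun s => f s q.2) s) ?_
      ((measurable_pi_apply i).comp measurable_snd))
    have hs : MeasurableSet {q : ℝ × (ℝ × (ι → Obs)) | q.1 < q.2.1} :=
      measurableSet_lt measurable_fst (measurable_fst.comp measurable_snd)
    exact (hf.comp (measurable_fst.prodMk (measurable_snd.comp measurable_snd))).indicator hs
  have hgp : PredictableAt j g := by
    intro t ω z h1 h2
    simp only [hg, hp j t ω z h1 h2]
    congr 1
    by_cases hij : i = j
    · subst hij
      rw [Function.update_self]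
      have e1 : ∀ y : Obs, t ≤ y.1 → ∀ k : ℝ → ℝ, mart Λ ((Iio t).indicator k) y
          = - ∫ s in Iio t, k s ∂Λ := by
        intro y hy k
        rw [mart, setIntegral_indicator measurableSet_Iio,
          show Iic y.1 ∩ Iio t = Iio t from inter_eq_right.2 fun s hs => (le_of_lt hs).trans hy]
        simp [hy]
      rw [e1 _ h2, e1 _ h1]
      congr 1
      refine setIntegral_congr_fun measurableSet_Iio fun s hs => ?_
      exact hp i s ω z ((le_of_lt hs).trans h1) ((le_of_lt hs).trans h2)
    · rw [Function.update_of_ne hij]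
      congr 1
      ext s
      by_cases hs : s < t
      · simp only [indicator, mem_Iio, hs, if_true]
        exact hp j s ω z (hs.le.trans h1) (hs.le.trans h2)
      · simp [hs]
  simp only [e]
  exact ⟨(hB.mul hd).integrable_mart hgm hgB j, h.integral_mart_predictable (hB.mul hd) hgm hgB hgp⟩

/-- The second moment of a compensated integral with a bounded predictable integrand. -/
lemma IsHazard.integral_sampleInt_sq_bdd (h : IsHazard μ Λ) {c : ℝ} {B : Set ℝ}
    (hB : BddSupp Λ c B) {f : ℝ → (ι → Obs) → ℝ} (hf : Measurable (Function.uncurry f))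
    (hfB : ∀ s ω, |f s ω| ≤ B.indicator (fun _ => c) s) (hp : Predictable f) :
    ∫ ω, sampleInt Λ (fun s => f s ω) ω ^ 2 ∂(Measure.pi fun _ => μ)
      = ∑ j, ∫ ω, ∫ t in Iic (ω j).1, f t ω ^ 2 * (1 - Λ.real {t}) ∂Λ
          ∂(Measure.pi fun _ : ι => μ) := by
  have hf2B : ∀ s ω, |f s ω ^ 2| ≤ B.indicator (fun _ => c * c) s := fun s ω => by
    rw [sq]; exact abs_mul_le_indicator (hfB s ω) hB.1 fun _ => hB.abs_le (fun s => hfB s ω) s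
  have hf2m : Measurable (Function.uncurry fun s ω => f s ω ^ 2) := hf.pow_const 2
  have hBc := hB.mul hB.1
  have hdiag := fun i j => h.integral_diag_bdd (ι := ι) hBc hf2m hf2B
    (fun j s ω z h1 h2 => by simp only [hp j s ω z h1 h2]) i j
  have hoff := h.integral_offDiag_bdd (ι := ι) hB hf hfB hp
  have hdi : ∀ i j, Integrable (fun ω : ι → Obs =>
      mart Λ (fun t => f t ω ^ 2 * martAtom Λ (ω i) t) (ω j)) (Measure.pi fun _ => μ) := by
    intro i j
    refine (hBc.mul (d := 1 + Λ.real B) (by positivity)).integrable_mart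
      (f := fun t ω => f t ω ^ 2 * martAtom Λ (ω i) t) ?_ ?_ j
    · exact hf2m.mul (measurable_martAtom ((measurable_pi_apply i).comp measurable_snd) measurable_fst)
    · intro s ω
      refine abs_mul_le_indicator (hf2B s ω) hBc.1 fun hs => ?_
      exact (abs_martAtom_le _ _).trans (by linarith [hB.real_singleton_le hs])
  -- The square is a double sum of iterated integrals. Both off-diagonal parts are centred, and of
  -- the diagonal parts only those with i = j have a mean.
  have key : ∀ ω : ι → Obs, sampleInt Λ (fun s => f s ω) ω ^ 2
      = ∑ i, ∑ j, (mart Λ (fun t => mart Λ ((Iio t).indicator fun s => f s ω * f t ω) (ω i)) (ω j)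
        + mart Λ (fun t => mart Λ ((Iio t).indicator fun s => f s ω * f t ω) (ω j)) (ω i)
        + mart Λ (fun t => f t ω ^ 2 * martAtom Λ (ω i) t) (ω j)) := by
    intro ω
    have hfint : Integrable (fun s => f s ω) Λ :=
      hB.integrable_of_le (hf.comp (measurable_id.prodMk measurable_const)).aestronglyMeasurable
        fun s => hfB s ω
    rw [sq, sampleInt, Finset.sum_mul_sum]
    refine Finset.sum_congr rfl fun i _ => Finset.sum_congr rfl fun j _ => ?_
    have e1 : mart Λ (fun s => f s ω) (ω i) * mart Λ (fun s => f s ω) (ω j)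
        = mart Λ (fun t => mart Λ (fun s => f s ω * f t ω) (ω i)) (ω j) := by
      rw [← mart_const_mul]
      congr 1
      ext t
      rw [mul_comm, ← mart_const_mul]
      congr 1
      ext s
      ring
    rw [e1, mart_mart_split (k := fun s t => f s ω * f t ω)]
    · simp only [sq]
      congr 2
      congr 1
      ext t
      congr 1
      ext s
      by_cases hs : s < t <;> simp [hs, mul_comm]
    · have hi : ∀ z, Integrable (fun s => f s ω) (totalMeasure Λ z) :=
        fun z => integrable_totalMeasure.2 hfint.integrableOn
      exact (hi (ω i)).mul_prod (hi (ω j))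
  simp only [key]
  have hI : ∀ i j, Integrable (fun ω : ι → Obs =>
      mart Λ (fun t => mart Λ ((Iio t).indicator fun s => f s ω * f t ω) (ω i)) (ω j)
        + mart Λ (fun t => mart Λ ((Iio t).indicator fun s => f s ω * f t ω) (ω j)) (ω i)
        + mart Λ (fun t => f t ω ^ 2 * martAtom Λ (ω i) t) (ω j)) (Measure.pi fun _ => μ) :=
    fun i j => ((hoff i j).1.add (hoff j i).1).add (hdi i j)
  rw [integral_finsetSum _ fun i _ => integrable_finsetSum _ fun j _ => hI i j]
  simp_rw [integral_finsetSum _ fun j _ => hI _ j]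
  rw [Finset.sum_comm]
  refine Finset.sum_congr rfl fun j _ => ?_
  have : ∀ i, ∫ ω, (mart Λ (fun t => mart Λ ((Iio t).indicator fun s => f s ω * f t ω) (ω i)) (ω j)
        + mart Λ (fun t => mart Λ ((Iio t).indicator fun s => f s ω * f t ω) (ω j)) (ω i)
        + mart Λ (fun t => f t ω ^ 2 * martAtom Λ (ω i) t) (ω j)) ∂(Measure.pi fun _ => μ)
      = if i = j then
          ∫ ω, ∫ t in Iic (ω j).1, f t ω ^ 2 * (1 - Λ.real {t}) ∂Λ ∂(Measure.pi fun _ => μ)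
        else 0 := by
    intro i
    have e0 : Integrable (fun ω : ι → Obs =>
        mart Λ (fun t => mart Λ ((Iio t).indicator fun s => f s ω * f t ω) (ω i)) (ω j)
        + mart Λ (fun t => mart Λ ((Iio t).indicator fun s => f s ω * f t ω) (ω j)) (ω i))
        (Measure.pi fun _ => μ) := (hoff i j).1.add (hoff j i).1
    rw [integral_add e0 (hdi i j), integral_add (hoff i j).1 (hoff j i).1,
      (hoff i j).2, (hoff j i).2, hdiag i j]
    simp
  simp only [this]
  simp

end Sample

/-! ### Moment bounds for general predictable integrands -/

section Sample

variable {ι : Type*} [Fintype ι] [DecidableEq ι]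
variable {μ : Measure Obs} [IsProbabilityMeasure μ] {Λ : Measure ℝ} [SFinite Λ]

lemma ofReal_integral_le_lintegral {α : Type*} [MeasurableSpace α] {ν : Measure α} (f : α → ℝ) :
    ENNReal.ofReal (∫ a, f a ∂ν) ≤ ∫⁻ a, ENNReal.ofReal (f a) ∂ν := by
  by_cases hf : Integrable f ν
  · rw [integral_eq_lintegral_pos_part_sub_lintegral_neg_part hf]
    refine (ENNReal.ofReal_le_ofReal (sub_le_self _ ENNReal.toReal_nonneg)).trans ?_
    exact ENNReal.ofReal_toReal_le
  · rw [integral_undef hf]; simp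

/-- The jumps of a sample and their compensator. -/
def jumpSum (ω : ι → Obs) : Measure ℝ := ∑ j, jumpMeasure (ω j)

/-- The compensator of the jumps of a sample. -/
def compSum (Λ : Measure ℝ) (ω : ι → Obs) : Measure ℝ := ∑ j, Λ.restrict (Iic (ω j).1)

instance (ω : ι → Obs) : IsFiniteMeasure (jumpSum ω) := by
  unfold jumpSum; infer_instance

lemma sampleInt_eq {f : ℝ → ℝ} {ω : ι → Obs} (hf : ∀ j, IntegrableOn f (Iic (ω j).1) Λ) :
    sampleInt Λ f ω = (∫ t, f t ∂(jumpSum ω)) - ∫ t, f t ∂(compSum Λ ω) := by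
  rw [jumpSum, compSum, integral_finsetSum_measure fun j _ => integrable_jumpMeasure f _,
    integral_finsetSum_measure fun j _ => hf j, ← Finset.sum_sub_distrib]
  refine Finset.sum_congr rfl fun j _ => ?_
  rw [integral_jumpMeasure, mart]

lemma sampleAtom_eq {ω : ι → Obs} (hfin : ∀ j, Λ (Iic (ω j).1) ≠ ∞) (t : ℝ) :
    sampleAtom Λ ω t = (jumpSum ω).real {t} - (compSum Λ ω).real {t} := by
  have h1 : (jumpSum ω).real {t} = ∑ j, (jumpMeasure (ω j)).real {t} := by
    simp [jumpSum, Measure.real, ENNReal.toReal_sum]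
  have h2 : (compSum Λ ω).real {t} = ∑ j, (Λ.restrict (Iic (ω j).1)).real {t} := by
    simp only [compSum, Measure.real, Measure.finsetSum_apply]
    rw [ENNReal.toReal_sum]
    intro j _
    exact (((measure_mono (subset_univ _)).trans (by rw [Measure.restrict_apply_univ])).trans_lt
      (hfin j).lt_top).ne
  rw [h1, h2, ← Finset.sum_sub_distrib, sampleAtom]
  refine Finset.sum_congr rfl fun j _ => ?_
  rw [martAtom]
  congr 1
  · unfold jumpMeasure
    by_cases h : (ω j).2 = true <;> by_cases h' : (ω j).1 = t <;>
      simp [h, h', Measure.real]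
  · rw [measureReal_restrict_apply (measurableSet_singleton t)]
    by_cases h : t ≤ (ω j).1
    · rw [if_pos h, inter_eq_left.2 (by simpa using h)]
    · rw [if_neg h, show ({t} : Set ℝ) ∩ Iic (ω j).1 = ∅ by
        ext u; simp; rintro rfl; exact not_le.1 h]
      simp

lemma abs_sampleAtom_le {ω : ι → Obs} {t : ℝ} (h1 : Λ.real {t} ≤ 1) :
    |sampleAtom Λ ω t| ≤ Fintype.card ι * 2 := by
  refine (Finset.abs_sum_le_sum_abs _ _).trans ?_
  refine (Finset.sum_le_card_nsmul _ _ 2 fun i _ =>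
    (abs_martAtom_le _ _).trans (by linarith)).trans ?_
  simp

lemma integrableOn_mul_sampleAtom {ω : ι → Obs} {g : ℝ → ℝ} {x : ℝ}
    (hg : IntegrableOn g (Iic x) Λ) (hΛ : ∀ t ≤ x, Λ.real {t} ≤ 1) :
    IntegrableOn (fun t => g t * sampleAtom Λ ω t) (Iic x) Λ := by
  refine Integrable.mono' (hg.norm.mul_const (Fintype.card ι * 2 : ℝ)) ?_ ?_
  · exact hg.aestronglyMeasurable.mul
      (measurable_sampleAtom measurable_const measurable_id).aestronglyMeasurable
  · filter_upwards [ae_restrict_mem measurableSet_Iic] with t ht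
    rw [norm_mul]
    exact mul_le_mul_of_nonneg_left (abs_sampleAtom_le (hΛ t ht)) (norm_nonneg _)

/-- The diagonal part of the squared compensated counting measure is a positive measure. -/
lemma sampleInt_mul_sampleAtom_nonneg {ω : ι → Obs} {g : ℝ → ℝ} (hg0 : ∀ t, 0 ≤ g t)
    (hg : ∀ j, IntegrableOn g (Iic (ω j).1) Λ) (hfin : ∀ j, Λ (Iic (ω j).1) ≠ ∞)
    (hΛ : ∀ j, ∀ t ≤ (ω j).1, Λ.real {t} ≤ 1) :
    0 ≤ sampleInt Λ (fun t => g t * sampleAtom Λ ω t) ω := by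
  have hI := fun j => integrableOn_mul_sampleAtom (ω := ω) (hg j) (hΛ j)
  rw [sampleInt_eq hI]
  have hfinA : IsFiniteMeasure (compSum Λ ω) := by
    refine ⟨?_⟩
    simp only [compSum, Measure.finsetSum_apply, Measure.restrict_apply_univ]
    exact ENNReal.sum_lt_top.2 fun j _ => (hfin j).lt_top
  set N := jumpSum ω with hN
  set A := compSum Λ ω with hA
  set f : ℝ → ℝ := fun t => g t * sampleAtom Λ ω t with hf
  have hfA : Integrable f A := integrable_finsetSum_measure.2 fun j _ => hI j
  have hfN : Integrable f N := integrable_finsetSum_measure.2 fun j _ => integrable_jumpMeasure f _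
  -- C is the countable set of atoms of the compensator. Outside C the atom of N - A is that of N,
  -- and on C the difference of the integrals is a sum of terms g(t)(N{t} - A{t})².
  have hC : {t : ℝ | 0 < A {t}}.Countable :=
    Measure.countable_meas_level_set_pos (μ := A) (g := id) measurable_id
  set C := {t : ℝ | 0 < A {t}} with hCdef
  have hCm : MeasurableSet C := hC.measurableSet
  have hsub : ∀ t ∉ C, f t = g t * N.real {t} := by
    intro t ht
    have : A {t} = 0 := by simpa [hCdef] using ht
    simp only [hf]
    rw [sampleAtom_eq hfin, ← hN, ← hA, Measure.real, Measure.real, this]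
    simp
  have hNzero : ∀ t ∉ Finset.univ.image (fun j => (ω j).1), N.real {t} = 0 := by
    intro t ht
    have : N {t} = 0 := by
      rw [hN, jumpSum, Measure.finsetSum_apply]
      refine Finset.sum_eq_zero fun j _ => ?_
      unfold jumpMeasure
      split_ifs
      · have : (ω j).1 ≠ t := fun h => ht (by simpa using ⟨j, h⟩)
        simp [this]
      · simp
    simp [Measure.real, this]
  -- Off C the integrand vanishes except at the finitely many observed times, none of which is
  -- charged by A.
  have h1 : ∫ t in Cᶜ, f t ∂A = 0 := by
    rw [setIntegral_congr_fun hCm.compl fun t ht => hsub t ht]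
    refine integral_eq_zero_of_ae ?_
    have hz : A ((Finset.univ.image (fun j => (ω j).1) : Finset ℝ) ∩ Cᶜ : Set ℝ) = 0 := by
      refine (measure_null_iff_singleton ((Finset.countable_toSet _).mono inter_subset_left)).2 ?_
      rintro t ⟨-, ht⟩
      simpa [hCdef] using ht
    rw [EventuallyEq, ae_restrict_iff' hCm.compl]
    refine measure_mono_null ?_ hz
    intro t ht
    simp only [mem_compl_iff, mem_ofPred_eq, Classical.not_imp, Pi.zero_apply] at ht
    refine ⟨?_, ht.1⟩
    by_contra hcon
    exact ht.2 (by rw [hNzero t hcon, mul_zero])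
  have h2 : 0 ≤ ∫ t in Cᶜ, f t ∂N := by
    refine setIntegral_nonneg hCm.compl fun t ht => ?_
    rw [hsub t ht]
    exact mul_nonneg (hg0 t) measureReal_nonneg
  have h3 : ∫ t in C, f t ∂A ≤ ∫ t in C, f t ∂N := by
    have hs : ∀ ν : Measure ℝ, Integrable f ν →
        HasSum (fun t : C => ν.real {(t : ℝ)} * f t) (∫ t in C, f t ∂ν) := by
      intro ν hν
      have : Countable C := hC
      have := hasSum_integral_iUnion (μ := ν) (f := f) (s := fun t : C => {(t : ℝ)})
        (fun t => measurableSet_singleton _)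
        (fun a b hab => disjoint_singleton.2 fun h => hab (Subtype.ext h)) hν.integrableOn
      simpa only [iUnion_of_singleton_coe, integral_singleton, smul_eq_mul] using this
    refine hasSum_le (fun t => ?_) (hs A hfA) (hs N hfN)
    simp only [hf]
    rw [sampleAtom_eq hfin, ← hN, ← hA]
    nlinarith [mul_nonneg (hg0 t) (sq_nonneg (N.real {(t : ℝ)} - A.real {(t : ℝ)}))]
  rw [← integral_add_compl hCm hfN, ← integral_add_compl hCm hfA]
  linarith

/-- On (-∞,x) the factor 1 - ΔΛ is at least the risk probability at x and can be removed. At x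
itself it may vanish, but a single point of finite mass does no harm. -/
lemma integrableOn_of_lintegral_hazard (h : IsHazard μ Λ) {g : ℝ → ℝ} (hgm : Measurable g)
    (hg0 : ∀ t, 0 ≤ g t) {x : ℝ} (hx : 0 < riskProb μ x)
    (hg : ∫⁻ t in Iic x, ENNReal.ofReal (g t * (1 - Λ.real {t})) ∂Λ ≠ ∞) :
    IntegrableOn g (Iic x) Λ := by
  have hfin := h.measure_Iic_lt_top hx
  have hp : 0 < (riskProb μ x).toReal := ENNReal.toReal_pos hx.ne' (riskProb_ne_top μ x)
  rw [← Iio_union_right, integrableOn_union]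
  refine ⟨?_, ?_⟩
  · have hm : Measurable fun t => g t * (1 - Λ.real {t}) :=
      hgm.mul (measurable_const.sub measurable_measureReal_singleton)
    have h1 : IntegrableOn (fun t => g t * (1 - Λ.real {t})) (Iio x) Λ := by
      refine ⟨hm.aestronglyMeasurable, ?_⟩
      rw [hasFiniteIntegral_iff_ofReal]
      · exact (lintegral_mono_set Iio_subset_Iic_self).trans_lt hg.lt_top
      · filter_upwards [ae_restrict_mem measurableSet_Iio] with t ht
        rcases h.singleton_bound ht with h1 | h1
        · exact mul_nonneg (hg0 t) (hp.le.trans h1)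
        · exact absurd h1 hx.ne'
    refine (h1.const_mul (riskProb μ x).toReal⁻¹).mono' hgm.aestronglyMeasurable ?_
    filter_upwards [ae_restrict_mem measurableSet_Iio] with t ht
    rcases h.singleton_bound ht with h1 | h1
    · rw [Real.norm_of_nonneg (hg0 t), mul_left_comm]
      refine le_mul_of_one_le_right (hg0 t) ?_
      rw [inv_mul_eq_div, one_le_div hp]
      exact h1
    · exact absurd h1 hx.ne'
  · exact integrableOn_singleton (hx := (measure_mono (singleton_subset_iff.2 self_mem_Iic)).trans_lt hfin)

lemma ae_forall_riskProb_pos : ∀ᵐ ω ∂(Measure.pi fun _ : ι => μ), ∀ j, 0 < riskProb μ (ω j).1 := by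
  rw [ae_all_iff]
  intro j
  exact (measurePreserving_eval (fun _ : ι => μ) j).quasiMeasurePreserving.ae
    (ae_riskProb_pos (μ := μ))

/-- Truncation of an integrand to a bounded one with a support of finite hazard. -/
def truncIntegrand (μ : Measure Obs) (f : ℝ → (ι → Obs) → ℝ) (k : ℕ) (s : ℝ) (ω : ι → Obs) : ℝ :=
  if |f s ω| ≤ k ∧ ((k : ℝ≥0∞) + 1)⁻¹ ≤ riskProb μ s then f s ω else 0

lemma measurable_truncIntegrand {f : ℝ → (ι → Obs) → ℝ} (hf : Measurable (Function.uncurry f))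
    (k : ℕ) : Measurable (Function.uncurry (truncIntegrand μ f k)) := by
  refine Measurable.ite (MeasurableSet.inter ?_ ?_) hf measurable_const
  · exact measurableSet_le hf.abs measurable_const
  · exact measurableSet_le measurable_const ((measurable_riskProb μ).comp measurable_fst)

lemma Predictable.truncIntegrand {f : ℝ → (ι → Obs) → ℝ} (hf : Predictable f) (k : ℕ) :
    Predictable (truncIntegrand μ f k) := by
  intro j s ω z h1 h2
  simp only [KaplanMeier.truncIntegrand, hf j s ω z h1 h2]

lemma IsHazard.bddSupp_level (h : IsHazard μ Λ) (k : ℕ) :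
    BddSupp Λ k {s | ((k : ℝ≥0∞) + 1)⁻¹ ≤ riskProb μ s} :=
  ⟨k.cast_nonneg, measurableSet_le measurable_const (measurable_riskProb μ),
    (h.measure_level_lt_top (by simp)).ne⟩

lemma abs_truncIntegrand_le_indicator (f : ℝ → (ι → Obs) → ℝ) (k : ℕ) (s : ℝ) (ω : ι → Obs) :
    |truncIntegrand μ f k s ω| ≤
      {s | ((k : ℝ≥0∞) + 1)⁻¹ ≤ riskProb μ s}.indicator (fun _ => (k : ℝ)) s := by
  unfold truncIntegrand
  split_ifs with h
  · rw [indicator_of_mem (by exact h.2)]; exact h.1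
  · rw [abs_zero]; exact indicator_nonneg (fun _ _ => k.cast_nonneg) s

lemma abs_truncIntegrand_le (f : ℝ → (ι → Obs) → ℝ) (k : ℕ) (s : ℝ) (ω : ι → Obs) :
    |truncIntegrand μ f k s ω| ≤ |f s ω| := by
  unfold truncIntegrand
  split_ifs <;> simp

lemma tendsto_truncIntegrand (f : ℝ → (ι → Obs) → ℝ) {s : ℝ} (hs : 0 < riskProb μ s)
    (ω : ι → Obs) : Tendsto (fun k => truncIntegrand μ f k s ω) atTop (𝓝 (f s ω)) := by
  obtain ⟨k1, hk1⟩ := exists_nat_ge |f s ω|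
  obtain ⟨k2, hk2⟩ := ENNReal.exists_inv_nat_lt hs.ne'
  refine tendsto_const_nhds.congr' ?_
  filter_upwards [eventually_ge_atTop (max k1 k2)] with k hk
  unfold truncIntegrand
  rw [if_pos]
  refine ⟨hk1.trans (by exact_mod_cast (le_max_left _ _).trans hk), ?_⟩
  refine le_trans (ENNReal.inv_le_inv.2 ?_) hk2.le
  have : (k2 : ℝ≥0∞) ≤ k := by exact_mod_cast (le_max_right _ _).trans hk
  exact this.trans le_self_add

lemma tendsto_mart {f : ℝ → ℝ} {F : ℕ → ℝ → ℝ} {z : Obs} (hF : ∀ k, Measurable (F k))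
    (hf : IntegrableOn f (Iic z.1) Λ) (hle : ∀ k s, |F k s| ≤ |f s|)
    (hlim : ∀ s ≤ z.1, Tendsto (fun k => F k s) atTop (𝓝 (f s))) :
    Tendsto (fun k => mart Λ (F k) z) atTop (𝓝 (mart Λ f z)) := by
  unfold mart
  refine Tendsto.sub ?_ ?_
  · split_ifs
    · exact hlim _ le_rfl
    · exact tendsto_const_nhds
  · refine tendsto_integral_of_dominated_convergence (fun s => |f s|)
      (fun k => (hF k).aestronglyMeasurable) hf.abs
      (fun k => Eventually.of_forall fun s => hle k s) ?_
    filter_upwards [ae_restrict_mem measurableSet_Iic] with s hs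
    exact hlim s hs

lemma measurable_section {α : Type*} [MeasurableSpace α] {f : ℝ → α → ℝ}
    (hf : Measurable (Function.uncurry f)) (a : α) : Measurable fun s => f s a :=
  hf.comp (measurable_id.prodMk measurable_const)

lemma measurable_energy {f : ℝ → (ι → Obs) → ℝ} (hf : Measurable (Function.uncurry f)) :
    Measurable fun q : (ι → Obs) × ℝ =>
      ENNReal.ofReal (riskCount q.1 q.2 * (f q.2 q.1 * (1 - Λ.real {q.2}))) :=
  ((measurable_riskCount.comp measurable_swap).mul ((hf.comp measurable_swap).mul
    (measurable_const.sub (measurable_measureReal_singleton.comp measurable_snd)))).ennreal_ofReal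

lemma ae_lintegral_Iic_ne_top {f : ℝ → (ι → Obs) → ℝ} (hf : Measurable (Function.uncurry f))
    (hfin : ∫⁻ ω, ∫⁻ s, ENNReal.ofReal (riskCount ω s * (f s ω * (1 - Λ.real {s}))) ∂Λ
      ∂(Measure.pi fun _ : ι => μ) ≠ ∞) :
    ∀ᵐ ω ∂(Measure.pi fun _ : ι => μ), ∀ j,
      ∫⁻ s in Iic (ω j).1, ENNReal.ofReal (f s ω * (1 - Λ.real {s})) ∂Λ ≠ ∞ := by
  filter_upwards [ae_lt_top (measurable_energy (ι := ι) (Λ := Λ) hf).lintegral_prod_right' hfin]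
    with ω hω j
  have hm : Measurable fun s => f s ω * (1 - Λ.real {s}) :=
    (measurable_section hf ω).mul (measurable_const.sub measurable_measureReal_singleton)
  rw [← sum_lintegral_Iic ω hm] at hω
  exact ((ENNReal.sum_lt_top.1 hω) j (Finset.mem_univ j)).ne

lemma ofReal_sum_integral_le {G : ℝ → (ι → Obs) → ℝ} (hG : Measurable (Function.uncurry G)) :
    ENNReal.ofReal (∑ j, ∫ ω, ∫ t in Iic (ω j).1, G t ω * (1 - Λ.real {t}) ∂Λ
        ∂(Measure.pi fun _ : ι => μ))
      ≤ ∫⁻ ω, ∫⁻ s, ENNReal.ofReal (riskCount ω s * (G s ω * (1 - Λ.real {s}))) ∂Λ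
        ∂(Measure.pi fun _ : ι => μ) := by
  have hGm : Measurable fun q : (ι → Obs) × ℝ => ENNReal.ofReal (G q.2 q.1 * (1 - Λ.real {q.2})) :=
    ((hG.comp measurable_swap).mul
      (measurable_const.sub (measurable_measureReal_singleton.comp measurable_snd))).ennreal_ofReal
  have hm : ∀ j : ι, Measurable fun ω : ι → Obs =>
      ∫⁻ t in Iic (ω j).1, ENNReal.ofReal (G t ω * (1 - Λ.real {t})) ∂Λ := by
    intro j
    simp only [← lintegral_indicator measurableSet_Iic]
    refine Measurable.lintegral_prod_right' (f := fun q : (ι → Obs) × ℝ => (Iic (q.1 j).1).indicator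
      (fun t => ENNReal.ofReal (G t q.1 * (1 - Λ.real {t}))) q.2) ?_
    exact hGm.indicator (s := {q : (ι → Obs) × ℝ | q.2 ≤ (q.1 j).1}) (measurableSet_le measurable_snd
      (measurable_fst.comp ((measurable_pi_apply j).comp measurable_fst)))
  have hsum : ∀ A : Finset ι, ENNReal.ofReal (∑ j ∈ A, ∫ ω, ∫ t in Iic (ω j).1,
      G t ω * (1 - Λ.real {t}) ∂Λ ∂(Measure.pi fun _ : ι => μ)) ≤ ∑ j ∈ A, ENNReal.ofReal
        (∫ ω, ∫ t in Iic (ω j).1, G t ω * (1 - Λ.real {t}) ∂Λ ∂(Measure.pi fun _ : ι => μ)) := by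
    intro A
    induction A using Finset.induction_on with
    | empty => simp
    | insert a A ha ih =>
      rw [Finset.sum_insert ha, Finset.sum_insert ha]
      exact ENNReal.ofReal_add_le.trans (add_le_add le_rfl ih)
  refine (hsum _).trans ?_
  calc _ ≤ ∑ j, ∫⁻ ω, ∫⁻ t in Iic (ω j).1, ENNReal.ofReal (G t ω * (1 - Λ.real {t})) ∂Λ
          ∂(Measure.pi fun _ : ι => μ) :=
        Finset.sum_le_sum fun j _ => (ofReal_integral_le_lintegral _).trans
          (lintegral_mono fun ω => ofReal_integral_le_lintegral _)
    _ = _ := by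
        rw [← lintegral_finsetSum _ fun j _ => hm j]
        refine lintegral_congr fun ω => sum_lintegral_Iic ω ?_
        exact (measurable_section hG ω).mul (measurable_const.sub measurable_measureReal_singleton)

/-- Here e stands for 1 - ΔΛ, whose sign is unknown where nobody can be at risk. For negative e the
left side is truncated to zero. -/
lemma ofReal_energy_mono {y a b e : ℝ} (hy : 0 ≤ y) (ha : 0 ≤ a) (hab : a ≤ b) :
    ENNReal.ofReal (y * (a * e)) ≤ ENNReal.ofReal (y * (b * e)) := by
  rcases le_total 0 e with he | he
  · gcongr
  · rw [ENNReal.ofReal_of_nonpos]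
    · exact zero_le
    · exact mul_nonpos_of_nonneg_of_nonpos hy (mul_nonpos_of_nonneg_of_nonpos ha he)

lemma BddSupp.abs_sampleInt_le {c : ℝ} {B : Set ℝ} (hB : BddSupp Λ c B) {f : ℝ → ℝ}
    (hfB : ∀ s, |f s| ≤ B.indicator (fun _ => c) s) (ω : ι → Obs) :
    |sampleInt Λ f ω| ≤ Fintype.card ι * (c + c * Λ.real B) := by
  refine (Finset.abs_sum_le_sum_abs _ _).trans ?_
  refine (Finset.sum_le_card_nsmul _ _ _ fun i _ => hB.abs_mart_le hfB (ω i)).trans ?_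
  simp [mul_add]

/-- Second moment bound for the compensated integral of a predictable process. -/
theorem IsHazard.lintegral_sampleInt_sq_le (h : IsHazard μ Λ) {f : ℝ → (ι → Obs) → ℝ}
    (hf : Measurable (Function.uncurry f)) (hp : Predictable f) :
    ∫⁻ ω, ENNReal.ofReal (sampleInt Λ (fun s => f s ω) ω ^ 2) ∂(Measure.pi fun _ : ι => μ)
      ≤ ∫⁻ ω, ∫⁻ s, ENNReal.ofReal (riskCount ω s * (f s ω ^ 2 * (1 - Λ.real {s}))) ∂Λ
        ∂(Measure.pi fun _ : ι => μ) := by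
  set R := ∫⁻ ω, ∫⁻ s, ENNReal.ofReal (riskCount ω s * (f s ω ^ 2 * (1 - Λ.real {s}))) ∂Λ
        ∂(Measure.pi fun _ : ι => μ) with hR
  by_cases hfin : R = ∞
  · rw [hfin]; exact le_top
  -- The isometry applies to the truncated integrand, whose energy is at most that of f. Fatou's
  -- lemma then removes the truncation.
  have hbdd : ∀ k, ∫⁻ ω, ENNReal.ofReal (sampleInt Λ (fun s => truncIntegrand μ f k s ω) ω ^ 2)
      ∂(Measure.pi fun _ : ι => μ) ≤ R := by
    intro k
    set g := truncIntegrand μ f k with hg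
    have hgm : Measurable (Function.uncurry g) := measurable_truncIntegrand hf k
    have hB := h.bddSupp_level k
    have hgB := fun s ω => abs_truncIntegrand_le_indicator (μ := μ) f k s ω
    have hsq := h.integral_sampleInt_sq_bdd hB hgm hgB (hp.truncIntegrand k)
    rw [← ofReal_integral_eq_lintegral_ofReal, hsq]
    · refine (ofReal_sum_integral_le (hgm.pow_const 2)).trans ?_
      exact lintegral_mono fun ω => lintegral_mono fun s => ofReal_energy_mono (riskCount_nonneg ω s)
        (sq_nonneg _) (sq_le_sq.2 (abs_truncIntegrand_le f k s ω))
    · refine Integrable.of_bound (C := (Fintype.card ι * (k + k * Λ.real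
        {s | ((k : ℝ≥0∞) + 1)⁻¹ ≤ riskProb μ s})) ^ 2)
        ((measurable_sampleInt hgm measurable_id).pow_const 2).aestronglyMeasurable
        (Eventually.of_forall fun ω => ?_)
      rw [Real.norm_eq_abs, abs_pow]
      exact pow_le_pow_left₀ (abs_nonneg _) (hB.abs_sampleInt_le (fun s => hgB s ω) ω) 2
    · exact Eventually.of_forall fun ω => sq_nonneg _
  have hlim : ∀ᵐ ω ∂(Measure.pi fun _ : ι => μ),
      ENNReal.ofReal (sampleInt Λ (fun s => f s ω) ω ^ 2)
        = liminf (fun k => ENNReal.ofReal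
            (sampleInt Λ (fun s => truncIntegrand μ f k s ω) ω ^ 2)) atTop := by
    filter_upwards [ae_forall_riskProb_pos (μ := μ), ae_lintegral_Iic_ne_top (hf.pow_const 2) hfin]
      with ω h1 h2
    refine (Tendsto.liminf_eq ?_).symm
    refine ENNReal.tendsto_ofReal (Tendsto.pow ?_ 2)
    refine tendsto_finsetSum _ fun j _ => ?_
    refine tendsto_mart (fun k => measurable_section (measurable_truncIntegrand hf k) ω) ?_
      (fun k s => abs_truncIntegrand_le f k s ω)
      (fun s hs => tendsto_truncIntegrand f ((h1 j).trans_le (antitone_riskProb μ hs)) ω)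
    have h3 := integrableOn_of_lintegral_hazard h ((measurable_section hf ω).pow_const 2)
      (fun t => sq_nonneg _) (h1 j) (h2 j)
    -- Up to an observed time `Λ` is finite, so |f| ≤ 1 + f² is integrable once f² is.
    refine ((integrableOn_const (h.measure_Iic_lt_top (h1 j)).ne (C := (1:ℝ))).add h3).mono'
      (measurable_section hf ω).aestronglyMeasurable (Eventually.of_forall fun s => ?_)
    simp only [Pi.add_apply, Real.norm_eq_abs]
    nlinarith [sq_nonneg (|f s ω| - 1), sq_abs (f s ω), abs_nonneg (f s ω)]
  rw [lintegral_congr_ae hlim]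
  refine (lintegral_liminf_le fun k => ?_).trans ?_
  · exact ((measurable_sampleInt (measurable_truncIntegrand hf k) measurable_id).pow_const 2).ennreal_ofReal
  · exact (liminf_le_liminf (Eventually.of_forall hbdd)).trans (by simp)

/-- First moment bound for the diagonal part of a double compensated integral. -/
theorem IsHazard.lintegral_diag_le (h : IsHazard μ Λ) {f : ℝ → (ι → Obs) → ℝ}
    (hf : Measurable (Function.uncurry f)) (hp : Predictable f) :
    ∫⁻ ω, ENNReal.ofReal |sampleInt Λ (fun t => f t ω * sampleAtom Λ ω t) ω|
        ∂(Measure.pi fun _ : ι => μ)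
      ≤ ∫⁻ ω, ∫⁻ s, ENNReal.ofReal (riskCount ω s * (|f s ω| * (1 - Λ.real {s}))) ∂Λ
        ∂(Measure.pi fun _ : ι => μ) := by
  set R := ∫⁻ ω, ∫⁻ s, ENNReal.ofReal (riskCount ω s * (|f s ω| * (1 - Λ.real {s}))) ∂Λ
        ∂(Measure.pi fun _ : ι => μ) with hR
  by_cases hfin : R = ∞
  · rw [hfin]; exact le_top
  have hatom : ∀ ω : ι → Obs, (∀ j, 0 < riskProb μ (ω j).1) →
      ∀ j, ∀ t ≤ (ω j).1, Λ.real {t} ≤ 1 := fun ω hω j t ht =>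
    h.singleton_le_one ((hω j).trans_le (antitone_riskProb μ ht))
  have hbdd : ∀ k, ∫⁻ ω, ENNReal.ofReal |sampleInt Λ (fun t => truncIntegrand μ f k t ω
      * sampleAtom Λ ω t) ω| ∂(Measure.pi fun _ : ι => μ) ≤ R := by
    intro k
    set g := truncIntegrand μ f k with hg
    have hgm : Measurable (Function.uncurry g) := measurable_truncIntegrand hf k
    have hB := h.bddSupp_level k
    have hgB := fun s ω => abs_truncIntegrand_le_indicator (μ := μ) f k s ω
    have hgp : Predictable g := hp.truncIntegrand k
    have hgaB : ∀ s ω, |(|g s ω|)| ≤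
        {s | ((k : ℝ≥0∞) + 1)⁻¹ ≤ riskProb μ s}.indicator (fun _ => (k : ℝ)) s := fun s ω => by
      rw [abs_abs]; exact hgB s ω
    have hgam : Measurable (Function.uncurry fun s ω => |g s ω|) := hgm.abs
    have hdiag := fun i j => h.integral_diag_bdd (ι := ι) hB hgam hgaB
      (fun j s ω z h1 h2 => by simp only [hgp j s ω z h1 h2]) i j
    -- The diagonal measure is positive, so the absolute value may be moved inside. This follows
    -- from positivity for the integrands |g| + e·g with e = 1 and e = -1.
    have hpath : ∀ᵐ ω ∂(Measure.pi fun _ : ι => μ),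
        ENNReal.ofReal |sampleInt Λ (fun t => g t ω * sampleAtom Λ ω t) ω|
          ≤ ENNReal.ofReal (sampleInt Λ (fun t => |g t ω| * sampleAtom Λ ω t) ω) := by
      filter_upwards [ae_forall_riskProb_pos (μ := μ)] with ω hω
      refine ENNReal.ofReal_le_ofReal ?_
      have hgi : ∀ j, IntegrableOn (fun t => g t ω) (Iic (ω j).1) Λ := fun j =>
        (hB.integrable_of_le (measurable_section hgm ω).aestronglyMeasurable
          fun s => hgB s ω).integrableOn
      have hfinj := fun j => (h.measure_Iic_lt_top (hω j)).ne
      have hpos := fun (e : ℝ) (he : |e| ≤ 1) => sampleInt_mul_sampleAtom_nonneg (ω := ω)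
        (g := fun t => |g t ω| + e * g t ω)
        (fun t => by
          have := neg_abs_le (e * g t ω)
          rw [abs_mul] at this
          nlinarith [abs_nonneg (g t ω), mul_le_mul_of_nonneg_right he (abs_nonneg (g t ω))])
        (fun j => (hgi j).abs.add ((hgi j).const_mul e)) hfinj (hatom ω hω)
      have hlin : ∀ e : ℝ, sampleInt Λ (fun t => (|g t ω| + e * g t ω) * sampleAtom Λ ω t) ω
          = sampleInt Λ (fun t => |g t ω| * sampleAtom Λ ω t) ω
            + e * sampleInt Λ (fun t => g t ω * sampleAtom Λ ω t) ω := by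
        intro e
        unfold sampleInt
        rw [Finset.mul_sum, ← Finset.sum_add_distrib]
        refine Finset.sum_congr rfl fun j _ => ?_
        rw [← mart_const_mul, ← mart_add
          (integrableOn_mul_sampleAtom (ω := ω) (hgi j).abs (hatom ω hω j))
          ((integrableOn_mul_sampleAtom (ω := ω) (hgi j) (hatom ω hω j)).const_mul e)]
        congr 1
        ext t
        ring
      have p1 := hpos 1 (by simp)
      have p2 := hpos (-1) (by simp)
      rw [hlin] at p1 p2
      rw [abs_le]
      constructor <;> linarith
    have hpos2 : ∀ᵐ ω ∂(Measure.pi fun _ : ι => μ),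
        0 ≤ sampleInt Λ (fun t => |g t ω| * sampleAtom Λ ω t) ω := by
      filter_upwards [ae_forall_riskProb_pos (μ := μ)] with ω hω
      exact sampleInt_mul_sampleAtom_nonneg (fun t => abs_nonneg _)
        (fun j => (hB.integrable_of_le (measurable_section hgm ω).aestronglyMeasurable
          fun s => hgB s ω).abs.integrableOn) (fun j => (h.measure_Iic_lt_top (hω j)).ne) (hatom ω hω)
    have hsum : ∀ ω : ι → Obs, sampleInt Λ (fun t => |g t ω| * sampleAtom Λ ω t) ω
        = ∑ j, ∑ i, mart Λ (fun t => |g t ω| * martAtom Λ (ω i) t) (ω j) := by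
      intro ω
      refine Finset.sum_congr rfl fun j _ => ?_
      rw [← mart_finset_sum]
      · congr 1
        ext t
        rw [sampleAtom, Finset.mul_sum]
      · intro i _
        refine ((hB.mul (d := 1 + Λ.real _) (by positivity)).integrable_of_le ?_ fun s =>
          abs_mul_le_indicator (hgaB s ω) hB.1 fun hs => (abs_martAtom_le _ _).trans
            (by linarith [hB.real_singleton_le hs])).integrableOn
        exact ((measurable_section hgam ω).mul
          (measurable_martAtom measurable_const measurable_id)).aestronglyMeasurable
    have hB2 := hB.mul (d := 1 + Λ.real {s | ((k : ℝ≥0∞) + 1)⁻¹ ≤ riskProb μ s}) (by positivity)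
    have hdi : ∀ i j, Integrable (fun ω : ι → Obs =>
        mart Λ (fun t => |g t ω| * martAtom Λ (ω i) t) (ω j)) (Measure.pi fun _ => μ) := by
      intro i j
      refine hB2.integrable_mart
        (f := fun t ω => |g t ω| * martAtom Λ (ω i) t) ?_ ?_ j
      · exact hgam.mul (measurable_martAtom ((measurable_pi_apply i).comp measurable_snd) measurable_fst)
      · intro s ω
        refine abs_mul_le_indicator (hgaB s ω) hB.1 fun hs => ?_
        exact (abs_martAtom_le _ _).trans (by linarith [hB.real_singleton_le hs])
    refine (lintegral_mono_ae hpath).trans ?_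
    rw [← ofReal_integral_eq_lintegral_ofReal _ hpos2]
    · simp only [hsum]
      rw [integral_finsetSum _ fun j _ => integrable_finsetSum _ fun i _ => hdi i j]
      simp_rw [integral_finsetSum _ fun i _ => hdi i _, hdiag]
      simp only [Finset.sum_ite_eq', Finset.mem_univ, if_true]
      refine (ofReal_sum_integral_le hgam).trans ?_
      exact lintegral_mono fun ω => lintegral_mono fun s => ofReal_energy_mono (riskCount_nonneg ω s)
        (abs_nonneg _) (abs_truncIntegrand_le f k s ω)
    · simp only [hsum]
      exact integrable_finsetSum _ fun j _ => integrable_finsetSum _ fun i _ => hdi i j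
  have hlim : ∀ᵐ ω ∂(Measure.pi fun _ : ι => μ),
      ENNReal.ofReal |sampleInt Λ (fun t => f t ω * sampleAtom Λ ω t) ω|
        = liminf (fun k => ENNReal.ofReal
            |sampleInt Λ (fun t => truncIntegrand μ f k t ω * sampleAtom Λ ω t) ω|) atTop := by
    filter_upwards [ae_forall_riskProb_pos (μ := μ), ae_lintegral_Iic_ne_top (f := fun s ω => |f s ω|)
      hf.abs hfin] with ω h1 h2
    refine (Tendsto.liminf_eq ?_).symm
    refine ENNReal.tendsto_ofReal (Tendsto.abs ?_)
    have hat : Measurable fun t => sampleAtom Λ ω t := measurable_sampleAtom measurable_const measurable_id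
    refine tendsto_finsetSum _ fun j _ => ?_
    refine tendsto_mart (fun k => (measurable_section (measurable_truncIntegrand hf k) ω).mul hat) ?_
      (fun k s => ?_) (fun s hs => (tendsto_truncIntegrand f
        ((h1 j).trans_le (antitone_riskProb μ hs)) ω).mul_const _)
    · have h3 := integrableOn_of_lintegral_hazard h (measurable_section hf ω).abs
        (fun t => abs_nonneg _) (h1 j) (h2 j)
      refine integrableOn_mul_sampleAtom ?_ (hatom ω h1 j)
      exact h3.mono' (measurable_section hf ω).aestronglyMeasurable
        (Eventually.of_forall fun s => le_rfl)
    · rw [abs_mul, abs_mul]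
      exact mul_le_mul_of_nonneg_right (abs_truncIntegrand_le f k s ω) (abs_nonneg _)
  rw [lintegral_congr_ae hlim]
  refine (lintegral_liminf_le fun k => ?_).trans ?_
  · refine (measurable_sampleInt (f := fun t ω => truncIntegrand μ f k t ω * sampleAtom Λ ω t)
      ?_ measurable_id).abs.ennreal_ofReal
    exact (measurable_truncIntegrand hf k).mul (measurable_sampleAtom measurable_snd measurable_fst)
  · exact (liminf_le_liminf (Eventually.of_forall hbdd)).trans (by simp)

lemma measurable_sampleInt_Iio {k : ℝ → ℝ → ℝ} (hk : Measurable (Function.uncurry k))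
    {α : ℝ → (ι → Obs) → ℝ} (hα : Measurable (Function.uncurry α)) :
    Measurable (Function.uncurry fun t (ω : ι → Obs) =>
      sampleInt Λ ((Iio t).indicator fun s => k s t * α s ω) ω) := by
  refine measurable_sampleInt (f := fun s (q : ℝ × (ι → Obs)) =>
    (Iio q.1).indicator (fun s => k s q.1 * α s q.2) s) (z := fun q : ℝ × (ι → Obs) => q.2) ?_
    measurable_snd
  have hs : MeasurableSet {q : ℝ × (ℝ × (ι → Obs)) | q.1 < q.2.1} :=
    measurableSet_lt measurable_fst (measurable_fst.comp measurable_snd)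
  exact ((hk.comp (measurable_fst.prodMk (measurable_fst.comp measurable_snd))).mul
    (hα.comp (measurable_fst.prodMk (measurable_snd.comp measurable_snd)))).indicator hs

/-- An observation still at risk at t enters the integral over s < t only through its compensator on
(-∞,t), where its own time no longer appears and α is predictable. -/
lemma Predictable.sampleInt_Iio {k : ℝ → ℝ → ℝ} {α : ℝ → (ι → Obs) → ℝ} (hα : Predictable α) :
    Predictable fun t (ω : ι → Obs) => sampleInt Λ ((Iio t).indicator fun s => k s t * α s ω) ω := by
  intro j t ω z h1 h2
  refine Finset.sum_congr rfl fun i _ => ?_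
  by_cases hij : i = j
  · subst hij
    rw [Function.update_self]
    have e1 : ∀ y : Obs, t ≤ y.1 → ∀ k : ℝ → ℝ, mart Λ ((Iio t).indicator k) y
        = - ∫ s in Iio t, k s ∂Λ := by
      intro y hy k
      rw [mart, setIntegral_indicator measurableSet_Iio,
        show Iic y.1 ∩ Iio t = Iio t from inter_eq_right.2 fun s hs => (le_of_lt hs).trans hy]
      simp [hy]
    rw [e1 _ h2, e1 _ h1]
    congr 1
    refine setIntegral_congr_fun measurableSet_Iio fun s hs => ?_
    simp only [hα i s ω z ((le_of_lt hs).trans h1) ((le_of_lt hs).trans h2)]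
  · rw [Function.update_of_ne hij]
    congr 1
    ext s
    by_cases hs : s < t
    · simp only [indicator, mem_Iio, hs, if_true]
      rw [hα j s ω z (hs.le.trans h1) (hs.le.trans h2)]
    · simp [hs]

/-- Second moment bound for the part of a double compensated integral below the diagonal. -/
theorem IsHazard.lintegral_offDiag_sq_le (h : IsHazard μ Λ) {k : ℝ → ℝ → ℝ}
    (hk : Measurable (Function.uncurry k)) {α β : ℝ → (ι → Obs) → ℝ}
    (hα : Measurable (Function.uncurry α)) (hαp : Predictable α)
    (hβ : Measurable (Function.uncurry β)) (hβp : Predictable β) {a b : ℝ → ℝ}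
    (ha : ∀ s ω, riskCount ω s * α s ω ^ 2 ≤ a s) (hb : ∀ s ω, riskCount ω s * β s ω ^ 2 ≤ b s) :
    ∫⁻ ω, ENNReal.ofReal (sampleInt Λ (fun t => β t ω *
        sampleInt Λ ((Iio t).indicator fun s => k s t * α s ω) ω) ω ^ 2)
        ∂(Measure.pi fun _ : ι => μ)
      ≤ ∫⁻ t, ∫⁻ s, ENNReal.ofReal (b t * (1 - Λ.real {t})) *
          ENNReal.ofReal (k s t ^ 2 * a s * (1 - Λ.real {s})) ∂Λ ∂Λ := by
  have ha0 : ∀ s, 0 ≤ a s := fun s => (mul_nonneg (riskCount_nonneg _ _) (sq_nonneg _)).trans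
    (ha s fun _ => (0, true))
  have hIm := measurable_sampleInt_Iio (ι := ι) (Λ := Λ) hk hα
  have hIp : Predictable fun t (ω : ι → Obs) =>
    sampleInt Λ ((Iio t).indicator fun s => k s t * α s ω) ω := hαp.sampleInt_Iio
  have step1 := h.lintegral_sampleInt_sq_le (ι := ι) (f := fun t ω => β t ω *
      sampleInt Λ ((Iio t).indicator fun s => k s t * α s ω) ω) (hβ.mul hIm)
    (fun j s ω z h1 h2 => by
      have := hIp j s ω z h1 h2
      simp only at this ⊢
      rw [hβp j s ω z h1 h2, this])
  refine step1.trans ?_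
  have hswapm : Measurable fun q : (ι → Obs) × ℝ => ENNReal.ofReal (riskCount q.1 q.2 *
      ((β q.2 q.1 * sampleInt Λ ((Iio q.2).indicator fun s => k s q.2 * α s q.1) q.1) ^ 2
        * (1 - Λ.real {q.2}))) :=
    measurable_energy (f := fun t (ω : ι → Obs) => (β t ω *
      sampleInt Λ ((Iio t).indicator fun s => k s t * α s ω) ω) ^ 2) ((hβ.mul hIm).pow_const 2)
  -- With t outermost, the bound Y·β² ≤ b is deterministic and leaves the expectation. The second
  -- moment bound then applies once more, to the inner integral at fixed t.
  rw [lintegral_lintegral_swap hswapm.aemeasurable]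
  refine lintegral_mono fun t => ?_
  have hb0 : 0 ≤ b t := (mul_nonneg (riskCount_nonneg _ _) (sq_nonneg _)).trans
    (hb t fun _ => (0, true))
  have hpt : ∀ ω : ι → Obs, ENNReal.ofReal (riskCount ω t *
      ((β t ω * sampleInt Λ ((Iio t).indicator fun s => k s t * α s ω) ω) ^ 2 * (1 - Λ.real {t})))
      ≤ ENNReal.ofReal (b t * (1 - Λ.real {t})) *
        ENNReal.ofReal (sampleInt Λ ((Iio t).indicator fun s => k s t * α s ω) ω ^ 2) := by
    intro ω
    rw [mul_comm (ENNReal.ofReal (b t * _)), ← ENNReal.ofReal_mul (sq_nonneg _)]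
    set I := sampleInt Λ ((Iio t).indicator fun s => k s t * α s ω) ω
    rw [show riskCount ω t * ((β t ω * I) ^ 2 * (1 - Λ.real {t}))
      = I ^ 2 * ((riskCount ω t * β t ω ^ 2) * (1 - Λ.real {t})) by ring]
    exact ofReal_energy_mono (sq_nonneg _) (mul_nonneg (riskCount_nonneg _ _) (sq_nonneg _)) (hb t ω)
  refine (lintegral_mono hpt).trans ?_
  rw [lintegral_const_mul' _ _ ENNReal.ofReal_ne_top, lintegral_const_mul' _ _ ENNReal.ofReal_ne_top]
  refine mul_le_mul_right (?_ : _ ≤ _) _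
  have hgm : Measurable (Function.uncurry fun s (ω : ι → Obs) =>
      (Iio t).indicator (fun s => k s t * α s ω) s) :=
    ((hk.comp (measurable_fst.prodMk measurable_const)).mul hα).indicator
      (s := {q : ℝ × (ι → Obs) | q.1 < t}) (measurableSet_lt measurable_fst measurable_const)
  have step2 := h.lintegral_sampleInt_sq_le (ι := ι) hgm (fun j s ω z h1 h2 => by
    by_cases hs : s < t
    · simp only [indicator, mem_Iio, hs, if_true, hαp j s ω z h1 h2]
    · simp [hs])
  refine step2.trans ?_
  calc _ ≤ ∫⁻ ω, ∫⁻ s, ENNReal.ofReal (k s t ^ 2 * a s * (1 - Λ.real {s})) ∂Λ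
        ∂(Measure.pi fun _ : ι => μ) := by
        refine lintegral_mono fun ω => lintegral_mono fun s => ?_
        by_cases hs : s < t
        · simp only [indicator, mem_Iio, hs, if_true]
          rw [show riskCount ω s * ((k s t * α s ω) ^ 2 * (1 - Λ.real {s}))
            = k s t ^ 2 * ((riskCount ω s * α s ω ^ 2) * (1 - Λ.real {s})) by ring,
            mul_assoc (k s t ^ 2) (a s)]
          exact ofReal_energy_mono (sq_nonneg _) (mul_nonneg (riskCount_nonneg _ _) (sq_nonneg _))
            (ha s ω)
        · simp [hs]
    _ = _ := by simp

end Sample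

/-! ### Maximal inequalities -/

section Maximal

variable {ι : Type*} [Fintype ι] [DecidableEq ι]
variable {μ : Measure Obs} [IsProbabilityMeasure μ]

/-- A statistic that is determined by the observations up to time `s`. -/
def DependsUpTo (s : ℝ) (ξ : (ι → Obs) → ℝ) : Prop :=
  ∀ j ω z, s < (ω j).1 → s < z.1 → ξ (Function.update ω j z) = ξ ω

/-- A martingale, indexed by the times in `D`, of bounded statistics of a sample. -/
structure SampleMart (μ : Measure Obs) (D : Set ℝ) (Z : ℝ → (ι → Obs) → ℝ) : Prop where
  meas : ∀ t ∈ D, Measurable (Z t)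
  bdd : ∀ t ∈ D, ∃ C, ∀ ω, |Z t ω| ≤ C
  dep : ∀ t ∈ D, DependsUpTo t (Z t)
  mart : ∀ s ∈ D, ∀ t ∈ D, s < t → ∀ ξ : (ι → Obs) → ℝ, Measurable ξ → (∃ C, ∀ ω, |ξ ω| ≤ C) →
    DependsUpTo s ξ → ∫ ω, Z t ω * ξ ω ∂(Measure.pi fun _ => μ)
      = ∫ ω, Z s ω * ξ ω ∂(Measure.pi fun _ => μ)

/-- The event is split by the first time q at which V exceeds c. The first-crossing event `A q` is
determined up to time q, so the submartingale inequality replaces V q by V at the last time, and the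
disjoint pieces add up. -/
lemma maximal_finset {V : ℝ → (ι → Obs) → ℝ} {D : Finset ℝ} {c v : ℝ} (hc : 0 < c)
    (hm : ∀ q ∈ D, Measurable (V q)) (hi : ∀ q ∈ D, Integrable (V q) (Measure.pi fun _ => μ))
    (h0 : ∀ q ∈ D, ∀ᵐ ω ∂(Measure.pi fun _ => μ), 0 ≤ V q ω) (hd : ∀ q ∈ D, DependsUpTo q (V q))
    (hsub : ∀ q ∈ D, ∀ t ∈ D, q < t → ∀ A, MeasurableSet A → DependsUpTo q (A.indicator fun _ => 1) →
      ∫ ω in A, V q ω ∂(Measure.pi fun _ => μ) ≤ ∫ ω in A, V t ω ∂(Measure.pi fun _ => μ))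
    (hmean : ∀ t ∈ D, ∫ ω, V t ω ∂(Measure.pi fun _ => μ) ≤ v) :
    (Measure.pi fun _ => μ) {ω | ∃ q ∈ D, c < V q ω} ≤ ENNReal.ofReal (v / c) := by
  rcases D.eq_empty_or_nonempty with rfl | hne
  · simp
  set P : Measure (ι → Obs) := Measure.pi fun _ => μ with hP
  set t := D.max' hne with ht
  have htD : t ∈ D := D.max'_mem hne
  set A : ℝ → Set (ι → Obs) := fun q => {ω | c < V q ω ∧ ∀ r ∈ D, r < q → V r ω ≤ c} with hA
  have hAm : ∀ q ∈ D, MeasurableSet (A q) := by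
    intro q hq
    refine (measurableSet_lt measurable_const (hm q hq)).inter ?_
    have : {ω : ι → Obs | ∀ r ∈ D, r < q → V r ω ≤ c} = ⋂ r ∈ D, ⋂ _ : r < q, {ω | V r ω ≤ c} := by
      ext ω; simp
    change MeasurableSet {ω : ι → Obs | ∀ r ∈ D, r < q → V r ω ≤ c}
    rw [this]
    exact D.measurableSet_biInter fun r hr => MeasurableSet.iInter fun _ =>
      measurableSet_le (hm r hr) measurable_const
  have hdisj : (D : Set ℝ).PairwiseDisjoint A := by
    intro q hq r hr hqr
    rw [Function.onFun, Set.disjoint_left]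
    rintro ω ⟨h1, h2⟩ ⟨h3, h4⟩
    rcases lt_or_gt_of_ne hqr with h | h
    · exact absurd (h4 q hq h) (not_le.2 h1)
    · exact absurd (h2 r hr h) (not_le.2 h3)
  have hunion : {ω | ∃ q ∈ D, c < V q ω} = ⋃ q ∈ D, A q := by
    ext ω
    simp only [mem_ofPred_eq, mem_iUnion, exists_prop]
    constructor
    · rintro ⟨q, hq, hqc⟩
      have hne' : (D.filter fun q => c < V q ω).Nonempty := ⟨q, by simp [hq, hqc]⟩
      have hmem := Finset.min'_mem _ hne'
      rw [Finset.mem_filter] at hmem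
      refine ⟨_, hmem.1, hmem.2, fun r hr hlt => ?_⟩
      by_contra hcon
      exact absurd (Finset.min'_le (D.filter fun q => c < V q ω) r (by simp [hr, not_le.1 hcon]))
        (not_le.2 hlt)
    · rintro ⟨q, hq, hqc, -⟩
      exact ⟨q, hq, hqc⟩
  have hAdep : ∀ q ∈ D, DependsUpTo q ((A q).indicator fun _ => (1:ℝ)) := by
    intro q hq j ω z h1 h2
    have : Function.update ω j z ∈ A q ↔ ω ∈ A q := by
      simp only [hA, mem_ofPred_eq, hd q hq j ω z h1 h2]
      refine and_congr_right fun _ => forall_congr' fun r => forall_congr' fun hr =>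
        forall_congr' fun hlt => ?_
      rw [hd r hr j ω z (hlt.trans h1) (hlt.trans h2)]
    by_cases hω : ω ∈ A q
    · simp [hω, this.2 hω]
    · have h3 : Function.update ω j z ∉ A q := fun h => hω (this.1 h)
      simp [hω, h3]
  have hstep : ∀ q ∈ D, c * P.real (A q) ≤ ∫ ω in A q, V t ω ∂P := by
    intro q hq
    calc c * P.real (A q) = ∫ _ in A q, c ∂P := by rw [setIntegral_const, smul_eq_mul, mul_comm]
      _ ≤ ∫ ω in A q, V q ω ∂P := by
        refine setIntegral_mono_on (integrableOn_const (measure_ne_top _ _)) (hi q hq).integrableOn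
          (hAm q hq) fun ω hω => hω.1.le
      _ ≤ ∫ ω in A q, V t ω ∂P := by
        rcases (D.le_max' q hq).lt_or_eq with h | h
        · exact hsub q hq t htD h _ (hAm q hq) (hAdep q hq)
        · rw [h]
  have hfinal : c * P.real (⋃ q ∈ D, A q) ≤ v := by
    rw [measureReal_biUnion_finset hdisj hAm, Finset.mul_sum]
    calc _ ≤ ∑ q ∈ D, ∫ ω in A q, V t ω ∂P := Finset.sum_le_sum hstep
      _ = ∫ ω in ⋃ q ∈ D, A q, V t ω ∂P :=
        (integral_biUnion_finset D hAm hdisj fun q _ => (hi t htD).integrableOn).symm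
      _ ≤ ∫ ω, V t ω ∂P := setIntegral_le_integral (hi t htD) (h0 t htD)
      _ ≤ v := hmean t htD
  rw [hunion, ← ofReal_measureReal (measure_ne_top _ _)]
  refine ENNReal.ofReal_le_ofReal ?_
  rw [le_div_iff₀ hc, mul_comm]
  exact hfinal

/-- The events increase along the finite initial segments of an enumeration of D. -/
lemma maximal_countable {V : ℝ → (ι → Obs) → ℝ} {D : Set ℝ} (hD : D.Countable) {c : ℝ} {b : ℝ≥0∞}
    (h : ∀ D' : Finset ℝ, (D' : Set ℝ) ⊆ D →
      (Measure.pi fun _ => μ) {ω | ∃ q ∈ D', c < V q ω} ≤ b) :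
    (Measure.pi fun _ => μ) {ω | ∃ q ∈ D, c < V q ω} ≤ b := by
  rcases D.eq_empty_or_nonempty with rfl | hne
  · simp
  obtain ⟨e, rfl⟩ := hD.exists_eq_range hne
  have hU : {ω : ι → Obs | ∃ q ∈ range e, c < V q ω}
      = ⋃ n : ℕ, {ω | ∃ q ∈ (Finset.range n).image e, c < V q ω} := by
    ext ω
    simp only [mem_ofPred_eq, mem_iUnion, mem_range, Finset.mem_image, Finset.mem_range]
    constructor
    · rintro ⟨q, ⟨k, rfl⟩, hq⟩
      exact ⟨k + 1, e k, ⟨k, by omega, rfl⟩, hq⟩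
    · rintro ⟨n, q, ⟨k, -, rfl⟩, hq⟩
      exact ⟨e k, ⟨k, rfl⟩, hq⟩
  rw [hU, Monotone.measure_iUnion]
  · refine iSup_le fun n => h _ ?_
    intro q hq
    simp only [Finset.coe_image, mem_image] at hq
    obtain ⟨k, -, rfl⟩ := hq
    exact ⟨k, rfl⟩
  · intro n m hnm ω
    rintro ⟨q, hq, hqc⟩
    refine ⟨q, ?_, hqc⟩
    exact Finset.image_subset_image (Finset.range_mono hnm) hq

lemma SampleMart.integrable {D : Set ℝ} {Z : ℝ → (ι → Obs) → ℝ} (hZ : SampleMart μ D Z) {t : ℝ}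
    (ht : t ∈ D) : Integrable (Z t) (Measure.pi fun _ => μ) := by
  obtain ⟨C, hC⟩ := hZ.bdd t ht
  exact Integrable.of_bound (hZ.meas t ht).aestronglyMeasurable C (Eventually.of_forall hC)

/-- Doob's maximal inequality for nonnegative martingales. -/
theorem SampleMart.maximal {D : Set ℝ} (hD : D.Countable) {Z : ℝ → (ι → Obs) → ℝ}
    (hZ : SampleMart μ D Z) (h0 : ∀ t ∈ D, ∀ᵐ ω ∂(Measure.pi fun _ => μ), 0 ≤ Z t ω)
    (h1 : ∀ t ∈ D, ∫ ω, Z t ω ∂(Measure.pi fun _ => μ) ≤ 1) {c : ℝ} (hc : 0 < c) :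
    (Measure.pi fun _ => μ) {ω | ∃ q ∈ D, c < Z q ω} ≤ ENNReal.ofReal (1 / c) := by
  refine maximal_countable hD fun D' hD' => maximal_finset hc
    (fun q hq => hZ.meas q (hD' hq)) (fun q hq => hZ.integrable (hD' hq))
    (fun q hq => h0 q (hD' hq)) (fun q hq => hZ.dep q (hD' hq)) ?_ (fun t ht => h1 t (hD' ht))
  intro q hq t ht hqt A hA hAd
  have := hZ.mart q (hD' hq) t (hD' ht) hqt (A.indicator fun _ => 1) (measurable_const.indicator hA)
    ⟨1, fun ω => by by_cases h : ω ∈ A <;> simp [h]⟩ hAd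
  have e : ∀ Y : (ι → Obs) → ℝ, (fun ω => Y ω * A.indicator (fun _ => 1) ω) = A.indicator Y := by
    intro Y; ext ω; by_cases h : ω ∈ A <;> simp [h]
  rw [e, e, integral_indicator hA, integral_indicator hA] at this
  exact this.ge

/-- Kolmogorov's maximal inequality for martingales. -/
theorem SampleMart.maximal_sq {D : Set ℝ} (hD : D.Countable) {Z : ℝ → (ι → Obs) → ℝ}
    (hZ : SampleMart μ D Z) {v : ℝ}
    (h2 : ∀ t ∈ D, ∫ ω, (Z t ω - 1) ^ 2 ∂(Measure.pi fun _ => μ) ≤ v) {δ : ℝ} (hδ : 0 < δ) :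
    (Measure.pi fun _ => μ) {ω | ∃ q ∈ D, δ < |Z q ω - 1|} ≤ ENNReal.ofReal (v / δ ^ 2) := by
  have hset : {ω : ι → Obs | ∃ q ∈ D, δ < |Z q ω - 1|}
      = {ω | ∃ q ∈ D, δ ^ 2 < (Z q ω - 1) ^ 2} := by
    ext ω
    refine exists_congr fun q => and_congr_right fun _ => ?_
    rw [sq_lt_sq, abs_of_pos hδ]
  have hbdd : ∀ t ∈ D, ∃ C, ∀ ω, |Z t ω - 1| ≤ C := fun t ht => by
    obtain ⟨C, hC⟩ := hZ.bdd t ht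
    exact ⟨C + 1, fun ω => (abs_sub _ _).trans (add_le_add (hC ω) (by simp))⟩
  have hprod : ∀ f g : (ι → Obs) → ℝ, Measurable f → Measurable g → (∃ C, ∀ ω, |f ω| ≤ C) →
      (∃ C, ∀ ω, |g ω| ≤ C) → Integrable (fun ω => f ω * g ω) (Measure.pi fun _ => μ) := by
    rintro f g hf hg ⟨C, hC⟩ ⟨C', hC'⟩
    refine Integrable.of_bound (hf.mul hg).aestronglyMeasurable (C * C') (Eventually.of_forall fun ω => ?_)
    rw [Real.norm_eq_abs, abs_mul]
    exact mul_le_mul (hC ω) (hC' ω) (abs_nonneg _) ((abs_nonneg _).trans (hC ω))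
  have hm : ∀ t ∈ D, Measurable fun ω => Z t ω - 1 := fun t ht => (hZ.meas t ht).sub_const 1
  have hsq : ∀ t ∈ D, Integrable (fun ω => (Z t ω - 1) ^ 2) (Measure.pi fun _ => μ) := fun t ht => by
    simp only [sq]; exact hprod _ _ (hm t ht) (hm t ht) (hbdd t ht) (hbdd t ht)
  rw [hset]
  refine maximal_countable (V := fun q ω => (Z q ω - 1) ^ 2) hD fun D' hD' =>
    maximal_finset (pow_pos hδ 2)
    (fun q hq => (hm q (hD' hq)).pow_const 2) (fun q hq => hsq q (hD' hq))
    (fun q hq => Eventually.of_forall fun ω => sq_nonneg _)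
    (fun q hq j ω z h1 h2 => by simp only [hZ.dep q (hD' hq) j ω z h1 h2]) ?_
    (fun t ht => h2 t (hD' ht))
  intro q hq t ht hqt A hA hAd
  have hq := hD' hq
  have ht := hD' ht
  -- Testing the martingale property against Z q - 1 on A removes the cross term of (Z t - 1)² - (Z
  -- q - 1)² = (Z t - Z q)² + 2 (Z t - Z q)(Z q - 1).
  set ξ : (ι → Obs) → ℝ := fun ω => A.indicator (fun _ => 1) ω * (Z q ω - 1) with hξ
  have hξm : Measurable ξ := (measurable_const.indicator hA).mul (hm q hq)
  have hξb : ∃ C, ∀ ω, |ξ ω| ≤ C := by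
    obtain ⟨C, hC⟩ := hbdd q hq
    refine ⟨C, fun ω => ?_⟩
    by_cases h : ω ∈ A
    · simpa [hξ, h] using hC ω
    · simpa [hξ, h] using (abs_nonneg _).trans (hC ω)
  have hcross := hZ.mart q hq t ht hqt ξ hξm hξb (fun j ω z h1 h2 => by
    simp only [hξ, hAd j ω z h1 h2, hZ.dep q hq j ω z h1 h2])
  have hI1 := hprod _ _ (hZ.meas t ht) hξm (hZ.bdd t ht) hξb
  have hI2 := hprod _ _ (hZ.meas q hq) hξm (hZ.bdd q hq) hξb
  rw [← sub_nonneg, ← integral_sub (hsq t ht).integrableOn (hsq q hq).integrableOn,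
    ← integral_indicator hA]
  have e : ∀ ω, A.indicator (fun ω => (Z t ω - 1) ^ 2 - (Z q ω - 1) ^ 2) ω
      = A.indicator (fun ω => (Z t ω - Z q ω) ^ 2) ω + 2 * (Z t ω * ξ ω - Z q ω * ξ ω) := by
    intro ω
    by_cases h : ω ∈ A
    · simp only [hξ, h, indicator_of_mem]; ring
    · simp [hξ, h]
  have hI3 : Integrable (A.indicator fun ω => (Z t ω - Z q ω) ^ 2) (Measure.pi fun _ => μ) := by
    refine Integrable.indicator ?_ hA
    have := ((hsq t ht).add (hsq q hq)).sub ((hprod _ _ (hm t ht) (hm q hq) (hbdd t ht)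
      (hbdd q hq)).const_mul 2)
    refine this.congr (Eventually.of_forall fun ω => ?_)
    simp only [Pi.sub_apply, Pi.add_apply]
    ring
  have hI4 : Integrable (fun ω => 2 * (Z t ω * ξ ω - Z q ω * ξ ω)) (Measure.pi fun _ => μ) :=
    (hI1.sub hI2).const_mul 2
  simp only [e]
  rw [integral_add hI3 hI4, integral_const_mul, integral_sub hI1 hI2, hcross,
    sub_self, mul_zero, add_zero]
  exact integral_nonneg fun ω => indicator_nonneg (fun _ _ => sq_nonneg _) ω

/-! ### The number at risk -/

/-- The probability that an observation exceeds `s`. -/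
def exceedProb (μ : Measure Obs) (s : ℝ) : ℝ := μ.real {z | s < z.1}

/-- The number of observations that exceed `s`. -/
def exceedCount (ω : ι → Obs) (s : ℝ) : ℝ := ∑ i, if s < (ω i).1 then 1 else 0

lemma measurableSet_exceed (s : ℝ) : MeasurableSet {z : Obs | s < z.1} :=
  measurable_fst measurableSet_Ioi

lemma integral_exceed (s : ℝ) : ∫ z : Obs, (if s < z.1 then (1:ℝ) else 0) ∂μ = exceedProb μ s := by
  have : (fun z : Obs => if s < z.1 then (1:ℝ) else 0) = {z : Obs | s < z.1}.indicator fun _ => 1 := by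
    ext z; simp [indicator]
  rw [this, integral_indicator (measurableSet_exceed s), setIntegral_const, smul_eq_mul, mul_one]
  rfl

lemma measurable_exceedCount (s : ℝ) : Measurable fun ω : ι → Obs => exceedCount ω s :=
  Finset.measurable_sum _ fun i _ => Measurable.ite
    ((measurableSet_exceed s).preimage (measurable_pi_apply i)) measurable_const measurable_const

lemma exceedCount_nonneg (ω : ι → Obs) (s : ℝ) : 0 ≤ exceedCount ω s :=
  Finset.sum_nonneg fun i _ => by split_ifs <;> norm_num

lemma exceedCount_le (ω : ι → Obs) (s : ℝ) : exceedCount ω s ≤ Fintype.card ι := by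
  refine (Finset.sum_le_card_nsmul _ _ 1 fun i _ => ?_).trans (by simp)
  split_ifs <;> norm_num

/-- The normalized number of observations that exceed a time. -/
def exceedRatio (μ : Measure Obs) (s : ℝ) (ω : ι → Obs) : ℝ :=
  exceedCount ω s / (Fintype.card ι * exceedProb μ s)

/-- On {t < X_j} the statistic ξ does not depend on observation j, which may be frozen at any time
beyond s, here s + 1. The two factors are then independent. -/
lemma integral_exceed_mul {s t : ℝ} (hst : s ≤ t) (j : ι) {ξ : (ι → Obs) → ℝ} (hξ : Measurable ξ)
    (hξb : ∃ C, ∀ ω, |ξ ω| ≤ C) (hd : DependsUpTo s ξ) :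
    ∫ ω, (if t < (ω j).1 then 1 else 0) * ξ ω ∂(Measure.pi fun _ => μ)
      = exceedProb μ t * ∫ ω, ξ (Function.update ω j (s + 1, true)) ∂(Measure.pi fun _ => μ) := by
  obtain ⟨C, hC⟩ := hξb
  rw [integral_update j]
  · rw [← integral_const_mul]
    congr 1
    ext ω
    rw [← integral_exceed, ← integral_mul_const]
    congr 1
    ext z
    rw [Function.update_self]
    by_cases h : t < z.1
    · have := hd j (Function.update ω j (s + 1, true)) z (by simp) (hst.trans_lt h)
      rw [Function.update_idem] at this
      rw [this]
    · simp [h]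
  · refine Integrable.of_bound (C := C) ?_ (Eventually.of_forall fun ω => ?_)
    · exact ((Measurable.ite ((measurableSet_exceed t).preimage (measurable_pi_apply j))
        measurable_const measurable_const).mul hξ).aestronglyMeasurable
    · split_ifs
      · simpa using hC ω
      · simpa using (abs_nonneg _).trans (hC ω)

/-- Given survival beyond s, an observation exceeds t > s with probability p(t)/p(s), so division by
p produces a martingale in time. In the proof the factor p(u) cancels, and the tested integral does
not depend on u ≥ s. -/
lemma sampleMart_exceedRatio {D : Set ℝ} (hD : ∀ q ∈ D, 0 < exceedProb μ q) :
    SampleMart (ι := ι) μ D (exceedRatio μ) where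
  meas t _ := (measurable_exceedCount t).div_const _
  bdd t _ := by
    refine ⟨Fintype.card ι / (Fintype.card ι * exceedProb μ t), fun ω => ?_⟩
    have h0 : 0 ≤ exceedProb μ t := measureReal_nonneg
    rw [exceedRatio, abs_of_nonneg (div_nonneg (exceedCount_nonneg _ _) (by positivity))]
    exact div_le_div_of_nonneg_right (exceedCount_le ω t) (by positivity)
  dep t _ := by
    intro j ω z h1 h2
    unfold exceedRatio exceedCount
    congr 1
    refine Finset.sum_congr rfl fun i _ => ?_
    by_cases hij : i = j
    · subst hij; simp [h1, h2]
    · rw [Function.update_of_ne hij]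
  mart s hs t ht hst ξ hξ hξb hd := by
    have key : ∀ u ∈ D, s ≤ u → ∫ ω, exceedRatio μ u ω * ξ ω ∂(Measure.pi fun _ => μ)
        = ∑ j : ι, (1 / (Fintype.card ι : ℝ)) *
          ∫ ω, ξ (Function.update ω j (s + 1, true)) ∂(Measure.pi fun _ => μ) := by
      intro u hu hsu
      have e : ∀ ω : ι → Obs, exceedRatio μ u ω * ξ ω = ∑ j : ι,
          (1 / (Fintype.card ι * exceedProb μ u)) * ((if u < (ω j).1 then 1 else 0) * ξ ω) := by
        intro ω
        rw [exceedRatio, exceedCount, ← Finset.mul_sum, ← Finset.sum_mul]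
        ring
      simp only [e]
      rw [integral_finsetSum]
      · refine Finset.sum_congr rfl fun j _ => ?_
        rw [integral_const_mul, integral_exceed_mul hsu j hξ hξb hd, ← mul_assoc]
        congr 1
        have := (hD u hu).ne'
        field_simp
      · intro j _
        obtain ⟨C, hC⟩ := hξb
        refine Integrable.const_mul (Integrable.of_bound (C := C) ?_ (Eventually.of_forall fun ω => ?_)) _
        · exact ((Measurable.ite ((measurableSet_exceed u).preimage (measurable_pi_apply j))
            measurable_const measurable_const).mul hξ).aestronglyMeasurable
        · split_ifs
          · simpa using hC ω
          · simpa using (abs_nonneg _).trans (hC ω)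
    rw [key t ht hst.le, key s hs le_rfl]

lemma integral_exceedRatio [Nonempty ι] {t : ℝ} (ht : 0 < exceedProb μ t) :
    ∫ ω, exceedRatio μ t ω ∂(Measure.pi fun _ : ι => μ) = 1 := by
  have hc : (Fintype.card ι : ℝ) ≠ 0 := by exact_mod_cast Fintype.card_ne_zero
  unfold exceedRatio exceedCount
  rw [integral_div, integral_finsetSum]
  · have : ∀ j : ι, ∫ ω, (if t < (ω j).1 then (1:ℝ) else 0) ∂(Measure.pi fun _ : ι => μ)
        = exceedProb μ t := by
      intro j
      have := integral_exceed_mul (μ := μ) (le_refl t) j (ξ := fun _ : ι → Obs => 1) measurable_const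
        ⟨1, by simp⟩ (fun _ _ _ _ _ => rfl)
      simpa using this
    simp only [this, Finset.sum_const, Finset.card_univ, nsmul_eq_mul]
    field_simp
  · intro j _
    refine Integrable.of_bound (C := 1) (Measurable.ite
      ((measurableSet_exceed t).preimage (measurable_pi_apply j)) measurable_const
        measurable_const).aestronglyMeasurable (Eventually.of_forall fun ω => ?_)
    split_ifs <;> simp

/-- The centred indicators are uncorrelated, each with variance p - p² ≤ p. -/
lemma integral_exceedRatio_sq [Nonempty ι] {t : ℝ} (ht : 0 < exceedProb μ t) :
    ∫ ω, (exceedRatio μ t ω - 1) ^ 2 ∂(Measure.pi fun _ : ι => μ)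
      ≤ 1 / (Fintype.card ι * exceedProb μ t) := by
  have hc : (0:ℝ) < Fintype.card ι := by exact_mod_cast Fintype.card_pos
  set p := exceedProb μ t with hp
  set e : ι → (ι → Obs) → ℝ := fun j ω => (if t < (ω j).1 then 1 else 0) - p with he
  have hem : ∀ j, Measurable (e j) := fun j => (Measurable.ite
    ((measurableSet_exceed t).preimage (measurable_pi_apply j)) measurable_const
      measurable_const).sub_const p
  have hp1 : p ≤ 1 := measureReal_le_one
  have heb : ∀ j ω, |e j ω| ≤ 1 := by
    intro j ω
    simp only [he]
    split_ifs <;> rw [abs_le] <;> constructor <;> linarith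
  have hei : ∀ i j, Integrable (fun ω => e i ω * e j ω) (Measure.pi fun _ : ι => μ) := by
    intro i j
    refine Integrable.of_bound (C := 1) ((hem i).mul (hem j)).aestronglyMeasurable
      (Eventually.of_forall fun ω => ?_)
    rw [Real.norm_eq_abs, abs_mul]
    exact mul_le_one₀ (heb i ω) (abs_nonneg _) (heb j ω)
  have hint1 : Integrable (fun z : Obs => if t < z.1 then (1:ℝ) else 0) μ := by
    refine Integrable.of_bound (C := 1) (Measurable.ite (measurableSet_exceed t) measurable_const
      measurable_const).aestronglyMeasurable (Eventually.of_forall fun ω => ?_)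
    split_ifs <;> simp
  have hoff : ∀ i j, i ≠ j → ∫ ω, e i ω * e j ω ∂(Measure.pi fun _ : ι => μ) = 0 := by
    intro i j hij
    rw [integral_update j (hei i j)]
    refine integral_eq_zero_of_ae (Eventually.of_forall fun ω => ?_)
    simp only [he, Function.update_self, Function.update_of_ne hij]
    rw [integral_const_mul, integral_sub hint1 (integrable_const _), integral_exceed]
    simp [hp]
  have hon : ∀ j, ∫ ω, e j ω * e j ω ∂(Measure.pi fun _ : ι => μ) ≤ p := by
    intro j
    rw [integral_update j (hei j j)]
    have : ∀ ω : ι → Obs, ∫ z, e j (Function.update ω j z) * e j (Function.update ω j z) ∂μ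
        = p - p ^ 2 := by
      intro ω
      simp only [he, Function.update_self]
      have e2 : ∀ z : Obs, ((if t < z.1 then (1:ℝ) else 0) - p) * ((if t < z.1 then 1 else 0) - p)
          = (1 - 2 * p) * (if t < z.1 then 1 else 0) + p ^ 2 := by
        intro z; split_ifs <;> ring
      simp only [e2]
      rw [integral_add (hint1.const_mul _) (integrable_const _), integral_const_mul, integral_exceed]
      simp
      ring
    simp only [this, integral_const, probReal_univ, smul_eq_mul, one_mul]
    nlinarith [sq_nonneg p]
  have hrat : ∀ ω, (exceedRatio μ t ω - 1) ^ 2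
      = (1 / (Fintype.card ι * p) ^ 2) * ∑ i, ∑ j, e i ω * e j ω := by
    intro ω
    have : exceedRatio μ t ω - 1 = (1 / (Fintype.card ι * p)) * ∑ i, e i ω := by
      simp only [he, exceedRatio, exceedCount, Finset.sum_sub_distrib, Finset.sum_const,
        Finset.card_univ, nsmul_eq_mul, ← hp]
      field_simp
    rw [this, mul_pow, sq (∑ i, e i ω), Finset.sum_mul_sum]
    ring
  simp only [hrat]
  rw [integral_const_mul, integral_finsetSum _ fun i _ => integrable_finsetSum _ fun j _ => hei i j]
  simp_rw [integral_finsetSum _ fun j _ => hei _ j]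
  have : ∑ i, ∑ j, ∫ ω, e i ω * e j ω ∂(Measure.pi fun _ : ι => μ) ≤ Fintype.card ι * p := by
    calc _ = ∑ i, ∫ ω, e i ω * e i ω ∂(Measure.pi fun _ : ι => μ) :=
          Finset.sum_congr rfl fun i _ => Finset.sum_eq_single i
            (fun j _ hj => hoff i j hj.symm) (by simp)
      _ ≤ ∑ _i : ι, p := Finset.sum_le_sum fun i _ => hon i
      _ = _ := by simp
  calc _ ≤ (1 / (Fintype.card ι * p) ^ 2) * (Fintype.card ι * p) :=
        mul_le_mul_of_nonneg_left this (by positivity)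
    _ = _ := by field_simp

lemma tendsto_exceedProb {s : ℝ} {u : ℕ → ℝ} (hu : Monotone u) (hlt : ∀ n, u n < s)
    (hlim : Tendsto u atTop (𝓝 s)) :
    Tendsto (fun n => exceedProb μ (u n)) atTop (𝓝 (riskProb μ s).toReal) := by
  have hset : {z : Obs | s ≤ z.1} = ⋂ n, {z : Obs | u n < z.1} := by
    ext z
    simp only [mem_ofPred_eq, mem_iInter]
    exact ⟨fun h n => (hlt n).trans_le h, fun h => le_of_tendsto' hlim fun n => (h n).le⟩
  have h1 := tendsto_measure_iInter_atTop (μ := μ) (s := fun n => {z : Obs | u n < z.1})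
    (fun n => (measurableSet_exceed _).nullMeasurableSet)
    (fun n m hnm z hz => (hu hnm).trans_lt hz) ⟨0, measure_ne_top _ _⟩
  rw [← hset] at h1
  exact (ENNReal.tendsto_toReal (riskProb_ne_top μ s)).comp h1

lemma tendsto_exceedCount (ω : ι → Obs) {s : ℝ} {u : ℕ → ℝ} (hlt : ∀ n, u n < s)
    (hlim : Tendsto u atTop (𝓝 s)) :
    Tendsto (fun n => exceedCount ω (u n)) atTop (𝓝 (riskCount ω s)) := by
  refine tendsto_finsetSum _ fun i _ => ?_
  by_cases h : s ≤ (ω i).1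
  · simp [h, fun n => (hlt n).trans_le h]
  · rw [if_neg h]
    refine tendsto_const_nhds.congr' ?_
    filter_upwards [hlim.eventually (eventually_gt_nhds (not_le.1 h))] with n hn
    rw [if_neg (not_lt.2 hn.le)]

/-- The maximal inequalities run over countably many times. Left limits along rationals carry strict
exceedances over to the numbers at risk at every s. -/
lemma exists_rat_seq (s : ℝ) : ∃ u : ℕ → ℝ, (∀ n, u n ∈ range ((↑) : ℚ → ℝ)) ∧ Monotone u ∧
    (∀ n, u n < s) ∧ Tendsto u atTop (𝓝 s) := by
  obtain ⟨u, h1, h2, h3⟩ := Real.exists_seq_rat_strictMono_tendsto s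
  exact ⟨fun n => (u n : ℝ), fun n => ⟨u n, rfl⟩, fun n m h => Rat.cast_le.2 (h1.monotone h), h2, h3⟩

lemma riskProb_le_exceedProb {q s : ℝ} (h : q < s) : (riskProb μ s).toReal ≤ exceedProb μ q :=
  ENNReal.toReal_mono (measure_ne_top _ _) (measure_mono fun _ hz => h.trans_le hz)

/-- Uniform relative consistency of the number at risk. -/
lemma measure_riskCount_far_le [Nonempty ι] {a δ : ℝ} (ha : 0 < a) (hδ : 0 < δ) :
    (Measure.pi fun _ : ι => μ) {ω | ∃ s, a ≤ (riskProb μ s).toReal ∧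
        δ < |riskCount ω s / (Fintype.card ι * (riskProb μ s).toReal) - 1|}
      ≤ ENNReal.ofReal (1 / (Fintype.card ι * a) / δ ^ 2) := by
  have hc : (0:ℝ) < Fintype.card ι := by exact_mod_cast Fintype.card_pos
  set D : Set ℝ := {q | q ∈ range ((↑) : ℚ → ℝ) ∧ a ≤ exceedProb μ q} with hD
  have hDc : D.Countable := (countable_range _).mono fun q hq => hq.1
  have hDp : ∀ q ∈ D, 0 < exceedProb μ q := fun q hq => ha.trans_le hq.2
  refine le_trans (measure_mono ?_) ((sampleMart_exceedRatio (ι := ι) hDp).maximal_sq hDc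
    (v := 1 / (Fintype.card ι * a)) (fun t ht => ?_) hδ)
  · rintro ω ⟨s, hs, hlt⟩
    by_contra hcon
    simp only [mem_ofPred_eq, not_exists, not_and, not_lt] at hcon
    obtain ⟨u, hu1, hu2, hu3, hu4⟩ := exists_rat_seq s
    have hlim : Tendsto (fun n => |exceedRatio μ (u n) ω - 1|) atTop
        (𝓝 |riskCount ω s / (Fintype.card ι * (riskProb μ s).toReal) - 1|) := by
      refine Tendsto.abs (Tendsto.sub_const (Tendsto.div (tendsto_exceedCount ω hu3 hu4)
        ((tendsto_exceedProb hu2 hu3 hu4).const_mul _) ?_) _)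
      exact (mul_pos hc (ha.trans_le hs)).ne'
    exact absurd (le_of_tendsto' hlim fun n => hcon (u n)
      ⟨hu1 n, hs.trans (riskProb_le_exceedProb (hu3 n))⟩) (not_le.2 hlt)
  · refine (integral_exceedRatio_sq (hDp t ht)).trans ?_
    have := ht.2
    gcongr

/-- The number at risk is bounded by a multiple of its mean. -/
lemma measure_riskCount_large_le [Nonempty ι] {c : ℝ} (hc : 0 < c) :
    (Measure.pi fun _ : ι => μ) {ω | ∃ s, 0 < (riskProb μ s).toReal ∧
        c * (Fintype.card ι * (riskProb μ s).toReal) < riskCount ω s}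
      ≤ ENNReal.ofReal (1 / c) := by
  have hc' : (0:ℝ) < Fintype.card ι := by exact_mod_cast Fintype.card_pos
  set D : Set ℝ := {q | q ∈ range ((↑) : ℚ → ℝ) ∧ 0 < exceedProb μ q} with hD
  have hDc : D.Countable := (countable_range _).mono fun q hq => hq.1
  have hDp : ∀ q ∈ D, 0 < exceedProb μ q := fun q hq => hq.2
  refine le_trans (measure_mono ?_) ((sampleMart_exceedRatio (ι := ι) hDp).maximal hDc
    (fun t ht => Eventually.of_forall fun ω => div_nonneg (exceedCount_nonneg _ _)
      (mul_nonneg hc'.le (hDp t ht).le)) (fun t ht => (integral_exceedRatio (hDp t ht)).le) hc)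
  rintro ω ⟨s, hs, hlt⟩
  by_contra hcon
  simp only [mem_ofPred_eq, not_exists, not_and, not_lt] at hcon
  obtain ⟨u, hu1, hu2, hu3, hu4⟩ := exists_rat_seq s
  have hlim : Tendsto (fun n => exceedRatio μ (u n) ω) atTop
      (𝓝 (riskCount ω s / (Fintype.card ι * (riskProb μ s).toReal))) :=
    Tendsto.div (tendsto_exceedCount ω hu3 hu4)
      ((tendsto_exceedProb hu2 hu3 hu4).const_mul _) (mul_pos hc' hs).ne'
  have := le_of_tendsto' hlim fun n => hcon (u n)
    ⟨hu1 n, hs.trans_le (riskProb_le_exceedProb (hu3 n))⟩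
  rw [div_le_iff₀ (mul_pos hc' hs)] at this
  linarith

end Maximal

/-! ### The Kaplan-Meier estimator of a sample -/

section Estimator

variable {n : ℕ}

/-- The observed times of a sample. -/
def obsX (ω : Fin n → Obs) (i : Fin n) : ℝ := (ω i).1

/-- The censoring indicators of a sample. -/
def obsD (ω : Fin n → Obs) (i : Fin n) : ℝ := if (ω i).2 then 1 else 0

/-- The ordering permutation of a sample. -/
def obsOrder (ω : Fin n → Obs) : Equiv.Perm (Fin n) := order (obsX ω) (obsD ω)

/-- The left limit at `s` of the Kaplan-Meier estimator of the survival function. -/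
def kmLeft (s : ℝ) (ω : Fin n → Obs) : ℝ :=
  1 - ∑ k, if obsX ω (obsOrder ω k) < s then weight (obsX ω) (obsD ω) k else 0

/-- The Kaplan-Meier mass of an uncensored observation at `s`. -/
def kmJump (s : ℝ) (ω : Fin n → Obs) : ℝ := kmLeft s ω / riskCount ω s

lemma obsD_mem (ω : Fin n → Obs) (i : Fin n) : 0 ≤ obsD ω i ∧ obsD ω i ≤ 1 := by
  unfold obsD; split_ifs <;> norm_num

lemma factor_nonneg {d : Fin n → ℝ} (hd : ∀ i, 0 ≤ d i ∧ d i ≤ 1) (j : Fin n) :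
    0 ≤ 1 + (1 - d j) / ((n : ℝ) - ((j : ℕ) + 1)) := by
  have h1 : (0:ℝ) ≤ (n : ℝ) - ((j : ℕ) + 1) := by
    have := j.2
    have : ((j : ℕ) : ℝ) + 1 ≤ n := by exact_mod_cast this
    linarith
  have := div_nonneg (sub_nonneg.2 (hd j).2) h1
  linarith

/-- Passing an uncensored position multiplies the remaining mass by (n - l - 1)/(n - l), while a
censored one leaves it unchanged. The algebra of the induction works for arbitrary values d. -/
lemma one_sub_sum_weight {d : Fin n → ℝ} (l : ℕ) (hl : l < n) :
    1 - ∑ k ∈ Finset.Iio (⟨l, hl⟩ : Fin n), d k / n *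
        ∏ j ∈ Finset.Iio k, (1 + (1 - d j) / ((n : ℝ) - ((j : ℕ) + 1)))
      = (n - l) / n * ∏ j ∈ Finset.Iio (⟨l, hl⟩ : Fin n),
        (1 + (1 - d j) / ((n : ℝ) - ((j : ℕ) + 1))) := by
  have hn : (n : ℝ) ≠ 0 := by exact_mod_cast (Nat.zero_lt_of_lt hl).ne'
  induction l with
  | zero =>
    have : Finset.Iio (⟨0, hl⟩ : Fin n) = ∅ := by
      ext k; simp [Fin.lt_def]
    simp [this, hn]
  | succ l ih =>
    have hl' : l < n := by omega
    have hins : Finset.Iio (⟨l + 1, hl⟩ : Fin n) = insert ⟨l, hl'⟩ (Finset.Iio ⟨l, hl'⟩) := by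
      ext k
      simp only [Finset.mem_Iio, Finset.mem_insert, Fin.lt_def, Fin.ext_iff]
      omega
    have hnot : (⟨l, hl'⟩ : Fin n) ∉ Finset.Iio (⟨l, hl'⟩ : Fin n) := by simp
    rw [hins, Finset.sum_insert hnot, Finset.prod_insert hnot]
    have ih' := ih hl'
    have hpos : (n : ℝ) - (l + 1) ≠ 0 := by
      have : ((l : ℝ) + 1) < n := by exact_mod_cast hl
      linarith
    set S := ∑ k ∈ Finset.Iio (⟨l, hl'⟩ : Fin n), d k / n *
        ∏ j ∈ Finset.Iio k, (1 + (1 - d j) / ((n : ℝ) - ((j : ℕ) + 1)))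
    set p := ∏ j ∈ Finset.Iio (⟨l, hl'⟩ : Fin n), (1 + (1 - d j) / ((n : ℝ) - ((j : ℕ) + 1)))
    have : S = 1 - (n - l) / n * p := by linarith
    rw [this]
    push_cast
    field_simp
    ring

lemma weight_nonneg (ω : Fin n → Obs) (k : Fin n) : 0 ≤ weight (obsX ω) (obsD ω) k :=
  mul_nonneg (div_nonneg (obsD_mem ω _).1 n.cast_nonneg)
    (Finset.prod_nonneg fun j _ => factor_nonneg (d := fun j => obsD ω (obsOrder ω j))
      (fun _ => obsD_mem ω _) j)

/-- Before the last position the remaining mass is 1/n times the product of the factors, and the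
last weight is at most this. Mass is lost when the last observation is censored. -/
lemma sum_weight_le_one (ω : Fin n → Obs) : ∑ k, weight (obsX ω) (obsD ω) k ≤ 1 := by
  rcases Nat.eq_zero_or_pos n with rfl | hn
  · simp
  set d : Fin n → ℝ := fun j => obsD ω (obsOrder ω j) with hd
  have hl : n - 1 < n := by omega
  have huniv : (Finset.univ : Finset (Fin n)) = insert ⟨n - 1, hl⟩ (Finset.Iio ⟨n - 1, hl⟩) := by
    ext k
    simp only [Finset.mem_univ, Finset.mem_insert, Finset.mem_Iio, Fin.lt_def, Fin.ext_iff, true_iff]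
    omega
  have h1 := one_sub_sum_weight (d := d) (n - 1) hl
  have h2 : ∑ k, weight (obsX ω) (obsD ω) k = weight (obsX ω) (obsD ω) ⟨n - 1, hl⟩
      + ∑ k ∈ Finset.Iio (⟨n - 1, hl⟩ : Fin n), weight (obsX ω) (obsD ω) k := by
    rw [huniv, Finset.sum_insert (by simp)]
  rw [h2]
  have hn' : (0:ℝ) < n := by exact_mod_cast hn
  have hcast : ((n : ℝ) - ((n - 1 : ℕ) : ℝ)) = 1 := by
    rw [Nat.cast_sub hn]; simp
  rw [hcast] at h1
  have hp : 0 ≤ ∏ j ∈ Finset.Iio (⟨n - 1, hl⟩ : Fin n), (1 + (1 - d j) / ((n : ℝ) - ((j : ℕ) + 1))) :=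
    Finset.prod_nonneg fun j _ => factor_nonneg (d := d) (fun i => obsD_mem ω _) j
  have h3 : weight (obsX ω) (obsD ω) ⟨n - 1, hl⟩ ≤ 1 / n *
      ∏ j ∈ Finset.Iio (⟨n - 1, hl⟩ : Fin n), (1 + (1 - d j) / ((n : ℝ) - ((j : ℕ) + 1))) := by
    refine mul_le_mul_of_nonneg_right ?_ hp
    exact div_le_div_of_nonneg_right (obsD_mem ω _).2 hn'.le
  change _ = _ at h1
  have h4 : 1 - ∑ k ∈ Finset.Iio (⟨n - 1, hl⟩ : Fin n), weight (obsX ω) (obsD ω) k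
      = 1 / n * ∏ j ∈ Finset.Iio (⟨n - 1, hl⟩ : Fin n),
        (1 + (1 - d j) / ((n : ℝ) - ((j : ℕ) + 1))) := h1
  linarith

lemma kmLeft_le_one (s : ℝ) (ω : Fin n → Obs) : kmLeft s ω ≤ 1 :=
  sub_le_self _ (Finset.sum_nonneg fun k _ => by split_ifs; exacts [weight_nonneg ω k, le_rfl])

lemma kmLeft_nonneg (s : ℝ) (ω : Fin n → Obs) : 0 ≤ kmLeft s ω := by
  refine sub_nonneg.2 ((Finset.sum_le_sum fun k _ => ?_).trans (sum_weight_le_one ω))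
  split_ifs
  exacts [le_rfl, weight_nonneg ω k]

lemma sorted_le (ω : Fin n → Obs) {k l : Fin n} (h : k ≤ l) :
    obsX ω (obsOrder ω k) < obsX ω (obsOrder ω l) ∨
      obsX ω (obsOrder ω k) = obsX ω (obsOrder ω l) ∧
        1 - obsD ω (obsOrder ω k) ≤ 1 - obsD ω (obsOrder ω l) := by
  have := Tuple.monotone_sort (fun i => toLex (obsX ω i, 1 - obsD ω i)) h
  exact Prod.Lex.le_iff.1 this

lemma sorted_time_le (ω : Fin n → Obs) {k l : Fin n} (h : k ≤ l) :
    obsX ω (obsOrder ω k) ≤ obsX ω (obsOrder ω l) := by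
  rcases sorted_le ω h with h | h
  exacts [h.le, h.1.le]

/-- The weight of an uncensored observation, in terms of the estimated survival function and of
the number at risk. -/
lemma weight_eq_kmJump (ω : Fin n → Obs) (i : Fin n) :
    weight (obsX ω) (obsD ω) i
      = if (ω (obsOrder ω i)).2 then kmJump (obsX ω (obsOrder ω i)) ω else 0 := by
  split_ifs with hi
  swap
  · have : obsD ω (obsOrder ω i) = 0 := by simp [obsD, hi]
    have h2 : obsD ω (order (obsX ω) (obsD ω) i) = 0 := this
    simp [weight, h2]
  set u := obsX ω (obsOrder ω i) with hu
  set d : Fin n → ℝ := fun j => obsD ω (obsOrder ω j) with hd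
  have hn : (0:ℝ) < n := by exact_mod_cast (Nat.zero_le _).trans_lt i.2
  have hdi : d i = 1 := by simp [hd, obsD, hi]
  have hne : (Finset.univ.filter fun k => obsX ω (obsOrder ω k) = u).Nonempty := ⟨i, by simp [hu]⟩
  -- l is the first position of the block of ties at u. Uncensored observations come first in a
  -- block, so the factors from l up to i are 1, and the n - l positions from l on are the
  -- observations at risk at u.
  set l := Finset.min' _ hne with hl
  have hlm : obsX ω (obsOrder ω l) = u := by
    have := Finset.min'_mem _ hne
    simpa using this
  have hli : l ≤ i := Finset.min'_le _ _ (by simp [hu])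
  have hlt : ∀ k, obsX ω (obsOrder ω k) < u ↔ k < l := by
    intro k
    constructor
    · intro h
      by_contra hcon
      exact absurd (sorted_time_le ω (not_lt.1 hcon)) (not_le.2 (hlm ▸ h))
    · intro h
      refine lt_of_le_of_ne (hlm ▸ sorted_time_le ω h.le) fun he => ?_
      exact absurd (Finset.min'_le _ k (by simpa using he)) (not_le.2 h)
  have hprod : ∏ j ∈ Finset.Iio i, (1 + (1 - d j) / ((n : ℝ) - ((j : ℕ) + 1)))
      = ∏ j ∈ Finset.Iio l, (1 + (1 - d j) / ((n : ℝ) - ((j : ℕ) + 1))) := by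
    symm
    refine Finset.prod_subset (Finset.Iio_subset_Iio hli) fun j hj hj' => ?_
    simp only [Finset.mem_Iio, not_lt] at hj hj'
    have h1 : ¬ obsX ω (obsOrder ω j) < u := fun h => absurd ((hlt j).1 h) (not_lt.2 hj')
    rcases sorted_le ω hj.le with h | ⟨-, h⟩
    · exact absurd h h1
    · have h2 : d j = 1 := le_antisymm (obsD_mem ω _).2 (by
        have h3 : 1 - d j ≤ 1 - d i := h
        linarith)
      rw [h2]; simp
  have hsum : kmLeft u ω = (n - (l : ℕ)) / n *
      ∏ j ∈ Finset.Iio l, (1 + (1 - d j) / ((n : ℝ) - ((j : ℕ) + 1))) := by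
    rw [← one_sub_sum_weight (d := d) l l.2, kmLeft, ← Finset.sum_filter]
    congr 1
    refine Finset.sum_congr ?_ fun k _ => rfl
    ext k
    simp [hlt k]
  have hrisk : riskCount ω u = n - (l : ℕ) := by
    have h1 : riskCount ω u = ∑ k, if u ≤ obsX ω (obsOrder ω k) then (1:ℝ) else 0 :=
      (Equiv.sum_comp (obsOrder ω) fun i => if u ≤ (ω i).1 then (1:ℝ) else 0).symm
    rw [h1, ← Finset.sum_filter]
    have h2 : (Finset.univ.filter fun k => u ≤ obsX ω (obsOrder ω k)) = Finset.Ici l := by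
      ext k
      simp only [Finset.mem_filter, Finset.mem_univ, true_and, Finset.mem_Ici]
      rw [← not_lt, hlt k, not_lt]
    rw [h2, Finset.sum_const, Fin.card_Ici, nsmul_eq_mul, mul_one, Nat.cast_sub l.2.le]
  have hpos : (0:ℝ) < n - (l : ℕ) := by
    have : ((l : ℕ) : ℝ) < n := by exact_mod_cast l.2
    linarith
  change d i / n * ∏ j ∈ Finset.Iio i, (1 + (1 - d j) / ((n : ℝ) - ((j : ℕ) + 1))) = _
  rw [hprod, hdi, kmJump, hsum, hrisk]
  field_simp

lemma kmJump_nonneg (s : ℝ) (ω : Fin n → Obs) : 0 ≤ kmJump s ω :=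
  div_nonneg (kmLeft_nonneg s ω) (riskCount_nonneg ω s)

lemma kmLeft_eq (s : ℝ) (ω : Fin n → Obs) :
    kmLeft s ω = 1 - ∑ i, if (ω i).2 ∧ (ω i).1 < s then kmJump (ω i).1 ω else 0 := by
  rw [kmLeft]
  congr 1
  rw [← Equiv.sum_comp (obsOrder ω)
    (fun i => if (ω i).2 ∧ (ω i).1 < s then kmJump (ω i).1 ω else 0)]
  refine Finset.sum_congr rfl fun k _ => ?_
  rw [weight_eq_kmJump]
  by_cases h1 : (ω (obsOrder ω k)).2 = true <;> by_cases h2 : (ω (obsOrder ω k)).1 < s <;>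
    simp [h1, h2, obsX]

/-- The Kaplan-Meier estimator of the survival function. -/
def kmRight (s : ℝ) (ω : Fin n → Obs) : ℝ :=
  1 - ∑ i, if (ω i).2 ∧ (ω i).1 ≤ s then kmJump (ω i).1 ω else 0

lemma sum_kmJump_le_one (ω : Fin n → Obs) : ∑ i, (if (ω i).2 then kmJump (ω i).1 ω else 0) ≤ 1 := by
  refine le_trans (le_of_eq ?_) (sum_weight_le_one ω)
  rw [← Equiv.sum_comp (obsOrder ω)]
  exact Finset.sum_congr rfl fun k _ => (weight_eq_kmJump ω k).symm

lemma kmRight_nonneg (s : ℝ) (ω : Fin n → Obs) : 0 ≤ kmRight s ω := by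
  refine sub_nonneg.2 ((Finset.sum_le_sum fun k _ => ?_).trans (sum_kmJump_le_one ω))
  have := kmJump_nonneg (ω k).1 ω
  by_cases h1 : (ω k).2 = true <;> by_cases h2 : (ω k).1 ≤ s <;> simp [h1, h2, this]

/-- The estimator as a sum over the uncensored observations. -/
lemma estimator_eq (ω : Fin n → Obs) : estimator (obsX ω) (obsD ω)
    = ∑ i, ENNReal.ofReal (kmJump (ω i).1 ω) • jumpMeasure (ω i) := by
  rw [estimator, ← Equiv.sum_comp (obsOrder ω)
    (fun i => ENNReal.ofReal (kmJump (ω i).1 ω) • jumpMeasure (ω i))]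
  refine Finset.sum_congr rfl fun k _ => ?_
  rw [weight_eq_kmJump, jumpMeasure]
  split_ifs with h
  · rfl
  · simp

lemma riskCount_update {ι : Type*} [Fintype ι] [DecidableEq ι] {ω : ι → Obs} {j : ι} {z : Obs}
    {s : ℝ} (h1 : s ≤ (ω j).1) (h2 : s ≤ z.1) :
    riskCount (Function.update ω j z) s = riskCount ω s := by
  refine Finset.sum_congr rfl fun i _ => ?_
  by_cases hij : i = j
  · subst hij; simp [h1, h2]
  · rw [Function.update_of_ne hij]

/-- Induction on the number of observations before s: `kmLeft_eq` expresses the value at s by the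
jumps at earlier event times, and observation j is not among these. -/
lemma predictable_kmLeft : Predictable (kmLeft (n := n)) := by
  intro j s ω z
  induction hm : (Finset.univ.filter fun i => (ω i).1 < s).card using Nat.strong_induction_on
    generalizing s with
  | _ m ih =>
    intro h1 h2
    rw [kmLeft_eq, kmLeft_eq]
    congr 1
    refine Finset.sum_congr rfl fun i _ => ?_
    by_cases hij : i = j
    · subst hij
      rw [Function.update_self]
      simp [not_lt.2 h1, not_lt.2 h2]
    · rw [Function.update_of_ne hij]
      by_cases hs : (ω i).1 < s
      · have hcard : (Finset.univ.filter fun k => (ω k).1 < (ω i).1).card < m := by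
          rw [← hm]
          refine Finset.card_lt_card ⟨fun k hk => ?_, fun hcon => ?_⟩
          · simp only [Finset.mem_filter, Finset.mem_univ, true_and] at hk ⊢
            exact hk.trans hs
          · have := hcon (show i ∈ Finset.univ.filter fun k => (ω k).1 < s by simp [hs])
            simp at this
        have e := ih _ hcard (ω i).1 rfl (hs.le.trans h1) (hs.le.trans h2)
        unfold kmJump
        rw [e, riskCount_update (hs.le.trans h1) (hs.le.trans h2)]
      · simp [hs]

lemma predictable_kmJump : Predictable (kmJump (n := n)) := by
  intro j s ω z h1 h2
  unfold kmJump
  rw [predictable_kmLeft j s ω z h1 h2, riskCount_update h1 h2]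

lemma measurable_obsX (i : Fin n) : Measurable fun ω : Fin n → Obs => obsX ω i :=
  measurable_fst.comp (measurable_pi_apply i)

lemma measurable_obsD (i : Fin n) : Measurable fun ω : Fin n → Obs => obsD ω i :=
  Measurable.ite (measurableSet_snd_true.preimage (measurable_pi_apply i)) measurable_const measurable_const

/-- The sorting permutation is characterised by finitely many comparisons of times and indicators,
the second family expressing stability of the sort. Once the permutation is fixed, the estimator is
an explicit function of the data. -/
lemma measurableSet_obsOrder (σ : Equiv.Perm (Fin n)) :
    MeasurableSet {ω : Fin n → Obs | obsOrder ω = σ} := by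
  have h : {ω : Fin n → Obs | obsOrder ω = σ}
      = (⋂ (i : Fin n) (j : Fin n) (_ : i ≤ j), ({ω | obsX ω (σ i) < obsX ω (σ j)} ∪
          ({ω | obsX ω (σ i) = obsX ω (σ j)} ∩ {ω | 1 - obsD ω (σ i) ≤ 1 - obsD ω (σ j)})))
        ∩ ⋂ (i : Fin n) (j : Fin n) (_ : i < j), ({ω | obsX ω (σ i) = obsX ω (σ j)} ∩
          {ω | 1 - obsD ω (σ i) = 1 - obsD ω (σ j)})ᶜ ∪ {_ω | σ i < σ j} := by
    ext ω
    simp only [mem_ofPred_eq, mem_inter_iff, mem_iInter, mem_union, mem_compl_iff]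
    rw [obsOrder, order, eq_comm, Tuple.eq_sort_iff]
    simp only [Monotone, Function.comp, Prod.Lex.le_iff, ofLex_toLex, toLex_inj, Prod.mk.injEq]
    refine and_congr Iff.rfl ?_
    refine forall_congr' fun i => forall_congr' fun j => forall_congr' fun _ => ?_
    tauto
  rw [h]
  refine MeasurableSet.inter ?_ ?_
  · refine MeasurableSet.iInter fun i => MeasurableSet.iInter fun j => MeasurableSet.iInter fun _ => ?_
    exact (measurableSet_lt (measurable_obsX _) (measurable_obsX _)).union
      ((measurableSet_eq_fun (measurable_obsX _) (measurable_obsX _)).inter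
        (measurableSet_le (measurable_const.sub (measurable_obsD _))
          (measurable_const.sub (measurable_obsD _))))
  · refine MeasurableSet.iInter fun i => MeasurableSet.iInter fun j => MeasurableSet.iInter fun _ => ?_
    exact ((measurableSet_eq_fun (measurable_obsX _) (measurable_obsX _)).inter
        (measurableSet_eq_fun (measurable_const.sub (measurable_obsD _))
          (measurable_const.sub (measurable_obsD _)))).compl.union (MeasurableSet.const _)

lemma measurable_kmLeft : Measurable (Function.uncurry (kmLeft (n := n))) := by
  have h : Function.uncurry (kmLeft (n := n)) = fun q => ∑ σ : Equiv.Perm (Fin n),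
      if obsOrder q.2 = σ then 1 - ∑ k, (if obsX q.2 (σ k) < q.1 then
        obsD q.2 (σ k) / n * ∏ j ∈ Finset.Iio k,
          (1 + (1 - obsD q.2 (σ j)) / ((n : ℝ) - ((j : ℕ) + 1))) else 0) else 0 := by
    ext q
    rw [Finset.sum_ite_eq]
    simp only [Finset.mem_univ, if_true]
    rfl
  rw [h]
  refine Finset.measurable_sum _ fun σ _ => Measurable.ite
    ((measurableSet_obsOrder σ).preimage measurable_snd) ?_ measurable_const
  refine measurable_const.sub (Finset.measurable_sum _ fun k _ => Measurable.ite
    (measurableSet_lt ((measurable_obsX _).comp measurable_snd) measurable_fst) ?_ measurable_const)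
  refine (((measurable_obsD _).comp measurable_snd).div_const _).mul
    (Finset.measurable_prod _ fun j _ => ?_)
  exact ((measurable_const.sub ((measurable_obsD _).comp measurable_snd)).div_const _).const_add _

lemma measurable_kmJump : Measurable (Function.uncurry (kmJump (n := n))) :=
  measurable_kmLeft.div measurable_riskCount

lemma tendsto_kmRight (ω : Fin n → Obs) {s : ℝ} {u : ℕ → ℝ} (hlt : ∀ n, u n < s)
    (hlim : Tendsto u atTop (𝓝 s)) : Tendsto (fun k => kmRight (u k) ω) atTop (𝓝 (kmLeft s ω)) := by
  rw [kmLeft_eq]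
  refine Tendsto.const_sub _ (tendsto_finsetSum _ fun i _ => ?_)
  by_cases h : (ω i).1 < s
  · refine tendsto_const_nhds.congr' ?_
    filter_upwards [hlim.eventually (eventually_gt_nhds h)] with k hk
    simp [h, hk.le]
  · have : ∀ k, ¬ (ω i).1 ≤ u k := fun k hk => h (hk.trans_lt (hlt k))
    simp [h, this]

end Estimator

/-! ### Calculus of survival functions with atoms -/

section Survival

/-- Left and right limits of survival functions. -/
lemma tendsto_surv_left {ν : Measure ℝ} [IsFiniteMeasure ν] {s : ℝ} {u : ℕ → ℝ}
    (hlt : ∀ n, u n < s) (hlim : Tendsto u atTop (𝓝 s)) :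
    Tendsto (fun n => surv ν (u n)) atTop (𝓝 (survLeft ν s)) := by
  have e : ∀ A : Set ℝ, MeasurableSet A → ν.real A = ∫ x, A.indicator (fun _ => (1:ℝ)) x ∂ν :=
    fun A hA => by rw [integral_indicator_const _ hA]; simp
  simp only [surv, survLeft]
  simp_rw [e _ measurableSet_Ioi, e _ measurableSet_Ici]
  refine tendsto_integral_of_dominated_convergence (fun _ => 1)
    (fun n => (measurable_const.indicator measurableSet_Ioi).aestronglyMeasurable)
    (integrable_const _) (fun n => ae_of_all _ fun x => ?_) (ae_of_all _ fun x => ?_)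
  · simp only [indicator]; split_ifs <;> simp
  · by_cases h : x < s
    · refine tendsto_const_nhds.congr' ?_
      filter_upwards [hlim.eventually (eventually_gt_nhds h)] with k hk
      simp [h, hk.le]
    · refine tendsto_const_nhds.congr fun k => ?_
      have h1 : u k < x := (hlt k).trans_le (not_lt.1 h)
      simp [not_lt.1 h, h1]

lemma tendsto_surv_right {ν : Measure ℝ} [IsFiniteMeasure ν] {s : ℝ} {u : ℕ → ℝ}
    (hlt : ∀ n, s ≤ u n) (hlim : Tendsto u atTop (𝓝 s)) :
    Tendsto (fun n => surv ν (u n)) atTop (𝓝 (surv ν s)) := by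
  have e : ∀ A : Set ℝ, MeasurableSet A → ν.real A = ∫ x, A.indicator (fun _ => (1:ℝ)) x ∂ν :=
    fun A hA => by rw [integral_indicator_const _ hA]; simp
  simp only [surv]
  simp_rw [e _ measurableSet_Ioi]
  refine tendsto_integral_of_dominated_convergence (fun _ => 1)
    (fun n => (measurable_const.indicator measurableSet_Ioi).aestronglyMeasurable)
    (integrable_const _) (fun n => ae_of_all _ fun x => ?_) (ae_of_all _ fun x => ?_)
  · simp only [indicator]; split_ifs <;> simp
  · by_cases h : s < x
    · refine tendsto_const_nhds.congr' ?_
      filter_upwards [hlim.eventually (eventually_lt_nhds h)] with k hk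
      simp [h, hk]
    · refine tendsto_const_nhds.congr fun k => ?_
      have h1 : x ≤ u k := (not_lt.1 h).trans (hlt k)
      simp [not_lt.1 h, h1]

lemma surv_antitone (ν : Measure ℝ) [IsFiniteMeasure ν] : Antitone (surv ν) :=
  fun _ _ h => measureReal_mono (Ioi_subset_Ioi h)

lemma survLeft_antitone (ν : Measure ℝ) [IsFiniteMeasure ν] : Antitone (survLeft ν) :=
  fun _ _ h => measureReal_mono (Ici_subset_Ici.2 h)

lemma surv_nonneg (ν : Measure ℝ) (x : ℝ) : 0 ≤ surv ν x := measureReal_nonneg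

lemma survLeft_nonneg (ν : Measure ℝ) (x : ℝ) : 0 ≤ survLeft ν x := measureReal_nonneg

lemma surv_le_survLeft (ν : Measure ℝ) [IsFiniteMeasure ν] (x : ℝ) : surv ν x ≤ survLeft ν x :=
  measureReal_mono Ioi_subset_Ici_self

lemma survLeft_le_surv (ν : Measure ℝ) [IsFiniteMeasure ν] {x y : ℝ} (h : x < y) :
    survLeft ν y ≤ surv ν x :=
  measureReal_mono fun _ hz => h.trans_le hz

lemma measurable_surv (ν : Measure ℝ) [IsFiniteMeasure ν] : Measurable (surv ν) :=
  (surv_antitone ν).measurable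

lemma measurable_survLeft (ν : Measure ℝ) [IsFiniteMeasure ν] : Measurable (survLeft ν) :=
  (survLeft_antitone ν).measurable

lemma survLeft_eq (ν : Measure ℝ) [IsFiniteMeasure ν] (x : ℝ) :
    survLeft ν x = ν.real {x} + surv ν x := by
  rw [survLeft, surv, ← measureReal_union (by simp) measurableSet_Ioi, singleton_union, Ioi_insert]

lemma surv_sub (ν : Measure ℝ) [IsFiniteMeasure ν] {a b : ℝ} (h : a ≤ b) :
    surv ν a - surv ν b = ν.real (Ioc a b) := by
  rw [surv, surv, ← Ioc_union_Ioi_eq_Ioi h, measureReal_union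
    (Set.disjoint_left.2 fun x (hx : x ∈ Ioc a b) (hx' : x ∈ Ioi b) => absurd hx.2 (not_le.2 hx'))
    measurableSet_Ioi]
  ring

/-- The change of `1 / (κ + S)` over an interval. -/
lemma integral_inv_surv_add {ν : Measure ℝ} [IsFiniteMeasure ν] {κ : ℝ} (hκ : 0 < κ) {a c : ℝ}
    (hac : a < c) :
    ∫ s in Ioc a c, ((κ + surv ν s) * (κ + survLeft ν s))⁻¹ ∂ν
      = (κ + surv ν c)⁻¹ - (κ + surv ν a)⁻¹ := by
  have hpos : ∀ x, 0 < κ + surv ν x := fun x => by have := surv_nonneg ν x; linarith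
  set mesh : ℕ → ℕ → ℝ := fun m k => a + (c - a) * (k / m) with hmesh
  have hmono : ∀ m, Monotone (mesh m) := fun m k l h => by
    have : (k : ℝ) / m ≤ l / m := by gcongr
    have h2 : 0 ≤ c - a := by linarith
    simp only [hmesh]
    nlinarith
  have h0 : ∀ m, mesh m 0 = a := fun m => by simp [hmesh]
  have hm : ∀ m, 0 < m → mesh m m = c := fun m hm => by
    have : (m : ℝ) ≠ 0 := by exact_mod_cast hm.ne'
    simp [hmesh, this]
  -- A step function on a uniform mesh. Its integral over each cell is an exact increment of 1/(κ +
  -- S), so the sum telescopes. In the limit the left end of the cell around s gives S(s-), the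
  -- right end gives S(s), and κ > 0 provides the domination.
  set φ : ℕ → ℝ → ℝ := fun m s => ∑ k ∈ Finset.range m,
    (Ioc (mesh m k) (mesh m (k + 1))).indicator
      (fun _ => ((κ + surv ν (mesh m (k + 1))) * (κ + surv ν (mesh m k)))⁻¹) s with hφ
  have hint : ∀ m, 0 < m → ∫ s in Ioc a c, φ m s ∂ν = (κ + surv ν c)⁻¹ - (κ + surv ν a)⁻¹ := by
    intro m hm0
    rw [integral_finsetSum]
    swap
    · exact fun k _ => (integrable_const _).indicator measurableSet_Ioc
    have : ∀ k ∈ Finset.range m, ∫ s in Ioc a c, (Ioc (mesh m k) (mesh m (k + 1))).indicator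
      (fun _ => ((κ + surv ν (mesh m (k + 1))) * (κ + surv ν (mesh m k)))⁻¹) s ∂ν
        = (κ + surv ν (mesh m (k + 1)))⁻¹ - (κ + surv ν (mesh m k))⁻¹ := by
      intro k hk
      have hsub : Ioc (mesh m k) (mesh m (k + 1)) ⊆ Ioc a c := by
        refine Ioc_subset_Ioc ?_ ?_
        · rw [← h0 m]; exact hmono m (Nat.zero_le _)
        · rw [← hm m hm0]; exact hmono m (Finset.mem_range.1 hk)
      rw [integral_indicator measurableSet_Ioc, Measure.restrict_restrict measurableSet_Ioc,
        inter_eq_left.2 hsub, setIntegral_const, ← surv_sub ν (hmono m (Nat.le_succ k)), smul_eq_mul]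
      have h1 := (hpos (mesh m k)).ne'
      have h2 := (hpos (mesh m (k + 1))).ne'
      field_simp
      ring
    rw [Finset.sum_congr rfl this, Finset.sum_range_sub (fun k => (κ + surv ν (mesh m k))⁻¹), h0,
      hm m hm0]
  have hval : ∀ m : ℕ, 0 < m → ∀ s ∈ Ioc a c, ∃ l r : ℝ, l < s ∧ s ≤ r ∧ r - l = (c - a) / m ∧
      φ m s = ((κ + surv ν r) * (κ + surv ν l))⁻¹ := by
    intro m hm0 s hs
    have hex : ∃ k, s ≤ mesh m k := ⟨m, by rw [hm m hm0]; exact hs.2⟩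
    classical
    set k := Nat.find hex with hk
    have hk0 : k ≠ 0 := fun h => by
      have := Nat.find_spec hex
      rw [← hk, h, h0] at this
      exact absurd hs.1 (not_lt.2 this)
    obtain ⟨j, hj⟩ := Nat.exists_eq_succ_of_ne_zero hk0
    have hle : s ≤ mesh m (j + 1) := by have := Nat.find_spec hex; rwa [← hk, hj] at this
    have hlt : mesh m j < s := not_le.1 (Nat.find_min hex (by rw [← hk, hj]; exact Nat.lt_succ_self j))
    have hjm : j < m := by
      by_contra hcon
      have := hmono m (not_lt.1 hcon)
      rw [hm m hm0] at this
      exact absurd (hlt.trans_le hs.2) (not_lt.2 this)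
    refine ⟨mesh m j, mesh m (j + 1), hlt, hle, ?_, ?_⟩
    · simp only [hmesh]; push_cast; ring
    · simp only [hφ]
      rw [Finset.sum_eq_single_of_mem j (Finset.mem_range.2 hjm)]
      · exact indicator_of_mem (show s ∈ Ioc _ _ from ⟨hlt, hle⟩) _
      · intro i _ hij
        refine indicator_of_notMem (fun h => ?_) _
        rcases lt_or_gt_of_ne hij with h' | h'
        · exact absurd (hlt.trans_le h.2) (not_lt.2 (hmono m h'))
        · exact absurd (h.1.trans_le hle) (not_lt.2 (hmono m h'))
  have hlim : Tendsto (fun m => ∫ s in Ioc a c, φ (m + 1) s ∂ν) atTop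
      (𝓝 (∫ s in Ioc a c, ((κ + surv ν s) * (κ + survLeft ν s))⁻¹ ∂ν)) := by
    refine tendsto_integral_of_dominated_convergence (fun _ => (κ * κ)⁻¹) (fun m => ?_)
      (integrable_const _) (fun m => ?_) ?_
    · refine (Finset.measurable_sum _ fun k _ => ?_).aestronglyMeasurable
      exact measurable_const.indicator measurableSet_Ioc
    · filter_upwards [ae_restrict_mem measurableSet_Ioc] with s hs
      obtain ⟨l, r, -, -, -, h⟩ := hval (m + 1) m.succ_pos s hs
      rw [h, Real.norm_of_nonneg (inv_nonneg.2 (mul_pos (hpos _) (hpos _)).le)]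
      have h1 := surv_nonneg ν r
      have h2 := surv_nonneg ν l
      gcongr <;> linarith
    · filter_upwards [ae_restrict_mem measurableSet_Ioc] with s hs
      choose l r hl hr hlr h using fun m : ℕ => hval (m + 1) m.succ_pos s hs
      have hz : Tendsto (fun m : ℕ => (c - a) / ((m + 1 : ℕ) : ℝ)) atTop (𝓝 0) :=
        (tendsto_const_div_atTop_nhds_zero_nat (c - a)).comp (tendsto_add_atTop_nat 1)
      have hl' : Tendsto l atTop (𝓝 s) := by
        refine tendsto_of_tendsto_of_tendsto_of_le_of_le (by simpa using hz.const_sub s)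
          tendsto_const_nhds (fun m => ?_) fun m => (hl m).le
        have h1 := hlr m; have h2 := hr m; push_cast at h1 ⊢; linarith
      have hr' : Tendsto r atTop (𝓝 s) := by
        refine tendsto_of_tendsto_of_tendsto_of_le_of_le tendsto_const_nhds
          (by simpa using hz.const_add s) (fun m => hr m) fun m => ?_
        have h1 := hlr m; have h2 := hl m; push_cast at h1 ⊢; linarith
      simp_rw [h]
      refine Tendsto.inv₀ (((tendsto_surv_right hr hr').const_add κ).mul
        ((tendsto_surv_left hl hl').const_add κ)) (mul_pos (hpos s) ?_).ne'
      have := survLeft_nonneg ν s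
      linarith
  exact tendsto_nhds_unique hlim (tendsto_const_nhds.congr fun m => (hint (m + 1) m.succ_pos).symm)

/-- The perturbed formula is applied to F restricted to (-∞,c) with κ = S(c-): there κ plus the
restricted survival function equals S. Thus S(c) itself may vanish. -/
lemma integral_Ioo_inv_surv {F : Measure ℝ} [IsFiniteMeasure F] {a c : ℝ} (hac : a < c)
    (hc : 0 < survLeft F c) :
    ∫ s in Ioo a c, (surv F s * survLeft F s)⁻¹ ∂F = (survLeft F c)⁻¹ - (surv F a)⁻¹ := by
  have h := integral_inv_surv_add (ν := F.restrict (Iio c)) hc hac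
  have h1 : ∀ s < c, survLeft F c + surv (F.restrict (Iio c)) s = surv F s := fun s hs => by
    rw [survLeft, surv, surv, measureReal_restrict_apply measurableSet_Ioi, Ioi_inter_Iio,
      ← Ioo_union_Ici_eq_Ioi hs, measureReal_union
        (Set.disjoint_left.2 fun x (hx : x ∈ Ioo s c) (hx' : x ∈ Ici c) => absurd hx.2 (not_lt.2 hx'))
        measurableSet_Ici]
    ring
  have h2 : ∀ s < c, survLeft F c + survLeft (F.restrict (Iio c)) s = survLeft F s := fun s hs => by
    rw [survLeft, survLeft, survLeft, measureReal_restrict_apply measurableSet_Ici, Ici_inter_Iio,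
      ← Ico_union_Ici_eq_Ici hs.le, measureReal_union
        (Set.disjoint_left.2 fun x (hx : x ∈ Ico s c) (hx' : x ∈ Ici c) => absurd hx.2 (not_lt.2 hx'))
        measurableSet_Ici]
    ring
  have h3 : surv (F.restrict (Iio c)) c = 0 := by
    rw [surv, measureReal_restrict_apply measurableSet_Ioi, Ioi_inter_Iio]; simp
  rw [h1 a hac, h3, add_zero, Measure.restrict_restrict measurableSet_Ioc,
    show Ioc a c ∩ Iio c = Ioo a c by
      ext x; exact ⟨fun h => ⟨h.1.1, h.2⟩, fun h => ⟨⟨h.1, le_of_lt h.2⟩, h.2⟩⟩] at h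
  rw [← h]
  refine setIntegral_congr_fun measurableSet_Ioo fun s hs => ?_
  simp only [h1 s hs.2, h2 s hs.2]

lemma integral_Ioc_inv_surv {F : Measure ℝ} [IsFiniteMeasure F] {a c : ℝ} (hac : a < c)
    (hc : 0 < surv F c) :
    ∫ s in Ioc a c, (surv F s * survLeft F s)⁻¹ ∂F = (surv F c)⁻¹ - (surv F a)⁻¹ := by
  have h0 : 0 < survLeft F c := hc.trans_le (surv_le_survLeft F c)
  have hdisj : Disjoint (Ioo a c) {c} := by simp
  have hi : ∀ s ≤ c, (surv F s * survLeft F s)⁻¹ ≤ (surv F c * surv F c)⁻¹ := fun s hs => by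
    have h0' := surv_nonneg F s
    have := surv_antitone F hs
    have := (surv_antitone F hs).trans (surv_le_survLeft F s)
    gcongr
  have hint : IntegrableOn (fun s => (surv F s * survLeft F s)⁻¹) (Iic c) F := by
    refine Integrable.mono' (integrable_const (surv F c * surv F c)⁻¹)
      ((measurable_surv F).mul (measurable_survLeft F)).inv.aestronglyMeasurable ?_
    filter_upwards [ae_restrict_mem measurableSet_Iic] with s hs
    rw [Real.norm_of_nonneg (inv_nonneg.2 (mul_nonneg (surv_nonneg F s) (survLeft_nonneg F s)))]
    exact hi s hs
  rw [← Ioo_union_right hac, setIntegral_union hdisj (measurableSet_singleton c)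
    (hint.mono_set fun x hx => hx.2.le) (hint.mono_set fun x hx => (mem_singleton_iff.1 hx).le),
    integral_Ioo_inv_surv hac h0, integral_singleton, smul_eq_mul]
  have h1 := survLeft_eq F c
  have h2 : F.real {c} = survLeft F c - surv F c := by linarith
  rw [h2]
  field_simp
  ring

end Survival

/-! ### The hazard measure and the forward operator -/

section Forward

variable {F : Measure ℝ} [IsProbabilityMeasure F]

lemma measurable_Ici_inv (ν : Measure ℝ) : Measurable fun t => (ν (Ici t))⁻¹ :=
  (show Antitone fun t => ν (Ici t) from
    fun _ _ h => measure_mono (Ici_subset_Ici.2 h)).measurable.inv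

lemma hazard_eq (hF : F (Iic 0) = 0) : hazard F = F.withDensity fun t => (F (Ici t))⁻¹ := by
  rw [hazard, Measure.restrict_eq_self_of_ae_mem]
  rw [← compl_Ioi] at hF
  exact mem_ae_iff.2 hF

lemma ae_survLeft_pos : ∀ᵐ x ∂F, 0 < survLeft F x := by
  filter_upwards [ae_measure_Ici_pos F] with x hx
  exact ENNReal.toReal_pos hx.ne' (measure_ne_top _ _)

lemma hazard_setIntegral (hF : F (Iic 0) = 0) {A : Set ℝ} (hA : MeasurableSet A) (f : ℝ → ℝ) :
    ∫ s in A, f s ∂(hazard F) = ∫ s in A, (survLeft F s)⁻¹ * f s ∂F := by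
  rw [hazard_eq hF, setIntegral_withDensity_eq_setIntegral_toReal_smul (measurable_Ici_inv F) _ _ hA]
  · simp only [ENNReal.toReal_inv, smul_eq_mul]; rfl
  · refine ae_restrict_of_ae ?_
    filter_upwards [ae_measure_Ici_pos F] with x hx
    exact ENNReal.inv_lt_top.2 hx

lemma hazard_integrableOn (hF : F (Iic 0) = 0) {A : Set ℝ} (hA : MeasurableSet A) (f : ℝ → ℝ) :
    IntegrableOn f A (hazard F) ↔ IntegrableOn (fun s => (survLeft F s)⁻¹ * f s) A F := by
  rw [hazard_eq hF, IntegrableOn, restrict_withDensity hA,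
    integrable_withDensity_iff_integrable_smul' (measurable_Ici_inv F)]
  · simp only [ENNReal.toReal_inv, smul_eq_mul]; rfl
  · refine ae_restrict_of_ae ?_
    filter_upwards [ae_measure_Ici_pos F] with x hx
    exact ENNReal.inv_lt_top.2 hx

lemma hazard_lintegral (hF : F (Iic 0) = 0) {f : ℝ → ℝ≥0∞} (hf : Measurable f) :
    ∫⁻ s, f s ∂(hazard F) = ∫⁻ s, ENNReal.ofReal (survLeft F s)⁻¹ * f s ∂F := by
  rw [hazard_eq hF, lintegral_withDensity_eq_lintegral_mul _ (measurable_Ici_inv F) hf]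
  refine lintegral_congr_ae ?_
  filter_upwards [ae_survLeft_pos (F := F)] with x hx
  rw [Pi.mul_apply, ENNReal.ofReal_inv_of_pos hx, survLeft, ofReal_measureReal]

instance hazard_sFinite (F : Measure ℝ) [SFinite F] : SFinite (hazard F) := by
  unfold hazard; infer_instance

lemma hazard_Iic_zero (hF : F (Iic 0) = 0) : hazard F (Iic 0) = 0 := by
  rw [hazard_eq hF]
  exact withDensity_absolutelyContinuous _ _ hF

lemma hazard_absolutelyContinuous (hF : F (Iic 0) = 0) : hazard F ≪ F := by
  rw [hazard_eq hF]
  exact withDensity_absolutelyContinuous _ _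

lemma hazard_real_singleton (hF : F (Iic 0) = 0) (t : ℝ) :
    (hazard F).real {t} = (survLeft F t)⁻¹ * F.real {t} := by
  have := hazard_setIntegral hF (measurableSet_singleton t) fun _ => 1
  rw [integral_singleton, integral_singleton] at this
  simpa [mul_comm] using this

/-- `1 - ΔΛ = S / S(·-)`. -/
lemma one_sub_hazard (hF : F (Iic 0) = 0) {t : ℝ} (ht : 0 < survLeft F t) :
    1 - (hazard F).real {t} = surv F t / survLeft F t := by
  rw [hazard_real_singleton hF]
  have := survLeft_eq F t
  field_simp
  linarith

/-- The conditional mean of `g` on `(x, ∞)`. -/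
def tailMean (F : Measure ℝ) (g : ℝ → ℝ) (x : ℝ) : ℝ := (∫ s in Ioi x, g s ∂F) / surv F x

/-- The forward operator. -/
def forward (F : Measure ℝ) (g : ℝ → ℝ) (x : ℝ) : ℝ := g x - tailMean F g x

/-- If S(x) = 0 the tail is a null set, so the value 0 given by division is the right one. -/
lemma surv_mul_tailMean (g : ℝ → ℝ) (x : ℝ) :
    surv F x * tailMean F g x = ∫ s in Ioi x, g s ∂F := by
  rw [tailMean]
  by_cases h : surv F x = 0
  · have : F (Ioi x) = 0 := by simpa [surv, measureReal_eq_zero_iff] using h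
    rw [h, Measure.restrict_eq_zero.2 this]; simp
  · field_simp

lemma measurable_tail_integral {α : Type*} [MeasurableSpace α] {g : ℝ → α → ℝ}
    (hg : Measurable (Function.uncurry g)) :
    Measurable fun q : ℝ × α => ∫ s in Ioi q.1, g s q.2 ∂F := by
  have e : (fun q : ℝ × α => ∫ s in Ioi q.1, g s q.2 ∂F)
      = fun q => ∫ s, (if q.1 < s then g s q.2 else 0) ∂F := by
    ext q
    rw [← integral_indicator measurableSet_Ioi]
    rfl
  rw [e]
  refine (StronglyMeasurable.integral_prod_right ?_).measurable
  refine (Measurable.ite (measurableSet_lt (measurable_fst.comp measurable_fst) measurable_snd)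
    (hg.comp (measurable_snd.prodMk (measurable_snd.comp measurable_fst)))
    measurable_const).stronglyMeasurable

lemma measurable_tailMean {α : Type*} [MeasurableSpace α] {g : ℝ → α → ℝ}
    (hg : Measurable (Function.uncurry g)) :
    Measurable fun q : ℝ × α => tailMean F (fun s => g s q.2) q.1 :=
  (measurable_tail_integral hg).div ((measurable_surv F).comp measurable_fst)

lemma measurable_forward {α : Type*} [MeasurableSpace α] {g : ℝ → α → ℝ}
    (hg : Measurable (Function.uncurry g)) :
    Measurable fun q : ℝ × α => forward F (fun s => g s q.2) q.1 :=
  hg.sub (measurable_tailMean hg)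

lemma measurable_tailMean_one {g : ℝ → ℝ} (hg : Measurable g) : Measurable (tailMean F g) :=
  (measurable_tailMean (α := Unit) (g := fun s _ => g s) (hg.comp measurable_fst)).comp
    (measurable_id.prodMk (measurable_const (a := ())))

lemma measurable_forward_one {g : ℝ → ℝ} (hg : Measurable g) : Measurable (forward F g) :=
  hg.sub (measurable_tailMean_one hg)

/-- S is bounded below on (-∞,b], except possibly at b, where it may drop to 0; for s < b one has
S(s) ≥ S(b-). Hence tail means are bounded by the L¹ norm, with a constant that is uniform in g. -/
lemma exists_forward_le {b : ℝ} (hb : 0 < survLeft F b) : ∃ C, 0 ≤ C ∧ ∀ g : ℝ → ℝ,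
    Integrable g F → ∀ s ≤ b, (survLeft F s)⁻¹ * |forward F g s| ≤ C * (|g s| + ∫ u, |g u| ∂F) := by
  obtain ⟨c, hc, hcb⟩ : ∃ c, 0 < c ∧ ∀ s ≤ b, surv F s = 0 ∨ c ≤ surv F s := by
    rcases (surv_nonneg F b).eq_or_lt with h | h
    · refine ⟨survLeft F b, hb, fun s hs => ?_⟩
      rcases hs.eq_or_lt with rfl | hs
      exacts [Or.inl h.symm, Or.inr (survLeft_le_surv F hs)]
    · exact ⟨surv F b, h, fun s hs => Or.inr (surv_antitone F hs)⟩
  refine ⟨(survLeft F b)⁻¹ * (1 + c⁻¹), by positivity, fun g hg s hs => ?_⟩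
  have h0 : 0 ≤ ∫ u, |g u| ∂F := integral_nonneg fun u => abs_nonneg _
  have h1 : |tailMean F g s| ≤ c⁻¹ * ∫ u, |g u| ∂F := by
    rcases hcb s hs with hx | hx
    · rw [tailMean, hx]; simp; positivity
    · rw [tailMean, abs_div, abs_of_nonneg (surv_nonneg F s), div_eq_inv_mul]
      have h1 : |∫ u in Ioi s, g u ∂F| ≤ ∫ u, |g u| ∂F := abs_integral_le_integral_abs.trans
        (setIntegral_le_integral hg.abs (ae_of_all _ fun u => abs_nonneg _))
      gcongr
  have h2 := abs_sub (g s) (tailMean F g s)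
  have h3 : (survLeft F s)⁻¹ ≤ (survLeft F b)⁻¹ := by
    have := survLeft_antitone F hs
    gcongr
  have h4 : 0 ≤ (survLeft F s)⁻¹ := inv_nonneg.2 (survLeft_nonneg F s)
  have h5 : 0 ≤ c⁻¹ * |g s| := by positivity
  rw [mul_assoc, forward]
  refine mul_le_mul h3 (h2.trans ?_) (abs_nonneg _) (h4.trans h3)
  linarith

lemma forward_integrableOn (hF : F (Iic 0) = 0) {g : ℝ → ℝ} (hgm : Measurable g)
    (hg : Integrable g F) {b : ℝ} (hb : 0 < survLeft F b) :
    IntegrableOn (forward F g) (Iic b) (hazard F) := by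
  rw [hazard_integrableOn hF measurableSet_Iic]
  obtain ⟨C, -, hC⟩ := exists_forward_le hb
  refine Integrable.mono' ((hg.abs.add (integrable_const (∫ u, |g u| ∂F))).const_mul C).integrableOn
    ((measurable_survLeft F).inv.mul (measurable_forward_one hgm)).aestronglyMeasurable ?_
  filter_upwards [ae_restrict_mem measurableSet_Iic] with s hs
  rw [norm_mul, Real.norm_of_nonneg (inv_nonneg.2 (survLeft_nonneg F s)), Real.norm_eq_abs]
  exact hC g hg s hs

/-- Fubini over a < s < t: the integral of 1/(S(s) S(s-)) over (a, min t b) is 1/S(min(t,b)-) -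
1/S(a). The cases t < b and t ≥ b give the first two terms. -/
lemma integral_tailMean_Ioo {g : ℝ → ℝ} (hgm : Measurable g) (hg : Integrable g F) {a b : ℝ}
    (hab : a < b) (hb : 0 < survLeft F b) :
    ∫ s in Ioo a b, (survLeft F s)⁻¹ * tailMean F g s ∂F
      = (∫ s in Ioo a b, (survLeft F s)⁻¹ * g s ∂F) + (survLeft F b)⁻¹ * (∫ s in Ici b, g s ∂F)
        - tailMean F g a := by
  set w : ℝ → ℝ := fun s => (surv F s * survLeft F s)⁻¹ with hw
  have hwm : Measurable w := ((measurable_surv F).mul (measurable_survLeft F)).inv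
  have hw0 : ∀ s, 0 ≤ w s := fun s => inv_nonneg.2 (mul_nonneg (surv_nonneg F s) (survLeft_nonneg F s))
  have hwb : ∀ s < b, w s ≤ (survLeft F b * survLeft F b)⁻¹ := fun s hs => by
    have h1 := survLeft_le_surv F hs
    have h2 := survLeft_antitone F hs.le
    have h3 := surv_nonneg F s
    simp only [hw]
    gcongr
  have hL : ∫ s in Ioo a b, (survLeft F s)⁻¹ * tailMean F g s ∂F
      = ∫ s, ∫ t, (Ioo a b).indicator w s * (if s < t then g t else 0) ∂F ∂F := by
    rw [← integral_indicator measurableSet_Ioo]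
    congr 1
    ext s
    rw [integral_const_mul]
    have h1 : ∫ t, (if s < t then g t else 0) ∂F = ∫ t in Ioi s, g t ∂F := by
      rw [← integral_indicator measurableSet_Ioi]; rfl
    rw [h1]
    by_cases hs : s ∈ Ioo a b
    · rw [indicator_of_mem hs, indicator_of_mem hs, hw, tailMean]
      simp only [mul_inv, div_eq_mul_inv]
      ring
    · rw [indicator_of_notMem hs, indicator_of_notMem hs, zero_mul]
  have hint : Integrable (Function.uncurry fun s t =>
      (Ioo a b).indicator w s * (if s < t then g t else 0)) (F.prod F) := by
    have hd : Integrable (fun q : ℝ × ℝ => (survLeft F b * survLeft F b)⁻¹ * |g q.2|) (F.prod F) :=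
      (hg.abs.comp_snd F).const_mul _
    refine hd.mono' ?_ (ae_of_all _ fun q => ?_)
    · exact (((hwm.indicator measurableSet_Ioo).comp measurable_fst).mul
        (Measurable.ite (measurableSet_lt measurable_fst measurable_snd)
          (hgm.comp measurable_snd) measurable_const)).aestronglyMeasurable
    · simp only [Function.uncurry, norm_mul, Real.norm_eq_abs]
      refine mul_le_mul ?_ ?_ (abs_nonneg _) (by positivity)
      · by_cases hs : q.1 ∈ Ioo a b
        · rw [indicator_of_mem hs, abs_of_nonneg (hw0 _)]
          exact hwb _ hs.2
        · rw [indicator_of_notMem hs, abs_zero]; positivity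
      · split_ifs <;> simp
  have hinner : ∀ t, ∫ s, (Ioo a b).indicator w s * (if s < t then g t else 0) ∂F
      = (Ioi a).indicator (fun t => ((survLeft F (min t b))⁻¹ - (surv F a)⁻¹) * g t) t := by
    intro t
    have h1 : ∀ s, (Ioo a b).indicator w s * (if s < t then g t else 0)
        = (Ioo a (min t b)).indicator w s * g t := by
      intro s
      have hiff : s ∈ Ioo a (min t b) ↔ s ∈ Ioo a b ∧ s < t := by
        simp only [mem_Ioo, lt_min_iff]; tauto
      by_cases h1 : s ∈ Ioo a b <;> by_cases h2 : s < t <;> simp [indicator, hiff, h1, h2]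
    simp_rw [h1]
    rw [integral_mul_const, integral_indicator measurableSet_Ioo]
    by_cases hat : a < t
    · rw [indicator_of_mem (show t ∈ Ioi a from hat), integral_Ioo_inv_surv (lt_min hat hab)
        (hb.trans_le (survLeft_antitone F (min_le_right _ _)))]
    · rw [indicator_of_notMem (show t ∉ Ioi a from hat), Ioo_eq_empty, Measure.restrict_empty]
      · simp
      · exact fun h => hat (lt_min_iff.1 h).1
  rw [hL, integral_integral_swap hint]
  simp_rw [hinner]
  rw [integral_indicator measurableSet_Ioi]
  have hgi : ∀ A : Set ℝ, IntegrableOn (fun t => (survLeft F (min t b))⁻¹ * g t) A F := fun A => by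
    refine Integrable.integrableOn ?_
    refine (hg.abs.const_mul (survLeft F b)⁻¹).mono' (((measurable_survLeft F).comp
      (measurable_id.min measurable_const)).inv.mul hgm).aestronglyMeasurable (ae_of_all _ fun t => ?_)
    rw [norm_mul, Real.norm_eq_abs, Real.norm_eq_abs, abs_of_nonneg (inv_nonneg.2 (survLeft_nonneg F _))]
    have := survLeft_antitone F (min_le_right t b)
    gcongr
  have h2 : ∫ t in Ioi a, ((survLeft F (min t b))⁻¹ - (surv F a)⁻¹) * g t ∂F
      = (∫ t in Ioi a, (survLeft F (min t b))⁻¹ * g t ∂F) - tailMean F g a := by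
    simp_rw [sub_mul]
    rw [integral_sub (hgi _) (hg.const_mul _).integrableOn, integral_const_mul, tailMean,
      div_eq_inv_mul]
  rw [h2, ← Ioo_union_Ici_eq_Ioi hab, setIntegral_union
    (Set.disjoint_left.2 fun x (hx : x ∈ Ioo a b) (hx' : x ∈ Ici b) => absurd hx.2 (not_lt.2 hx'))
    measurableSet_Ici (hgi _) (hgi _), ← integral_const_mul]
  congr 2
  · refine setIntegral_congr_fun measurableSet_Ioo fun s hs => ?_
    simp only [min_eq_left hs.2.le]
  · refine setIntegral_congr_fun measurableSet_Ici fun s hs => ?_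
    simp only [min_eq_right (show b ≤ s from hs)]

/-- Integration by parts for the forward operator. -/
lemma integral_forward_Ioc (hF : F (Iic 0) = 0) {g : ℝ → ℝ} (hgm : Measurable g)
    (hg : Integrable g F) {a b : ℝ} (hab : a ≤ b) (hb : 0 < survLeft F b) :
    ∫ s in Ioc a b, forward F g s ∂(hazard F) = tailMean F g a - tailMean F g b := by
  rcases hab.eq_or_lt with rfl | hab
  · simp
  rw [hazard_setIntegral hF measurableSet_Ioc]
  have hI := (hazard_integrableOn hF measurableSet_Iic (forward F g)).1 (forward_integrableOn hF hgm hg hb)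
  have hgI : IntegrableOn (fun s => (survLeft F s)⁻¹ * g s) (Iic b) F := by
    refine Integrable.mono' ((hg.abs.const_mul (survLeft F b)⁻¹).integrableOn)
      ((measurable_survLeft F).inv.mul hgm).aestronglyMeasurable ?_
    filter_upwards [ae_restrict_mem measurableSet_Iic] with s hs
    rw [norm_mul, Real.norm_eq_abs, Real.norm_eq_abs, abs_of_nonneg (inv_nonneg.2 (survLeft_nonneg F _))]
    have := survLeft_antitone F (show s ≤ b from hs)
    gcongr
  have hUI : IntegrableOn (fun s => (survLeft F s)⁻¹ * tailMean F g s) (Iic b) F := by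
    refine (hgI.sub hI).congr (ae_of_all _ fun s => ?_)
    simp only [Pi.sub_apply, forward]; ring
  have hdisj : Disjoint (Ioo a b) {b} := by simp
  rw [← Ioo_union_right hab, setIntegral_union hdisj (measurableSet_singleton b)
    (hI.mono_set fun x hx => hx.2.le) (hI.mono_set fun x hx => (mem_singleton_iff.1 hx).le),
    integral_singleton, smul_eq_mul]
  have h1 : ∫ s in Ioo a b, (survLeft F s)⁻¹ * forward F g s ∂F
      = (∫ s in Ioo a b, (survLeft F s)⁻¹ * g s ∂F)
        - ∫ s in Ioo a b, (survLeft F s)⁻¹ * tailMean F g s ∂F := by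
    rw [← integral_sub (hgI.mono_set fun x hx => hx.2.le) (hUI.mono_set fun x hx => hx.2.le)]
    simp only [forward, mul_sub]
  rw [h1, integral_tailMean_Ioo hgm hg hab hb]
  -- The atom at b accounts for the difference between S(b-) and S(b).
  have h2 : ∫ s in Ici b, g s ∂F = F.real {b} * g b + surv F b * tailMean F g b := by
    rw [← Ioi_insert, ← singleton_union, setIntegral_union (by simp) measurableSet_Ioi
      hg.integrableOn hg.integrableOn, integral_singleton, smul_eq_mul, surv_mul_tailMean]
  have h3 := survLeft_eq F b
  have h4 : F.real {b} = survLeft F b - surv F b := by linarith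
  rw [h2, h4, forward]
  field_simp
  ring

lemma surv_zero (hF : F (Iic 0) = 0) : surv F 0 = 1 := by
  rw [surv, ← compl_Iic, probReal_compl_eq_one_sub measurableSet_Iic, measureReal_def, hF]; simp

lemma tailMean_zero (hF : F (Iic 0) = 0) (g : ℝ → ℝ) : tailMean F g 0 = ∫ s, g s ∂F := by
  have h1 := surv_zero hF
  have hF' : ∀ᵐ x ∂F, x ∈ Ioi (0:ℝ) := by
    rw [← compl_Ioi] at hF
    exact mem_ae_iff.2 hF
  rw [tailMean, h1, div_one, Measure.restrict_eq_self_of_ae_mem hF']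

lemma integral_forward_Iic (hF : F (Iic 0) = 0) {g : ℝ → ℝ} (hgm : Measurable g)
    (hg : Integrable g F) {b : ℝ} (hb0 : 0 ≤ b) (hb : 0 < survLeft F b) :
    ∫ s in Iic b, forward F g s ∂(hazard F) = (∫ s, g s ∂F) - tailMean F g b := by
  rw [← tailMean_zero hF, ← integral_forward_Ioc hF hgm hg hb0 hb]
  refine setIntegral_congr_set (ae_eq_set.2 ⟨?_, ?_⟩)
  · refine measure_mono_null (fun x hx => ?_) (hazard_Iic_zero hF)
    exact not_lt.1 fun h => hx.2 ⟨h, hx.1⟩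
  · rw [sdiff_eq_empty.2 Ioc_subset_Iic_self, measure_empty]

end Forward

/-! ### The forward operator as a contraction of L² (a Hardy inequality) -/

section Hardy

variable {F : Measure ℝ} [IsProbabilityMeasure F]

/-- The law of an uncensored observation. -/
def uncensored (F : Measure ℝ) : Measure Obs := F.map fun x => (x, true)

lemma measurable_pair_true : Measurable fun x : ℝ => ((x, true) : Obs) :=
  measurable_id.prodMk measurable_const

instance uncensored_isProbabilityMeasure : IsProbabilityMeasure (uncensored F) :=
  Measure.isProbabilityMeasure_map measurable_pair_true.aemeasurable

lemma riskProb_uncensored (s : ℝ) : riskProb (uncensored F) s = F (Ici s) := by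
  rw [riskProb, uncensored, Measure.map_apply measurable_pair_true
    (measurableSet_le measurable_const measurable_fst)]
  rfl

/-- Without censoring the risk probability is F[s,∞), which cancels the density of the hazard. This
makes the martingale isometry available for F alone. -/
lemma isHazard_uncensored (hF : F (Iic 0) = 0) : IsHazard (uncensored F) (hazard F) := by
  have h1 : riskProb (uncensored F) = fun s => F (Ici s) := funext riskProb_uncensored
  have h2 : ((uncensored F).restrict {z | z.2 = true}).map Prod.fst = F := by
    rw [uncensored, Measure.restrict_map measurable_pair_true measurableSet_snd_true,
      Measure.map_map measurable_fst measurable_pair_true]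
    simp [Function.comp_def]
  rw [IsHazard, h2, h1, hazard_eq hF]
  have hm : Measurable fun s => F (Ici s) :=
    (show Antitone fun t => F (Ici t) from fun _ _ h => measure_mono (Ici_subset_Ici.2 h)).measurable
  rw [← withDensity_mul _ (measurable_Ici_inv F) hm]
  conv_lhs => rw [← withDensity_one (μ := F)]
  refine withDensity_congr_ae ?_
  filter_upwards [ae_measure_Ici_pos F] with x hx
  simp [ENNReal.inv_mul_cancel hx.ne' (measure_ne_top _ _)]

lemma abs_tailMean_le_of_bdd {g : ℝ → ℝ} {k : ℝ} (hk : ∀ x, |g x| ≤ k) (x : ℝ) :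
    |tailMean F g x| ≤ k := by
  have hk0 : 0 ≤ k := (abs_nonneg _).trans (hk 0)
  rw [tailMean, abs_div, abs_of_nonneg (surv_nonneg F x)]
  refine div_le_of_le_mul₀ (surv_nonneg F x) hk0 ?_
  have := norm_setIntegral_le_of_norm_le_const (μ := F) (s := Ioi x) (f := g) (C := k)
    (measure_lt_top _ _) (fun s _ => hk s)
  simpa [surv] using this

/-- For T with law F, integration by parts gives g(T) - E g(T) = ∫ Ag dM. By the isometry the left
side is the variance of g(T), hence at most E g(T)². The vanishing of g where S(s-) is small
confines Ag to a set of finite hazard. -/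
lemma integral_forward_sq_le_of_bdd (hF : F (Iic 0) = 0) {g : ℝ → ℝ} (hgm : Measurable g) {k κ : ℝ}
    (hk : ∀ x, |g x| ≤ k) (hκ : 0 < κ) (h0 : ∀ x, survLeft F x < κ → g x = 0) :
    ∫⁻ s, ENNReal.ofReal (forward F g s ^ 2 * (surv F s / survLeft F s)) ∂F
      ≤ ∫⁻ s, ENNReal.ofReal (g s ^ 2) ∂F := by
  have hk0 : 0 ≤ k := (abs_nonneg _).trans (hk 0)
  have hgi : Integrable g F := (integrable_const k).mono' hgm.aestronglyMeasurable
    (ae_of_all _ fun x => hk x)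
  have hAm := measurable_forward_one (F := F) hgm
  set B : Set ℝ := {s | κ ≤ survLeft F s} with hBdef
  have hBm : MeasurableSet B := measurableSet_le measurable_const (measurable_survLeft F)
  have hH := isHazard_uncensored hF
  have hB : BddSupp (hazard F) (2 * k) B := by
    refine ⟨by positivity, hBm, ?_⟩
    have := hH.measure_level_lt_top (c := ENNReal.ofReal κ) (by simpa using hκ)
    refine ((measure_mono fun s hs => ?_).trans_lt this).ne
    change ENNReal.ofReal κ ≤ riskProb (uncensored F) s
    rw [riskProb_uncensored]
    exact ENNReal.ofReal_le_of_le_toReal hs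
  have hfB : ∀ s, |forward F g s| ≤ B.indicator (fun _ => 2 * k) s := by
    intro s
    by_cases hs : s ∈ B
    · rw [indicator_of_mem hs]
      have h1 := abs_sub (g s) (tailMean F g s)
      have h2 := hk s
      have h3 := abs_tailMean_le_of_bdd (F := F) hk s
      rw [forward]; linarith
    · rw [indicator_of_notMem hs]
      have hs' : survLeft F s < κ := not_le.1 hs
      have h1 : ∫ x in Ioi s, g x ∂F = 0 := by
        refine setIntegral_eq_zero_of_forall_eq_zero fun x hx => h0 x ?_
        exact (survLeft_antitone F (le_of_lt hx)).trans_lt hs'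
      rw [forward, tailMean, h1, h0 s hs']
      simp
  -- The isometry for a sample of size one.
  have hL := hH.integral_sampleInt_sq_bdd (ι := Unit) hB (f := fun s _ => forward F g s)
    (hAm.comp measurable_fst) (fun s _ => hfB s) (fun _ _ _ _ _ _ => rfl)
  have hmap : ∀ h : Obs → ℝ, Measurable h →
      ∫ ω : Unit → Obs, h (ω ()) ∂(Measure.pi fun _ => uncensored F) = ∫ x, h (x, true) ∂F := by
    intro h hh
    have e2 := integral_map (μ := Measure.pi fun _ : Unit => uncensored F)
      (measurable_pi_apply ()).aemeasurable (f := h) hh.aestronglyMeasurable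
    have e : (Measure.pi fun _ : Unit => uncensored F).map (fun ω => ω ()) = uncensored F :=
      (measurePreserving_eval (fun _ : Unit => uncensored F) ()).map_eq
    rw [← e2, e, uncensored,
      integral_map measurable_pair_true.aemeasurable hh.aestronglyMeasurable]
  simp only [sampleInt, Finset.univ_unique, Finset.sum_singleton] at hL
  have hmart : Measurable fun z => mart (hazard F) (forward F g) z :=
    measurable_mart (f := fun s (_ : Obs) => forward F g s) (hAm.comp measurable_fst) measurable_id
  set e : ℝ → ℝ := fun t => forward F g t ^ 2 * (1 - (hazard F).real {t}) with he
  have hem : Measurable e := (hAm.pow_const 2).mul (measurable_const.sub measurable_measureReal_singleton)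
  have heB : ∀ s, |e s| ≤ B.indicator (fun _ => 2 * k * (2 * k * (1 + (hazard F).real B))) s := by
    intro s
    rw [he]; simp only
    rw [pow_two, mul_assoc]
    refine abs_mul_le_indicator (hfB s) hB.1 fun hs => ?_
    rw [abs_mul]
    refine mul_le_mul (hB.abs_le hfB s) ?_ (abs_nonneg _) hB.1
    have h1 := hB.real_singleton_le hs
    have h2 : 0 ≤ (hazard F).real {s} := measureReal_nonneg
    rw [abs_le]; constructor <;> linarith
  have hei : Integrable e (hazard F) :=
    (hB.mul (by have : 0 ≤ (hazard F).real B := measureReal_nonneg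
                positivity)).integrable_of_le hem.aestronglyMeasurable heB
  have hmc : Measurable fun z : Obs => ∫ t in Iic z.1, e t ∂(hazard F) := by
    have e1 : (fun z : Obs => ∫ t in Iic z.1, e t ∂(hazard F))
        = fun z => ∫ t, (if t ≤ z.1 then e t else 0) ∂(hazard F) := by
      ext z
      rw [← integral_indicator measurableSet_Iic]; rfl
    rw [e1]
    exact (StronglyMeasurable.integral_prod_right (Measurable.ite (measurableSet_le measurable_snd
      (measurable_fst.comp measurable_fst)) (hem.comp measurable_snd)
      measurable_const).stronglyMeasurable).measurable
  -- Fubini: the F-mass of {x ≥ t} is S(t-), which turns dΛ back into dF.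
  have hR : ∫ x, ∫ t in Iic x, e t ∂(hazard F) ∂F = ∫ s, e s ∂F := by
    have h1 : ∀ x, ∫ t in Iic x, e t ∂(hazard F) = ∫ t, (if t ≤ x then 1 else 0) * e t ∂(hazard F) := by
      intro x
      rw [← integral_indicator measurableSet_Iic]
      congr 1; ext t
      by_cases h : t ≤ x <;> simp [indicator, h]
    simp_rw [h1]
    rw [integral_integral_swap]
    · have h2 : ∀ t, ∫ x, (if t ≤ x then (1:ℝ) else 0) * e t ∂F = survLeft F t * e t := by
        intro t
        rw [integral_mul_const]
        congr 1
        rw [survLeft, ← integral_indicator_one measurableSet_Ici]; rfl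
      simp_rw [h2]
      have h3 := hazard_setIntegral hF MeasurableSet.univ fun t => survLeft F t * e t
      rw [Measure.restrict_univ, Measure.restrict_univ] at h3
      rw [h3]
      refine integral_congr_ae ?_
      filter_upwards [ae_survLeft_pos (F := F)] with x hx
      field_simp
    · refine (hei.comp_snd F).abs.mono' ?_ (ae_of_all _ fun q => ?_)
      · exact ((Measurable.ite (measurableSet_le measurable_snd measurable_fst) measurable_const
          measurable_const).mul (hem.comp measurable_snd)).aestronglyMeasurable
      · simp only [Function.uncurry]
        split_ifs <;> simp
  have hl : ∫ x, mart (hazard F) (forward F g) (x, true) ^ 2 ∂F = ∫ s, e s ∂F := by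
    rw [← hR, ← hmap (fun z => mart (hazard F) (forward F g) z ^ 2) (hmart.pow_const 2),
      ← hmap (fun z => ∫ t in Iic z.1, e t ∂(hazard F)) hmc]
    exact hL
  have hval : ∀ᵐ x ∂F, mart (hazard F) (forward F g) (x, true) = g x - ∫ s, g s ∂F := by
    have h00 : ∀ᵐ x ∂F, 0 < x := by
      rw [← compl_Ioi] at hF
      exact mem_ae_iff.2 hF
    filter_upwards [ae_survLeft_pos (F := F), h00] with x hx hx0
    simp only [mart, if_true]
    rw [integral_forward_Iic hF hgm hgi hx0.le hx, forward]
    ring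
  have hg2 : Integrable (fun x => g x ^ 2) F := by
    refine (integrable_const (k ^ 2)).mono' (hgm.pow_const 2).aestronglyMeasurable
      (ae_of_all _ fun x => ?_)
    rw [Real.norm_of_nonneg (sq_nonneg _)]
    exact sq_le_sq' (neg_le_of_abs_le (hk x)) ((le_abs_self _).trans (hk x))
  have hle : ∫ s, e s ∂F ≤ ∫ s, g s ^ 2 ∂F := by
    rw [← hl, integral_congr_ae (g := fun x => (g x - ∫ s, g s ∂F) ^ 2)
      (hval.mono fun x hx => by simp only [hx])]
    set m := ∫ s, g s ∂F with hm
    have h1 : ∀ x, (g x - m) ^ 2 = g x ^ 2 - (2 * m) * g x + m ^ 2 := fun x => by ring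
    simp_rw [h1]
    have h2 : Integrable (fun x => g x ^ 2 - (2 * m) * g x) F := hg2.sub (hgi.const_mul _)
    rw [integral_add h2 (integrable_const _), integral_sub hg2 (hgi.const_mul _),
      integral_const_mul, integral_const]
    simp only [probReal_univ, one_smul, ← hm]
    nlinarith [sq_nonneg m]
  have hae : (fun s => forward F g s ^ 2 * (surv F s / survLeft F s)) =ᵐ[F] e := by
    filter_upwards [ae_survLeft_pos (F := F)] with x hx
    rw [he]; simp only [one_sub_hazard hF hx]
  have he0 : 0 ≤ᵐ[F] e := by
    filter_upwards [hae] with x hx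
    rw [← hx]
    exact mul_nonneg (sq_nonneg _) (div_nonneg (surv_nonneg F x) (survLeft_nonneg F x))
  have hei' : Integrable e F := by
    refine (integrable_const ((2 * k) ^ 2 * 1)).mono' hem.aestronglyMeasurable ?_
    filter_upwards [hae, ae_survLeft_pos (F := F)] with x hx hpos
    rw [← hx, Real.norm_of_nonneg (mul_nonneg (sq_nonneg _)
      (div_nonneg (surv_nonneg F x) (survLeft_nonneg F x)))]
    have h1 := hB.abs_le hfB x
    have h2 : surv F x / survLeft F x ≤ 1 := (div_le_one hpos).2 (surv_le_survLeft F x)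
    exact mul_le_mul (sq_le_sq' (neg_le_of_abs_le h1) ((le_abs_self _).trans h1)) h2
      (div_nonneg (surv_nonneg F x) (survLeft_nonneg F x)) (by positivity)
  rw [lintegral_congr_ae (g := fun x => ENNReal.ofReal (e x)) (hae.mono fun x hx => by simp only [hx]), ← ofReal_integral_eq_lintegral_ofReal hei' he0,
    ← ofReal_integral_eq_lintegral_ofReal hg2 (ae_of_all _ fun x => sq_nonneg _)]
  exact ENNReal.ofReal_le_ofReal hle

lemma integrable_of_lintegral_sq {g : ℝ → ℝ} (hgm : Measurable g)
    (h : ∫⁻ s, ENNReal.ofReal (g s ^ 2) ∂F ≠ ∞) : Integrable g F := by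
  have h2 : Integrable (fun s => g s ^ 2) F := by
    refine ⟨(hgm.pow_const 2).aestronglyMeasurable, ?_⟩
    rw [hasFiniteIntegral_iff_ofReal (ae_of_all _ fun s => sq_nonneg _)]
    exact lt_top_iff_ne_top.2 h
  refine (h2.add (integrable_const (1:ℝ))).mono' hgm.aestronglyMeasurable (ae_of_all _ fun s => ?_)
  simp only [Pi.add_apply, Real.norm_eq_abs]
  nlinarith [sq_nonneg (|g s| - 1), sq_abs (g s)]

/-- The forward operator contracts `L²`. -/
lemma lintegral_forward_sq_le (hF : F (Iic 0) = 0) {g : ℝ → ℝ} (hgm : Measurable g) :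
    ∫⁻ s, ENNReal.ofReal (forward F g s ^ 2 * (surv F s / survLeft F s)) ∂F
      ≤ ∫⁻ s, ENNReal.ofReal (g s ^ 2) ∂F := by
  by_cases hfin : ∫⁻ s, ENNReal.ofReal (g s ^ 2) ∂F = ∞
  · rw [hfin]; exact le_top
  have hgi := integrable_of_lintegral_sq hgm hfin
  -- Truncation to bounded values and to S(x-) ≥ 1/(k+1), removed at the end by Fatou's lemma.
  set A : ℕ → Set ℝ := fun k => {x | 1 / ((k : ℝ) + 1) ≤ survLeft F x ∧ |g x| ≤ k} with hA
  have hAm : ∀ k, MeasurableSet (A k) := fun k =>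
    (measurableSet_le measurable_const (measurable_survLeft F)).inter
      (measurableSet_le hgm.abs measurable_const)
  have hle : ∀ k x, |(A k).indicator g x| ≤ |g x| := fun k x => by
    by_cases h : x ∈ A k <;> simp [h]
  have hlim : ∀ x, 0 < survLeft F x → Tendsto (fun k => (A k).indicator g x) atTop (𝓝 (g x)) := by
    intro x hx
    refine tendsto_const_nhds.congr' ?_
    filter_upwards [tendsto_one_div_add_atTop_nhds_zero_nat.eventually (eventually_le_nhds hx),
      tendsto_natCast_atTop_atTop.eventually (eventually_ge_atTop |g x|)] with k h1 h2
    rw [indicator_of_mem (show x ∈ A k from ⟨h1, h2⟩)]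
  have hU : ∀ x, Tendsto (fun k => tailMean F ((A k).indicator g) x) atTop (𝓝 (tailMean F g x)) := by
    intro x
    refine Tendsto.div_const ?_ _
    refine tendsto_integral_of_dominated_convergence (fun s => |g s|)
      (fun k => (hgm.indicator (hAm k)).aestronglyMeasurable) hgi.abs.integrableOn
      (fun k => ae_of_all _ fun s => hle k s) (ae_restrict_of_ae ?_)
    filter_upwards [ae_survLeft_pos (F := F)] with s hs
    exact hlim s hs
  calc ∫⁻ s, ENNReal.ofReal (forward F g s ^ 2 * (surv F s / survLeft F s)) ∂F
      = ∫⁻ s, liminf (fun k => ENNReal.ofReal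
          (forward F ((A k).indicator g) s ^ 2 * (surv F s / survLeft F s))) atTop ∂F := by
        refine lintegral_congr_ae ?_
        filter_upwards [ae_survLeft_pos (F := F)] with s hs
        refine (Tendsto.liminf_eq ?_).symm
        refine (ENNReal.continuous_ofReal.tendsto _).comp ?_
        exact (((hlim s hs).sub (hU s)).pow 2).mul_const _
    _ ≤ liminf (fun k => ∫⁻ s, ENNReal.ofReal
          (forward F ((A k).indicator g) s ^ 2 * (surv F s / survLeft F s)) ∂F) atTop := by
        refine lintegral_liminf_le fun k => ?_
        exact (((measurable_forward_one (hgm.indicator (hAm k))).pow_const 2).mul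
          ((measurable_surv F).div (measurable_survLeft F))).ennreal_ofReal
    _ ≤ ∫⁻ s, ENNReal.ofReal (g s ^ 2) ∂F := by
        refine liminf_le_of_le (by isBoundedDefault) fun b hb => ?_
        obtain ⟨k, hk⟩ := hb.exists
        refine hk.trans ((integral_forward_sq_le_of_bdd hF (hgm.indicator (hAm k)) (k := k)
          (κ := 1 / ((k : ℝ) + 1)) (fun x => ?_) (by positivity) fun x hx => ?_).trans ?_)
        · by_cases h : x ∈ A k
          · rw [indicator_of_mem h]; exact h.2
          · rw [indicator_of_notMem h]; simp
        · exact indicator_of_notMem (fun h => absurd h.1 (not_le.2 hx)) _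
        · refine lintegral_mono fun s => ENNReal.ofReal_le_ofReal ?_
          have := hle k s
          rw [← sq_abs, ← sq_abs (g s)]
          gcongr

/-- At a point of an upper set, the forward operator only sees values of g on that set. -/
lemma lintegral_upper_forward_sq_le (hF : F (Iic 0) = 0) {g : ℝ → ℝ} (hgm : Measurable g)
    {W : Set ℝ} (hW : IsUpperSet W) :
    ∫⁻ s in W, ENNReal.ofReal (forward F g s ^ 2 * (surv F s / survLeft F s)) ∂F
      ≤ ∫⁻ s in W, ENNReal.ofReal (g s ^ 2) ∂F := by
  have hWm : MeasurableSet W := hW.ordConnected.measurableSet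
  have h1 : ∀ s ∈ W, forward F g s = forward F (W.indicator g) s := by
    intro s hs
    rw [forward, forward, tailMean, tailMean, indicator_of_mem hs]
    congr 2
    refine setIntegral_congr_fun measurableSet_Ioi fun t ht => ?_
    simp only [indicator_of_mem (hW (le_of_lt ht) hs)]
  have h2 : ∫⁻ s in W, ENNReal.ofReal (g s ^ 2) ∂F
      = ∫⁻ s, ENNReal.ofReal (W.indicator g s ^ 2) ∂F := by
    rw [← lintegral_indicator hWm]
    congr 1; ext s
    by_cases hs : s ∈ W <;> simp [hs]
  rw [h2]
  refine le_trans ?_ (lintegral_forward_sq_le hF (hgm.indicator hWm))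
  rw [setLIntegral_congr_fun (g := fun s => ENNReal.ofReal
    (forward F (W.indicator g) s ^ 2 * (surv F s / survLeft F s))) hWm fun s hs => by
      simp only [h1 s hs]]
  exact setLIntegral_le_lintegral _ _

lemma lintegral_layer (q : ℝ≥0∞) :
    ∫⁻ y in Ioi (0:ℝ), (if ENNReal.ofReal y < q then 1 else 0) = q := by
  have h : ∀ y : ℝ, (if ENNReal.ofReal y < q then (1:ℝ≥0∞) else 0)
      = {y : ℝ | ENNReal.ofReal y < q}.indicator 1 y := fun y => by
    simp [indicator]
  simp_rw [h]
  have hm : MeasurableSet {y : ℝ | ENNReal.ofReal y < q} :=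
    measurableSet_lt ENNReal.measurable_ofReal measurable_const
  rw [lintegral_indicator_one hm, Measure.restrict_apply hm]
  by_cases hq : q = ∞
  · subst hq
    have : {y : ℝ | ENNReal.ofReal y < ∞} ∩ Ioi 0 = Ioi 0 := by ext y; simp
    rw [this, Real.volume_Ioi]
  · have : {y : ℝ | ENNReal.ofReal y < q} ∩ Ioi 0 = Ioo 0 q.toReal := by
      ext y
      simp only [mem_inter_iff, mem_ofPred_eq, mem_Ioi, mem_Ioo]
      constructor
      · rintro ⟨h1, h2⟩
        exact ⟨h2, (ENNReal.ofReal_lt_iff_lt_toReal h2.le hq).1 h1⟩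
      · rintro ⟨h1, h2⟩
        exact ⟨(ENNReal.ofReal_lt_iff_lt_toReal h1.le hq).2 h2, h1⟩
    rw [this, Real.volume_Ioo, sub_zero, ENNReal.ofReal_toReal hq]

/-- The weighted inequality for the forward operator, for an increasing weight. -/
lemma lintegral_weight_forward_sq_le (hF : F (Iic 0) = 0) {g : ℝ → ℝ} (hgm : Measurable g)
    {Q : ℝ → ℝ≥0∞} (hQ : Monotone Q) :
    ∫⁻ s, Q s * ENNReal.ofReal (forward F g s ^ 2 * (surv F s / survLeft F s)) ∂F
      ≤ ∫⁻ s, Q s * ENNReal.ofReal (g s ^ 2) ∂F := by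
  -- Layer cake: an increasing weight is an integral of indicators of its superlevel sets, and these
  -- are upper sets.
  have key : ∀ h : ℝ → ℝ≥0∞, Measurable h →
      ∫⁻ s, Q s * h s ∂F = ∫⁻ y in Ioi (0:ℝ), ∫⁻ s in {s | ENNReal.ofReal y < Q s}, h s ∂F := by
    intro h hh
    have h1 : ∀ s, Q s * h s
        = ∫⁻ y in Ioi (0:ℝ), (if ENNReal.ofReal y < Q s then 1 else 0) * h s := by
      intro s
      rw [lintegral_mul_const _ (Measurable.ite (measurableSet_lt ENNReal.measurable_ofReal
        measurable_const) measurable_const measurable_const), lintegral_layer]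
    simp_rw [h1]
    rw [lintegral_lintegral_swap]
    · refine lintegral_congr fun y => ?_
      rw [← lintegral_indicator (measurableSet_lt measurable_const hQ.measurable)]
      congr 1; ext s
      by_cases hs : ENNReal.ofReal y < Q s <;> simp [indicator, hs]
    · exact ((Measurable.ite (measurableSet_lt (ENNReal.measurable_ofReal.comp measurable_snd)
        (hQ.measurable.comp measurable_fst)) measurable_const measurable_const).mul
        (hh.comp measurable_fst)).aemeasurable
  rw [key (fun s => ENNReal.ofReal (forward F g s ^ 2 * (surv F s / survLeft F s)))
    (((measurable_forward_one hgm).pow_const 2).mul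
      ((measurable_surv F).div (measurable_survLeft F))).ennreal_ofReal,
    key _ (hgm.pow_const 2).ennreal_ofReal]
  refine lintegral_mono fun y => lintegral_upper_forward_sq_le hF hgm ?_
  exact fun a b hab ha => lt_of_lt_of_le ha (hQ hab)

end Hardy

/-! ### The forward operator on kernels of two variables -/

section Kernel

variable {F : Measure ℝ} [IsProbabilityMeasure F]

/-- The constant does not depend on g, so the bound can be integrated over the sections of a kernel.
-/
lemma lintegral_abs_forward_le {b : ℝ} (hF : F (Iic 0) = 0) (hb : 0 < survLeft F b) :
    ∃ C : ℝ≥0∞, C ≠ ∞ ∧ ∀ g : ℝ → ℝ, Measurable g → Integrable g F →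
      ∫⁻ s in Iic b, ‖forward F g s‖ₑ ∂(hazard F) ≤ C * ∫⁻ s, ‖g s‖ₑ ∂F := by
  obtain ⟨C, hC0, hC⟩ := exists_forward_le hb
  refine ⟨2 * ENNReal.ofReal C, ENNReal.mul_ne_top (by simp) ENNReal.ofReal_ne_top, fun g hgm hg => ?_⟩
  have hm : Measurable fun s => (Iic b).indicator (fun s => ‖forward F g s‖ₑ) s :=
    (measurable_forward_one hgm).enorm.indicator measurableSet_Iic
  rw [← lintegral_indicator measurableSet_Iic, hazard_lintegral hF hm]
  calc ∫⁻ s, ENNReal.ofReal (survLeft F s)⁻¹ * (Iic b).indicator (fun s => ‖forward F g s‖ₑ) s ∂F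
      ≤ ∫⁻ s, ENNReal.ofReal C * (‖g s‖ₑ + ∫⁻ u, ‖g u‖ₑ ∂F) ∂F := by
        refine lintegral_mono fun s => ?_
        by_cases hs : s ∈ Iic b
        · rw [indicator_of_mem hs]
          have := ENNReal.ofReal_le_ofReal (hC g hg s hs)
          rw [ENNReal.ofReal_mul (inv_nonneg.2 (survLeft_nonneg F s)), ENNReal.ofReal_mul hC0,
            ENNReal.ofReal_add (abs_nonneg _) (integral_nonneg fun u => abs_nonneg _),
            ofReal_integral_eq_lintegral_ofReal hg.abs (ae_of_all _ fun u => abs_nonneg _)] at this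
          simpa only [← Real.enorm_eq_ofReal_abs] using this
        · rw [indicator_of_notMem hs, mul_zero]; exact zero_le
    _ = 2 * ENNReal.ofReal C * ∫⁻ s, ‖g s‖ₑ ∂F := by
        rw [lintegral_const_mul _ (hgm.enorm.add_const _), lintegral_add_right _ measurable_const,
          lintegral_const, measure_univ, mul_one]
        ring

lemma integrable_dirac_prod {m : Measure ℝ} [SFinite m] {h : ℝ × ℝ → ℝ} (hm : Measurable h) (x : ℝ) :
    Integrable h ((Measure.dirac x).prod m) ↔ Integrable (fun a => h (x, a)) m := by
  rw [Measure.dirac_prod, integrable_map_measure hm.aestronglyMeasurable (by fun_prop)]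
  rfl

/-- The forward operator in one variable preserves integrability. -/
lemma integrable_forward_prod (hF : F (Iic 0) = 0) {h : ℝ → ℝ → ℝ}
    (hm : Measurable (Function.uncurry h)) {m : Measure ℝ} [SFinite m] {z : Obs}
    (hz : 0 < survLeft F z.1) (hi : Integrable (Function.uncurry h) ((F + jumpMeasure z).prod m)) :
    Integrable (fun q : ℝ × ℝ => forward F (fun s => h s q.2) q.1)
      ((totalMeasure (hazard F) z).prod m) := by
  rw [Measure.add_prod, integrable_add_measure] at hi
  obtain ⟨hi1, hi2⟩ := hi
  have hfm : Measurable fun q : ℝ × ℝ => forward F (fun s => h s q.2) q.1 := measurable_forward hm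
  rw [totalMeasure, Measure.add_prod, integrable_add_measure]
  constructor
  · rcases z with ⟨x, _ | _⟩
    · simp [jumpMeasure]
    -- Statements that hold F-almost everywhere say nothing about the section at the jump time x,
    -- which is why `jumpMeasure z` is added to F in the hypothesis.
    · simp only [jumpMeasure, if_true] at hi2 ⊢
      rw [integrable_dirac_prod hfm]
      rw [integrable_dirac_prod hm] at hi2
      have h3 : Integrable (Function.uncurry h) ((F.restrict (Ioi x)).prod m) :=
        hi1.mono_measure (Measure.prod_mono Measure.restrict_le_self le_rfl)
      exact hi2.sub (h3.integral_prod_right.div_const (surv F x))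
  · refine ⟨hfm.aestronglyMeasurable, ?_⟩
    obtain ⟨C, hC, hle⟩ := lintegral_abs_forward_le hF hz
    rw [HasFiniteIntegral, lintegral_prod_symm _ hfm.enorm.aemeasurable]
    have h1 : ∀ᵐ a ∂m, ∫⁻ s in Iic z.1, ‖forward F (fun s => h s a) s‖ₑ ∂(hazard F)
        ≤ C * ∫⁻ s, ‖h s a‖ₑ ∂F := by
      filter_upwards [hi1.prod_left_ae] with a ha
      exact hle _ (hm.comp (measurable_id.prodMk measurable_const)) ha
    refine (lintegral_mono_ae h1).trans_lt ?_
    have h2 : Measurable fun a => ∫⁻ s, ‖h s a‖ₑ ∂F := hm.enorm.lintegral_prod_left'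
    rw [lintegral_const_mul _ h2]
    refine ENNReal.mul_lt_top hC.lt_top ?_
    have := hi1.2
    rwa [HasFiniteIntegral, lintegral_prod_symm _ hm.enorm.aemeasurable] at this

/-- The forward operator in both variables. -/
def twoForward (F : Measure ℝ) (K : ℝ → ℝ → ℝ) (s t : ℝ) : ℝ :=
  forward F (fun t' => forward F (fun s' => K s' t') s) t

lemma measurable_forward_swap {K : ℝ → ℝ → ℝ} (hK : Measurable (Function.uncurry K)) :
    Measurable (Function.uncurry fun t s => forward F (fun s' => K s' t) s) :=
  (measurable_forward hK).comp measurable_swap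

lemma measurable_twoForward {K : ℝ → ℝ → ℝ} (hK : Measurable (Function.uncurry K)) :
    Measurable (Function.uncurry (twoForward F K)) :=
  (measurable_forward (measurable_forward_swap hK)).comp measurable_swap

lemma integrable_twoForward (hF : F (Iic 0) = 0) {K : ℝ → ℝ → ℝ}
    (hK : Measurable (Function.uncurry K)) {z z' : Obs} (hz : 0 < survLeft F z.1)
    (hz' : 0 < survLeft F z'.1)
    (hi : Integrable (Function.uncurry K) ((F + jumpMeasure z).prod (F + jumpMeasure z'))) :
    Integrable (Function.uncurry (twoForward F K))
      ((totalMeasure (hazard F) z).prod (totalMeasure (hazard F) z')) := by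
  have h1 := (integrable_forward_prod hF hK hz hi).swap
  exact (integrable_forward_prod hF (measurable_forward_swap hK) hz' h1).swap

/-- Fubini is needed only for the last term. Integrability of the section at the given s does not
follow from that of K and is assumed separately. -/
lemma twoForward_eq {K : ℝ → ℝ → ℝ}
    (hi : Integrable (Function.uncurry K) (F.prod F)) {s : ℝ} (hs : Integrable (K s) F) (t : ℝ) :
    twoForward F K s t = K s t - (∫ u in Ioi s, K u t ∂F) / surv F s
      - (∫ v in Ioi t, K s v ∂F) / surv F t
      + (∫ u in Ioi s, ∫ v in Ioi t, K u v ∂F ∂F) / (surv F s * surv F t) := by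
  have h3 : Integrable (Function.uncurry K) ((F.restrict (Ioi s)).prod (F.restrict (Ioi t))) :=
    hi.mono_measure (Measure.prod_mono Measure.restrict_le_self Measure.restrict_le_self)
  have h4 : IntegrableOn (fun v => ∫ u in Ioi s, K u v ∂F) (Ioi t) F := h3.integral_prod_right
  rw [twoForward]
  simp only [forward, tailMean]
  rw [integral_sub hs.integrableOn (h4.div_const _), integral_div, integral_integral_swap h3]
  simp only [div_eq_mul_inv, mul_inv]
  ring

/-- The forward operator in both variables contracts the weighted `L²` norm of kernels. -/
lemma lintegral_twoForward_sq_le (hF : F (Iic 0) = 0) {K : ℝ → ℝ → ℝ}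
    (hK : Measurable (Function.uncurry K)) {Q : ℝ → ℝ≥0∞} (hQ : Monotone Q) :
    ∫⁻ s, Q s * ENNReal.ofReal (surv F s / survLeft F s) * ∫⁻ t, Q t *
        ENNReal.ofReal (twoForward F K s t ^ 2 * (surv F t / survLeft F t)) ∂F ∂F
      ≤ ∫⁻ t, Q t * ∫⁻ s, Q s * ENNReal.ofReal (K s t ^ 2) ∂F ∂F := by
  set r : ℝ → ℝ := fun s => surv F s / survLeft F s with hr
  have hrm : Measurable r := (measurable_surv F).div (measurable_survLeft F)
  have hr0 : ∀ s, 0 ≤ r s := fun s => div_nonneg (surv_nonneg F s) (survLeft_nonneg F s)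
  have hQm := hQ.measurable
  have hA := measurable_forward (F := F) hK
  calc ∫⁻ s, Q s * ENNReal.ofReal (r s) * ∫⁻ t, Q t *
        ENNReal.ofReal (twoForward F K s t ^ 2 * r t) ∂F ∂F
      ≤ ∫⁻ s, Q s * ENNReal.ofReal (r s) * ∫⁻ t, Q t *
        ENNReal.ofReal (forward F (fun s' => K s' t) s ^ 2) ∂F ∂F := by
        -- The contraction acts in one variable at a time: here in t at fixed s, and after Fubini in
        -- s at fixed t.
        refine lintegral_mono fun s => mul_le_mul_right ?_ _
        exact lintegral_weight_forward_sq_le hF (hA.comp (measurable_const.prodMk measurable_id)) hQ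
    _ = ∫⁻ s, ∫⁻ t, Q t * (Q s * ENNReal.ofReal (forward F (fun s' => K s' t) s ^ 2 * r s)) ∂F ∂F := by
        refine lintegral_congr fun s => ?_
        rw [← lintegral_const_mul]
        · refine lintegral_congr fun t => ?_
          rw [ENNReal.ofReal_mul (sq_nonneg _)]
          ring
        · exact hQm.mul ((hA.comp (measurable_const.prodMk measurable_id)).pow_const 2).ennreal_ofReal
    _ = ∫⁻ t, Q t * ∫⁻ s, Q s * ENNReal.ofReal (forward F (fun s' => K s' t) s ^ 2 * r s) ∂F ∂F := by
        rw [lintegral_lintegral_swap]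
        · refine lintegral_congr fun t => ?_
          rw [lintegral_const_mul]
          exact hQm.mul (((hA.comp (measurable_id.prodMk measurable_const)).pow_const 2).mul
            hrm).ennreal_ofReal
        · exact ((hQm.comp measurable_snd).mul ((hQm.comp measurable_fst).mul
            (((hA.pow_const 2).mul (hrm.comp measurable_fst)).ennreal_ofReal))).aemeasurable
    _ ≤ ∫⁻ t, Q t * ∫⁻ s, Q s * ENNReal.ofReal (K s t ^ 2) ∂F ∂F := by
        refine lintegral_mono fun t => mul_le_mul_right ?_ _
        exact lintegral_weight_forward_sq_le hF (hK.comp (measurable_id.prodMk measurable_const)) hQ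

end Kernel

/-! ### Pathwise identities for a fixed sample -/

section Path

variable {n : ℕ} {F : Measure ℝ} [IsProbabilityMeasure F]

lemma one_le_riskCount {ω : Fin n → Obs} {s : ℝ} {j : Fin n} (h : s ≤ (ω j).1) :
    1 ≤ riskCount ω s := by
  have := Finset.single_le_sum (f := fun i => if s ≤ (ω i).1 then (1:ℝ) else 0)
    (fun i _ => by split_ifs <;> norm_num) (Finset.mem_univ j)
  simpa [riskCount, h] using this

lemma riskCount_eq_zero {ω : Fin n → Obs} {s : ℝ} (h : ∀ j, (ω j).1 < s) : riskCount ω s = 0 :=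
  Finset.sum_eq_zero fun j _ => if_neg (not_le.2 (h j))

lemma kmJump_le_one (s : ℝ) (ω : Fin n → Obs) : kmJump s ω ≤ 1 := by
  by_cases h : ∃ j, s ≤ (ω j).1
  · obtain ⟨j, hj⟩ := h
    have h1 := one_le_riskCount hj
    exact (div_le_one (by linarith)).2 ((kmLeft_le_one s ω).trans h1)
  · push Not at h
    rw [kmJump, riskCount_eq_zero h, div_zero]
    exact zero_le_one

lemma measurable_kmJump_left (ω : Fin n → Obs) : Measurable fun s => kmJump s ω :=
  measurable_section measurable_kmJump ω

lemma integrable_kmJump_mul {α : Type*} [MeasurableSpace α] {m : Measure α} {f g : α → ℝ}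
    (hf : Integrable f m) (hg : Measurable g) (ω : Fin n → Obs) :
    Integrable (fun a => kmJump (g a) ω * f a) m := by
  refine hf.mono (((measurable_kmJump_left ω).comp hg).aestronglyMeasurable.mul hf.1)
    (ae_of_all _ fun a => ?_)
  rw [norm_mul, Real.norm_of_nonneg (kmJump_nonneg _ _)]
  exact mul_le_of_le_one_left (norm_nonneg _) (kmJump_le_one _ _)

/-- The Kaplan-Meier estimator of a sample. -/
def kmMeasure (ω : Fin n → Obs) : Measure ℝ :=
  ∑ i, ENNReal.ofReal (kmJump (ω i).1 ω) • jumpMeasure (ω i)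

instance (ω : Fin n → Obs) : IsFiniteMeasure (kmMeasure ω) := by
  refine ⟨?_⟩
  rw [kmMeasure, Measure.finsetSum_apply]
  exact ENNReal.sum_lt_top.2 fun i _ => ENNReal.mul_lt_top ENNReal.ofReal_lt_top (measure_lt_top _ _)

lemma integral_kmMeasure (g : ℝ → ℝ) (ω : Fin n → Obs) :
    ∫ s, g s ∂(kmMeasure ω) = ∑ i, if (ω i).2 then kmJump (ω i).1 ω * g (ω i).1 else 0 := by
  rw [kmMeasure, integral_finsetSum_measure fun i _ =>
    (integrable_jumpMeasure g _).smul_measure (by simp)]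
  refine Finset.sum_congr rfl fun i _ => ?_
  rw [integral_smul_measure, integral_jumpMeasure, ENNReal.toReal_ofReal (kmJump_nonneg _ _)]
  split_ifs <;> simp

lemma kmMeasure_le (ω : Fin n → Obs) : kmMeasure ω ≤ jumpSum ω := by
  refine Finset.sum_le_sum fun i _ => ?_
  refine Measure.le_iff.2 fun A _ => ?_
  rw [Measure.smul_apply, smul_eq_mul]
  exact mul_le_of_le_one_left zero_le (by simpa using kmJump_le_one _ _)

lemma jumpMeasure_le (ω : Fin n → Obs) (j : Fin n) : jumpMeasure (ω j) ≤ jumpSum ω :=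
  Finset.single_le_sum (f := fun j => jumpMeasure (ω j)) (fun _ _ => Measure.zero_le _)
    (Finset.mem_univ j)

/-- Summed over the sample, the compensator is ∫ Y q f dΛ = ∫ Ŝ(s-) f dΛ, because Y q = Ŝ(s-) while
someone is at risk. Writing Ŝ(s-) as 1 minus the earlier jumps gives the last sum. -/
lemma sampleInt_kmJump_mul {Λ : Measure ℝ} [SFinite Λ] {f : ℝ → ℝ} {ω : Fin n → Obs} {m : Fin n}
    (hm : ∀ j, (ω j).1 ≤ (ω m).1) (hf : IntegrableOn f (Iic (ω m).1) Λ) :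
    sampleInt Λ (fun s => kmJump s ω * f s) ω
      = (∫ s, f s ∂(kmMeasure ω)) - (∫ s in Iic (ω m).1, f s ∂Λ)
        + ∑ i, if (ω i).2 then kmJump (ω i).1 ω * ∫ s in Ioc (ω i).1 (ω m).1, f s ∂Λ else 0 := by
  have hqf : IntegrableOn (fun s => kmJump s ω * f s) (Iic (ω m).1) Λ :=
    integrable_kmJump_mul hf measurable_id ω
  have h1 : ∑ j, ∫ s in Iic (ω j).1, kmJump s ω * f s ∂Λ
      = ∫ s in Iic (ω m).1, kmLeft s ω * f s ∂Λ := by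
    have h2 : ∀ j ∈ Finset.univ, ∫ s in Iic (ω j).1, kmJump s ω * f s ∂Λ
        = ∫ s in Iic (ω m).1, (Iic (ω j).1).indicator (fun s => kmJump s ω * f s) s ∂Λ := by
      intro j _
      rw [integral_indicator measurableSet_Iic, Measure.restrict_restrict measurableSet_Iic,
        inter_eq_left.2 (Iic_subset_Iic.2 (hm j))]
    rw [Finset.sum_congr rfl h2, ← integral_finsetSum _ fun j _ => hqf.indicator measurableSet_Iic]
    refine setIntegral_congr_fun measurableSet_Iic fun s hs => ?_
    have h3 : ∀ j ∈ Finset.univ, (Iic (ω j).1).indicator (fun s => kmJump s ω * f s) s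
        = (if s ≤ (ω j).1 then 1 else 0) * (kmJump s ω * f s) := fun j _ => by
      by_cases h : s ≤ (ω j).1 <;> simp [indicator, h]
    rw [Finset.sum_congr rfl h3, ← Finset.sum_mul, ← mul_assoc]
    congr 1
    have h4 := one_le_riskCount (show s ≤ (ω m).1 from hs)
    change riskCount ω s * (kmLeft s ω / riskCount ω s) = _
    field_simp
  have h2 : ∫ s in Iic (ω m).1, kmLeft s ω * f s ∂Λ = (∫ s in Iic (ω m).1, f s ∂Λ)
      - ∑ i, if (ω i).2 then kmJump (ω i).1 ω * ∫ s in Ioc (ω i).1 (ω m).1, f s ∂Λ else 0 := by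
    have h3 : ∀ s, kmLeft s ω * f s = f s - ∑ i, (if (ω i).2 then kmJump (ω i).1 ω else 0) *
        (Ioi (ω i).1).indicator f s := by
      intro s
      rw [kmLeft_eq, sub_mul, one_mul, Finset.sum_mul]
      congr 1
      refine Finset.sum_congr rfl fun i _ => ?_
      by_cases h1 : (ω i).2 = true <;> by_cases h2 : (ω i).1 < s <;> simp [indicator, h1, h2]
    simp_rw [h3]
    rw [integral_sub hf (integrable_finsetSum _ fun i _ =>
      (hf.integrable.indicator measurableSet_Ioi).const_mul _),
      integral_finsetSum _ fun i _ => (hf.integrable.indicator measurableSet_Ioi).const_mul _]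
    congr 1
    refine Finset.sum_congr rfl fun i _ => ?_
    rw [integral_const_mul, integral_indicator measurableSet_Ioi,
      Measure.restrict_restrict measurableSet_Ioi, Ioi_inter_Iic]
    split_ifs <;> simp
  have h3 : sampleInt Λ (fun s => kmJump s ω * f s) ω = (∫ s, f s ∂(kmMeasure ω))
      - ∑ j, ∫ s in Iic (ω j).1, kmJump s ω * f s ∂Λ := by
    rw [integral_kmMeasure, ← Finset.sum_sub_distrib]
    rfl
  rw [h3, h1, h2]
  ring

/-- A sample of positive times inside the range of `F`. -/
structure Regular (F : Measure ℝ) (ω : Fin n → Obs) : Prop where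
  pos : ∀ j, 0 < (ω j).1
  surv : ∀ j, 0 < survLeft F (ω j).1

lemma kmRight_eq (s : ℝ) (ω : Fin n → Obs) {m : Fin n} (hm : ∀ j, (ω j).1 ≤ (ω m).1)
    (hs : (ω m).1 ≤ s) : kmRight s ω = 1 - ∑ i, if (ω i).2 then kmJump (ω i).1 ω else 0 := by
  rw [kmRight]
  congr 1
  refine Finset.sum_congr rfl fun i _ => ?_
  simp [(hm i).trans hs]

/-- The Duhamel identity for the Kaplan-Meier estimator. -/
lemma integralDiff_kmMeasure (hF : F (Iic 0) = 0) {ω : Fin n → Obs} (hω : Regular F ω) {m : Fin n}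
    (hm : ∀ j, (ω j).1 ≤ (ω m).1) {g : ℝ → ℝ} (hgm : Measurable g) (hg : Integrable g F) :
    integralDiff (kmMeasure ω) F g
      = sampleInt (hazard F) (fun s => kmJump s ω * forward F g s) ω
        - kmRight (ω m).1 ω / surv F (ω m).1 * ∫ s in Ioi (ω m).1, g s ∂F := by
  -- Integration by parts turns the hazard integrals of Ag into tail means. Those at event times
  -- cancel against the ones inside Ag, and those at the last observation x combine to Ŝ(x) times
  -- the tail mean at x.
  rw [sampleInt_kmJump_mul hm (forward_integrableOn hF hgm hg (hω.surv m)),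
    integral_forward_Iic hF hgm hg (hω.pos m).le (hω.surv m), kmRight_eq _ ω hm le_rfl]
  have h1 : ∀ i ∈ Finset.univ, (if (ω i).2 then kmJump (ω i).1 ω *
      ∫ s in Ioc (ω i).1 (ω m).1, forward F g s ∂(hazard F) else 0)
      = (if (ω i).2 then kmJump (ω i).1 ω * tailMean F g (ω i).1 else 0)
        - (if (ω i).2 then kmJump (ω i).1 ω else 0) * tailMean F g (ω m).1 := fun i _ => by
    rw [integral_forward_Ioc hF hgm hg (hm i) (hω.surv m)]
    split_ifs <;> ring
  rw [Finset.sum_congr rfl h1, Finset.sum_sub_distrib, ← Finset.sum_mul, integral_kmMeasure]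
  have h2 : ∑ i, (if (ω i).2 then kmJump (ω i).1 ω * forward F g (ω i).1 else 0)
      = ∑ i, (if (ω i).2 then kmJump (ω i).1 ω * g (ω i).1 else 0)
        - ∑ i, (if (ω i).2 then kmJump (ω i).1 ω * tailMean F g (ω i).1 else 0) := by
    rw [← Finset.sum_sub_distrib]
    refine Finset.sum_congr rfl fun i _ => ?_
    split_ifs <;> simp [forward]; ring
  rw [h2, integralDiff, integral_kmMeasure, tailMean]
  ring

lemma surv_of_nonpos (hF : F (Iic 0) = 0) {x : ℝ} (hx : x ≤ 0) : surv F x = 1 :=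
  le_antisymm (by rw [surv]; exact measureReal_le_one)
    ((surv_zero hF).symm.le.trans (surv_antitone F hx))

lemma integral_hazard_inv_surv (hF : F (Iic 0) = 0) {a c : ℝ} (hac : a ≤ c) (hc : 0 < surv F c) :
    ∫ s in Ioc a c, (surv F s)⁻¹ ∂(hazard F) = (surv F c)⁻¹ - (surv F a)⁻¹ := by
  rcases hac.eq_or_lt with rfl | hac
  · simp
  rw [← integral_Ioc_inv_surv hac hc, hazard_setIntegral hF measurableSet_Ioc]
  simp only [mul_inv, mul_comm]

lemma integral_hazard_Iic_inv_surv (hF : F (Iic 0) = 0) {c : ℝ} (hc : 0 < surv F c) :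
    ∫ s in Iic c, (surv F s)⁻¹ ∂(hazard F) = (surv F c)⁻¹ - 1 := by
  have h := integral_hazard_inv_surv hF (min_le_left c 0) hc
  rw [surv_of_nonpos hF (min_le_right c 0), inv_one] at h
  rw [← h]
  refine setIntegral_congr_set (ae_eq_set.2 ⟨?_, ?_⟩)
  · refine measure_mono_null (fun x hx => ?_) (hazard_Iic_zero hF)
    have : x ≤ min c 0 := not_lt.1 fun h => hx.2 ⟨h, hx.1⟩
    exact this.trans (min_le_right _ _)
  · rw [sdiff_eq_empty.2 Ioc_subset_Iic_self, measure_empty]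

lemma integrableOn_inv_surv {Λ : Measure ℝ} {t : ℝ} (ht : 0 < surv F t) (hΛ : Λ (Iic t) ≠ ∞) :
    IntegrableOn (fun s => (surv F s)⁻¹) (Iic t) Λ := by
  have : IsFiniteMeasure (Λ.restrict (Iic t)) := ⟨by simpa using hΛ.lt_top⟩
  refine Integrable.mono' (integrable_const (surv F t)⁻¹) (measurable_surv F).inv.aestronglyMeasurable ?_
  filter_upwards [ae_restrict_mem measurableSet_Iic] with s hs
  rw [Real.norm_of_nonneg (inv_nonneg.2 (surv_nonneg F s))]
  have := surv_antitone F (show s ≤ t from hs)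
  gcongr

lemma hazard_Iic_lt_top (hF : F (Iic 0) = 0) {x : ℝ} (hx : 0 < survLeft F x) :
    hazard F (Iic x) < ∞ := by
  refine (isHazard_uncensored hF).measure_Iic_lt_top ?_
  rw [riskProb_uncensored]
  exact (ENNReal.toReal_pos_iff.1 hx).1

/-- The integrand of the martingale `Ŝ / S` stopped at the last observation. -/
def ratioIntegrand (F : Measure ℝ) (t s : ℝ) (ω : Fin n → Obs) : ℝ :=
  kmJump s ω * (Iic t).indicator (fun s => (surv F s)⁻¹) s

/-- The ratio of the estimated and the true survival function as a stochastic integral. -/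
lemma one_sub_sampleInt_ratio (hF : F (Iic 0) = 0) {ω : Fin n → Obs} {m : Fin n}
    (hm : ∀ j, (ω j).1 ≤ (ω m).1) {t : ℝ} (ht : 0 < surv F t) :
    1 - sampleInt (hazard F) (fun s => ratioIntegrand F t s ω) ω
      = kmRight (min t (ω m).1) ω / surv F (min t (ω m).1) := by
  set c := min t (ω m).1 with hc
  have hS : 0 < surv F c := ht.trans_le (surv_antitone F (min_le_left _ _))
  have hfin : hazard F (Iic t) ≠ ∞ :=
    (hazard_Iic_lt_top hF (ht.trans_le (surv_le_survLeft F t))).ne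
  have hi : IntegrableOn ((Iic t).indicator fun s => (surv F s)⁻¹) (Iic (ω m).1) (hazard F) :=
    (((integrable_indicator_iff measurableSet_Iic).2 (integrableOn_inv_surv ht hfin))).integrableOn
  simp only [ratioIntegrand]
  rw [sampleInt_kmJump_mul hm hi]
  -- As ∫_(a,c] dΛ/S = 1/S(c) - 1/S(a), every term is explicit. The jumps divided by S at their own
  -- times cancel, which leaves Ŝ(c)/S(c).
  have h1 : ∫ s in Iic (ω m).1, (Iic t).indicator (fun s => (surv F s)⁻¹) s ∂(hazard F)
      = (surv F c)⁻¹ - 1 := by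
    rw [integral_indicator measurableSet_Iic, Measure.restrict_restrict measurableSet_Iic,
      Iic_inter_Iic, ← integral_hazard_Iic_inv_surv hF hS]
  have h2 : ∀ i ∈ Finset.univ, (if (ω i).2 then kmJump (ω i).1 ω * ∫ s in Ioc (ω i).1 (ω m).1,
      (Iic t).indicator (fun s => (surv F s)⁻¹) s ∂(hazard F) else 0)
      = (if (ω i).2 ∧ (ω i).1 ≤ c then kmJump (ω i).1 ω else 0) * (surv F c)⁻¹
        - if (ω i).2 then kmJump (ω i).1 ω * (Iic t).indicator (fun s => (surv F s)⁻¹) (ω i).1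
          else 0 := fun i _ => by
    have e : (ω i).1 ≤ c ↔ (ω i).1 ≤ t := by
      rw [hc, le_min_iff, and_iff_left (hm i)]
    by_cases hb : (ω i).2 = true
    swap
    · simp [hb]
    rw [if_pos hb, if_pos hb, integral_indicator measurableSet_Iic,
      Measure.restrict_restrict measurableSet_Iic]
    have e2 : Iic t ∩ Ioc (ω i).1 (ω m).1 = Ioc (ω i).1 c := by
      ext s; simp only [mem_inter_iff, mem_Iic, mem_Ioc, hc, le_min_iff]; tauto
    rw [e2]
    by_cases hle : (ω i).1 ≤ c
    · rw [integral_hazard_inv_surv hF hle hS, if_pos ⟨hb, hle⟩, indicator_of_mem (show (ω i).1 ∈ Iic t from e.1 hle)]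
      ring
    · rw [Ioc_eq_empty (fun h => hle h.le), if_neg (fun h => hle h.2),
        indicator_of_notMem (show (ω i).1 ∉ Iic t from fun h => hle (e.2 h))]
      simp
  rw [h1, Finset.sum_congr rfl h2, Finset.sum_sub_distrib, ← Finset.sum_mul, integral_kmMeasure,
    kmRight]
  field_simp
  ring

end Path

/-! ### Decomposition of the second-order error -/

section Decomposition

lemma integralDiff_congr {μ ν θ : Measure ℝ} (h1 : μ ≤ θ) (h2 : ν ≤ θ) {f g : ℝ → ℝ}
    (h : f =ᵐ[θ] g) : integralDiff μ ν f = integralDiff μ ν g := by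
  rw [integralDiff, integralDiff, integral_congr_ae (ae_mono h1 h), integral_congr_ae (ae_mono h2 h)]

lemma integralDiff_sub_mul {μ ν : Measure ℝ} {f g : ℝ → ℝ} (c : ℝ) (hf : Integrable f (μ + ν))
    (hg : Integrable g (μ + ν)) :
    integralDiff μ ν (fun s => f s - c * g s) = integralDiff μ ν f - c * integralDiff μ ν g := by
  rw [integrable_add_measure] at hf hg
  simp only [integralDiff]
  rw [integral_sub hf.1 (hg.1.const_mul c), integral_sub hf.2 (hg.2.const_mul c),
    integral_const_mul, integral_const_mul]
  ring

lemma integralDiff_finset_sum {κ : Type*} {μ ν : Measure ℝ} (A : Finset κ) {f : κ → ℝ → ℝ}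
    (hf : ∀ i, Integrable (f i) (μ + ν)) :
    integralDiff μ ν (fun s => ∑ i ∈ A, f i s) = ∑ i ∈ A, integralDiff μ ν (f i) := by
  simp only [integralDiff]
  rw [integral_finsetSum _ fun i _ => (integrable_add_measure.1 (hf i)).1,
    integral_finsetSum _ fun i _ => (integrable_add_measure.1 (hf i)).2, Finset.sum_sub_distrib]

variable {Λ : Measure ℝ} [SFinite Λ]

lemma mart_congr_ae {f g : ℝ → ℝ} {z : Obs} (h : f =ᵐ[totalMeasure Λ z] g) :
    mart Λ f z = mart Λ g z := by
  rw [mart_eq_integralDiff, mart_eq_integralDiff]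
  exact integralDiff_congr (Measure.le_add_right le_rfl) (Measure.le_add_left le_rfl) h

lemma integrable_mart_prod {f : ℝ → ℝ → ℝ} {z : Obs} {m : Measure ℝ} [SFinite m]
    (hf : Integrable (Function.uncurry f) ((totalMeasure Λ z).prod m)) :
    Integrable (fun v => mart Λ (fun s => f s v) z) m := by
  rw [totalMeasure, Measure.add_prod, integrable_add_measure] at hf
  simp_rw [mart_eq_integralDiff]
  exact hf.1.integral_prod_right.sub hf.2.integral_prod_right

lemma integralDiff_mart_swap {f : ℝ → ℝ → ℝ} {z : Obs} {μ ν : Measure ℝ} [SFinite μ] [SFinite ν]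
    (hf : Integrable (Function.uncurry f) ((totalMeasure Λ z).prod (μ + ν))) :
    integralDiff μ ν (fun v => mart Λ (fun s => f s v) z)
      = mart Λ (fun s => integralDiff μ ν fun v => f s v) z := by
  simp_rw [mart_eq_integralDiff]
  exact integralDiff_swap hf

lemma integral_mart_swap {f : ℝ → ℝ → ℝ} {z : Obs} {m : Measure ℝ} [SFinite m]
    (hf : Integrable (Function.uncurry f) ((totalMeasure Λ z).prod m)) :
    ∫ v, mart Λ (fun s => f s v) z ∂m = mart Λ (fun s => ∫ v, f s v ∂m) z := by
  have := integralDiff_mart_swap (Λ := Λ) (z := z) (μ := m) (ν := 0) (f := f) (by rwa [add_zero])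
  simpa [integralDiff] using this

lemma mart_mart_swap {f : ℝ → ℝ → ℝ} {z z' : Obs}
    (hf : Integrable (Function.uncurry f) ((totalMeasure Λ z).prod (totalMeasure Λ z'))) :
    mart Λ (fun t => mart Λ (fun s => f s t) z) z' = mart Λ (fun s => mart Λ (fun t => f s t) z') z := by
  have h := integralDiff_mart_swap (Λ := Λ) (z := z) (μ := jumpMeasure z')
    (ν := Λ.restrict (Iic z'.1)) (f := f) hf
  simpa only [← mart_eq_integralDiff] using h

/-- The double integral of a kernel with respect to the compensated counting measure. -/
def doubleInt {ι : Type*} [Fintype ι] (Λ : Measure ℝ) (k : ℝ → ℝ → ℝ) (ω : ι → Obs) : ℝ :=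
  ∑ j, ∑ i, mart Λ (fun t => mart Λ (fun s => k s t) (ω i)) (ω j)

variable {n : ℕ} {F : Measure ℝ} [IsProbabilityMeasure F]

lemma integrable_kmJump_forward (hF : F (Iic 0) = 0) {ω : Fin n → Obs} (hω : Regular F ω)
    {K : ℝ → ℝ → ℝ} (hK : Measurable (Function.uncurry K))
    (hi : Integrable (Function.uncurry K) ((F + jumpSum ω).prod (F + jumpSum ω))) (j : Fin n) :
    Integrable (Function.uncurry fun s t => kmJump s ω * forward F (fun u => K u t) s)
      ((totalMeasure (hazard F) (ω j)).prod (F + jumpSum ω)) :=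
  integrable_kmJump_mul (integrable_forward_prod hF hK (hω.surv j) (hi.mono_measure
    (Measure.prod_mono (add_le_add le_rfl (jumpMeasure_le ω j)) le_rfl))) measurable_fst ω

lemma integrable_forward_right (hF : F (Iic 0) = 0) {ω : Fin n → Obs} (hω : Regular F ω)
    {K : ℝ → ℝ → ℝ} (hK : Measurable (Function.uncurry K))
    (hi : Integrable (Function.uncurry K) ((F + jumpSum ω).prod (F + jumpSum ω))) (j : Fin n) :
    ∀ᵐ s ∂(totalMeasure (hazard F) (ω j)), Integrable (fun t => forward F (fun u => K u t) s) F :=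
  (integrable_forward_prod (m := F) hF hK (hω.surv j) (hi.mono_measure (Measure.prod_mono
    (add_le_add le_rfl (jumpMeasure_le ω j)) (Measure.le_add_right le_rfl)))).prod_right_ae

/-- The linear term in the remainder of the second-order error. -/
def crossTerm (F : Measure ℝ) (K : ℝ → ℝ → ℝ) (x : ℝ) (ω : Fin n → Obs) : ℝ :=
  ∫ t in Ioi x, sampleInt (hazard F) (fun s => kmJump s ω * forward F (fun u => K u t) s) ω ∂F

lemma crossTerm_eq (hF : F (Iic 0) = 0) {ω : Fin n → Obs} (hω : Regular F ω)
    {K : ℝ → ℝ → ℝ} (hK : Measurable (Function.uncurry K))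
    (hi : Integrable (Function.uncurry K) ((F + jumpSum ω).prod (F + jumpSum ω))) (x : ℝ) :
    crossTerm F K x ω = sampleInt (hazard F)
      (fun s => kmJump s ω * ∫ t in Ioi x, forward F (fun u => K u t) s ∂F) ω := by
  have hle : F.restrict (Ioi x) ≤ F + jumpSum ω :=
    Measure.restrict_le_self.trans (Measure.le_add_right le_rfl)
  have h1 := fun j => (integrable_kmJump_forward hF hω hK hi j).mono_measure
    (Measure.prod_mono le_rfl hle)
  simp only [crossTerm, sampleInt]
  rw [integral_finsetSum _ fun j _ => integrable_mart_prod (h1 j)]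
  refine Finset.sum_congr rfl fun j _ => ?_
  rw [integral_mart_swap (h1 j)]
  simp_rw [integral_const_mul]

/-- The difference F̂ - F is moved inside the stochastic integral over s, and the Duhamel identity
is applied, for almost every s, to the section t ↦ A₁K(s,t). -/
lemma integralDiff_sampleInt_forward (hF : F (Iic 0) = 0) {ω : Fin n → Obs} (hω : Regular F ω)
    {m : Fin n} (hm : ∀ j, (ω j).1 ≤ (ω m).1) {K : ℝ → ℝ → ℝ} (hK : Measurable (Function.uncurry K))
    (hi : Integrable (Function.uncurry K) ((F + jumpSum ω).prod (F + jumpSum ω))) :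
    integralDiff (kmMeasure ω) F (fun t => sampleInt (hazard F)
        (fun s => kmJump s ω * forward F (fun u => K u t) s) ω)
      = doubleInt (hazard F) (fun s t => kmJump s ω * kmJump t ω * twoForward F K s t) ω
        - kmRight (ω m).1 ω / surv F (ω m).1 * crossTerm F K (ω m).1 ω := by
  set R := kmRight (ω m).1 ω / surv F (ω m).1 with hR
  have hkm : kmMeasure ω + F ≤ F + jumpSum ω := by
    rw [add_comm]; exact add_le_add le_rfl (kmMeasure_le ω)
  have h1 := integrable_kmJump_forward hF hω hK hi
  have h2 : ∀ j, Integrable (Function.uncurry fun s t => kmJump s ω * forward F (fun u => K u t) s)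
      ((totalMeasure (hazard F) (ω j)).prod (kmMeasure ω + F)) :=
    fun j => (h1 j).mono_measure (Measure.prod_mono le_rfl hkm)
  have htwo : ∀ i j, Integrable (Function.uncurry fun s t =>
      kmJump s ω * kmJump t ω * twoForward F K s t)
      ((totalMeasure (hazard F) (ω i)).prod (totalMeasure (hazard F) (ω j))) := by
    intro i j
    have h3 := integrable_twoForward hF hK (hω.surv i) (hω.surv j) (hi.mono_measure
      (Measure.prod_mono (add_le_add le_rfl (jumpMeasure_le ω i))
        (add_le_add le_rfl (jumpMeasure_le ω j))))
    refine (integrable_kmJump_mul (integrable_kmJump_mul h3 measurable_snd ω) measurable_fst ω).congr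
      (ae_of_all _ fun q => ?_)
    simp only [Function.uncurry]; ring
  have htail : ∀ j, IntegrableOn (fun s => kmJump s ω *
      ∫ t in Ioi (ω m).1, forward F (fun u => K u t) s ∂F) (Iic (ω j).1) (hazard F) := by
    intro j
    have hle : F.restrict (Ioi (ω m).1) ≤ F + jumpSum ω :=
      Measure.restrict_le_self.trans (Measure.le_add_right le_rfl)
    have h3 := ((h1 j).mono_measure (Measure.prod_mono le_rfl hle)).integral_prod_left
    simp only [Function.uncurry, integral_const_mul] at h3
    exact integrable_totalMeasure.1 h3
  have hmain : ∀ i j, IntegrableOn (fun s => mart (hazard F) (fun t =>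
      kmJump s ω * kmJump t ω * twoForward F K s t) (ω i)) (Iic (ω j).1) (hazard F) := by
    intro i j
    have h3 := integrable_mart_prod (f := fun t s => kmJump s ω * kmJump t ω * twoForward F K s t)
      (htwo j i).swap
    exact integrable_totalMeasure.1 h3
  have h4 : ∀ j, mart (hazard F) (fun s => integralDiff (kmMeasure ω) F fun t =>
      kmJump s ω * forward F (fun u => K u t) s) (ω j)
      = (∑ i, mart (hazard F) (fun s => mart (hazard F) (fun t =>
          kmJump s ω * kmJump t ω * twoForward F K s t) (ω i)) (ω j))
        - R * mart (hazard F) (fun s => kmJump s ω *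
          ∫ t in Ioi (ω m).1, forward F (fun u => K u t) s ∂F) (ω j) := by
    intro j
    rw [← mart_finset_sum _ fun i _ => hmain i j, sub_eq_add_neg, ← neg_mul, ← mart_const_mul,
      ← mart_add (integrable_finsetSum _ fun i _ => hmain i j) ((htail j).const_mul _)]
    refine mart_congr_ae ?_
    filter_upwards [integrable_forward_right hF hω hK hi j] with s hs
    have h5 := integralDiff_kmMeasure hF hω hm (g := fun t => forward F (fun u => K u t) s)
      ((measurable_forward hK).comp (measurable_const.prodMk measurable_id)) hs
    have h6 : integralDiff (kmMeasure ω) F (fun t => kmJump s ω * forward F (fun u => K u t) s)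
        = kmJump s ω * integralDiff (kmMeasure ω) F fun t => forward F (fun u => K u t) s := by
      simp only [integralDiff, integral_const_mul]; ring
    rw [h6, h5]
    have h7 : sampleInt (hazard F) (fun t => kmJump t ω *
        forward F (fun t => forward F (fun u => K u t) s) t) ω
        = ∑ i, mart (hazard F) (fun t => kmJump t ω * twoForward F K s t) (ω i) := rfl
    have h8 : ∀ i, mart (hazard F) (fun t => kmJump s ω * kmJump t ω * twoForward F K s t) (ω i)
        = kmJump s ω * mart (hazard F) (fun t => kmJump t ω * twoForward F K s t) (ω i) := by
      intro i
      rw [← mart_const_mul]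
      simp only [mul_assoc]
    rw [h7]
    simp_rw [h8]
    rw [← Finset.mul_sum]
    ring
  simp only [sampleInt]
  rw [integralDiff_finset_sum _ fun j => integrable_mart_prod (h2 j)]
  simp_rw [integralDiff_mart_swap (h2 _), h4]
  rw [Finset.sum_sub_distrib, ← Finset.mul_sum, crossTerm_eq hF hω hK hi]
  congr 1
  rw [doubleInt, Finset.sum_comm]
  refine Finset.sum_congr rfl fun i _ => Finset.sum_congr rfl fun j _ => ?_
  exact (mart_mart_swap (htwo j i)).symm

/-- The Duhamel identity for the tail integral of K. By symmetry of K, the forward operator applied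
to this tail integral is the tail integral of the forward operator, so the stochastic integral is
again the cross term. -/
lemma integralDiff_tail_integral (hF : F (Iic 0) = 0) {ω : Fin n → Obs} (hω : Regular F ω)
    {m : Fin n} (hm : ∀ j, (ω j).1 ≤ (ω m).1) {K : ℝ → ℝ → ℝ} (hK : Measurable (Function.uncurry K))
    (hsym : ∀ x y, K x y = K y x)
    (hi : Integrable (Function.uncurry K) ((F + jumpSum ω).prod (F + jumpSum ω))) :
    integralDiff (kmMeasure ω) F (fun t => ∫ u in Ioi (ω m).1, K u t ∂F)
      = crossTerm F K (ω m).1 ω - kmRight (ω m).1 ω / surv F (ω m).1 *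
        ∫ t in Ioi (ω m).1, ∫ u in Ioi (ω m).1, K u t ∂F ∂F := by
  set x := (ω m).1 with hx
  have hle : F ≤ F + jumpSum ω := Measure.le_add_right le_rfl
  have hi1 : Integrable (Function.uncurry K) (F.prod F) := hi.mono_measure (Measure.prod_mono hle hle)
  have he : Measurable fun t => ∫ u in Ioi x, K u t ∂F :=
    (measurable_tail_integral hK).comp (measurable_const.prodMk measurable_id)
  have hei : Integrable (fun t => ∫ u in Ioi x, K u t ∂F) F :=
    (hi1.mono_measure (Measure.prod_mono (Measure.restrict_le_self (s := Ioi x)) le_rfl)).integral_prod_right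
  rw [integralDiff_kmMeasure hF hω hm he hei, crossTerm_eq hF hω hK hi]
  congr 1
  refine Finset.sum_congr rfl fun j _ => mart_congr_ae ?_
  have h1 : ∀ᵐ s ∂(totalMeasure (hazard F) (ω j)), Integrable (K s) F := by
    have h2 := (hi.mono_measure (Measure.prod_mono le_rfl hle)).prod_right_ae
    rw [ae_add_measure_iff] at h2
    rw [totalMeasure, ae_add_measure_iff]
    exact ⟨ae_mono (jumpMeasure_le ω j) h2.2,
      ae_restrict_of_ae ((hazard_absolutelyContinuous hF).ae_le h2.1)⟩
  filter_upwards [h1] with s hs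
  congr 1
  have h3 : Integrable (Function.uncurry K) ((F.restrict (Ioi s)).prod (F.restrict (Ioi x))) :=
    hi1.mono_measure (Measure.prod_mono Measure.restrict_le_self Measure.restrict_le_self)
  have h4 : IntegrableOn (fun t => ∫ u in Ioi s, K u t ∂F) (Ioi x) F := h3.integral_prod_right
  simp only [forward, tailMean]
  rw [integral_sub hs.integrableOn (h4.div_const _), integral_div, ← integral_integral_swap h3]
  have h5 : ∀ t, ∫ u in Ioi x, K u t ∂F = ∫ u in Ioi x, K t u ∂F := fun t =>
    integral_congr_ae (ae_of_all _ fun u => hsym u t)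
  simp_rw [h5]

/-- The second-order error in terms of stochastic integrals. -/
theorem integralDiff_integralDiff_kmMeasure (hF : F (Iic 0) = 0) {ω : Fin n → Obs}
    (hω : Regular F ω) {m : Fin n} (hm : ∀ j, (ω j).1 ≤ (ω m).1) {K : ℝ → ℝ → ℝ}
    (hK : Measurable (Function.uncurry K)) (hsym : ∀ x y, K x y = K y x)
    (hi : Integrable (Function.uncurry K) ((F + jumpSum ω).prod (F + jumpSum ω))) :
    integralDiff (kmMeasure ω) F (fun v => integralDiff (kmMeasure ω) F fun u => K u v)
      = doubleInt (hazard F) (fun s t => kmJump s ω * kmJump t ω * twoForward F K s t) ω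
        - 2 * (kmRight (ω m).1 ω / surv F (ω m).1) * crossTerm F K (ω m).1 ω
        + (kmRight (ω m).1 ω / surv F (ω m).1) ^ 2 *
          ∫ t in Ioi (ω m).1, ∫ u in Ioi (ω m).1, K u t ∂F ∂F := by
  set R := kmRight (ω m).1 ω / surv F (ω m).1 with hR
  have hle : F ≤ F + jumpSum ω := Measure.le_add_right le_rfl
  have hkm : kmMeasure ω + F ≤ F + jumpSum ω := by
    rw [add_comm]; exact add_le_add le_rfl (kmMeasure_le ω)
  have h1 : (fun v => integralDiff (kmMeasure ω) F fun u => K u v) =ᵐ[F + jumpSum ω] fun v =>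
      sampleInt (hazard F) (fun s => kmJump s ω * forward F (fun u => K u v) s) ω
        - R * ∫ u in Ioi (ω m).1, K u v ∂F := by
    filter_upwards [(hi.mono_measure (Measure.prod_mono hle le_rfl)).prod_left_ae] with v hv
    exact integralDiff_kmMeasure hF hω hm (hK.comp (measurable_id.prodMk measurable_const)) hv
  have h2 : Integrable (fun t => ∫ u in Ioi (ω m).1, K u t ∂F) (kmMeasure ω + F) :=
    (hi.mono_measure (Measure.prod_mono ((Measure.restrict_le_self (s := Ioi (ω m).1)).trans hle)
      hkm)).integral_prod_right
  have h3 : Integrable (fun t => sampleInt (hazard F)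
      (fun s => kmJump s ω * forward F (fun u => K u t) s) ω) (kmMeasure ω + F) :=
    integrable_finsetSum _ fun j _ => integrable_mart_prod
      ((integrable_kmJump_forward hF hω hK hi j).mono_measure (Measure.prod_mono le_rfl hkm))
  -- The outer identity contributes -R times the cross term. The inner remainder contributes -R
  -- times (cross term - R times the double tail integral).
  rw [integralDiff_congr ((Measure.le_add_right le_rfl).trans hkm) hle h1,
    integralDiff_sub_mul R h3 h2, integralDiff_sampleInt_forward hF hω hm hK hi,
    integralDiff_tail_integral hF hω hm hK hsym hi]
  ring

end Decomposition

/-! ### The law of a censored observation -/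

section Model

variable {F G : Measure ℝ} [IsProbabilityMeasure F] [IsProbabilityMeasure G]

/-- The censored observation of a survival time and a censoring time. -/
def censor (q : ℝ × ℝ) : Obs := (min q.1 q.2, if q.1 ≤ q.2 then true else false)

lemma measurable_censor : Measurable censor :=
  (measurable_fst.min measurable_snd).prodMk
    (Measurable.ite (measurableSet_le measurable_fst measurable_snd) measurable_const measurable_const)

/-- The law of a censored observation. -/
def obsModel (F G : Measure ℝ) : Measure Obs := (F.prod G).map censor

instance : IsProbabilityMeasure (obsModel F G) :=
  Measure.isProbabilityMeasure_map measurable_censor.aemeasurable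

lemma riskProb_obsModel (s : ℝ) : riskProb (obsModel F G) s = F (Ici s) * G (Ici s) := by
  rw [riskProb, obsModel, Measure.map_apply measurable_censor
    (measurableSet_le measurable_const measurable_fst), ← Measure.prod_prod]
  congr 1
  ext q
  simp [censor, Prod.le_def]

lemma toReal_riskProb_obsModel (s : ℝ) :
    (riskProb (obsModel F G) s).toReal = survLeft F s * survLeft G s := by
  rw [riskProb_obsModel, ENNReal.toReal_mul]; rfl

lemma exceedProb_obsModel (s : ℝ) : exceedProb (obsModel F G) s = surv F s * surv G s := by
  rw [exceedProb, obsModel, measureReal_def, Measure.map_apply measurable_censor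
    (measurableSet_exceed s), surv, surv, measureReal_def, measureReal_def, ← ENNReal.toReal_mul,
    ← Measure.prod_prod]
  congr 2
  ext q
  simp [censor]

lemma surv_le_one (ν : Measure ℝ) [IsProbabilityMeasure ν] (s : ℝ) : surv ν s ≤ 1 :=
  measureReal_le_one

lemma survLeft_le_one (ν : Measure ℝ) [IsProbabilityMeasure ν] (s : ℝ) : survLeft ν s ≤ 1 :=
  measureReal_le_one

lemma exceedProb_le_surv (s : ℝ) : exceedProb (obsModel F G) s ≤ surv F s := by
  rw [exceedProb_obsModel]
  exact mul_le_of_le_one_right (surv_nonneg F s) (surv_le_one G s)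

lemma riskProb_le_survLeft (s : ℝ) : (riskProb (obsModel F G) s).toReal ≤ survLeft F s := by
  rw [toReal_riskProb_obsModel]
  exact mul_le_of_le_one_right (survLeft_nonneg F s) (survLeft_le_one G s)

/-- An event at s means T = s and C ≥ s, ties counting as events, so event times have density 1 -
G(s-) with respect to F. The risk probability is S(s-)(1 - G(s-)), hence the quotient is the hazard
of F: censoring does not change it. -/
lemma isHazard_obsModel (hF : F (Iic 0) = 0) : IsHazard (obsModel F G) (hazard F) := by
  have hm : Measurable fun s => G (Ici s) :=
    (show Antitone fun t => G (Ici t) from fun _ _ h => measure_mono (Ici_subset_Ici.2 h)).measurable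
  have hmF : Measurable fun s => F (Ici s) :=
    (show Antitone fun t => F (Ici t) from fun _ _ h => measure_mono (Ici_subset_Ici.2 h)).measurable
  have h1 : (hazard F).withDensity (riskProb (obsModel F G)) = F.withDensity fun s => G (Ici s) := by
    have e : riskProb (obsModel F G) = fun s => F (Ici s) * G (Ici s) := funext riskProb_obsModel
    rw [e, hazard_eq hF, ← withDensity_mul _ (measurable_Ici_inv F)
      (show Measurable fun s => F (Ici s) * G (Ici s) from hmF.mul hm)]
    refine withDensity_congr_ae ?_
    filter_upwards [ae_measure_Ici_pos F] with x hx
    rw [Pi.mul_apply, ← mul_assoc, ENNReal.inv_mul_cancel hx.ne' (measure_ne_top _ _), one_mul]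
  rw [IsHazard, h1]
  ext A hA
  rw [Measure.map_apply measurable_fst hA, Measure.restrict_apply (measurable_fst hA), obsModel,
    Measure.map_apply measurable_censor ((measurable_fst hA).inter measurableSet_snd_true),
    withDensity_apply _ hA]
  have e : censor ⁻¹' (Prod.fst ⁻¹' A ∩ {z | z.2 = true}) = {q | q.1 ∈ A ∧ q.1 ≤ q.2} := by
    ext q
    simp only [censor, mem_preimage, mem_inter_iff, mem_ofPred_eq]
    constructor
    · rintro ⟨h1, h2⟩
      by_cases h : q.1 ≤ q.2
      · rw [min_eq_left h] at h1; exact ⟨h1, h⟩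
      · simp [h] at h2
    · rintro ⟨h1, h⟩
      rw [min_eq_left h]; simp [h, h1]
  have hms : MeasurableSet {q : ℝ × ℝ | q.1 ∈ A ∧ q.1 ≤ q.2} :=
    (measurable_fst hA).inter (measurableSet_le measurable_fst measurable_snd)
  rw [e, Measure.prod_apply hms, ← lintegral_indicator hA]
  congr 1
  ext s
  by_cases hs : s ∈ A
  · rw [indicator_of_mem hs]; congr 1; ext c; simp [hs]
  · rw [indicator_of_notMem hs]; convert measure_empty (μ := G) using 2; ext c; simp [hs]

lemma mem_obsRange {t : ℝ} :
    t ∈ obsRange F G ↔ 0 < t ∧ 0 < survLeft F t * survLeft G t := by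
  have hm : Measurable fun p : ℝ × ℝ => min p.1 p.2 := measurable_fst.min measurable_snd
  have hp : IsProbabilityMeasure (obsLaw F G) := Measure.isProbabilityMeasure_map hm.aemeasurable
  have h1 : obsLaw F G (Ici t) = F (Ici t) * G (Ici t) := by
    rw [obsLaw, Measure.map_apply hm measurableSet_Ici, ← Measure.prod_prod]
    congr 1; ext q; simp [Prod.le_def]
  have h2 : obsLaw F G (Iio t) < 1 ↔ 0 < survLeft F t * survLeft G t := by
    rw [← compl_Ici, prob_compl_eq_one_sub measurableSet_Ici, h1, survLeft, survLeft,
      measureReal_def, measureReal_def, ← ENNReal.toReal_mul, ENNReal.toReal_pos_iff]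
    have h3 : F (Ici t) * G (Ici t) < ∞ := ENNReal.mul_lt_top (measure_lt_top _ _) (measure_lt_top _ _)
    rw [and_iff_left h3, ENNReal.sub_lt_self_iff ENNReal.one_ne_top]
    simp
  rw [obsRange, mem_ofPred_eq, h2]

lemma survLeft_obsLaw (t : ℝ) : survLeft (obsLaw F G) t = survLeft F t * survLeft G t := by
  have hm : Measurable fun p : ℝ × ℝ => min p.1 p.2 := measurable_fst.min measurable_snd
  rw [survLeft, survLeft, survLeft, measureReal_def, measureReal_def, measureReal_def,
    ← ENNReal.toReal_mul, obsLaw, Measure.map_apply hm measurableSet_Ici, ← Measure.prod_prod]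
  congr 2; ext q; simp [Prod.le_def]

end Model

/-! ### The ratio of the survival functions as a martingale -/

section Ratio

variable {F : Measure ℝ} [IsProbabilityMeasure F] {n : ℕ}
variable {μ : Measure Obs} [IsProbabilityMeasure μ]

lemma bddSupp_ratio (hF : F (Iic 0) = 0) {t : ℝ} (ht : 0 < surv F t) :
    BddSupp (hazard F) (surv F t)⁻¹ (Iic t) :=
  ⟨by positivity, measurableSet_Iic,
    (hazard_Iic_lt_top hF (ht.trans_le (surv_le_survLeft F t))).ne⟩

lemma abs_ratioIntegrand_le {t : ℝ} (ht : 0 < surv F t) (s : ℝ) (ω : Fin n → Obs) :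
    |ratioIntegrand F t s ω| ≤ (Iic t).indicator (fun _ => (surv F t)⁻¹) s := by
  rw [ratioIntegrand, abs_mul, abs_of_nonneg (kmJump_nonneg s ω)]
  by_cases hs : s ∈ Iic t
  · rw [indicator_of_mem hs, indicator_of_mem hs, abs_of_nonneg (inv_nonneg.2 (surv_nonneg F s))]
    have := surv_antitone F (show s ≤ t from hs)
    calc kmJump s ω * (surv F s)⁻¹ ≤ 1 * (surv F t)⁻¹ := by
          refine mul_le_mul (kmJump_le_one s ω) ?_ (inv_nonneg.2 (surv_nonneg F s)) zero_le_one
          gcongr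
      _ = _ := one_mul _
  · rw [indicator_of_notMem hs, indicator_of_notMem hs]; simp

lemma measurable_ratioIntegrand (t : ℝ) :
    Measurable (Function.uncurry fun s (ω : Fin n → Obs) => ratioIntegrand F t s ω) :=
  measurable_kmJump.mul (((measurable_surv F).inv.indicator measurableSet_Iic).comp measurable_fst)

lemma predictable_ratioIntegrand (t : ℝ) :
    Predictable fun s (ω : Fin n → Obs) => ratioIntegrand F t s ω := by
  intro j s ω z h1 h2
  simp only [ratioIntegrand]
  rw [predictable_kmJump j s ω z h1 h2]

/-- The stopped ratio of the estimated and the true survival function. -/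
def survRatio (F : Measure ℝ) (t : ℝ) (ω : Fin n → Obs) : ℝ :=
  1 - sampleInt (hazard F) (fun s => ratioIntegrand F t s ω) ω

lemma measurable_survRatio (t : ℝ) : Measurable fun ω : Fin n → Obs => survRatio F t ω :=
  measurable_const.sub (measurable_sampleInt (measurable_ratioIntegrand t) measurable_id)

/-- The increment from s to t is a stochastic integral over (s,t]. There ξ, being determined up to
time s, can be absorbed into the integrand without losing predictability. -/
lemma integral_mul_survRatio (hF : F (Iic 0) = 0) (h : IsHazard μ (hazard F)) {s t : ℝ}
    (ht : 0 < surv F t) (hst : s < t) {ξ : (Fin n → Obs) → ℝ} (hξ : Measurable ξ)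
    (hξb : ∃ C, ∀ ω, |ξ ω| ≤ C) (hd : DependsUpTo s ξ) :
    ∫ ω, survRatio F t ω * ξ ω ∂(Measure.pi fun _ => μ)
      = ∫ ω, survRatio F s ω * ξ ω ∂(Measure.pi fun _ => μ) := by
  obtain ⟨C, hC⟩ := hξb
  have hC0 : 0 ≤ C := (abs_nonneg _).trans (hC fun _ => (0, true))
  have hs : 0 < surv F s := ht.trans_le (surv_antitone F hst.le)
  set f : ℝ → (Fin n → Obs) → ℝ := fun u ω =>
    ξ ω * (ratioIntegrand F t u ω - ratioIntegrand F s u ω) with hf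
  have hfm : Measurable (Function.uncurry f) :=
    (hξ.comp measurable_snd).mul ((measurable_ratioIntegrand t).sub (measurable_ratioIntegrand s))
  have hzero : ∀ u ≤ s, ∀ ω : Fin n → Obs, ratioIntegrand F t u ω - ratioIntegrand F s u ω = 0 := by
    intro u hu ω
    rw [ratioIntegrand, ratioIntegrand, indicator_of_mem (show u ∈ Iic s from hu),
      indicator_of_mem (show u ∈ Iic t from hu.trans hst.le), sub_self]
  have hB : BddSupp (hazard F) (C * (2 * (surv F t)⁻¹)) (Iic t) :=
    ⟨by positivity, measurableSet_Iic, (bddSupp_ratio hF ht).2.2⟩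
  have hfB : ∀ u ω, |f u ω| ≤ (Iic t).indicator (fun _ => C * (2 * (surv F t)⁻¹)) u := by
    intro u ω
    have h1 := abs_ratioIntegrand_le ht u ω
    have h2 := abs_ratioIntegrand_le hs u ω
    have h3 := surv_antitone F hst.le
    have h4 : (surv F s)⁻¹ ≤ (surv F t)⁻¹ := by gcongr
    rw [hf, abs_mul]
    by_cases hu : u ∈ Iic t
    · rw [indicator_of_mem hu] at h1 ⊢
      refine mul_le_mul (hC ω) ((abs_sub _ _).trans ?_) (abs_nonneg _) hC0
      have h5 : (Iic s).indicator (fun _ => (surv F s)⁻¹) u ≤ (surv F t)⁻¹ := by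
        by_cases hus : u ∈ Iic s
        · rw [indicator_of_mem hus]; exact h4
        · rw [indicator_of_notMem hus]; positivity
      linarith
    · have hus : u ∉ Iic s := fun h => hu (le_trans (show u ≤ s from h) hst.le)
      rw [indicator_of_notMem hu] at h1 ⊢
      rw [indicator_of_notMem hus] at h2
      have e1 := abs_nonpos_iff.1 h1
      have e2 := abs_nonpos_iff.1 h2
      rw [e1, e2]; simp
  have hp : ∀ j, PredictableAt j f := by
    intro j u ω z h1 h2
    rcases le_or_gt u s with hu | hu
    · simp only [hf, hzero u hu, mul_zero]
    · have e1 := predictable_ratioIntegrand (F := F) t j u ω z h1 h2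
      have e2 := predictable_ratioIntegrand (F := F) s j u ω z h1 h2
      simp only at e1 e2
      simp only [hf]
      rw [hd j ω z (hu.trans_le h1) (hu.trans_le h2), e1, e2]
  have hI : ∀ {v : ℝ}, 0 < surv F v → ∀ (ω : Fin n → Obs) j,
      IntegrableOn (fun u => ratioIntegrand F v u ω) (Iic (ω j).1) (hazard F) := fun hv ω j =>
    ((bddSupp_ratio hF hv).integrable_of_le
      (measurable_section (measurable_ratioIntegrand _) ω).aestronglyMeasurable
      fun u => abs_ratioIntegrand_le hv u ω).integrableOn
  have e : ∀ ω : Fin n → Obs, survRatio F t ω * ξ ω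
      = survRatio F s ω * ξ ω - ∑ j, mart (hazard F) (fun u => f u ω) (ω j) := by
    intro ω
    have h1 : ∀ j, mart (hazard F) (fun u => f u ω) (ω j)
        = ξ ω * (mart (hazard F) (fun u => ratioIntegrand F t u ω) (ω j)
          - mart (hazard F) (fun u => ratioIntegrand F s u ω) (ω j)) := by
      intro j
      have h2 : (fun u => f u ω) = fun u => ξ ω * (ratioIntegrand F t u ω
          + (-1) * ratioIntegrand F s u ω) := by
        funext u; simp only [hf]; ring
      rw [h2, mart_const_mul, mart_add (hI ht ω j) ((hI hs ω j).const_mul _), mart_const_mul]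
      ring
    simp_rw [h1]
    rw [← Finset.mul_sum, Finset.sum_sub_distrib]
    simp only [survRatio, sampleInt]
    ring
  simp_rw [e]
  have hbdd : Integrable (fun ω : Fin n → Obs => survRatio F s ω * ξ ω) (Measure.pi fun _ => μ) := by
    refine Integrable.of_bound (C := (1 + Fintype.card (Fin n) * ((surv F s)⁻¹
      + (surv F s)⁻¹ * (hazard F).real (Iic s))) * C)
      ((measurable_survRatio s).mul hξ).aestronglyMeasurable (ae_of_all _ fun ω => ?_)
    rw [norm_mul]
    have h1 := (bddSupp_ratio hF hs).abs_sampleInt_le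
      (fun u => abs_ratioIntegrand_le hs u ω) ω
    have h2 : |survRatio F s ω| ≤ 1 + |sampleInt (hazard F) (fun u => ratioIntegrand F s u ω) ω| := by
      refine (abs_sub _ _).trans ?_
      simp
    exact mul_le_mul (h2.trans (by linarith)) (hC ω) (norm_nonneg _) ((abs_nonneg _).trans (h2.trans (by linarith)))
  have hmi : ∀ j, Integrable (fun ω : Fin n → Obs => mart (hazard F) (fun u => f u ω) (ω j))
      (Measure.pi fun _ => μ) := fun j => hB.integrable_mart hfm hfB j
  rw [integral_sub hbdd (integrable_finsetSum _ fun j _ => hmi j),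
    integral_finsetSum _ fun j _ => hmi j, Finset.sum_eq_zero fun j _ =>
      h.integral_mart_predictable hB hfm hfB (hp j), sub_zero]

lemma sampleMart_survRatio (hF : F (Iic 0) = 0) (h : IsHazard μ (hazard F)) {D : Set ℝ}
    (hD : ∀ t ∈ D, 0 < surv F t) : SampleMart (ι := Fin n) μ D (survRatio F) where
  meas t _ := measurable_survRatio t
  bdd t ht := by
    refine ⟨1 + Fintype.card (Fin n) * ((surv F t)⁻¹ + (surv F t)⁻¹ * (hazard F).real (Iic t)),
      fun ω => ?_⟩
    have h1 := (bddSupp_ratio hF (hD t ht)).abs_sampleInt_le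
      (fun u => abs_ratioIntegrand_le (hD t ht) u ω) ω
    have h2 : |survRatio F t ω| ≤ 1 + |sampleInt (hazard F) (fun u => ratioIntegrand F t u ω) ω| := by
      refine (abs_sub _ _).trans ?_
      simp
    linarith
  dep t _ := by
    intro j ω z h1 h2
    simp only [survRatio, sampleInt]
    congr 1
    have h3 : ∀ u ≤ t, ratioIntegrand F t u (Function.update ω j z) = ratioIntegrand F t u ω :=
      fun u hu => predictable_ratioIntegrand t j u ω z (hu.trans h1.le) (hu.trans h2.le)
    have h4 : (fun u => ratioIntegrand F t u (Function.update ω j z))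
        = fun u => ratioIntegrand F t u ω := by
      funext u
      by_cases hu : u ≤ t
      · exact h3 u hu
      · simp [ratioIntegrand, indicator_of_notMem (show u ∉ Iic t from hu)]
    rw [h4]
    refine Finset.sum_congr rfl fun i _ => ?_
    by_cases hij : i = j
    · subst hij
      rw [Function.update_self]
      have h5 : ∀ x, t < x → ratioIntegrand F t x ω = 0 := fun x hx => by
        rw [ratioIntegrand, indicator_of_notMem (show x ∉ Iic t from not_le.2 hx), mul_zero]
      have h6 : ∀ x, t < x → ∫ u in Iic x, ratioIntegrand F t u ω ∂(hazard F)
          = ∫ u in Iic t, ratioIntegrand F t u ω ∂(hazard F) := by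
        intro x hx
        exact setIntegral_eq_of_subset_of_forall_sdiff_eq_zero measurableSet_Iic
          (Iic_subset_Iic.2 hx.le) fun u hu => h5 u (not_le.1 hu.2)
      simp only [mart, h5 _ h1, h5 _ h2, h6 _ h1, h6 _ h2, ite_self]
    · rw [Function.update_of_ne hij]
  mart s hs t ht hst ξ hξ hξb hd := integral_mul_survRatio hF h (hD t ht) hst hξ hξb hd

end Ratio

/-! ### Uniform control of the estimated survival function -/

section Uniform

variable {F G : Measure ℝ} [IsProbabilityMeasure F] [IsProbabilityMeasure G] {n : ℕ}

/-- Y q² ≤ q ≤ 1 always. Unless Y deviates from its mean by more than half of it, q ≤ 2/(na). The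
exceptional event has probability at most 4/(na). -/
lemma lintegral_riskCount_mul_kmJump_sq_le {μ : Measure Obs} [IsProbabilityMeasure μ]
    [Nonempty (Fin n)] {a s : ℝ} (ha : 0 < a) (hs : a ≤ (riskProb μ s).toReal) :
    ∫⁻ ω, ENNReal.ofReal (riskCount ω s * kmJump s ω ^ 2) ∂(Measure.pi fun _ : Fin n => μ)
      ≤ ENNReal.ofReal (6 / (n * a)) := by
  have hn : (0:ℝ) < n := by exact_mod_cast Fin.pos_iff_nonempty.2 ‹_›
  set E : Set (Fin n → Obs) := {ω | ∃ s, a ≤ (riskProb μ s).toReal ∧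
        1 / 2 < |riskCount ω s / (Fintype.card (Fin n) * (riskProb μ s).toReal) - 1|} with hE
  have h1 : ∀ ω : Fin n → Obs, ENNReal.ofReal (riskCount ω s * kmJump s ω ^ 2)
      ≤ ENNReal.ofReal (2 / (n * a)) + E.indicator 1 ω := by
    intro ω
    have hle : riskCount ω s * kmJump s ω ^ 2 ≤ kmJump s ω := by
      by_cases h0 : riskCount ω s = 0
      · rw [h0, zero_mul]; exact kmJump_nonneg s ω
      · have : riskCount ω s * kmJump s ω ^ 2 = kmLeft s ω * kmJump s ω := by
          rw [kmJump]; field_simp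
        rw [this]
        exact mul_le_of_le_one_left (kmJump_nonneg s ω) (kmLeft_le_one s ω)
    by_cases hω : ω ∈ E
    · rw [indicator_of_mem hω]
      refine le_trans (ENNReal.ofReal_le_ofReal (hle.trans (kmJump_le_one s ω))) ?_
      simp
    · rw [indicator_of_notMem hω, add_zero]
      refine ENNReal.ofReal_le_ofReal (hle.trans ?_)
      simp only [hE, mem_ofPred_eq, not_exists, not_and, not_lt, Fintype.card_fin] at hω
      have h2 := (abs_le.1 (hω s hs)).1
      have hp : 0 < (riskProb μ s).toReal := ha.trans_le hs
      have h3 : (n : ℝ) * a / 2 ≤ riskCount ω s := by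
        have h4 : 1 / 2 ≤ riskCount ω s / (n * (riskProb μ s).toReal) := by linarith
        rw [le_div_iff₀ (mul_pos hn hp)] at h4
        nlinarith
      rw [kmJump]
      have h5 : 0 < (n : ℝ) * a / 2 := by positivity
      calc kmLeft s ω / riskCount ω s ≤ 1 / (n * a / 2) :=
            div_le_div₀ zero_le_one (kmLeft_le_one s ω) h5 h3
        _ = 2 / (n * a) := by field_simp
  refine (lintegral_mono h1).trans ?_
  rw [lintegral_add_left measurable_const, lintegral_const, measure_univ, mul_one]
  have h2 : ∫⁻ ω, E.indicator 1 ω ∂(Measure.pi fun _ : Fin n => μ) ≤ ENNReal.ofReal (4 / (n * a)) := by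
    refine (lintegral_indicator_one_le _).trans ?_
    refine (measure_riskCount_far_le ha (by norm_num)).trans (ENNReal.ofReal_le_ofReal (le_of_eq ?_))
    rw [Fintype.card_fin]
    field_simp
    norm_num
  refine (add_le_add le_rfl h2).trans ?_
  rw [← ENNReal.ofReal_add (by positivity) (by positivity)]
  refine ENNReal.ofReal_le_ofReal (le_of_eq ?_)
  field_simp
  norm_num

/-- In the second moment bound for ∫ q/S dM, the mean of Y q² gives 6/(na), S ≥ a gives 1/a², and
the hazard up to t is at most 1/a. -/
lemma integral_survRatio_sq_le (hF : F (Iic 0) = 0) [Nonempty (Fin n)] {a t : ℝ} (ha : 0 < a)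
    (ht : a ≤ exceedProb (obsModel F G) t) :
    ∫ ω : Fin n → Obs, (survRatio F t ω - 1) ^ 2 ∂(Measure.pi fun _ => obsModel F G)
      ≤ 6 / (n * a ^ 4) := by
  set μ := obsModel F G with hμ
  have hn : (0:ℝ) < n := by exact_mod_cast Fin.pos_iff_nonempty.2 ‹_›
  have hH : IsHazard μ (hazard F) := isHazard_obsModel hF
  have hS : a ≤ surv F t := ht.trans (exceedProb_le_surv t)
  have hp : ∀ s ≤ t, a ≤ (riskProb μ s).toReal := fun s hs =>
    ht.trans (ENNReal.toReal_mono (measure_ne_top _ _)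
      (measure_mono fun z (hz : t < z.1) => hs.trans hz.le))
  have e : ∀ ω : Fin n → Obs, (survRatio F t ω - 1) ^ 2
      = sampleInt (hazard F) (fun s => ratioIntegrand F t s ω) ω ^ 2 := fun ω => by
    rw [survRatio]; ring
  simp_rw [e]
  have hΛ : hazard F (Iic t) ≤ ENNReal.ofReal (1 / a) := by
    have h1 := hH.mul_measure_le (ENNReal.ofReal a)
    have h2 : hazard F (Iic t) ≤ hazard F {s | ENNReal.ofReal a ≤ riskProb μ s} :=
      measure_mono fun s hs => ENNReal.ofReal_le_of_le_toReal (hp s hs)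
    have h3 : ENNReal.ofReal a ≠ 0 := by simpa using ha
    rw [one_div, ENNReal.ofReal_inv_of_pos ha]
    refine ENNReal.le_inv_iff_mul_le.2 ?_
    rw [mul_comm]
    exact (mul_le_mul_right h2 _).trans h1
  have hrm := measurable_ratioIntegrand (F := F) (n := n) t
  have hyq : Measurable fun q : (Fin n → Obs) × ℝ =>
      ENNReal.ofReal (riskCount q.1 q.2 * kmJump q.2 q.1 ^ 2) :=
    ((measurable_riskCount.comp measurable_swap).mul
      ((measurable_kmJump.comp measurable_swap).pow_const 2)).ennreal_ofReal
  have main : ENNReal.ofReal (∫ ω : Fin n → Obs,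
      sampleInt (hazard F) (fun s => ratioIntegrand F t s ω) ω ^ 2 ∂(Measure.pi fun _ => μ))
      ≤ ENNReal.ofReal (6 / (n * a ^ 4)) := by
    refine (ofReal_integral_le_lintegral _).trans ((hH.lintegral_sampleInt_sq_le hrm
      (predictable_ratioIntegrand t)).trans ?_)
    calc ∫⁻ ω, ∫⁻ s, ENNReal.ofReal (riskCount ω s * (ratioIntegrand F t s ω ^ 2 *
            (1 - (hazard F).real {s}))) ∂(hazard F) ∂(Measure.pi fun _ : Fin n => μ)
        ≤ ∫⁻ ω, ∫⁻ s in Iic t, ENNReal.ofReal (1 / a ^ 2) *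
            ENNReal.ofReal (riskCount ω s * kmJump s ω ^ 2) ∂(hazard F)
              ∂(Measure.pi fun _ : Fin n => μ) := by
          refine lintegral_mono fun ω => ?_
          rw [← lintegral_indicator measurableSet_Iic]
          refine lintegral_mono fun s => ?_
          by_cases hs : s ∈ Iic t
          · rw [indicator_of_mem hs, ← ENNReal.ofReal_mul (by positivity), ratioIntegrand,
              indicator_of_mem hs]
            refine ENNReal.ofReal_le_ofReal ?_
            have h1 : a ≤ surv F s := hS.trans (surv_antitone F hs)
            have h2 : (surv F s)⁻¹ ^ 2 ≤ 1 / a ^ 2 := by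
              rw [one_div, ← inv_pow]
              have := inv_nonneg.2 (surv_nonneg F s)
              gcongr
            have h3 : 1 - (hazard F).real {s} ≤ 1 := by
              have : 0 ≤ (hazard F).real {s} := measureReal_nonneg
              linarith
            have h4 : 0 ≤ riskCount ω s * kmJump s ω ^ 2 :=
              mul_nonneg (riskCount_nonneg ω s) (sq_nonneg _)
            calc riskCount ω s * ((kmJump s ω * (surv F s)⁻¹) ^ 2 * (1 - (hazard F).real {s}))
                = (riskCount ω s * kmJump s ω ^ 2) * (surv F s)⁻¹ ^ 2 * (1 - (hazard F).real {s}) := by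
                  ring
              _ ≤ (riskCount ω s * kmJump s ω ^ 2) * (surv F s)⁻¹ ^ 2 * 1 := by gcongr
              _ ≤ (riskCount ω s * kmJump s ω ^ 2) * (1 / a ^ 2) := by rw [mul_one]; gcongr
              _ = _ := mul_comm _ _
          · rw [indicator_of_notMem hs, ratioIntegrand, indicator_of_notMem hs]
            simp
      _ = ∫⁻ s in Iic t, ENNReal.ofReal (1 / a ^ 2) * ∫⁻ ω, ENNReal.ofReal
            (riskCount ω s * kmJump s ω ^ 2) ∂(Measure.pi fun _ : Fin n => μ) ∂(hazard F) := by
          rw [lintegral_lintegral_swap (measurable_const.mul hyq).aemeasurable]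
          refine lintegral_congr fun s => ?_
          rw [lintegral_const_mul]
          exact hyq.comp (measurable_id.prodMk measurable_const)
      _ ≤ ∫⁻ s in Iic t, ENNReal.ofReal (1 / a ^ 2) * ENNReal.ofReal (6 / (n * a)) ∂(hazard F) := by
          refine setLIntegral_mono measurable_const fun s hs => ?_
          gcongr
          exact lintegral_riskCount_mul_kmJump_sq_le ha (hp s hs)
      _ ≤ ENNReal.ofReal (1 / a ^ 2) * ENNReal.ofReal (6 / (n * a)) * ENNReal.ofReal (1 / a) := by
          rw [setLIntegral_const]
          gcongr
      _ = ENNReal.ofReal (6 / (n * a ^ 4)) := by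
          rw [← ENNReal.ofReal_mul (by positivity), ← ENNReal.ofReal_mul (by positivity)]
          congr 1
          field_simp
  exact (ENNReal.ofReal_le_ofReal_iff (by positivity)).1 main

lemma survRatio_eq_left (hF : F (Iic 0) = 0) {ω : Fin n → Obs} {m : Fin n}
    (hm : ∀ j, (ω j).1 ≤ (ω m).1) {t : ℝ} (ht : 0 < surv F t) (htm : t ≤ (ω m).1) :
    survRatio F t ω = kmRight t ω / surv F t := by
  rw [survRatio, one_sub_sampleInt_ratio hF hm ht, min_eq_left htm]

lemma survRatio_eq_right (hF : F (Iic 0) = 0) {ω : Fin n → Obs} {m : Fin n}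
    (hm : ∀ j, (ω j).1 ≤ (ω m).1) {t : ℝ} (ht : 0 < surv F t) (htm : (ω m).1 ≤ t) :
    survRatio F t ω = kmRight (ω m).1 ω / surv F (ω m).1 := by
  rw [survRatio, one_sub_sampleInt_ratio hF hm ht, min_eq_right htm]

lemma exists_max [Nonempty (Fin n)] (ω : Fin n → Obs) : ∃ m, ∀ j, (ω j).1 ≤ (ω m).1 :=
  Finite.exists_max fun j => (ω j).1

lemma tendsto_survRatio (hF : F (Iic 0) = 0) {ω : Fin n → Obs} {m : Fin n}
    (hm : ∀ j, (ω j).1 ≤ (ω m).1) {s : ℝ} (hs : s ≤ (ω m).1) (hpos : 0 < survLeft F s) {u : ℕ → ℝ}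
    (hlt : ∀ k, u k < s) (hlim : Tendsto u atTop (𝓝 s)) :
    Tendsto (fun k => survRatio F (u k) ω) atTop (𝓝 (kmLeft s ω / survLeft F s)) := by
  have h1 : ∀ k, survRatio F (u k) ω = kmRight (u k) ω / surv F (u k) := fun k =>
    survRatio_eq_left hF hm (hpos.trans_le (survLeft_le_surv F (hlt k))) ((hlt k).le.trans hs)
  simp_rw [h1]
  exact (tendsto_kmRight ω hlt hlim).div (tendsto_surv_left hlt hlim) hpos.ne'

/-- The estimated survival function is bounded by a multiple of the true one. -/
lemma measure_kmLeft_large_le (hF : F (Iic 0) = 0) [Nonempty (Fin n)] {c : ℝ} (hc : 0 < c) :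
    (Measure.pi fun _ : Fin n => obsModel F G) {ω | ∃ m, (∀ j, (ω j).1 ≤ (ω m).1) ∧
        ((∃ s ≤ (ω m).1, 0 < survLeft F s ∧ c < kmLeft s ω / survLeft F s) ∨
          c < kmRight (ω m).1 ω / surv F (ω m).1)}
      ≤ ENNReal.ofReal (1 / c) := by
  set D : Set ℝ := {q | q ∈ range ((↑) : ℚ → ℝ) ∧ 0 < surv F q} with hD
  have hH : IsHazard (obsModel F G) (hazard F) := isHazard_obsModel hF
  have hDc : D.Countable := (countable_range _).mono fun q hq => hq.1
  have hDp : ∀ q ∈ D, 0 < surv F q := fun q hq => hq.2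
  refine le_trans (measure_mono ?_) ((sampleMart_survRatio (n := n) hF hH hDp).maximal hDc
    (fun t ht => ae_of_all _ fun ω => ?_) (fun t ht => ?_) hc)
  · rintro ω ⟨m, hm, h⟩
    by_contra hcon
    simp only [mem_ofPred_eq, not_exists, not_and, not_lt] at hcon
    rcases h with ⟨s, hs, hpos, hlt⟩ | hlt
    · obtain ⟨u, hu1, hu2, hu3, hu4⟩ := exists_rat_seq s
      exact absurd (le_of_tendsto' (tendsto_survRatio hF hm hs hpos hu3 hu4) fun k =>
        hcon (u k) ⟨hu1 k, hpos.trans_le (survLeft_le_surv F (hu3 k))⟩) (not_le.2 hlt)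
    -- If S vanished at the last observation, the ratio would be 0 by the convention for division.
    -- Otherwise S is still positive at a rational slightly to the right, where the stopped
    -- martingale takes the value at the last observation.
    · have hpos : 0 < surv F (ω m).1 := by
        refine lt_of_le_of_ne (surv_nonneg F _) fun h0 => ?_
        rw [← h0, div_zero] at hlt
        exact absurd hlt (not_lt.2 hc.le)
      have h1 : Tendsto (fun k : ℕ => (ω m).1 + 1 / ((k : ℝ) + 1)) atTop (𝓝 (ω m).1) := by
        simpa using tendsto_one_div_add_atTop_nhds_zero_nat.const_add (ω m).1
      have h2 := tendsto_surv_right (ν := F) (fun k => by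
        have : (0:ℝ) < 1 / ((k : ℝ) + 1) := by positivity
        linarith) h1
      obtain ⟨k, hk⟩ := (h2.eventually (eventually_gt_nhds hpos)).exists
      obtain ⟨q, hq1, hq2⟩ := exists_rat_btwn
        (show (ω m).1 < (ω m).1 + 1 / ((k : ℝ) + 1) by
          have : (0:ℝ) < 1 / ((k : ℝ) + 1) := by positivity
          linarith)
      have hq3 : 0 < surv F (q : ℝ) := hk.trans_le (surv_antitone F hq2.le)
      have := hcon q ⟨⟨q, rfl⟩, hq3⟩
      rw [survRatio_eq_right hF hm hq3 hq1.le] at this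
      exact absurd this (not_le.2 hlt)
  · obtain ⟨m, hm⟩ := exists_max ω
    rw [survRatio, one_sub_sampleInt_ratio hF hm (hDp t ht)]
    exact div_nonneg (kmRight_nonneg _ _) (surv_nonneg F _)
  · have hB := bddSupp_ratio hF (hDp t ht)
    have hfm := measurable_ratioIntegrand (F := F) (n := n) t
    have hfB := fun s (ω : Fin n → Obs) => abs_ratioIntegrand_le (F := F) (hDp t ht) s ω
    have hi := fun j => hB.integrable_mart (μ := obsModel F G) hfm hfB j
    have h0 : ∫ ω : Fin n → Obs, sampleInt (hazard F) (fun s => ratioIntegrand F t s ω) ω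
        ∂(Measure.pi fun _ => obsModel F G) = 0 := by
      simp only [sampleInt]
      rw [integral_finsetSum _ fun j _ => hi j]
      exact Finset.sum_eq_zero fun j _ =>
        hH.integral_mart_predictable hB hfm hfB (predictable_ratioIntegrand t j)
    have hsi : Integrable (fun ω : Fin n → Obs => sampleInt (hazard F)
        (fun s => ratioIntegrand F t s ω) ω) (Measure.pi fun _ => obsModel F G) :=
      integrable_finsetSum _ fun j _ => hi j
    simp only [survRatio]
    rw [integral_sub (integrable_const _) hsi, h0]
    simp

/-- Uniform relative consistency of the estimated survival function. -/
lemma measure_kmLeft_far_le (hF : F (Iic 0) = 0) [Nonempty (Fin n)] {a δ : ℝ} (ha : 0 < a)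
    (hδ : 0 < δ) :
    (Measure.pi fun _ : Fin n => obsModel F G) {ω | ∃ m, (∀ j, (ω j).1 ≤ (ω m).1) ∧
        ∃ s ≤ (ω m).1, a ≤ (riskProb (obsModel F G) s).toReal ∧
          δ < |kmLeft s ω / survLeft F s - 1|}
      ≤ ENNReal.ofReal (6 / (n * a ^ 4) / δ ^ 2) := by
  set D : Set ℝ := {q | q ∈ range ((↑) : ℚ → ℝ) ∧ a ≤ exceedProb (obsModel F G) q} with hD
  have hDc : D.Countable := (countable_range _).mono fun q hq => hq.1
  have hDp : ∀ q ∈ D, 0 < surv F q := fun q hq => (ha.trans_le hq.2).trans_le (exceedProb_le_surv q)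
  refine le_trans (measure_mono ?_) ((sampleMart_survRatio (n := n) hF (isHazard_obsModel hF)
    hDp).maximal_sq hDc (fun t ht => integral_survRatio_sq_le hF ha ht.2) hδ)
  rintro ω ⟨m, hm, s, hs, has, hlt⟩
  by_contra hcon
  simp only [mem_ofPred_eq, not_exists, not_and, not_lt] at hcon
  obtain ⟨u, hu1, hu2, hu3, hu4⟩ := exists_rat_seq s
  have hpos : 0 < survLeft F s := (ha.trans_le has).trans_le (riskProb_le_survLeft s)
  exact absurd (le_of_tendsto' (((tendsto_survRatio hF hm hs hpos hu3 hu4).sub_const 1).abs) fun k =>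
    hcon (u k) ⟨hu1 k, has.trans (riskProb_le_exceedProb (hu3 k))⟩) (not_le.2 hlt)

end Uniform

/-! ### Splitting a double integral along the diagonal -/

section Split

variable {ι : Type*} [Fintype ι] [DecidableEq ι] {Λ : Measure ℝ} [SFinite Λ]

/-- The contributions of `s < t`, `t < s` and `s = t` to a double integral. -/
lemma doubleInt_split {k : ℝ → ℝ → ℝ} {ω : ι → Obs}
    (hk : ∀ i j, Integrable (Function.uncurry k)
      ((totalMeasure Λ (ω i)).prod (totalMeasure Λ (ω j)))) :
    doubleInt Λ k ω = sampleInt Λ (fun t => sampleInt Λ ((Iio t).indicator fun s => k s t) ω) ω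
      + sampleInt Λ (fun t => sampleInt Λ ((Iio t).indicator fun s => k t s) ω) ω
      + sampleInt Λ (fun t => k t t * sampleAtom Λ ω t) ω := by
  have h1 : ∀ i j, IntegrableOn (fun t => mart Λ ((Iio t).indicator fun s => k s t) (ω i))
      (Iic (ω j).1) Λ := fun i j => by
    have h := integrable_mart_prod (Λ := Λ) (z := ω i) (f := fun s t => (Iio t).indicator (fun s => k s t) s)
      (m := totalMeasure Λ (ω j)) (((hk i j).indicator
        (measurableSet_lt measurable_fst measurable_snd)).congr (ae_of_all _ fun q => by
          by_cases h : q.1 < q.2 <;> simp [indicator, h, Function.uncurry]))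
    exact integrable_totalMeasure.1 h
  have h2 : ∀ i j, IntegrableOn (fun s => mart Λ ((Iio s).indicator fun t => k s t) (ω j))
      (Iic (ω i).1) Λ := fun i j => by
    have h := integrable_mart_prod (Λ := Λ) (z := ω j) (f := fun t s => (Iio s).indicator (fun t => k s t) t)
      (m := totalMeasure Λ (ω i)) (((hk i j).swap.indicator
        (measurableSet_lt measurable_fst measurable_snd)).congr (ae_of_all _ fun q => by
          by_cases h : q.1 < q.2 <;> simp [indicator, h, Function.uncurry]))
    exact integrable_totalMeasure.1 h
  have h3 : ∀ i j, IntegrableOn (fun t => k t t * martAtom Λ (ω i) t) (Iic (ω j).1) Λ := fun i j => by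
    have h := integrable_mart_prod (Λ := Λ) (z := ω i)
      (f := fun s t => ({t} : Set ℝ).indicator (fun s => k s t) s)
      (m := totalMeasure Λ (ω j)) (((hk i j).indicator
        (measurableSet_eq_fun measurable_fst measurable_snd)).congr (ae_of_all _ fun q => by
          by_cases h : q.1 = q.2 <;> simp [indicator, h, Function.uncurry]))
    simp only [mart_singleton] at h
    exact integrable_totalMeasure.1 h
  have e1 : sampleInt Λ (fun t => sampleInt Λ ((Iio t).indicator fun s => k s t) ω) ω
      = ∑ j, ∑ i, mart Λ (fun t => mart Λ ((Iio t).indicator fun s => k s t) (ω i)) (ω j) :=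
    Finset.sum_congr rfl fun j _ => mart_finset_sum _ fun i _ => h1 i j
  have e2 : sampleInt Λ (fun t => sampleInt Λ ((Iio t).indicator fun s => k t s) ω) ω
      = ∑ j, ∑ i, mart Λ (fun s => mart Λ ((Iio s).indicator fun t => k s t) (ω j)) (ω i) := by
    rw [Finset.sum_comm]
    exact Finset.sum_congr rfl fun i _ => mart_finset_sum _ fun j _ => h2 i j
  have e3 : sampleInt Λ (fun t => k t t * sampleAtom Λ ω t) ω
      = ∑ j, ∑ i, mart Λ (fun t => k t t * martAtom Λ (ω i) t) (ω j) := by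
    refine Finset.sum_congr rfl fun j _ => ?_
    simp only [sampleAtom, Finset.mul_sum]
    exact mart_finset_sum _ fun i _ => h3 i j
  rw [e1, e2, e3, doubleInt, ← Finset.sum_add_distrib, ← Finset.sum_add_distrib]
  refine Finset.sum_congr rfl fun j _ => ?_
  rw [← Finset.sum_add_distrib, ← Finset.sum_add_distrib]
  exact Finset.sum_congr rfl fun i _ => mart_mart_split (hk i j)

end Split

/-! ### Moment bounds in terms of kernel energies -/

section Energy

variable {F G : Measure ℝ} [IsProbabilityMeasure F] [IsProbabilityMeasure G] {n : ℕ}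

/-- The weight `1 / (1 - G(s-))`. -/
def invSurv (G : Measure ℝ) (s : ℝ) : ℝ := (survLeft G s)⁻¹

lemma invSurv_nonneg (s : ℝ) : 0 ≤ invSurv G s := inv_nonneg.2 (survLeft_nonneg G s)

lemma measurable_invSurv : Measurable (invSurv G) := (measurable_survLeft G).inv

/-- The weight of the energy of a stochastic integral. -/
def energyWeight (F G : Measure ℝ) (s : ℝ) : ℝ := invSurv G s * (surv F s / survLeft F s)

lemma energyWeight_nonneg (s : ℝ) : 0 ≤ energyWeight F G s :=
  mul_nonneg (invSurv_nonneg s) (div_nonneg (surv_nonneg F s) (survLeft_nonneg F s))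

lemma measurable_energyWeight : Measurable (energyWeight F G) :=
  measurable_invSurv.mul ((measurable_surv F).div (measurable_survLeft F))

/-- dΛ = dF/S(s-) and 1 - ΔΛ = S(s)/S(s-), while the risk probability S(s-)(1 - G(s-)) cancels one
power of each denominator. -/
lemma lintegral_hazard_energy (hF : F (Iic 0) = 0) {x : ℝ → ℝ} (hx : Measurable x) :
    ∫⁻ s, ENNReal.ofReal (x s * (survLeft F s * survLeft G s * invSurv G s ^ 2) *
        (1 - (hazard F).real {s})) ∂(hazard F)
      = ∫⁻ s, ENNReal.ofReal (x s * energyWeight F G s) ∂F := by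
  rw [hazard_lintegral hF]
  · refine lintegral_congr_ae ?_
    filter_upwards [ae_survLeft_pos (F := F)] with s hs
    rw [← ENNReal.ofReal_mul (inv_nonneg.2 (survLeft_nonneg F s)), one_sub_hazard hF hs, energyWeight,
      invSurv]
    congr 1
    by_cases hG : survLeft G s = 0
    · simp [hG]
    · field_simp
  · exact ((hx.mul (((measurable_survLeft F).mul (measurable_survLeft G)).mul
      (measurable_invSurv.pow_const 2))).mul
      (measurable_const.sub measurable_measureReal_singleton)).ennreal_ofReal

/-- A predictable process dominated by a multiple of the inverse censoring survival function. -/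
structure Dominated (F G : Measure ℝ) (c : ℝ) (κ : ℝ → ℝ) (α : ℝ → (Fin n → Obs) → ℝ) : Prop where
  meas : Measurable (Function.uncurry α)
  pred : Predictable α
  le : ∀ s ω, |α s ω| ≤ c * (κ s * invSurv G s)
  risk : ∀ s ω, α s ω ≠ 0 → riskCount ω s ≤ c * (n * (survLeft F s * survLeft G s))

/-- One factor c comes from the number at risk and one from each process. Where α vanishes the
number at risk is not controlled, but the product is zero. -/
lemma Dominated.mul_le {c : ℝ} {κ₁ κ₂ : ℝ → ℝ} {α β : ℝ → (Fin n → Obs) → ℝ}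
    (hc : 0 ≤ c) (hα : Dominated F G c κ₁ α) (hβ : Dominated F G c κ₂ β)
    (hκ₁ : ∀ s, 0 ≤ κ₁ s) (hκ₂ : ∀ s, 0 ≤ κ₂ s) (s : ℝ) (ω : Fin n → Obs) :
    riskCount ω s * (|α s ω| * |β s ω|) ≤ c ^ 3 * n * (κ₁ s * κ₂ s) *
      (survLeft F s * survLeft G s * invSurv G s ^ 2) := by
  have hp : 0 ≤ survLeft F s * survLeft G s := mul_nonneg (survLeft_nonneg F s) (survLeft_nonneg G s)
  have hQ := invSurv_nonneg (G := G) s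
  by_cases h0 : α s ω = 0
  · rw [h0, abs_zero, zero_mul, mul_zero]
    have := hκ₁ s; have := hκ₂ s
    positivity
  · calc riskCount ω s * (|α s ω| * |β s ω|)
        ≤ (c * (n * (survLeft F s * survLeft G s))) *
          ((c * (κ₁ s * invSurv G s)) * (c * (κ₂ s * invSurv G s))) := by
          have h1 := hα.risk s ω h0
          have h2 := hα.le s ω
          have h3 := hβ.le s ω
          have h4 := riskCount_nonneg ω s
          refine mul_le_mul h1 ?_ (by positivity) (h4.trans h1)
          exact mul_le_mul h2 h3 (abs_nonneg _) ((abs_nonneg _).trans h2)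
      _ = _ := by ring

lemma Dominated.sq_le {c : ℝ} {κ : ℝ → ℝ} {α : ℝ → (Fin n → Obs) → ℝ} (hc : 0 ≤ c)
    (hα : Dominated F G c κ α) (hκ : ∀ s, 0 ≤ κ s) (s : ℝ) (ω : Fin n → Obs) :
    riskCount ω s * α s ω ^ 2 ≤ c ^ 3 * n * κ s ^ 2 *
      (survLeft F s * survLeft G s * invSurv G s ^ 2) := by
  have := hα.mul_le hc hα hκ hκ s ω
  rwa [← sq, ← sq, sq_abs] at this

/-- The energy of a kernel with weights. -/
def energy (F G : Measure ℝ) (k : ℝ → ℝ → ℝ) (κ₁ κ₂ : ℝ → ℝ) : ℝ≥0∞ :=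
  ∫⁻ q, ENNReal.ofReal (κ₁ q.1 ^ 2 * κ₂ q.2 ^ 2 *
    (k q.1 q.2 ^ 2 * (energyWeight F G q.1 * energyWeight F G q.2))) ∂(F.prod F)

/-- The energy of a kernel on the diagonal. -/
def diagEnergy (F G : Measure ℝ) (k : ℝ → ℝ → ℝ) (κ₁ κ₂ : ℝ → ℝ) : ℝ≥0∞ :=
  ∫⁻ t, ENNReal.ofReal (κ₁ t * κ₂ t * (|k t t| * energyWeight F G t)) ∂F

variable {k : ℝ → ℝ → ℝ} {κ₁ κ₂ : ℝ → ℝ} {α β : ℝ → (Fin n → Obs) → ℝ} {c : ℝ}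

lemma energy_swap : energy F G (fun s t => k t s) κ₂ κ₁ = energy F G k κ₁ κ₂ := by
  rw [energy, energy, ← lintegral_prod_swap]
  refine lintegral_congr fun q => ?_
  simp only [Prod.fst_swap, Prod.snd_swap]
  congr 1; ring

/-- Each variable contributes a factor c³n. The n² is absorbed by the normalisation. -/
lemma lintegral_offDiag_le (hF : F (Iic 0) = 0) [Nonempty (Fin n)] (hk : Measurable (Function.uncurry k))
    (hκm₁ : Measurable κ₁) (hκm₂ : Measurable κ₂) (hκ₁ : ∀ s, 0 ≤ κ₁ s) (hκ₂ : ∀ s, 0 ≤ κ₂ s)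
    (hc : 0 ≤ c) (hα : Dominated F G c κ₁ α) (hβ : Dominated F G c κ₂ β) :
    ∫⁻ ω, ENNReal.ofReal ((sampleInt (hazard F) (fun t => β t ω * sampleInt (hazard F)
        ((Iio t).indicator fun s => k s t * α s ω) ω) ω / n) ^ 2)
        ∂(Measure.pi fun _ : Fin n => obsModel F G)
      ≤ ENNReal.ofReal (c ^ 6) * energy F G k κ₁ κ₂ := by
  have hn : (0:ℝ) < n := by exact_mod_cast Fin.pos_iff_nonempty.2 ‹_›
  have hmain := (isHazard_obsModel (G := G) hF).lintegral_offDiag_sq_le hk hα.meas hα.pred hβ.meas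
    hβ.pred (hα.sq_le hc hκ₁) (hβ.sq_le hc hκ₂)
  have e1 : ∀ ω : Fin n → Obs, ENNReal.ofReal ((sampleInt (hazard F) (fun t => β t ω *
      sampleInt (hazard F) ((Iio t).indicator fun s => k s t * α s ω) ω) ω / n) ^ 2)
      = ENNReal.ofReal (1 / n ^ 2) * ENNReal.ofReal (sampleInt (hazard F) (fun t => β t ω *
      sampleInt (hazard F) ((Iio t).indicator fun s => k s t * α s ω) ω) ω ^ 2) := fun ω => by
    rw [← ENNReal.ofReal_mul (by positivity)]
    congr 1; field_simp
  simp_rw [e1]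
  have hSm : Measurable fun ω : Fin n → Obs => sampleInt (hazard F) (fun t => β t ω *
      sampleInt (hazard F) ((Iio t).indicator fun s => k s t * α s ω) ω) ω :=
    measurable_sampleInt (hβ.meas.mul (measurable_sampleInt_Iio hk hα.meas)) measurable_id
  rw [lintegral_const_mul _ (hSm.pow_const 2).ennreal_ofReal]
  refine (mul_le_mul_right hmain _).trans (le_of_eq ?_)
  set w := energyWeight F G with hw
  have hwm : Measurable w := measurable_energyWeight
  have hw0 : ∀ s, 0 ≤ w s := energyWeight_nonneg
  have e2 : ∀ t, ∫⁻ s, ENNReal.ofReal (c ^ 3 * n * κ₂ t ^ 2 *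
        (survLeft F t * survLeft G t * invSurv G t ^ 2) * (1 - (hazard F).real {t})) *
        ENNReal.ofReal (k s t ^ 2 * (c ^ 3 * n * κ₁ s ^ 2 *
        (survLeft F s * survLeft G s * invSurv G s ^ 2)) * (1 - (hazard F).real {s})) ∂(hazard F)
      = ENNReal.ofReal (c ^ 3 * n * κ₂ t ^ 2 *
        (survLeft F t * survLeft G t * invSurv G t ^ 2) * (1 - (hazard F).real {t})) *
        ∫⁻ s, ENNReal.ofReal (k s t ^ 2 * (c ^ 3 * n * κ₁ s ^ 2) * w s) ∂F := by
    intro t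
    have hkt : Measurable fun s => k s t := hk.comp (measurable_id.prodMk measurable_const)
    have hm : Measurable fun s => k s t ^ 2 * (c ^ 3 * n * κ₁ s ^ 2) :=
      (hkt.pow_const 2).mul ((hκm₁.pow_const 2).const_mul _)
    rw [lintegral_const_mul, ← lintegral_hazard_energy (G := G) hF hm]
    · simp only [mul_assoc]
    · exact (((hkt.pow_const 2).mul (((hκm₁.pow_const 2).const_mul _).mul
        (((measurable_survLeft F).mul (measurable_survLeft G)).mul
        (measurable_invSurv.pow_const 2)))).mul
        (measurable_const.sub measurable_measureReal_singleton)).ennreal_ofReal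
  simp_rw [e2]
  have e3 : ∀ t, ∫⁻ s, ENNReal.ofReal (k s t ^ 2 * (c ^ 3 * n * κ₁ s ^ 2) * w s) ∂F
      = ENNReal.ofReal (c ^ 3 * n) * ∫⁻ s, ENNReal.ofReal (k s t ^ 2 * κ₁ s ^ 2 * w s) ∂F := by
    intro t
    rw [← lintegral_const_mul]
    · refine lintegral_congr fun s => ?_
      rw [← ENNReal.ofReal_mul (by positivity)]
      congr 1; ring
    · exact ((((hk.comp (measurable_id.prodMk measurable_const)).pow_const 2).mul
        (hκm₁.pow_const 2)).mul hwm).ennreal_ofReal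
  simp_rw [e3]
  set I : ℝ → ℝ≥0∞ := fun t => ∫⁻ s, ENNReal.ofReal (k s t ^ 2 * κ₁ s ^ 2 * w s) ∂F with hI
  have hker : Measurable fun q : ℝ × ℝ => ENNReal.ofReal (k q.1 q.2 ^ 2 * κ₁ q.1 ^ 2 * w q.1) :=
    (((hk.pow_const 2).mul ((hκm₁.comp measurable_fst).pow_const 2)).mul
      (hwm.comp measurable_fst)).ennreal_ofReal
  have hIm : Measurable I := hker.lintegral_prod_left'
  have hden : Measurable fun t => ENNReal.ofReal (c ^ 3 * n * κ₂ t ^ 2 *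
        (survLeft F t * survLeft G t * invSurv G t ^ 2) * (1 - (hazard F).real {t})) :=
    ((((hκm₂.pow_const 2).const_mul _).mul
        (((measurable_survLeft F).mul (measurable_survLeft G)).mul
        (measurable_invSurv.pow_const 2))).mul
        (measurable_const.sub measurable_measureReal_singleton)).ennreal_ofReal
  have e4 : ∫⁻ t, ENNReal.ofReal (c ^ 3 * n * κ₂ t ^ 2 *
        (survLeft F t * survLeft G t * invSurv G t ^ 2) * (1 - (hazard F).real {t})) *
        (ENNReal.ofReal (c ^ 3 * n) * I t) ∂(hazard F)
      = ∫⁻ t, ENNReal.ofReal (c ^ 3 * n * κ₂ t ^ 2 * w t) * (ENNReal.ofReal (c ^ 3 * n) * I t) ∂F := by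
    rw [hazard_lintegral hF (f := fun t => ENNReal.ofReal (c ^ 3 * n * κ₂ t ^ 2 *
        (survLeft F t * survLeft G t * invSurv G t ^ 2) * (1 - (hazard F).real {t})) *
        (ENNReal.ofReal (c ^ 3 * n) * I t)) (hden.mul (hIm.const_mul _))]
    refine lintegral_congr_ae ?_
    filter_upwards [ae_survLeft_pos (F := F)] with s hs
    rw [← mul_assoc, ← ENNReal.ofReal_mul (inv_nonneg.2 (survLeft_nonneg F s)),
      one_sub_hazard hF hs, hw, energyWeight, invSurv]
    congr 2
    by_cases hG : survLeft G s = 0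
    · simp [hG]
    · field_simp
  rw [e4, energy, lintegral_prod_symm']
  swap
  · exact ((((hκm₁.comp measurable_fst).pow_const 2).mul ((hκm₂.comp measurable_snd).pow_const 2)).mul
      ((hk.pow_const 2).mul ((hwm.comp measurable_fst).mul (hwm.comp measurable_snd)))).ennreal_ofReal
  rw [← lintegral_const_mul, ← lintegral_const_mul]
  · refine lintegral_congr fun t => ?_
    have e5 : ∫⁻ s, ENNReal.ofReal (κ₁ s ^ 2 * κ₂ t ^ 2 * (k s t ^ 2 * (w s * w t))) ∂F
        = ENNReal.ofReal (κ₂ t ^ 2 * w t) * I t := by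
      rw [hI, ← lintegral_const_mul]
      · refine lintegral_congr fun s => ?_
        rw [← ENNReal.ofReal_mul (mul_nonneg (sq_nonneg _) (hw0 t))]
        congr 1; ring
      · exact hker.comp (measurable_id.prodMk measurable_const)
    rw [e5, ← mul_assoc, ← mul_assoc, ← mul_assoc, ← ENNReal.ofReal_mul (by positivity),
      ← ENNReal.ofReal_mul (by
        have := hw0 t; positivity), ← ENNReal.ofReal_mul (by positivity)]
    congr 2
    field_simp
  · exact Measurable.lintegral_prod_left' (f := fun q : ℝ × ℝ => ENNReal.ofReal (κ₁ q.1 ^ 2 *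
      κ₂ q.2 ^ 2 * (k q.1 q.2 ^ 2 * (w q.1 * w q.2))))
      ((((hκm₁.comp measurable_fst).pow_const 2).mul ((hκm₂.comp measurable_snd).pow_const 2)).mul
      ((hk.pow_const 2).mul ((hwm.comp measurable_fst).mul (hwm.comp measurable_snd)))).ennreal_ofReal
  · exact (((hκm₂.pow_const 2).const_mul _).mul hwm).ennreal_ofReal.mul (hIm.const_mul _)

/-- The diagonal has one variable, hence a single factor c³n, which the normalisation by n absorbs
in a first moment. -/
lemma lintegral_diagTerm_le (hF : F (Iic 0) = 0) [Nonempty (Fin n)] (hk : Measurable (Function.uncurry k))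
    (hκm₁ : Measurable κ₁) (hκm₂ : Measurable κ₂) (hκ₁ : ∀ s, 0 ≤ κ₁ s) (hκ₂ : ∀ s, 0 ≤ κ₂ s)
    (hc : 0 ≤ c) (hα : Dominated F G c κ₁ α) (hβ : Dominated F G c κ₂ β) :
    ∫⁻ ω, ENNReal.ofReal |sampleInt (hazard F) (fun t => α t ω * β t ω * k t t *
        sampleAtom (hazard F) ω t) ω / n| ∂(Measure.pi fun _ : Fin n => obsModel F G)
      ≤ ENNReal.ofReal (c ^ 3) * diagEnergy F G k κ₁ κ₂ := by
  have hn : (0:ℝ) < n := by exact_mod_cast Fin.pos_iff_nonempty.2 ‹_›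
  have hkd : Measurable fun t => k t t := hk.comp (measurable_id.prodMk measurable_id)
  have hfm : Measurable (Function.uncurry fun t (ω : Fin n → Obs) => α t ω * β t ω * k t t) :=
    (hα.meas.mul hβ.meas).mul (hkd.comp measurable_fst)
  have hmain := (isHazard_obsModel (G := G) hF).lintegral_diag_le hfm (fun j s ω z h1 h2 => by
    simp only [hα.pred j s ω z h1 h2, hβ.pred j s ω z h1 h2])
  have e1 : ∀ ω : Fin n → Obs, ENNReal.ofReal |sampleInt (hazard F) (fun t => α t ω * β t ω * k t t *
        sampleAtom (hazard F) ω t) ω / n| = ENNReal.ofReal (1 / n) * ENNReal.ofReal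
        |sampleInt (hazard F) (fun t => α t ω * β t ω * k t t * sampleAtom (hazard F) ω t) ω| :=
      fun ω => by
    rw [← ENNReal.ofReal_mul (by positivity), abs_div, abs_of_pos hn]
    congr 1; field_simp
  simp_rw [e1]
  have hSm : Measurable fun ω : Fin n → Obs => sampleInt (hazard F) (fun t => α t ω * β t ω * k t t *
        sampleAtom (hazard F) ω t) ω :=
    measurable_sampleInt (hfm.mul (measurable_sampleAtom measurable_snd measurable_fst)) measurable_id
  rw [lintegral_const_mul _ hSm.abs.ennreal_ofReal]
  refine (mul_le_mul_right hmain _).trans ?_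
  have e2 : ∀ ω : Fin n → Obs, ∫⁻ s, ENNReal.ofReal (riskCount ω s * (|α s ω * β s ω * k s s| *
        (1 - (hazard F).real {s}))) ∂(hazard F)
      ≤ ∫⁻ s, ENNReal.ofReal (c ^ 3 * n * (κ₁ s * κ₂ s * |k s s|) * energyWeight F G s) ∂F := by
    intro ω
    rw [← lintegral_hazard_energy (G := G) hF (x := fun s => c ^ 3 * n * (κ₁ s * κ₂ s * |k s s|))
      (((hκm₁.mul hκm₂).mul hkd.abs).const_mul _)]
    have hae : ∀ᵐ s ∂(hazard F), 0 < survLeft F s :=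
      (hazard_absolutelyContinuous hF).ae_le ae_survLeft_pos
    refine lintegral_mono_ae ?_
    filter_upwards [hae] with s hs
    refine ENNReal.ofReal_le_ofReal ?_
    have h1 := hα.mul_le hc hβ hκ₁ hκ₂ s ω
    have h2 : 0 ≤ 1 - (hazard F).real {s} := by
      rw [one_sub_hazard hF hs]
      exact div_nonneg (surv_nonneg F s) (survLeft_nonneg F s)
    rw [abs_mul, abs_mul]
    calc riskCount ω s * (|α s ω| * |β s ω| * |k s s| * (1 - (hazard F).real {s}))
        = riskCount ω s * (|α s ω| * |β s ω|) * (|k s s| * (1 - (hazard F).real {s})) := by ring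
      _ ≤ c ^ 3 * n * (κ₁ s * κ₂ s) * (survLeft F s * survLeft G s * invSurv G s ^ 2) *
          (|k s s| * (1 - (hazard F).real {s})) := by gcongr
      _ = _ := by ring
  refine (mul_le_mul_right (lintegral_mono e2) _).trans (le_of_eq ?_)
  rw [lintegral_const, measure_univ, mul_one, diagEnergy, ← lintegral_const_mul, ← lintegral_const_mul]
  · refine lintegral_congr fun t => ?_
    rw [← ENNReal.ofReal_mul (by positivity), ← ENNReal.ofReal_mul (by positivity)]
    congr 1
    field_simp
  · exact ((hκm₁.mul hκm₂).mul (hkd.abs.mul measurable_energyWeight)).ennreal_ofReal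
  · exact ((((hκm₁.mul hκm₂).mul hkd.abs).const_mul _).mul measurable_energyWeight).ennreal_ofReal

/-- Tail bound for a double integral with predictable factors. -/
lemma measure_doubleInt_ge_le (hF : F (Iic 0) = 0) [Nonempty (Fin n)]
    (hk : Measurable (Function.uncurry k))
    (hκm₁ : Measurable κ₁) (hκm₂ : Measurable κ₂) (hκ₁ : ∀ s, 0 ≤ κ₁ s) (hκ₂ : ∀ s, 0 ≤ κ₂ s)
    (hc : 0 ≤ c) (hα : Dominated F G c κ₁ α) (hβ : Dominated F G c κ₂ β)
    (hint : ∀ᵐ ω ∂(Measure.pi fun _ : Fin n => obsModel F G), ∀ i j,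
      Integrable (Function.uncurry fun s t => α s ω * β t ω * k s t)
        ((totalMeasure (hazard F) (ω i)).prod (totalMeasure (hazard F) (ω j))))
    {ε : ℝ} (hε : 0 < ε) :
    (Measure.pi fun _ : Fin n => obsModel F G)
        {ω | 3 * ε < |doubleInt (hazard F) (fun s t => α s ω * β t ω * k s t) ω / n|}
      ≤ 2 * (ENNReal.ofReal (c ^ 6) * energy F G k κ₁ κ₂ / ENNReal.ofReal (ε ^ 2))
        + ENNReal.ofReal (c ^ 3) * diagEnergy F G k κ₁ κ₂ / ENNReal.ofReal ε := by
  set P := Measure.pi fun _ : Fin n => obsModel F G with hP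
  set A : (Fin n → Obs) → ℝ := fun ω => sampleInt (hazard F) (fun t => β t ω * sampleInt (hazard F)
        ((Iio t).indicator fun s => k s t * α s ω) ω) ω / n with hA
  set B : (Fin n → Obs) → ℝ := fun ω => sampleInt (hazard F) (fun t => α t ω * sampleInt (hazard F)
        ((Iio t).indicator fun s => k t s * β s ω) ω) ω / n with hB
  set D : (Fin n → Obs) → ℝ := fun ω => sampleInt (hazard F) (fun t => α t ω * β t ω * k t t *
        sampleAtom (hazard F) ω t) ω / n with hD
  have hk' : Measurable (Function.uncurry fun s t => k t s) := hk.comp measurable_swap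
  have hAm : Measurable A := (measurable_sampleInt (hβ.meas.mul
    (measurable_sampleInt_Iio hk hα.meas)) measurable_id).div_const _
  have hBm : Measurable B := (measurable_sampleInt (hα.meas.mul
    (measurable_sampleInt_Iio hk' hβ.meas)) measurable_id).div_const _
  have hkd : Measurable fun t => k t t := hk.comp (measurable_id.prodMk measurable_id)
  have hDm : Measurable D := (measurable_sampleInt (((hα.meas.mul hβ.meas).mul
    (hkd.comp measurable_fst)).mul (measurable_sampleAtom measurable_snd measurable_fst))
    measurable_id).div_const _
  have hsplit : ∀ᵐ ω ∂P, doubleInt (hazard F) (fun s t => α s ω * β t ω * k s t) ω / n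
      = A ω + B ω + D ω := by
    filter_upwards [hint] with ω hω
    rw [doubleInt_split hω]
    have e1 : ∀ t, sampleInt (hazard F) ((Iio t).indicator fun s => α s ω * β t ω * k s t) ω
        = β t ω * sampleInt (hazard F) ((Iio t).indicator fun s => k s t * α s ω) ω := by
      intro t
      rw [sampleInt, sampleInt, Finset.mul_sum]
      refine Finset.sum_congr rfl fun i _ => ?_
      rw [← mart_const_mul]
      congr 1; ext s
      by_cases h : s ∈ Iio t
      · rw [indicator_of_mem h, indicator_of_mem h]; ring
      · rw [indicator_of_notMem h, indicator_of_notMem h, mul_zero]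
    have e2 : ∀ t, sampleInt (hazard F) ((Iio t).indicator fun s => α t ω * β s ω * k t s) ω
        = α t ω * sampleInt (hazard F) ((Iio t).indicator fun s => k t s * β s ω) ω := by
      intro t
      rw [sampleInt, sampleInt, Finset.mul_sum]
      refine Finset.sum_congr rfl fun i _ => ?_
      rw [← mart_const_mul]
      congr 1; ext s
      by_cases h : s ∈ Iio t
      · rw [indicator_of_mem h, indicator_of_mem h]; ring
      · rw [indicator_of_notMem h, indicator_of_notMem h, mul_zero]
    simp_rw [e1, e2]
    simp only [hA, hB, hD]
    ring
  -- If the sum exceeds 3ε, one of the three parts reaches ε. Chebyshev's inequality serves for the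
  -- off-diagonal parts and Markov's for the diagonal.
  have hsub : ∀ᵐ ω ∂P, ω ∈ {ω | 3 * ε < |doubleInt (hazard F) (fun s t => α s ω * β t ω * k s t) ω / n|}
      → ω ∈ {ω | ENNReal.ofReal (ε ^ 2) ≤ ENNReal.ofReal (A ω ^ 2)}
        ∪ {ω | ENNReal.ofReal (ε ^ 2) ≤ ENNReal.ofReal (B ω ^ 2)}
        ∪ {ω | ENNReal.ofReal ε ≤ ENNReal.ofReal |D ω|} := by
    filter_upwards [hsplit] with ω hω h
    simp only [hω] at h
    by_contra hcon
    simp only [mem_union, mem_ofPred_eq, not_or, not_le] at hcon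
    obtain ⟨⟨h1, h2⟩, h3⟩ := hcon
    rw [ENNReal.ofReal_lt_ofReal_iff (by positivity)] at h1 h2 h3
    have h1' := abs_lt_of_sq_lt_sq h1 hε.le
    have h2' := abs_lt_of_sq_lt_sq h2 hε.le
    have h4 := abs_add_le (A ω + B ω) (D ω)
    have h5 := abs_add_le (A ω) (B ω)
    linarith
  have he2 : ENNReal.ofReal (ε ^ 2) ≠ 0 := by
    rw [Ne, ENNReal.ofReal_eq_zero, not_le]; positivity
  have he1 : ENNReal.ofReal ε ≠ 0 := by rwa [Ne, ENNReal.ofReal_eq_zero, not_le]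
  calc P {ω | 3 * ε < |doubleInt (hazard F) (fun s t => α s ω * β t ω * k s t) ω / n|}
      ≤ P ({ω | ENNReal.ofReal (ε ^ 2) ≤ ENNReal.ofReal (A ω ^ 2)}
        ∪ {ω | ENNReal.ofReal (ε ^ 2) ≤ ENNReal.ofReal (B ω ^ 2)}
        ∪ {ω | ENNReal.ofReal ε ≤ ENNReal.ofReal |D ω|}) := measure_mono_ae hsub
    _ ≤ P {ω | ENNReal.ofReal (ε ^ 2) ≤ ENNReal.ofReal (A ω ^ 2)}
        + P {ω | ENNReal.ofReal (ε ^ 2) ≤ ENNReal.ofReal (B ω ^ 2)}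
        + P {ω | ENNReal.ofReal ε ≤ ENNReal.ofReal |D ω|} :=
        (measure_union_le _ _).trans (add_le_add (measure_union_le _ _) le_rfl)
    _ ≤ _ := by
        rw [two_mul]
        refine add_le_add (add_le_add ?_ ?_) ?_
        · refine (meas_ge_le_lintegral_div (hAm.pow_const 2).ennreal_ofReal.aemeasurable he2
            ENNReal.ofReal_ne_top).trans ?_
          gcongr
          exact lintegral_offDiag_le hF hk hκm₁ hκm₂ hκ₁ hκ₂ hc hα hβ
        · refine (meas_ge_le_lintegral_div (hBm.pow_const 2).ennreal_ofReal.aemeasurable he2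
            ENNReal.ofReal_ne_top).trans ?_
          gcongr
          rw [← energy_swap]
          exact lintegral_offDiag_le hF hk' hκm₂ hκm₁ hκ₂ hκ₁ hc hβ hα
        · refine (meas_ge_le_lintegral_div hDm.abs.ennreal_ofReal.aemeasurable he1
            ENNReal.ofReal_ne_top).trans ?_
          gcongr
          exact lintegral_diagTerm_le hF hk hκm₁ hκm₂ hκ₁ hκ₂ hc hα hβ

end Energy

/-! ### Energies where few observations are at risk -/

variable {F G : Measure ℝ} [IsProbabilityMeasure F] [IsProbabilityMeasure G]

/-- The weight `1 / (1 - G(s-))` with values in `[0, ∞]`. -/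
def extInvSurv (G : Measure ℝ) (s : ℝ) : ℝ≥0∞ := (G (Ici s))⁻¹

/-- The real inverse `invSurv` drops to 0 where 1 - G(s-) = 0 and is not monotone. The extended one
is, as the weighted contraction requires. -/
lemma monotone_extInvSurv : Monotone (extInvSurv G) := fun _ _ h =>
  ENNReal.inv_le_inv.2 (measure_mono (Ici_subset_Ici.2 h))

lemma measurable_extInvSurv : Measurable (extInvSurv G) := monotone_extInvSurv.measurable

lemma ofReal_survLeft (s : ℝ) : ENNReal.ofReal (survLeft G s) = G (Ici s) :=
  ENNReal.ofReal_toReal (measure_ne_top _ _)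

lemma extInvSurv_eq {s : ℝ} (hs : 0 < survLeft G s) :
    extInvSurv G s = ENNReal.ofReal (invSurv G s) := by
  rw [extInvSurv, invSurv, ENNReal.ofReal_inv_of_pos hs, ofReal_survLeft]

lemma ofReal_invSurv_le (s : ℝ) : ENNReal.ofReal (invSurv G s) ≤ extInvSurv G s := by
  rcases (survLeft_nonneg G s).eq_or_lt with h | h
  · simp [invSurv, ← h]
  · exact (extInvSurv_eq h).ge

lemma ofReal_energyWeight_le (s : ℝ) : ENNReal.ofReal (energyWeight F G s)
    ≤ extInvSurv G s * ENNReal.ofReal (surv F s / survLeft F s) := by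
  rw [energyWeight, ENNReal.ofReal_mul (invSurv_nonneg s)]
  gcongr
  exact ofReal_invSurv_le s

lemma energyWeight_ne_zero {s : ℝ} (h : energyWeight F G s ≠ 0) :
    0 < survLeft F s * survLeft G s := by
  rw [energyWeight, invSurv] at h
  refine mul_pos ((survLeft_nonneg F s).lt_of_ne' fun h0 => h ?_)
    ((survLeft_nonneg G s).lt_of_ne' fun h0 => h ?_)
  · rw [h0, div_zero, mul_zero]
  · rw [h0, inv_zero, zero_mul]

/-- A small constant, enlarged by one where few observations are at risk. -/
def cutoff (F G : Measure ℝ) (a s : ℝ) : ℝ := a + if survLeft F s * survLeft G s < a then 1 else 0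

lemma measurable_cutoff (a : ℝ) : Measurable (cutoff F G a) :=
  measurable_const.add (Measurable.ite (measurableSet_lt
    ((measurable_survLeft F).mul (measurable_survLeft G)) measurable_const) measurable_const
    measurable_const)

lemma cutoff_nonneg {a : ℝ} (ha : 0 ≤ a) (s : ℝ) : 0 ≤ cutoff F G a s := by
  rw [cutoff]; split_ifs <;> linarith

lemma cutoff_le {a : ℝ} (ha : a ≤ 1) (s : ℝ) : cutoff F G a s ≤ 2 := by
  rw [cutoff]; split_ifs <;> linarith

lemma tendsto_cutoff {s : ℝ} (hs : 0 < survLeft F s * survLeft G s) :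
    Tendsto (fun j : ℕ => cutoff F G (1 / ((j : ℝ) + 1)) s) atTop (𝓝 0) := by
  have h := tendsto_one_div_add_atTop_nhds_zero_nat (𝕜 := ℝ)
  refine h.congr' ?_
  filter_upwards [h.eventually_lt_const hs] with j hj
  rw [cutoff, if_neg hj.le.not_gt, add_zero]

lemma one_div_succ_le_one (j : ℕ) : 1 / ((j : ℝ) + 1) ≤ 1 := by
  rw [div_le_one (by positivity)]
  have : (0 : ℝ) ≤ j := by positivity
  linarith

/-- Dominated convergence: the cutoff is at most 2, whence the factor 4, and it tends to 0 wherever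
the energy weight is nonzero. -/
lemma tendsto_energy {k : ℝ → ℝ → ℝ} (hk : Measurable (Function.uncurry k))
    (hfin : energy F G k (fun _ => 1) (fun _ => 1) ≠ ∞) :
    Tendsto (fun j : ℕ => energy F G k (cutoff F G (1 / ((j : ℝ) + 1))) (fun _ => 1)) atTop (𝓝 0) := by
  set h : ℝ × ℝ → ℝ := fun q => k q.1 q.2 ^ 2 * (energyWeight F G q.1 * energyWeight F G q.2) with hh
  have hw0 : ∀ s, 0 ≤ energyWeight F G s := energyWeight_nonneg
  have h0 : ∀ q, 0 ≤ h q := fun q => by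
    have := hw0 q.1; have := hw0 q.2
    simp only [hh]; positivity
  have hm : Measurable h := (hk.pow_const 2).mul ((measurable_energyWeight.comp measurable_fst).mul
    (measurable_energyWeight.comp measurable_snd))
  have hlim := tendsto_lintegral_of_dominated_convergence (μ := F.prod F)
    (F := fun (j : ℕ) q => ENNReal.ofReal (cutoff F G (1 / ((j : ℝ) + 1)) q.1 ^ 2 * 1 ^ 2 * h q))
    (f := fun _ => 0) (fun q => ENNReal.ofReal 4 * ENNReal.ofReal (h q))
    (fun j => (((((measurable_cutoff _).comp measurable_fst).pow_const 2).mul_const _).mul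
      hm).ennreal_ofReal) (fun j => ae_of_all _ fun q => by
        simp only
        rw [← ENNReal.ofReal_mul (by norm_num)]
        refine ENNReal.ofReal_le_ofReal (mul_le_mul_of_nonneg_right ?_ (h0 q))
        have h1 := cutoff_le (F := F) (G := G) (one_div_succ_le_one j) q.1
        have h2 := cutoff_nonneg (F := F) (G := G) (a := 1 / ((j : ℝ) + 1)) (by positivity) q.1
        nlinarith) (by
        rw [lintegral_const_mul _ hm.ennreal_ofReal]
        refine ENNReal.mul_ne_top ENNReal.ofReal_ne_top (ne_of_eq_of_ne ?_ hfin)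
        exact lintegral_congr fun q => by simp [hh]) (ae_of_all _ fun q => by
        by_cases hq : h q = 0
        · simp [hq]
        · have hw : energyWeight F G q.1 ≠ 0 := fun h' => hq (by simp [hh, h'])
          have := ENNReal.tendsto_ofReal ((((tendsto_cutoff (energyWeight_ne_zero hw)).pow 2).mul_const
            (1 ^ 2)).mul_const (h q))
          simpa using this)
  rwa [lintegral_zero] at hlim

lemma tendsto_energy_right {k : ℝ → ℝ → ℝ} (hk : Measurable (Function.uncurry k))
    (hfin : energy F G k (fun _ => 1) (fun _ => 1) ≠ ∞) :
    Tendsto (fun j : ℕ => energy F G k (fun _ => 1) (cutoff F G (1 / ((j : ℝ) + 1)))) atTop (𝓝 0) := by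
  simp_rw [← energy_swap (F := F) (G := G) (k := k)] at hfin ⊢
  exact tendsto_energy (hk.comp measurable_swap) hfin

lemma tendsto_diagEnergy {k : ℝ → ℝ → ℝ} (hk : Measurable (Function.uncurry k))
    (hfin : diagEnergy F G k (fun _ => 1) (fun _ => 1) ≠ ∞) :
    Tendsto (fun j : ℕ => diagEnergy F G k (cutoff F G (1 / ((j : ℝ) + 1))) (fun _ => 1))
      atTop (𝓝 0) := by
  set h : ℝ → ℝ := fun t => |k t t| * energyWeight F G t with hh
  have hw0 : ∀ s, 0 ≤ energyWeight F G s := energyWeight_nonneg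
  have h0 : ∀ q, 0 ≤ h q := fun q => mul_nonneg (abs_nonneg _) (hw0 q)
  have hm : Measurable h := (hk.comp (measurable_id.prodMk measurable_id)).abs.mul
    measurable_energyWeight
  have hlim := tendsto_lintegral_of_dominated_convergence (μ := F)
    (F := fun (j : ℕ) q => ENNReal.ofReal (cutoff F G (1 / ((j : ℝ) + 1)) q * 1 * h q))
    (f := fun _ => 0) (fun q => ENNReal.ofReal 2 * ENNReal.ofReal (h q))
    (fun j => (((measurable_cutoff _).mul_const _).mul hm).ennreal_ofReal)
    (fun j => ae_of_all _ fun q => by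
        simp only
        rw [← ENNReal.ofReal_mul (by norm_num)]
        refine ENNReal.ofReal_le_ofReal (mul_le_mul_of_nonneg_right ?_ (h0 q))
        rw [mul_one]
        exact cutoff_le (one_div_succ_le_one j) q) (by
        rw [lintegral_const_mul _ hm.ennreal_ofReal]
        refine ENNReal.mul_ne_top ENNReal.ofReal_ne_top (ne_of_eq_of_ne ?_ hfin)
        exact lintegral_congr fun q => by simp [hh]) (ae_of_all _ fun q => by
        by_cases hq : h q = 0
        · simp [hq]
        · have hw : energyWeight F G q ≠ 0 := fun h' => hq (by simp [hh, h'])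
          have := ENNReal.tendsto_ofReal (((tendsto_cutoff (energyWeight_ne_zero hw)).mul_const
            1).mul_const (h q))
          simpa using this)
  rwa [lintegral_zero] at hlim

lemma diagEnergy_comm {k : ℝ → ℝ → ℝ} (κ₁ κ₂ : ℝ → ℝ) :
    diagEnergy F G k κ₁ κ₂ = diagEnergy F G k κ₂ κ₁ :=
  lintegral_congr fun t => by rw [mul_comm (κ₁ t)]

/-- The integrability conditions on a kernel that vanishes where nothing is observed. -/
structure Admissible (F G : Measure ℝ) (K : ℝ → ℝ → ℝ) : Prop where
  meas : Measurable (Function.uncurry K)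
  symm : ∀ s t, K s t = K t s
  supp : ∀ s t, K s t ≠ 0 → 0 < survLeft F s * survLeft G s
  sq : ∫⁻ t, extInvSurv G t * ∫⁻ s, extInvSurv G s * ENNReal.ofReal (K s t ^ 2) ∂F ∂F ≠ ∞
  diag : diagEnergy F G (twoForward F K) (fun _ => 1) (fun _ => 1) ≠ ∞

/-- The energy of a kernel where few observations are at risk. -/
def tailEnergy (F G : Measure ℝ) (K : ℝ → ℝ → ℝ) (a : ℝ) : ℝ≥0∞ :=
  ∫⁻ t in {t | survLeft F t * survLeft G t < a},
    extInvSurv G t * ∫⁻ s, extInvSurv G s * ENNReal.ofReal (K s t ^ 2) ∂F ∂F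

variable {K : ℝ → ℝ → ℝ}

lemma measurable_weight_sq (hK : Measurable (Function.uncurry K)) : Measurable fun q : ℝ × ℝ =>
    extInvSurv G q.1 * ENNReal.ofReal (K q.1 q.2 ^ 2) :=
  (measurable_extInvSurv.comp measurable_fst).mul (hK.pow_const 2).ennreal_ofReal

/-- The contraction in both variables, with the increasing weight 1/(1 - G(s-)), transfers the
square integrability from K to K'. -/
lemma Admissible.energy_ne_top (hF : F (Iic 0) = 0) (hK : Admissible F G K) :
    energy F G (twoForward F K) (fun _ => 1) (fun _ => 1) ≠ ∞ := by
  refine ne_top_of_le_ne_top hK.sq (le_trans ?_ (lintegral_twoForward_sq_le hF hK.meas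
    (monotone_extInvSurv (G := G))))
  have hkm := measurable_twoForward (F := F) hK.meas
  rw [energy, lintegral_prod]
  · refine lintegral_mono fun s => ?_
    rw [← lintegral_const_mul]
    · refine lintegral_mono fun t => ?_
      have e : (1:ℝ) ^ 2 * 1 ^ 2 * (twoForward F K s t ^ 2 * (energyWeight F G s * energyWeight F G t))
        = energyWeight F G s * (energyWeight F G t * twoForward F K s t ^ 2) := by ring
      simp only
      rw [e, ENNReal.ofReal_mul (energyWeight_nonneg s)]
      refine mul_le_mul' (ofReal_energyWeight_le s) ?_
      rw [ENNReal.ofReal_mul (energyWeight_nonneg t), ENNReal.ofReal_mul (sq_nonneg _)]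
      refine (mul_le_mul' (ofReal_energyWeight_le t) le_rfl).trans (le_of_eq ?_)
      ring
    · exact measurable_extInvSurv.mul (((hkm.comp (measurable_const.prodMk measurable_id)).pow_const
        2).mul ((measurable_surv F).div (measurable_survLeft F))).ennreal_ofReal
  · exact (measurable_const.mul ((hkm.pow_const 2).mul ((measurable_energyWeight.comp
      measurable_fst).mul (measurable_energyWeight.comp measurable_snd)))).ennreal_ofReal.aemeasurable

/-- The sets shrink to the points of zero risk probability, where K vanishes. -/
lemma Admissible.tendsto_tailEnergy (hK : Admissible F G K) :
    Tendsto (fun j : ℕ => tailEnergy F G K (1 / ((j : ℝ) + 1))) atTop (𝓝 0) := by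
  set h : ℝ → ℝ≥0∞ := fun t => extInvSurv G t * ∫⁻ s, extInvSurv G s * ENNReal.ofReal (K s t ^ 2) ∂F
  have hm : Measurable h := measurable_extInvSurv.mul (measurable_weight_sq hK.meas).lintegral_prod_left'
  have hS : ∀ a : ℝ, MeasurableSet {t | survLeft F t * survLeft G t < a} := fun a =>
    measurableSet_lt ((measurable_survLeft F).mul (measurable_survLeft G)) measurable_const
  have hlim := tendsto_lintegral_of_dominated_convergence (μ := F)
    (F := fun (j : ℕ) => {t | survLeft F t * survLeft G t < 1 / ((j : ℝ) + 1)}.indicator h)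
    (f := fun _ => 0) h (fun j => hm.indicator (hS _)) (fun j => ae_of_all _ fun q =>
      indicator_le_self _ _ _) hK.sq (ae_of_all _ fun t => by
        by_cases ht : 0 < survLeft F t * survLeft G t
        · refine tendsto_const_nhds.congr' ?_
          filter_upwards [(tendsto_one_div_add_atTop_nhds_zero_nat (𝕜 := ℝ)).eventually_lt_const ht]
            with j hj
          rw [indicator_of_notMem]
          exact not_lt.2 hj.le
        · have h0 : h t = 0 := by
            have : ∀ s, K s t = 0 := fun s => by
              by_contra hne
              exact ht (hK.supp t s (by rwa [hK.symm]))
            simp [h, this]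
          refine tendsto_const_nhds.congr fun j => ?_
          by_cases hj : t ∈ {t | survLeft F t * survLeft G t < 1 / ((j : ℝ) + 1)}
          · rw [indicator_of_mem hj, h0]
          · rw [indicator_of_notMem hj])
  simp_rw [lintegral_indicator (hS _), lintegral_zero] at hlim
  exact hlim

/-- The Cauchy-Schwarz inequality on a tail. -/
lemma lintegral_Ioi_sq_le {f : ℝ → ℝ≥0∞} (hf : Measurable f) (h0 : ∀ t, G (Ici t) = 0 → f t = 0)
    (x : ℝ) : (∫⁻ t in Ioi x, f t ∂F) ^ 2
      ≤ F (Ioi x) * G (Ioi x) * ∫⁻ t in Ioi x, extInvSurv G t * f t ^ 2 ∂F := by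
  have hGm : Measurable fun t => G (Ici t) := by
    have : Antitone fun t => G (Ici t) := fun a b h => measure_mono (Ici_subset_Ici.2 h)
    exact this.measurable
  -- The weights are (1 - G(t-))^(1/2) and its inverse. The first factor is then controlled by
  -- S(x)(1 - G(x)), because 1 - G(t-) ≤ 1 - G(x) for t > x.
  have h1 := ENNReal.lintegral_mul_le_Lp_mul_Lq (F.restrict (Ioi x)) Real.HolderConjugate.two_two
    (f := fun t => G (Ici t) ^ (1 / 2 : ℝ)) (g := fun t => extInvSurv G t ^ (1 / 2 : ℝ) * f t)
    (hGm.pow_const _).aemeasurable ((measurable_extInvSurv.pow_const _).mul hf).aemeasurable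
  have e1 : ∀ t, ((fun t => G (Ici t) ^ (1 / 2 : ℝ)) * fun t => extInvSurv G t ^ (1 / 2 : ℝ) * f t) t
      = f t := by
    intro t
    simp only [Pi.mul_apply]
    by_cases ht : G (Ici t) = 0
    · rw [h0 t ht]; simp
    · rw [← mul_assoc, ← ENNReal.mul_rpow_of_nonneg _ _ (by norm_num), extInvSurv,
        ENNReal.mul_inv_cancel ht (measure_ne_top _ _), ENNReal.one_rpow, one_mul]
  have e2 : ∀ t, (G (Ici t) ^ (1 / 2 : ℝ)) ^ (2 : ℝ) = G (Ici t) := fun t => by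
    rw [← ENNReal.rpow_mul]; norm_num
  have e3 : ∀ t, (extInvSurv G t ^ (1 / 2 : ℝ) * f t) ^ (2 : ℝ) = extInvSurv G t * f t ^ 2 := fun t => by
    rw [ENNReal.mul_rpow_of_nonneg _ _ (by norm_num), ← ENNReal.rpow_mul]; norm_num
  rw [lintegral_congr e1] at h1
  simp_rw [e2, e3] at h1
  have h2 : ∫⁻ t in Ioi x, G (Ici t) ∂F ≤ F (Ioi x) * G (Ioi x) := by
    calc ∫⁻ t in Ioi x, G (Ici t) ∂F ≤ ∫⁻ t in Ioi x, G (Ioi x) ∂F :=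
          setLIntegral_mono measurable_const fun t ht => measure_mono fun u hu =>
            lt_of_lt_of_le (show x < t from ht) hu
      _ = _ := by rw [lintegral_const, Measure.restrict_apply_univ, mul_comm]
  have h3 := pow_le_pow_left' h1 2
  refine h3.trans ?_
  have e4 : ∀ y : ℝ≥0∞, (y ^ (1 / 2 : ℝ)) ^ 2 = y := fun y => by
    rw [← ENNReal.rpow_natCast, ← ENNReal.rpow_mul]; norm_num
  rw [mul_pow, e4, e4]
  gcongr

/-! ### Controlled samples and bounds for the tail terms -/

variable {F G : Measure ℝ} [IsProbabilityMeasure F] [IsProbabilityMeasure G] {n : ℕ}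

/-- At `s` the Kaplan-Meier weights and the number at risk are close to their limits, up to a factor
`c`, and with a relative error `a` unless few observations are at risk. -/
structure Controlled (F G : Measure ℝ) (c a s : ℝ) (ω : Fin n → Obs) : Prop where
  risk : riskCount ω s ≤ c * (n * (survLeft F s * survLeft G s))
  jump : n * kmJump s ω ≤ c * invSurv G s
  error : |n * kmJump s ω - invSurv G s| ≤ c * (cutoff F G a s * invSurv G s)

lemma measurableSet_controlled (c a : ℝ) :
    MeasurableSet {q : ℝ × (Fin n → Obs) | Controlled F G c a q.1 q.2} := by
  have hQ : Measurable fun q : ℝ × (Fin n → Obs) => invSurv G q.1 := measurable_invSurv.comp measurable_fst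
  have hp : Measurable fun q : ℝ × (Fin n → Obs) => survLeft F q.1 * survLeft G q.1 :=
    ((measurable_survLeft F).mul (measurable_survLeft G)).comp measurable_fst
  have hκ : Measurable fun q : ℝ × (Fin n → Obs) => cutoff F G a q.1 :=
    (measurable_cutoff a).comp measurable_fst
  have hj : Measurable fun q : ℝ × (Fin n → Obs) => (n : ℝ) * kmJump q.1 q.2 :=
    measurable_kmJump.const_mul _
  have h1 := measurableSet_le (measurable_riskCount (ι := Fin n)) ((hp.const_mul (n : ℝ)).const_mul c)
  have h2 := measurableSet_le hj (hQ.const_mul c)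
  have h3 := measurableSet_le (hj.sub hQ).abs ((hκ.mul hQ).const_mul c)
  convert h1.inter (h2.inter h3) using 1
  ext q
  exact ⟨fun h => ⟨h.1, h.2, h.3⟩, fun h => ⟨h.1, h.2.1, h.2.2⟩⟩

/-- Control at s involves the sample only through Y(s) and q(s), which are predictable. Cutting a
process to the controlled times therefore keeps it predictable, which conditioning on a global event
would not. -/
lemma controlled_update {c a s : ℝ} {ω : Fin n → Obs} {j : Fin n} {z : Obs} (h1 : s ≤ (ω j).1)
    (h2 : s ≤ z.1) : Controlled F G c a s (Function.update ω j z) ↔ Controlled F G c a s ω := by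
  have e := predictable_kmJump j s ω z h1 h2
  constructor
  · rintro ⟨a1, a2, a3⟩
    rw [riskCount_update h1 h2] at a1
    rw [e] at a2 a3
    exact ⟨a1, a2, a3⟩
  · rintro ⟨a1, a2, a3⟩
    rw [← riskCount_update (z := z) h1 h2] at a1
    rw [← e] at a2 a3
    exact ⟨a1, a2, a3⟩

open Classical in
/-- The restriction of a process to the times at which the sample is controlled. -/
def controlledPart (F G : Measure ℝ) (c a : ℝ) (f : ℝ → (Fin n → Obs) → ℝ) (s : ℝ) (ω : Fin n → Obs) : ℝ :=
  if Controlled F G c a s ω then f s ω else 0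

lemma dominated_controlledPart {c a : ℝ} (hc : 0 ≤ c) {κ : ℝ → ℝ} (hκ : ∀ s, 0 ≤ κ s)
    {f : ℝ → (Fin n → Obs) → ℝ} (hf : Measurable (Function.uncurry f)) (hp : Predictable f)
    (hle : ∀ s ω, Controlled F G c a s ω → |f s ω| ≤ c * (κ s * invSurv G s)) :
    Dominated F G c κ (controlledPart F G c a f) := by
  classical
  refine ⟨?_, fun j s ω z h1 h2 => ?_, fun s ω => ?_, fun s ω h => ?_⟩
  · exact Measurable.ite (measurableSet_controlled c a) hf measurable_const
  · rw [controlledPart, controlledPart, hp j s ω z h1 h2]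
    simp only [controlled_update h1 h2]
  · rw [controlledPart]
    split_ifs with h
    · exact hle s ω h
    · rw [abs_zero]
      exact mul_nonneg hc (mul_nonneg (hκ s) (invSurv_nonneg s))
  · rw [controlledPart] at h
    split_ifs at h with h'
    · exact h'.risk
    · exact absurd rfl h

/-- The error of the weights. -/
def errorPart (F G : Measure ℝ) (c a : ℝ) : ℝ → (Fin n → Obs) → ℝ :=
  controlledPart F G c a fun s ω => n * kmJump s ω - invSurv G s

/-- The weights of the estimator. -/
def estPart (F G : Measure ℝ) (c a : ℝ) : ℝ → (Fin n → Obs) → ℝ :=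
  controlledPart F G c a fun s ω => n * kmJump s ω

/-- The limits of the weights. -/
def limPart (F G : Measure ℝ) (c a : ℝ) : ℝ → (Fin n → Obs) → ℝ :=
  controlledPart F G c a fun s _ => invSurv G s

lemma dominated_errorPart {c a : ℝ} (hc : 0 ≤ c) (ha : 0 ≤ a) :
    Dominated (n := n) F G c (cutoff F G a) (errorPart F G c a) := by
  refine dominated_controlledPart hc (cutoff_nonneg ha) ?_ (fun j s ω z h1 h2 => ?_)
    fun s ω h => h.error
  · exact (measurable_kmJump.const_mul _).sub (measurable_invSurv.comp measurable_fst)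
  · simp only [predictable_kmJump j s ω z h1 h2]

lemma dominated_estPart {c a : ℝ} (hc : 0 ≤ c) :
    Dominated (n := n) F G c (fun _ => 1) (estPart F G c a) := by
  refine dominated_controlledPart hc (fun _ => zero_le_one) (measurable_kmJump.const_mul _)
    (fun j s ω z h1 h2 => ?_) fun s ω h => ?_
  · simp only [predictable_kmJump j s ω z h1 h2]
  · rw [abs_of_nonneg (mul_nonneg (Nat.cast_nonneg _) (kmJump_nonneg s ω)), one_mul]
    exact h.jump

lemma dominated_limPart {c a : ℝ} (hc : 1 ≤ c) :
    Dominated (n := n) F G c (fun _ => 1) (limPart F G c a) := by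
  refine dominated_controlledPart (zero_le_one.trans hc) (fun _ => zero_le_one)
    (measurable_invSurv.comp measurable_fst) (fun j s ω z h1 h2 => rfl) fun s ω h => ?_
  rw [abs_of_nonneg (invSurv_nonneg s), one_mul]
  exact le_mul_of_one_le_left (invSurv_nonneg s) hc

variable {K : ℝ → ℝ → ℝ} {c : ℝ} {β : ℝ → (Fin n → Obs) → ℝ}

/-- The stochastic integral of a section of the kernel. -/
def sectionInt (F : Measure ℝ) (K : ℝ → ℝ → ℝ) (β : ℝ → (Fin n → Obs) → ℝ) (t : ℝ)
    (ω : Fin n → Obs) : ℝ :=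
  sampleInt (hazard F) (fun s => β s ω * forward F (fun u => K u t) s) ω

lemma measurable_sectionInt (hK : Measurable (Function.uncurry K))
    (hβ : Measurable (Function.uncurry β)) : Measurable (Function.uncurry (sectionInt F K β)) := by
  refine measurable_sampleInt (α := ℝ × (Fin n → Obs)) (f := fun s q => β s q.2 * forward F (fun u => K u q.1) s)
    ?_ measurable_snd
  refine (hβ.comp (measurable_fst.prodMk (measurable_snd.comp measurable_snd))).mul ?_
  exact (measurable_forward hK).comp (measurable_fst.prodMk (measurable_fst.comp measurable_snd))

/-- The second moment bound in s, followed by the weighted contraction at fixed t, which replaces AK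
by K. -/
lemma lintegral_sectionInt_sq_le (hF : F (Iic 0) = 0) (hK : Measurable (Function.uncurry K))
    (hc : 0 ≤ c) (hβ : Dominated F G c (fun _ => 1) β) (t : ℝ) :
    ∫⁻ ω, ENNReal.ofReal (sectionInt F K β t ω ^ 2) ∂(Measure.pi fun _ : Fin n => obsModel F G)
      ≤ ENNReal.ofReal (c ^ 3 * n) * ∫⁻ s, extInvSurv G s * ENNReal.ofReal (K s t ^ 2) ∂F := by
  have hKt : Measurable fun u => K u t := hK.comp (measurable_id.prodMk measurable_const)
  have hA : Measurable (forward F fun u => K u t) := measurable_forward_one hKt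
  have h1 := (isHazard_obsModel (G := G) hF).lintegral_sampleInt_sq_le (ι := Fin n)
    (f := fun s ω => β s ω * forward F (fun u => K u t) s) (hβ.meas.mul (hA.comp measurable_fst))
    (fun j s ω z h1 h2 => by simp only [hβ.pred j s ω z h1 h2])
  refine h1.trans ?_
  have h2 : ∀ ω : Fin n → Obs, ∫⁻ s, ENNReal.ofReal (riskCount ω s *
      ((β s ω * forward F (fun u => K u t) s) ^ 2 * (1 - (hazard F).real {s}))) ∂(hazard F)
      ≤ ∫⁻ s, ENNReal.ofReal (c ^ 3 * n * forward F (fun u => K u t) s ^ 2 * energyWeight F G s) ∂F := by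
    intro ω
    rw [← lintegral_hazard_energy (G := G) hF (x := fun s => c ^ 3 * n * forward F (fun u => K u t) s ^ 2)
      ((hA.pow_const 2).const_mul _)]
    refine lintegral_mono_ae ?_
    filter_upwards [(hazard_absolutelyContinuous hF).ae_le (ae_survLeft_pos (F := F))] with s hs
    refine ENNReal.ofReal_le_ofReal ?_
    have h3 := hβ.sq_le hc (fun _ => zero_le_one) s ω
    have h4 : 0 ≤ 1 - (hazard F).real {s} := by
      rw [one_sub_hazard hF hs]
      exact div_nonneg (surv_nonneg F s) (survLeft_nonneg F s)
    calc riskCount ω s * ((β s ω * forward F (fun u => K u t) s) ^ 2 * (1 - (hazard F).real {s}))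
        = riskCount ω s * β s ω ^ 2 * (forward F (fun u => K u t) s ^ 2 * (1 - (hazard F).real {s})) := by
          ring
      _ ≤ c ^ 3 * n * 1 ^ 2 * (survLeft F s * survLeft G s * invSurv G s ^ 2) *
          (forward F (fun u => K u t) s ^ 2 * (1 - (hazard F).real {s})) := by gcongr
      _ = _ := by ring
  refine (lintegral_mono h2).trans ?_
  rw [lintegral_const, measure_univ, mul_one]
  have h5 : ∫⁻ s, ENNReal.ofReal (c ^ 3 * n * forward F (fun u => K u t) s ^ 2 * energyWeight F G s) ∂F
      ≤ ENNReal.ofReal (c ^ 3 * n) * ∫⁻ s, extInvSurv G s *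
        ENNReal.ofReal (forward F (fun u => K u t) s ^ 2 * (surv F s / survLeft F s)) ∂F := by
    rw [← lintegral_const_mul]
    · refine lintegral_mono fun s => ?_
      rw [mul_assoc, ENNReal.ofReal_mul (by positivity), ENNReal.ofReal_mul (sq_nonneg _),
        ENNReal.ofReal_mul (sq_nonneg _)]
      refine mul_le_mul' le_rfl ((mul_le_mul' le_rfl (ofReal_energyWeight_le s)).trans (le_of_eq ?_))
      ring
    · exact measurable_extInvSurv.mul ((hA.pow_const 2).mul ((measurable_surv F).div
        (measurable_survLeft F))).ennreal_ofReal
  exact h5.trans (mul_le_mul' le_rfl (lintegral_weight_forward_sq_le hF hKt monotone_extInvSurv))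

/-- The weighted square of the section integrals where few observations are at risk. -/
def sectionEnergy (F G : Measure ℝ) (K : ℝ → ℝ → ℝ) (β : ℝ → (Fin n → Obs) → ℝ) (a : ℝ)
    (ω : Fin n → Obs) : ℝ≥0∞ :=
  ∫⁻ t in {t | survLeft F t * survLeft G t < a}, extInvSurv G t *
    ENNReal.ofReal (sectionInt F K β t ω ^ 2) ∂F

lemma measurable_sectionEnergy_kernel (hK : Measurable (Function.uncurry K))
    (hβ : Measurable (Function.uncurry β)) : Measurable fun q : (Fin n → Obs) × ℝ =>
      extInvSurv G q.2 * ENNReal.ofReal (sectionInt F K β q.2 q.1 ^ 2) :=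
  (measurable_extInvSurv.comp measurable_snd).mul
    (((measurable_sectionInt hK hβ).comp measurable_swap).pow_const 2).ennreal_ofReal

lemma lintegral_sectionEnergy_le (hF : F (Iic 0) = 0) (hK : Measurable (Function.uncurry K))
    (hc : 0 ≤ c) (hβ : Dominated F G c (fun _ => 1) β) (a : ℝ) :
    ∫⁻ ω, sectionEnergy F G K β a ω ∂(Measure.pi fun _ : Fin n => obsModel F G)
      ≤ ENNReal.ofReal (c ^ 3 * n) * tailEnergy F G K a := by
  have hm := measurable_sectionEnergy_kernel (F := F) (G := G) hK hβ.meas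
  simp only [sectionEnergy, tailEnergy]
  rw [lintegral_lintegral_swap hm.aemeasurable, ← lintegral_const_mul]
  · refine lintegral_mono fun t => ?_
    simp only
    rw [lintegral_const_mul]
    · refine (mul_le_mul' le_rfl (lintegral_sectionInt_sq_le hF hK hc hβ t)).trans (le_of_eq ?_)
      ring
    · exact ((measurable_sectionInt hK hβ.meas).comp
        (measurable_const.prodMk measurable_id)).pow_const 2 |>.ennreal_ofReal
  · exact measurable_extInvSurv.mul (measurable_weight_sq hK).lintegral_prod_left'

lemma Ioi_subset_risk_lt {a x : ℝ} (hx : surv F x * surv G x < a) :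
    Ioi x ⊆ {t | survLeft F t * survLeft G t < a} := fun t ht =>
  lt_of_le_of_lt (mul_le_mul (survLeft_le_surv F ht) (survLeft_le_surv G ht) (survLeft_nonneg G t)
    (surv_nonneg F x)) hx

lemma measure_Ioi_mul (x : ℝ) : F (Ioi x) * G (Ioi x) = ENNReal.ofReal (surv F x * surv G x) := by
  rw [ENNReal.ofReal_mul (surv_nonneg F x), surv, surv, Measure.real, Measure.real,
    ENNReal.ofReal_toReal (measure_ne_top _ _), ENNReal.ofReal_toReal (measure_ne_top _ _)]

lemma Admissible.eq_zero (hK : Admissible F G K) {t : ℝ} (ht : G (Ici t) = 0) (s : ℝ) : K s t = 0 := by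
  by_contra h
  have h1 := hK.supp t s (by rwa [hK.symm])
  rw [survLeft, survLeft, Measure.real, Measure.real, ht] at h1
  simp at h1

lemma sectionInt_eq_zero (hK : Admissible F G K) {t : ℝ} (ht : G (Ici t) = 0) (ω : Fin n → Obs) :
    sectionInt F K β t ω = 0 := by
  have h : (fun u => K u t) = fun _ => 0 := funext fun u => hK.eq_zero ht u
  rw [sectionInt, h]
  have h2 : ∀ s, forward F (fun _ => (0:ℝ)) s = 0 := fun s => by simp [forward, tailMean]
  simp [h2, sampleInt, mart]

/-- Pathwise bound for the integral of the section integrals over a tail. -/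
lemma ofReal_integral_sectionInt_sq_le (hK : Admissible F G K) (hβ : Measurable (Function.uncurry β))
    {a x b : ℝ} (hx : surv F x * surv G x ≤ b) (hb : b < a) (ω : Fin n → Obs) :
    ENNReal.ofReal ((∫ t in Ioi x, sectionInt F K β t ω ∂F) ^ 2)
      ≤ ENNReal.ofReal b * sectionEnergy F G K β a ω := by
  have hm : Measurable fun t => sectionInt F K β t ω :=
    (measurable_sectionInt hK.meas hβ).comp (measurable_id.prodMk measurable_const)
  have e : ∀ y : ℝ, ‖y‖ₑ ^ 2 = ENNReal.ofReal (y ^ 2) := fun y => by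
    rw [← sq_abs, ENNReal.ofReal_pow (abs_nonneg _), ← Real.enorm_eq_ofReal_abs]
  calc ENNReal.ofReal ((∫ t in Ioi x, sectionInt F K β t ω ∂F) ^ 2)
      = ‖∫ t in Ioi x, sectionInt F K β t ω ∂F‖ₑ ^ 2 := (e _).symm
    _ ≤ (∫⁻ t in Ioi x, ‖sectionInt F K β t ω‖ₑ ∂F) ^ 2 :=
        pow_le_pow_left' (enorm_integral_le_lintegral_enorm _) 2
    _ ≤ F (Ioi x) * G (Ioi x) * ∫⁻ t in Ioi x, extInvSurv G t * ‖sectionInt F K β t ω‖ₑ ^ 2 ∂F :=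
        lintegral_Ioi_sq_le hm.enorm (fun t ht => by rw [sectionInt_eq_zero hK ht, enorm_zero]) x
    _ ≤ _ := by
        rw [measure_Ioi_mul, sectionEnergy]
        simp_rw [e]
        exact mul_le_mul' (ENNReal.ofReal_le_ofReal hx) (lintegral_mono_set
          (Ioi_subset_risk_lt (hx.trans_lt hb)))

/-- Tail bound for the integral of the section integrals over a tail. -/
lemma measure_integral_sectionInt_le (hF : F (Iic 0) = 0) [Nonempty (Fin n)] (hK : Admissible F G K)
    (hc : 0 ≤ c) (hβ : Dominated F G c (fun _ => 1) β) {a ℓ ε : ℝ} (hℓ : 0 ≤ ℓ) (ha : ℓ / n < a)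
    (hε : 0 < ε) :
    (Measure.pi fun _ : Fin n => obsModel F G) {ω | ∃ x, surv F x * surv G x ≤ ℓ / n ∧
        ε ≤ |∫ t in Ioi x, sectionInt F K β t ω ∂F|}
      ≤ ENNReal.ofReal (c ^ 3 * ℓ) * tailEnergy F G K a / ENNReal.ofReal (ε ^ 2) := by
  have hn : (0:ℝ) < n := by exact_mod_cast Fin.pos_iff_nonempty.2 ‹_›
  have he2 : ENNReal.ofReal (ε ^ 2) ≠ 0 := by
    rw [Ne, ENNReal.ofReal_eq_zero, not_le]; positivity
  have hm : Measurable fun ω => sectionEnergy F G K β a ω :=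
    (measurable_sectionEnergy_kernel hK.meas hβ.meas).lintegral_prod_right'
  refine (measure_mono (t := {ω | ENNReal.ofReal (ε ^ 2) ≤ ENNReal.ofReal (ℓ / n) *
    sectionEnergy F G K β a ω}) ?_).trans ((meas_ge_le_lintegral_div (hm.const_mul _).aemeasurable he2
      ENNReal.ofReal_ne_top).trans ?_)
  -- The bound by the section energy is pathwise and uniform in x, so x may later be the random last
  -- observation.
  · rintro ω ⟨x, hx, h⟩
    refine le_trans (ENNReal.ofReal_le_ofReal ?_) (ofReal_integral_sectionInt_sq_le hK hβ.meas hx ha ω)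
    rw [← sq_abs (∫ t in Ioi x, _ ∂F)]
    exact pow_le_pow_left₀ hε.le h 2
  · gcongr
    rw [lintegral_const_mul _ hm]
    -- The factor ℓ/n from Cauchy–Schwarz cancels the n of the second moment.
    refine (mul_le_mul' le_rfl (lintegral_sectionEnergy_le hF hK.meas hc hβ a)).trans (le_of_eq ?_)
    rw [← mul_assoc, ← ENNReal.ofReal_mul (by positivity)]
    congr 2
    field_simp

/-- Pathwise bound for the integral of the kernel over a tail. -/
lemma ofReal_integral_tail_sq_le (hK : Admissible F G K)
    {a x b : ℝ} (hb0 : 0 ≤ b) (hx : surv F x * surv G x ≤ b) (hb : b < a) :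
    ENNReal.ofReal ((∫ t in Ioi x, ∫ u in Ioi x, K u t ∂F ∂F) ^ 2)
      ≤ ENNReal.ofReal (b ^ 2) * tailEnergy F G K a := by
  have e : ∀ y : ℝ, ‖y‖ₑ ^ 2 = ENNReal.ofReal (y ^ 2) := fun y => by
    rw [← sq_abs, ENNReal.ofReal_pow (abs_nonneg _), ← Real.enorm_eq_ofReal_abs]
  have hKt : ∀ t, Measurable fun u => K u t := fun t =>
    hK.meas.comp (measurable_id.prodMk measurable_const)
  set f : ℝ → ℝ≥0∞ := fun t => ∫⁻ u in Ioi x, ‖K u t‖ₑ ∂F with hf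
  have hfm : Measurable f := Measurable.lintegral_prod_left' (f := fun q : ℝ × ℝ => ‖K q.1 q.2‖ₑ)
    hK.meas.enorm
  -- Cauchy–Schwarz is used in each variable and gains a factor b each time.
  have hf2 : ∀ t, f t ^ 2 ≤ ENNReal.ofReal b * ∫⁻ u, extInvSurv G u * ENNReal.ofReal (K u t ^ 2) ∂F := by
    intro t
    refine (lintegral_Ioi_sq_le (G := G) (hKt t).enorm (fun u hu => by
      rw [hK.symm, hK.eq_zero hu, enorm_zero]) x).trans ?_
    rw [measure_Ioi_mul]
    simp_rw [e]
    exact mul_le_mul' (ENNReal.ofReal_le_ofReal hx) (setLIntegral_le_lintegral _ _)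
  calc ENNReal.ofReal ((∫ t in Ioi x, ∫ u in Ioi x, K u t ∂F ∂F) ^ 2)
      = ‖∫ t in Ioi x, ∫ u in Ioi x, K u t ∂F ∂F‖ₑ ^ 2 := (e _).symm
    _ ≤ (∫⁻ t in Ioi x, f t ∂F) ^ 2 :=
        pow_le_pow_left' ((enorm_integral_le_lintegral_enorm _).trans
          (lintegral_mono fun t => enorm_integral_le_lintegral_enorm _)) 2
    _ ≤ F (Ioi x) * G (Ioi x) * ∫⁻ t in Ioi x, extInvSurv G t * f t ^ 2 ∂F :=
        lintegral_Ioi_sq_le hfm (fun t ht => by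
          simp only [hf, hK.eq_zero ht, enorm_zero, lintegral_zero]) x
    _ ≤ ENNReal.ofReal b * ∫⁻ t in {t | survLeft F t * survLeft G t < a}, ENNReal.ofReal b *
          (extInvSurv G t * ∫⁻ u, extInvSurv G u * ENNReal.ofReal (K u t ^ 2) ∂F) ∂F := by
        rw [measure_Ioi_mul]
        refine mul_le_mul' (ENNReal.ofReal_le_ofReal hx) ((lintegral_mono_set
          (Ioi_subset_risk_lt (hx.trans_lt hb))).trans (lintegral_mono fun t => ?_))
        rw [mul_left_comm]
        exact mul_le_mul' le_rfl (hf2 t)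
    _ = _ := by
        rw [lintegral_const_mul, tailEnergy, sq, ENNReal.ofReal_mul hb0, mul_assoc]
        exact measurable_extInvSurv.mul (measurable_weight_sq hK.meas).lintegral_prod_left'

/-! ### Linearity of the double integral -/

section Linear

variable {Λ : Measure ℝ} [SFinite Λ]

variable {ι : Type*} [Fintype ι] {ω : ι → Obs} {k k' : ℝ → ℝ → ℝ}

lemma doubleInt_congr (h : ∀ i j, ∀ s ≤ (ω i).1, ∀ t ≤ (ω j).1, k s t = k' s t) :
    doubleInt Λ k ω = doubleInt Λ k' ω :=
  Finset.sum_congr rfl fun j _ => Finset.sum_congr rfl fun i _ =>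
    mart_congr fun t ht => mart_congr fun s hs => h i j s hs t ht

lemma doubleInt_const_mul (c : ℝ) : doubleInt Λ (fun s t => c * k s t) ω = c * doubleInt Λ k ω := by
  simp only [doubleInt, mart_const_mul, Finset.mul_sum]

lemma doubleInt_add
    (hk : ∀ i j, Integrable (Function.uncurry k)
      ((totalMeasure Λ (ω i)).prod (totalMeasure Λ (ω j))))
    (hk' : ∀ i j, Integrable (Function.uncurry k')
      ((totalMeasure Λ (ω i)).prod (totalMeasure Λ (ω j)))) :
    doubleInt Λ (fun s t => k s t + k' s t) ω = doubleInt Λ k ω + doubleInt Λ k' ω := by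
  simp only [doubleInt, ← Finset.sum_add_distrib]
  refine Finset.sum_congr rfl fun j _ => Finset.sum_congr rfl fun i _ => ?_
  rw [← mart_add (integrable_totalMeasure.1 (integrable_mart_prod (hk i j)))
    (integrable_totalMeasure.1 (integrable_mart_prod (hk' i j)))]
  refine mart_congr_ae ?_
  filter_upwards [(hk i j).prod_left_ae, (hk' i j).prod_left_ae] with t h1 h2
  exact mart_add (integrable_totalMeasure.1 h1) (integrable_totalMeasure.1 h2)

lemma ae_totalMeasure_le (z : Obs) : ∀ᵐ s ∂(totalMeasure Λ z), s ≤ z.1 := by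
  rw [totalMeasure, ae_add_measure_iff]
  refine ⟨?_, ae_restrict_mem measurableSet_Iic⟩
  unfold jumpMeasure
  split_ifs
  · rw [ae_dirac_iff measurableSet_Iic]
  · simp

lemma integrable_mul_prod {z z' : Obs} {α β : ℝ → ℝ} {B : ℝ} (hα : Measurable α) (hβ : Measurable β)
    (hαB : ∀ s ≤ z.1, |α s| ≤ B) (hβB : ∀ s ≤ z'.1, |β s| ≤ B)
    (hk : Integrable (Function.uncurry k) ((totalMeasure Λ z).prod (totalMeasure Λ z'))) :
    Integrable (Function.uncurry fun s t => α s * β t * k s t)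
      ((totalMeasure Λ z).prod (totalMeasure Λ z')) := by
  refine (hk.norm.const_mul (B * B)).mono' (((hα.comp measurable_fst).mul
    (hβ.comp measurable_snd)).aestronglyMeasurable.mul hk.1) ?_
  filter_upwards [Measure.quasiMeasurePreserving_fst.ae (ae_totalMeasure_le (Λ := Λ) z),
    Measure.quasiMeasurePreserving_snd.ae (ae_totalMeasure_le (Λ := Λ) z')] with q h1 h2
  have h3 := hαB _ h1
  have h4 := hβB _ h2
  rw [Function.uncurry_def, norm_mul, norm_mul, Real.norm_eq_abs, Real.norm_eq_abs]
  exact mul_le_mul_of_nonneg_right (mul_le_mul h3 h4 (abs_nonneg _) ((abs_nonneg _).trans h3))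
    (norm_nonneg _)

end Linear

/-! ### Expansion of the remainder on a controlled sample -/

section Remainder

variable {F G : Measure ℝ} [IsProbabilityMeasure F] [IsProbabilityMeasure G] {n : ℕ}
  {K : ℝ → ℝ → ℝ} {ω : Fin n → Obs}

/-- The properties that almost every sample has. -/
structure RegularSample (F G : Measure ℝ) (K : ℝ → ℝ → ℝ) (ω : Fin n → Obs) : Prop
    extends Regular F ω where
  cens : ∀ j, 0 < survLeft G (ω j).1
  int : Integrable (Function.uncurry K) ((F + jumpSum ω).prod (F + jumpSum ω))

lemma invSurv_mono {s x : ℝ} (hx : 0 < survLeft G x) (h : s ≤ x) : invSurv G s ≤ invSurv G x :=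
  inv_anti₀ hx (survLeft_antitone G h)

lemma RegularSample.integrable_twoForward (hF : F (Iic 0) = 0) (hω : RegularSample F G K ω)
    (hK : Measurable (Function.uncurry K)) (i j : Fin n) :
    Integrable (Function.uncurry (twoForward F K))
      ((totalMeasure (hazard F) (ω i)).prod (totalMeasure (hazard F) (ω j))) :=
  KaplanMeier.integrable_twoForward hF hK (hω.surv i) (hω.surv j) (hω.int.mono_measure
    (Measure.prod_mono (add_le_add le_rfl (jumpMeasure_le ω i)) (add_le_add le_rfl (jumpMeasure_le ω j))))

lemma RegularSample.integrable_mul (hF : F (Iic 0) = 0) (hω : RegularSample F G K ω)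
    (hK : Measurable (Function.uncurry K)) {c : ℝ} (hc : 0 ≤ c) {α β : ℝ → ℝ} (hα : Measurable α)
    (hβ : Measurable β) (hαQ : ∀ s, |α s| ≤ c * invSurv G s) (hβQ : ∀ s, |β s| ≤ c * invSurv G s)
    (i j : Fin n) : Integrable (Function.uncurry fun s t => α s * β t * twoForward F K s t)
      ((totalMeasure (hazard F) (ω i)).prod (totalMeasure (hazard F) (ω j))) := by
  refine integrable_mul_prod (B := max (c * invSurv G (ω i).1) (c * invSurv G (ω j).1)) hα hβ
    (fun s hs => ?_) (fun s hs => ?_) (hω.integrable_twoForward hF hK i j)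
  · exact (hαQ s).trans ((mul_le_mul_of_nonneg_left (invSurv_mono (hω.cens i) hs) hc).trans
      (le_max_left _ _))
  · exact (hβQ s).trans ((mul_le_mul_of_nonneg_left (invSurv_mono (hω.cens j) hs) hc).trans
      (le_max_right _ _))

lemma RegularSample.integrable_dominated (hF : F (Iic 0) = 0) (hω : RegularSample F G K ω)
    (hK : Measurable (Function.uncurry K)) {c : ℝ} (hc : 0 ≤ c) {κ₁ κ₂ : ℝ → ℝ}
    (h1 : ∀ s, κ₁ s ≤ 2) (h2 : ∀ s, κ₂ s ≤ 2) {α β : ℝ → (Fin n → Obs) → ℝ}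
    (hα : Dominated F G c κ₁ α) (hβ : Dominated F G c κ₂ β) (i j : Fin n) :
    Integrable (Function.uncurry fun s t => α s ω * β t ω * twoForward F K s t)
      ((totalMeasure (hazard F) (ω i)).prod (totalMeasure (hazard F) (ω j))) := by
  have key : ∀ (κ : ℝ → ℝ) (α : ℝ → (Fin n → Obs) → ℝ), (∀ s, κ s ≤ 2) → Dominated F G c κ α →
      ∀ s, |α s ω| ≤ c * 2 * invSurv G s := fun κ α h hα s => by
    refine (hα.le s ω).trans ?_
    rw [mul_assoc]
    exact mul_le_mul_of_nonneg_left (mul_le_mul_of_nonneg_right (h s) (invSurv_nonneg s)) hc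
  exact hω.integrable_mul hF hK (by positivity) (measurable_section hα.meas ω)
    (measurable_section hβ.meas ω) (key κ₁ α h1 hα) (key κ₂ β h2 hβ) i j

lemma sectionInt_estPart {c a : ℝ} (hctrl : ∀ i, ∀ s ≤ (ω i).1, Controlled F G c a s ω) (t : ℝ) :
    sectionInt F K (estPart F G c a) t ω
      = n * sampleInt (hazard F) (fun s => kmJump s ω * forward F (fun u => K u t) s) ω := by
  rw [sectionInt, sampleInt, sampleInt, Finset.mul_sum]
  refine Finset.sum_congr rfl fun i _ => ?_
  rw [← mart_const_mul]
  refine mart_congr fun s hs => ?_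
  rw [estPart, controlledPart, if_pos (hctrl i s hs), mul_assoc]

/-- The remainder of the expansion of the second-order error, on a controlled sample. -/
lemma RegularSample.remainder_eq (hF : F (Iic 0) = 0) (hω : RegularSample F G K ω)
    (hK : Admissible F G K) {m : Fin n} (hm : ∀ j, (ω j).1 ≤ (ω m).1) {c a : ℝ} (hc : 1 ≤ c)
    (ha : 0 ≤ a) (ha1 : a ≤ 1) (hctrl : ∀ i, ∀ s ≤ (ω i).1, Controlled F G c a s ω) :
    (n : ℝ) * (integralDiff (kmMeasure ω) F (fun v => integralDiff (kmMeasure ω) F fun u => K u v)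
        - 1 / (n : ℝ) ^ 2 * doubleInt (hazard F)
            (fun s t => invSurv G s * invSurv G t * twoForward F K s t) ω)
      = doubleInt (hazard F) (fun s t => errorPart F G c a s ω * estPart F G c a t ω *
            twoForward F K s t) ω / n
        + doubleInt (hazard F) (fun s t => limPart F G c a s ω * errorPart F G c a t ω *
            twoForward F K s t) ω / n
        - 2 * (kmRight (ω m).1 ω / surv F (ω m).1) *
            ∫ t in Ioi (ω m).1, sectionInt F K (estPart F G c a) t ω ∂F
        + n * (kmRight (ω m).1 ω / surv F (ω m).1) ^ 2 *
            ∫ t in Ioi (ω m).1, ∫ u in Ioi (ω m).1, K u t ∂F ∂F := by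
  have hn : (0:ℝ) < n := by exact_mod_cast Fin.pos_iff_nonempty.2 ⟨m⟩
  have hc0 : 0 ≤ c := zero_le_one.trans hc
  have hE := dominated_errorPart (n := n) (F := F) (G := G) (a := a) hc0 ha
  have hB := dominated_estPart (n := n) (F := F) (G := G) (a := a) hc0
  have hL := dominated_limPart (n := n) (F := F) (G := G) (a := a) hc
  have h1le : ∀ _ : ℝ, (1:ℝ) ≤ 2 := fun _ => one_le_two
  have i1 := hω.integrable_dominated hF hK.meas hc0 (cutoff_le ha1) h1le hE hB
  have i2 := hω.integrable_dominated hF hK.meas hc0 h1le (cutoff_le ha1) hL hE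
  have i3 : ∀ i j, Integrable (Function.uncurry fun s t => invSurv G s * invSurv G t *
      twoForward F K s t) ((totalMeasure (hazard F) (ω i)).prod (totalMeasure (hazard F) (ω j))) :=
    hω.integrable_mul hF hK.meas zero_le_one measurable_invSurv measurable_invSurv
      (fun s => by rw [abs_of_nonneg (invSurv_nonneg s), one_mul])
      (fun s => by rw [abs_of_nonneg (invSurv_nonneg s), one_mul])
  -- With b = nq and l = 1/(1 - G(s-)): b(s)b(t) = l(s)l(t) + (b - l)(s) b(t) + l(s) (b - l)(t).
  have e1 : (n:ℝ) ^ 2 * doubleInt (hazard F) (fun s t => kmJump s ω * kmJump t ω * twoForward F K s t) ω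
      = doubleInt (hazard F) (fun s t => invSurv G s * invSurv G t * twoForward F K s t) ω
        + (doubleInt (hazard F) (fun s t => errorPart F G c a s ω * estPart F G c a t ω *
            twoForward F K s t) ω
          + doubleInt (hazard F) (fun s t => limPart F G c a s ω * errorPart F G c a t ω *
            twoForward F K s t) ω) := by
    rw [← doubleInt_const_mul, ← doubleInt_add i1 i2, ← doubleInt_add i3]
    · refine doubleInt_congr fun i j s hs t ht => ?_
      simp only [errorPart, estPart, limPart, controlledPart, if_pos (hctrl i s hs),
        if_pos (hctrl j t ht)]
      ring
    · exact fun i j => (i1 i j).add (i2 i j)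
  have e2 : ∫ t in Ioi (ω m).1, sectionInt F K (estPart F G c a) t ω ∂F
      = n * crossTerm F K (ω m).1 ω := by
    simp_rw [sectionInt_estPart hctrl, integral_const_mul]
    rfl
  rw [integralDiff_integralDiff_kmMeasure hF hω.toRegular hm hK.meas hK.symm hω.int, e2]
  field_simp
  linear_combination e1

end Remainder

/-! ### Almost sure regularity of the sample -/

section Regularity

variable {F G : Measure ℝ} [IsProbabilityMeasure F] [IsProbabilityMeasure G] {n : ℕ}
  {K : ℝ → ℝ → ℝ}

lemma one_le_extInvSurv (s : ℝ) : 1 ≤ extInvSurv G s := ENNReal.one_le_inv.2 prob_le_one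

lemma integrable_of_weight_sq (hK : Measurable (Function.uncurry K))
    (hfin : ∫⁻ t, extInvSurv G t * ∫⁻ s, extInvSurv G s * ENNReal.ofReal (K s t ^ 2) ∂F ∂F ≠ ∞) :
    Integrable (Function.uncurry K) (F.prod F) := by
  have h : ∫⁻ q, ENNReal.ofReal (Function.uncurry K q ^ 2) ∂(F.prod F) ≠ ∞ := by
    refine ne_top_of_le_ne_top hfin ?_
    rw [lintegral_prod_symm' _ (hK.pow_const 2).ennreal_ofReal]
    refine lintegral_mono fun t => ?_
    calc ∫⁻ s, ENNReal.ofReal (Function.uncurry K (s, t) ^ 2) ∂F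
        ≤ ∫⁻ s, extInvSurv G s * ENNReal.ofReal (K s t ^ 2) ∂F :=
          lintegral_mono fun s => le_mul_of_one_le_left' (one_le_extInvSurv s)
      _ ≤ _ := le_mul_of_one_le_left' (one_le_extInvSurv t)
  have h2 : Integrable (fun q => Function.uncurry K q ^ 2) (F.prod F) := by
    refine ⟨(hK.pow_const 2).aestronglyMeasurable, ?_⟩
    rw [hasFiniteIntegral_iff_ofReal (ae_of_all _ fun s => sq_nonneg _)]
    exact lt_top_iff_ne_top.2 h
  refine (h2.add (integrable_const (1:ℝ))).mono' hK.aestronglyMeasurable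
    (ae_of_all _ fun q => ?_)
  rw [Real.norm_eq_abs, Pi.add_apply]
  rcases abs_cases (Function.uncurry K q) with h | h <;>
    nlinarith [sq_nonneg (Function.uncurry K q - 1), sq_nonneg (Function.uncurry K q + 1)]

lemma Admissible.integrable (hK : Admissible F G K) : Integrable (Function.uncurry K) (F.prod F) :=
  integrable_of_weight_sq hK.meas hK.sq

/-- The uncensored observations have a law that is absolutely continuous with respect to `F`. -/
lemma ae_uncensored (hF : F (Iic 0) = 0) {p : ℝ → Prop} (hp : ∀ᵐ x ∂F, p x) :
    ∀ᵐ z ∂(obsModel F G), z.2 = true → p z.1 := by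
  have h1 : ((obsModel F G).restrict {z | z.2 = true}).map Prod.fst ≪ F := by
    rw [isHazard_obsModel (G := G) hF]
    exact (withDensity_absolutelyContinuous _ _).trans (hazard_absolutelyContinuous hF)
  exact (ae_restrict_iff' measurableSet_snd_true).1
    (ae_of_ae_map measurable_fst.aemeasurable (h1.ae_le hp))

lemma ae_pos (hF : F (Iic 0) = 0) (hG : G (Iic 0) = 0) : ∀ᵐ z ∂(obsModel F G), 0 < z.1 := by
  have h : ∀ᵐ q ∂(F.prod G), 0 < q.1 ∧ 0 < q.2 := by
    have h1 : ∀ᵐ x ∂F, 0 < x := by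
      rw [ae_iff]; simpa [Iic_def] using hF
    have h2 : ∀ᵐ x ∂G, 0 < x := by
      rw [ae_iff]; simpa [Iic_def] using hG
    exact (Measure.quasiMeasurePreserving_fst.ae h1).and (Measure.quasiMeasurePreserving_snd.ae h2)
  rw [obsModel, ae_map_iff measurable_censor.aemeasurable
    (measurableSet_lt measurable_const measurable_fst)]
  filter_upwards [h] with q hq
  exact lt_min hq.1 hq.2

lemma integrable_jumpSum (f : ℝ → ℝ) (ω : Fin n → Obs) : Integrable f (jumpSum ω) :=
  integrable_finsetSum_measure.2 fun _ _ => integrable_jumpMeasure f _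

/-- Jumps against jumps give finite sums, and jumps against F only involve sections of K at
uncensored times, in either variable by symmetry. Those sections are almost surely integrable since
the law of uncensored times is absolutely continuous with respect to F. -/
lemma integrable_add_jumpSum (hK : Admissible F G K) {ω : Fin n → Obs}
    (h : ∀ j, (ω j).2 = true → Integrable (K (ω j).1) F) :
    Integrable (Function.uncurry K) ((F + jumpSum ω).prod (F + jumpSum ω)) := by
  have hi := hK.integrable
  rw [integrable_prod_iff hK.meas.aestronglyMeasurable]
  constructor
  · rw [ae_add_measure_iff]
    refine ⟨?_, ?_⟩
    · filter_upwards [hi.prod_right_ae] with x hx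
      exact hx.add_measure (integrable_jumpSum _ ω)
    · rw [jumpSum, ae_finsetSum_measure_iff]
      intro j _
      unfold jumpMeasure
      split_ifs with hj
      · rw [ae_dirac_eq]
        exact (h j hj).add_measure (integrable_jumpSum _ ω)
      · simp
  · refine Integrable.add_measure ?_ (integrable_jumpSum _ ω)
    have e : (fun x => ∫ y, ‖Function.uncurry K (x, y)‖ ∂(F + jumpSum ω)) =ᵐ[F]
        fun x => (∫ y, ‖Function.uncurry K (x, y)‖ ∂F) +
          ∑ j, if (ω j).2 then ‖K x (ω j).1‖ else 0 := by
      filter_upwards [hi.prod_right_ae] with x hx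
      rw [integral_add_measure hx.norm (integrable_jumpSum _ ω), jumpSum,
        integral_finsetSum_measure fun i _ => integrable_jumpMeasure _ _]
      simp only [integral_jumpMeasure, Function.uncurry]
    refine Integrable.congr ?_ e.symm
    refine hi.norm.integral_prod_left.add (integrable_finsetSum _ fun j _ => ?_)
    by_cases hj : (ω j).2 = true
    · simp only [hj, if_true]
      simp_rw [hK.symm _ (ω j).1]
      exact (h j hj).norm
    · simp [hj]

/-- Almost every sample is regular. -/
lemma ae_regularSample (hF : F (Iic 0) = 0) (hG : G (Iic 0) = 0) (hK : Admissible F G K) :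
    ∀ᵐ ω ∂(Measure.pi fun _ : Fin n => obsModel F G), RegularSample F G K ω := by
  have h1 : ∀ᵐ z ∂(obsModel F G), 0 < z.1 ∧ 0 < survLeft F z.1 * survLeft G z.1 ∧
      (z.2 = true → Integrable (K z.1) F) := by
    filter_upwards [ae_pos hF hG, ae_riskProb_pos (μ := obsModel F G),
      ae_uncensored hF hK.integrable.prod_right_ae] with z a1 a2 a3
    refine ⟨a1, ?_, a3⟩
    rw [← toReal_riskProb_obsModel]
    exact ENNReal.toReal_pos a2.ne' (measure_ne_top _ _)
  have h2 : ∀ᵐ ω ∂(Measure.pi fun _ : Fin n => obsModel F G), ∀ j, 0 < (ω j).1 ∧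
      0 < survLeft F (ω j).1 * survLeft G (ω j).1 ∧ ((ω j).2 = true → Integrable (K (ω j).1) F) :=
    ae_all_iff.2 fun j => (measurePreserving_eval (fun _ : Fin n => obsModel F G)
      j).quasiMeasurePreserving.ae h1
  filter_upwards [h2] with ω hω
  exact ⟨⟨fun j => (hω j).1, fun j => pos_of_mul_pos_left (hω j).2.1 (survLeft_nonneg G _)⟩,
    fun j => pos_of_mul_pos_right (hω j).2.1 (survLeft_nonneg F _),
    integrable_add_jumpSum hK fun j => (hω j).2.2⟩

end Regularity

/-! ### Probability bound for the remainder -/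

section Convergence

variable {F G : Measure ℝ} [IsProbabilityMeasure F] [IsProbabilityMeasure G] {n : ℕ}
  {K : ℝ → ℝ → ℝ}

/-- Let y = S(s-)(1 - G(s-)), A = Ŝ(s-)/S(s-) and B = Y/(ny), so that nq = (A/B)/(1 - G(s-)). If y ≥
ℓ/n then B ≥ 1/2; otherwise Y ≥ 1 gives 1/B ≤ ny < ℓ. Thus A/B ≤ cℓ in all cases. If y ≥ a, then |A
- B| ≤ a/2 and B ≥ 3/4 give |A/B - 1| ≤ a. -/
lemma controlled_of {c ℓ a s : ℝ} {ω : Fin n → Obs} (hc : 1 ≤ c) (hℓ : 2 ≤ ℓ) (ha : 0 < a)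
    (ha1 : a ≤ 1) (hp : 0 < survLeft F s * survLeft G s) {j : Fin n} (hj : s ≤ (ω j).1)
    (h1 : ℓ / n ≤ survLeft F s * survLeft G s →
      |riskCount ω s / (n * (survLeft F s * survLeft G s)) - 1| ≤ 1 / 2)
    (h2 : riskCount ω s ≤ c * (n * (survLeft F s * survLeft G s)))
    (h3 : kmLeft s ω / survLeft F s ≤ c)
    (h4 : a ≤ survLeft F s * survLeft G s →
      |riskCount ω s / (n * (survLeft F s * survLeft G s)) - 1| ≤ a / 4)
    (h5 : a ≤ survLeft F s * survLeft G s → |kmLeft s ω / survLeft F s - 1| ≤ a / 4) :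
    Controlled F G (c * ℓ + 1) a s ω := by
  have hn : (0:ℝ) < n := by exact_mod_cast Fin.pos_iff_nonempty.2 ⟨j⟩
  have hSF : 0 < survLeft F s := pos_of_mul_pos_left hp (survLeft_nonneg G s)
  have hSG : 0 < survLeft G s := pos_of_mul_pos_right hp (survLeft_nonneg F s)
  have hr : 1 ≤ riskCount ω s := one_le_riskCount hj
  set A := kmLeft s ω / survLeft F s with hA
  set B := riskCount ω s / (n * (survLeft F s * survLeft G s)) with hB
  have hA0 : 0 ≤ A := div_nonneg (kmLeft_nonneg s ω) hSF.le
  have hB0 : 0 < B := by positivity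
  have hQ := invSurv_nonneg (G := G) s
  have e : n * kmJump s ω = A / B * invSurv G s := by
    rw [hA, hB, kmJump, invSurv]
    field_simp
  have hBinv : 1 / B ≤ ℓ := by
    rcases le_or_gt (ℓ / n) (survLeft F s * survLeft G s) with h | h
    · have := (abs_le.1 (h1 h)).1
      rw [div_le_iff₀ hB0]
      nlinarith
    · rw [hB, one_div_div, div_le_iff₀ (by linarith)]
      rw [lt_div_iff₀ hn] at h
      nlinarith
  have hAB : A / B ≤ c * ℓ := by
    rw [div_eq_mul_one_div]
    exact mul_le_mul h3 hBinv (by positivity) (by linarith)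
  have hAB0 : 0 ≤ A / B := by positivity
  refine ⟨h2.trans ?_, ?_, ?_⟩
  · refine mul_le_mul_of_nonneg_right ?_ (by positivity)
    nlinarith
  · rw [e]
    exact mul_le_mul_of_nonneg_right (by linarith) hQ
  · have e2 : n * kmJump s ω - invSurv G s = (A / B - 1) * invSurv G s := by rw [e]; ring
    rw [e2, abs_mul, abs_of_nonneg hQ, ← mul_assoc]
    refine mul_le_mul_of_nonneg_right ?_ hQ
    rw [cutoff]
    split_ifs with h
    · have : |A / B - 1| ≤ c * ℓ + 1 := by
        rw [abs_le]; constructor <;> nlinarith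
      nlinarith
    · push Not at h
      have hb := abs_le.1 (h4 h)
      have hb' := abs_le.1 (h5 h)
      have : |A / B - 1| ≤ a := by
        have e3 : A / B - 1 = (A - B) / B := by field_simp
        rw [e3, abs_div, abs_of_pos hB0, div_le_iff₀ hB0]
        have : |A - B| ≤ a / 2 := by
          rw [abs_le]; constructor <;> linarith
        nlinarith
      rw [add_zero]
      nlinarith

/-- Otherwise, just to the right of x, the risk probability would still be at least ℓ/n while nobody
is at risk, against the assumed closeness of Y to its mean. -/
lemma exceed_le_of {ℓ x : ℝ} {ω : Fin n → Obs} (hx : ∀ j, (ω j).1 ≤ x)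
    (h1 : ∀ s, ℓ / n ≤ survLeft F s * survLeft G s →
      |riskCount ω s / (n * (survLeft F s * survLeft G s)) - 1| ≤ 1 / 2) :
    surv F x * surv G x ≤ ℓ / n := by
  by_contra! hcon
  have hlim : Tendsto (fun k : ℕ => x + 1 / ((k : ℝ) + 1)) atTop (𝓝 x) := by
    simpa using tendsto_const_nhds.add (tendsto_one_div_add_atTop_nhds_zero_nat (𝕜 := ℝ))
  have hge : ∀ k : ℕ, x < x + 1 / ((k : ℝ) + 1) := fun k => lt_add_of_pos_right _ (by positivity)
  have h2 := (tendsto_surv_right (ν := F) (fun k => (hge k).le) hlim).mul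
    (tendsto_surv_right (ν := G) (fun k => (hge k).le) hlim)
  obtain ⟨k, hk⟩ := (h2.eventually_const_lt hcon).exists
  set t := x + 1 / ((k : ℝ) + 1)
  have h3 : ℓ / n ≤ survLeft F t * survLeft G t := hk.le.trans
    (mul_le_mul (surv_le_survLeft F t) (surv_le_survLeft G t) (surv_nonneg G t) (survLeft_nonneg F t))
  have h4 := h1 t h3
  rw [riskCount_eq_zero fun j => (hx j).trans_lt (hge k)] at h4
  norm_num at h4

/-- The remainder of the second-order error, scaled by the sample size. -/
def scaledRemainder (F G : Measure ℝ) (K : ℝ → ℝ → ℝ) (ω : Fin n → Obs) : ℝ :=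
  (n : ℝ) * (integralDiff (kmMeasure ω) F (fun v => integralDiff (kmMeasure ω) F fun u => K u v)
    - 1 / (n : ℝ) ^ 2 * doubleInt (hazard F)
        (fun s t => invSurv G s * invSurv G t * twoForward F K s t) ω)

/-- The part of the bound that is small when few observations are at risk at the cut. -/
def kernelBound (F G : Measure ℝ) (K : ℝ → ℝ → ℝ) (c b ℓ a ε : ℝ) : ℝ≥0∞ :=
  2 * (ENNReal.ofReal (b ^ 6) * energy F G (twoForward F K) (cutoff F G a) (fun _ => 1) /
      ENNReal.ofReal (ε ^ 2))
    + ENNReal.ofReal (b ^ 3) * diagEnergy F G (twoForward F K) (cutoff F G a) (fun _ => 1) /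
      ENNReal.ofReal ε
    + (2 * (ENNReal.ofReal (b ^ 6) * energy F G (twoForward F K) (fun _ => 1) (cutoff F G a) /
      ENNReal.ofReal (ε ^ 2))
    + ENNReal.ofReal (b ^ 3) * diagEnergy F G (twoForward F K) (cutoff F G a) (fun _ => 1) /
      ENNReal.ofReal ε)
    + ENNReal.ofReal (b ^ 3 * ℓ) * tailEnergy F G K a / ENNReal.ofReal ((ε / (2 * c)) ^ 2)

/-- The part of the bound that is small in large samples. -/
def sampleBound (n : ℕ) (a : ℝ) : ℝ≥0∞ :=
  ENNReal.ofReal (1 / (n * a) / (a / 4) ^ 2) + ENNReal.ofReal (6 / (n * a ^ 4) / (a / 4) ^ 2)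

lemma measure_scaledRemainder_le (hF : F (Iic 0) = 0) (hG : G (Iic 0) = 0) [Nonempty (Fin n)]
    (hK : Admissible F G K) {c ℓ a ε : ℝ} (hc : 1 ≤ c) (hℓ : 2 ≤ ℓ) (ha : 0 < a) (ha1 : a ≤ 1)
    (hna : ℓ / n < a) (hε : 0 < ε)
    (htail : ENNReal.ofReal (ℓ ^ 2) * tailEnergy F G K a ≤ ENNReal.ofReal ((ε / c ^ 2) ^ 2)) :
    (Measure.pi fun _ : Fin n => obsModel F G) {ω | 8 * ε < |scaledRemainder F G K ω|}
      ≤ ENNReal.ofReal (4 / ℓ) + ENNReal.ofReal (1 / c) + ENNReal.ofReal (1 / c)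
        + kernelBound F G K c (c * ℓ + 1) ℓ a ε + sampleBound n a := by
  have hn : (0:ℝ) < n := by exact_mod_cast Fin.pos_iff_nonempty.2 ‹_›
  have hc0 : 0 < c := by linarith
  have hℓ0 : 0 < ℓ := by linarith
  set b := c * ℓ + 1 with hb
  have hb1 : 1 ≤ b := by have : 0 ≤ c * ℓ := by positivity
                         linarith
  have hb0 : 0 ≤ b := by linarith
  set P := Measure.pi fun _ : Fin n => obsModel F G with hP
  have hkm : Measurable (Function.uncurry (twoForward F K)) := measurable_twoForward hK.meas
  have hE := dominated_errorPart (n := n) (F := F) (G := G) (a := a) hb0 ha.le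
  have hB := dominated_estPart (n := n) (F := F) (G := G) (a := a) hb0
  have hL := dominated_limPart (n := n) (F := F) (G := G) (a := a) hb1
  have hreg := ae_regularSample (n := n) hF hG hK
  have h1le : ∀ _ : ℝ, (1:ℝ) ≤ 2 := fun _ => one_le_two
  have hκ0 := cutoff_nonneg (F := F) (G := G) ha.le
  have hκm := measurable_cutoff (F := F) (G := G) a
  have h01 : ∀ _ : ℝ, (0:ℝ) ≤ 1 := fun _ => zero_le_one
  -- the exceptional events
  set U1 := {ω : Fin n → Obs | ∃ s, ℓ / n ≤ (riskProb (obsModel F G) s).toReal ∧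
    1 / 2 < |riskCount ω s / (Fintype.card (Fin n) * (riskProb (obsModel F G) s).toReal) - 1|} with hU1
  set U2 := {ω : Fin n → Obs | ∃ s, 0 < (riskProb (obsModel F G) s).toReal ∧
    c * (Fintype.card (Fin n) * (riskProb (obsModel F G) s).toReal) < riskCount ω s} with hU2
  set U3 := {ω : Fin n → Obs | ∃ m, (∀ j, (ω j).1 ≤ (ω m).1) ∧
    ((∃ s ≤ (ω m).1, 0 < survLeft F s ∧ c < kmLeft s ω / survLeft F s) ∨
      c < kmRight (ω m).1 ω / surv F (ω m).1)} with hU3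
  set U4 := {ω : Fin n → Obs | ∃ s, a ≤ (riskProb (obsModel F G) s).toReal ∧
    a / 4 < |riskCount ω s / (Fintype.card (Fin n) * (riskProb (obsModel F G) s).toReal) - 1|} with hU4
  set U5 := {ω : Fin n → Obs | ∃ m, (∀ j, (ω j).1 ≤ (ω m).1) ∧ ∃ s ≤ (ω m).1,
    a ≤ (riskProb (obsModel F G) s).toReal ∧ a / 4 < |kmLeft s ω / survLeft F s - 1|} with hU5
  set V1 := {ω : Fin n → Obs | 3 * ε < |doubleInt (hazard F) (fun s t => errorPart F G b a s ω *
    estPart F G b a t ω * twoForward F K s t) ω / n|} with hV1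
  set V2 := {ω : Fin n → Obs | 3 * ε < |doubleInt (hazard F) (fun s t => limPart F G b a s ω *
    errorPart F G b a t ω * twoForward F K s t) ω / n|} with hV2
  set V3 := {ω : Fin n → Obs | ∃ x, surv F x * surv G x ≤ ℓ / n ∧
    ε / (2 * c) ≤ |∫ t in Ioi x, sectionInt F K (estPart F G b a) t ω ∂F|} with hV3
  -- Off the exceptional events the sample is controlled at all its times, and the four terms of the
  -- expansion are bounded by 3ε, 3ε, ε and ε.
  have hsub : ∀ᵐ ω ∂P, ω ∈ {ω | 8 * ε < |scaledRemainder F G K ω|} →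
      ω ∈ U1 ∪ U2 ∪ U3 ∪ (V1 ∪ V2 ∪ V3) ∪ (U4 ∪ U5) := by
    filter_upwards [hreg] with ω hω hlarge
    by_contra hcon
    simp only [mem_union, not_or] at hcon
    obtain ⟨⟨⟨⟨n1, n2⟩, n3⟩, ⟨v1, v2⟩, v3⟩, n4, n5⟩ := hcon
    simp only [hU1, hU2, hU3, hU4, hU5, hV1, hV2, hV3, mem_ofPred_eq, not_exists, not_and, not_lt,
      not_le, toReal_riskProb_obsModel, Fintype.card_fin, not_or] at n1 n2 n3 n4 n5 v1 v2 v3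
    obtain ⟨m, hm⟩ := exists_max ω
    have hctrl : ∀ i, ∀ s ≤ (ω i).1, Controlled F G b a s ω := fun i s hs => by
      have hp : 0 < survLeft F s * survLeft G s :=
        mul_pos ((hω.surv i).trans_le (survLeft_antitone F hs))
          ((hω.cens i).trans_le (survLeft_antitone G hs))
      exact controlled_of hc hℓ ha ha1 hp hs (n1 s) (n2 s hp)
        ((n3 m hm).1 s (hs.trans (hm i)) ((hω.surv i).trans_le (survLeft_antitone F hs))) (n4 s)
        (n5 m hm s (hs.trans (hm i)))
    have hx : surv F (ω m).1 * surv G (ω m).1 ≤ ℓ / n :=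
      exceed_le_of hm n1
    set R := kmRight (ω m).1 ω / surv F (ω m).1 with hR
    have hR0 : 0 ≤ R := div_nonneg (kmRight_nonneg _ _) (surv_nonneg F _)
    have hRc : R ≤ c := (n3 m hm).2
    set T := ∫ t in Ioi (ω m).1, sectionInt F K (estPart F G b a) t ω ∂F with hT
    set E := ∫ t in Ioi (ω m).1, ∫ u in Ioi (ω m).1, K u t ∂F ∂F with hEdef
    have hTle : |T| < ε / (2 * c) := v3 _ hx
    -- The n from the scaling cancels the n in ℓ/n, so smallness comes from the tail energy alone,
    -- through `htail`.
    have hEle : |E * n| ≤ ε / c ^ 2 := by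
      have h := (ofReal_integral_tail_sq_le hK (a := a) (by positivity) hx hna)
      have h2 : ENNReal.ofReal ((E * n) ^ 2) ≤ ENNReal.ofReal ((ε / c ^ 2) ^ 2) := by
        calc ENNReal.ofReal ((E * n) ^ 2) = ENNReal.ofReal ((n:ℝ) ^ 2) * ENNReal.ofReal (E ^ 2) := by
              rw [← ENNReal.ofReal_mul (by positivity)]
              congr 1; ring
          _ ≤ ENNReal.ofReal ((n:ℝ) ^ 2) * (ENNReal.ofReal ((ℓ / n) ^ 2) * tailEnergy F G K a) :=
              mul_le_mul' le_rfl h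
          _ = ENNReal.ofReal (ℓ ^ 2) * tailEnergy F G K a := by
              rw [← mul_assoc, ← ENNReal.ofReal_mul (by positivity)]
              congr 2; field_simp
          _ ≤ _ := htail
      rw [ENNReal.ofReal_le_ofReal_iff (by positivity)] at h2
      exact abs_le_of_sq_le_sq h2 (by positivity)
    have hfin : scaledRemainder F G K ω = _ := hω.remainder_eq hF hK hm hb1 ha.le ha1 hctrl
    have hlarge' : 8 * ε < |scaledRemainder F G K ω| := hlarge
    rw [hfin] at hlarge'
    have b3 : |2 * R * T| ≤ ε := by
      rw [abs_mul, abs_mul, abs_two, abs_of_nonneg hR0]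
      calc 2 * R * |T| ≤ 2 * c * (ε / (2 * c)) := by gcongr
        _ = ε := by field_simp
    have b4 : |n * R ^ 2 * E| ≤ ε := by
      have : n * R ^ 2 * E = R ^ 2 * (E * n) := by ring
      rw [this, abs_mul, abs_of_nonneg (sq_nonneg R)]
      calc R ^ 2 * |E * n| ≤ c ^ 2 * (ε / c ^ 2) := by gcongr
        _ = ε := by field_simp
    rw [abs_le] at v1 v2 b3 b4
    rcases lt_abs.1 hlarge' with h | h <;> linarith [v1.1, v1.2, v2.1, v2.2, b3.1, b3.2, b4.1, b4.2]
  -- At the level a = ℓ/n the variance bound 1/(na)/δ² does not depend on n.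
  have c1 : P U1 ≤ ENNReal.ofReal (4 / ℓ) := by
    refine (measure_riskCount_far_le (μ := obsModel F G) (ι := Fin n) (a := ℓ / n) (by positivity)
      (δ := 1 / 2) (by norm_num)).trans (ENNReal.ofReal_le_ofReal (le_of_eq ?_))
    rw [Fintype.card_fin]
    field_simp
    norm_num
  have c2 : P U2 ≤ ENNReal.ofReal (1 / c) := measure_riskCount_large_le hc0
  have c3 : P U3 ≤ ENNReal.ofReal (1 / c) := measure_kmLeft_large_le hF hc0
  have c4 : P U4 ≤ ENNReal.ofReal (1 / (n * a) / (a / 4) ^ 2) := by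
    refine (measure_riskCount_far_le (μ := obsModel F G) (ι := Fin n) ha (δ := a / 4)
      (by positivity)).trans (le_of_eq ?_)
    rw [Fintype.card_fin]
  have c5 : P U5 ≤ ENNReal.ofReal (6 / (n * a ^ 4) / (a / 4) ^ 2) :=
    measure_kmLeft_far_le hF ha (by positivity)
  have d1 := measure_doubleInt_ge_le hF hkm hκm measurable_const hκ0 h01 hb0 hE hB
    (by filter_upwards [hreg] with ω hω using
      hω.integrable_dominated hF hK.meas hb0 (cutoff_le ha1) h1le hE hB) hε
  have d2 := measure_doubleInt_ge_le hF hkm measurable_const hκm h01 hκ0 hb0 hL hE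
    (by filter_upwards [hreg] with ω hω using
      hω.integrable_dominated hF hK.meas hb0 h1le (cutoff_le ha1) hL hE) hε
  rw [diagEnergy_comm] at d2
  have d3 := measure_integral_sectionInt_le (n := n) hF hK hb0 hB (a := a) (ε := ε / (2 * c)) hℓ0.le hna
    (by positivity)
  refine (measure_mono_ae hsub).trans ((measure_union_le _ _).trans (add_le_add
    ((measure_union_le _ _).trans (add_le_add ?_ ?_)) ?_))
  · exact (measure_union_le _ _).trans (add_le_add ((measure_union_le _ _).trans (add_le_add c1 c2)) c3)
  · exact (measure_union_le _ _).trans (add_le_add ((measure_union_le _ _).trans (add_le_add d1 d2)) d3)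
  · exact (measure_union_le _ _).trans (add_le_add c4 c5)

end Convergence

/-! ### Passage to the limit -/

section Limit

variable {F G : Measure ℝ} [IsProbabilityMeasure F] [IsProbabilityMeasure G] {n : ℕ}
  {K : ℝ → ℝ → ℝ}

lemma tendsto_const_mul_div_zero {u : ℕ → ℝ≥0∞} (hu : Tendsto u atTop (𝓝 0)) (x : ℝ) {y : ℝ}
    (hy : 0 < y) : Tendsto (fun j => ENNReal.ofReal x * u j / ENNReal.ofReal y) atTop (𝓝 0) := by
  have h := ENNReal.Tendsto.div_const (ENNReal.Tendsto.const_mul (a := ENNReal.ofReal x) hu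
    (Or.inr ENNReal.ofReal_ne_top)) (b := ENNReal.ofReal y) (Or.inr (by simpa using hy))
  simpa using h

lemma tendsto_kernelBound (hF : F (Iic 0) = 0) (hK : Admissible F G K) {c : ℝ} (hc : 0 < c) (b ℓ : ℝ)
    {ε : ℝ} (hε : 0 < ε) :
    Tendsto (fun j : ℕ => kernelBound F G K c b ℓ (1 / ((j : ℝ) + 1)) ε) atTop (𝓝 0) := by
  have hkm : Measurable (Function.uncurry (twoForward F K)) := measurable_twoForward hK.meas
  have h1 := tendsto_const_mul_div_zero (tendsto_energy hkm (hK.energy_ne_top hF)) (b ^ 6)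
    (pow_pos hε 2)
  have h2 := tendsto_const_mul_div_zero (tendsto_diagEnergy hkm hK.diag) (b ^ 3) hε
  have h3 := tendsto_const_mul_div_zero (tendsto_energy_right hkm (hK.energy_ne_top hF)) (b ^ 6)
    (pow_pos hε 2)
  have h4 := tendsto_const_mul_div_zero hK.tendsto_tailEnergy (b ^ 3 * ℓ)
    (y := (ε / (2 * c)) ^ 2) (by positivity)
  have h1' := ENNReal.Tendsto.const_mul (a := 2) h1 (Or.inr (by simp))
  have h3' := ENNReal.Tendsto.const_mul (a := 2) h3 (Or.inr (by simp))
  have := ((h1'.add h2).add (h3'.add h2)).add h4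
  simpa [kernelBound] using this

lemma tendsto_sampleBound {a : ℝ} (ha : 0 < a) :
    Tendsto (fun n : ℕ => sampleBound n a) atTop (𝓝 0) := by
  have h0 := tendsto_one_div_atTop_nhds_zero_nat (𝕜 := ℝ)
  have h1 := ENNReal.tendsto_ofReal (h0.mul_const (1 / a / (a / 4) ^ 2))
  have h2 := ENNReal.tendsto_ofReal (h0.mul_const (6 / a ^ 4 / (a / 4) ^ 2))
  have h := h1.add h2
  rw [zero_mul, zero_mul, ENNReal.ofReal_zero, add_zero] at h
  refine h.congr fun n => ?_
  rw [sampleBound]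
  congr 2 <;> field_simp

/-- The scaled remainder tends to zero in probability under the model. -/
theorem tendsto_measure_scaledRemainder (hF : F (Iic 0) = 0) (hG : G (Iic 0) = 0)
    (hK : Admissible F G K) {ε : ℝ} (hε : 0 < ε) :
    Tendsto (fun n : ℕ => (Measure.pi fun _ : Fin n => obsModel F G)
      {ω | ε < |scaledRemainder F G K ω|}) atTop (𝓝 0) := by
  obtain ⟨ε, rfl⟩ : ∃ e, ε = 8 * e := ⟨ε / 8, by ring⟩
  have hε : 0 < ε := by linarith
  rw [ENNReal.tendsto_nhds_zero]
  intro η hη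
  have hη3 : 0 < η / 3 := ENNReal.div_pos hη.ne' (by simp)
  have hA : Tendsto (fun k : ℕ => ENNReal.ofReal (4 / (4 * ((k : ℝ) + 1))) +
      ENNReal.ofReal (1 / ((k : ℝ) + 1)) + ENNReal.ofReal (1 / ((k : ℝ) + 1))) atTop (𝓝 0) := by
    have h0 := ENNReal.tendsto_ofReal (tendsto_one_div_add_atTop_nhds_zero_nat (𝕜 := ℝ))
    have h := (h0.add h0).add h0
    rw [ENNReal.ofReal_zero, add_zero, add_zero] at h
    refine h.congr fun k => ?_
    congr 3
    field_simp
  obtain ⟨k, hk⟩ := ((ENNReal.tendsto_nhds_zero.1 hA) _ hη3).exists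
  -- The order of the choices: c makes the exceptional events rare uniformly in n, with ℓ = 4c so
  -- that 4/ℓ = 1/c. Then a small a makes the energies at low risk negligible, and only then n
  -- grows.
  set c : ℝ := (k : ℝ) + 1 with hc
  have hc1 : 1 ≤ c := by have : (0:ℝ) ≤ k := by positivity
                         linarith
  have hc0 : 0 < c := by linarith
  set ℓ : ℝ := 4 * c with hℓ
  have hT := ENNReal.Tendsto.const_mul (a := ENNReal.ofReal (ℓ ^ 2)) hK.tendsto_tailEnergy
    (Or.inr ENNReal.ofReal_ne_top)
  rw [mul_zero] at hT
  have hpos : 0 < ENNReal.ofReal ((ε / c ^ 2) ^ 2) := by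
    rw [ENNReal.ofReal_pos]; positivity
  obtain ⟨j, hj1, hj2⟩ := (((ENNReal.tendsto_nhds_zero.1
    (tendsto_kernelBound hF hK hc0 (c * ℓ + 1) ℓ hε)) _ hη3).and
      ((ENNReal.tendsto_nhds_zero.1 hT) _ hpos)).exists
  set a : ℝ := 1 / ((j : ℝ) + 1) with ha
  have ha0 : 0 < a := by positivity
  have hdiv : Tendsto (fun n : ℕ => ℓ / (n : ℝ)) atTop (𝓝 0) := tendsto_const_div_atTop_nhds_zero_nat ℓ
  filter_upwards [(ENNReal.tendsto_nhds_zero.1 (tendsto_sampleBound ha0)) _ hη3,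
    hdiv.eventually_lt_const ha0, eventually_gt_atTop 0] with n h1 h2 h3
  have : Nonempty (Fin n) := Fin.pos_iff_nonempty.1 h3
  refine (measure_scaledRemainder_le hF hG hK hc1 (by linarith) ha0 (one_div_succ_le_one j) h2 hε
    hj2).trans ?_
  calc _ ≤ η / 3 + η / 3 + η / 3 := add_le_add (add_le_add hk hj1) h1
    _ = η := ENNReal.add_thirds η

end Limit

/-! ### Restriction of the kernel to the observable range -/

section Restriction

variable {F G : Measure ℝ} [IsProbabilityMeasure F] [IsProbabilityMeasure G] {n : ℕ}
  {K : ℝ → ℝ → ℝ}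

/-- The restriction of a kernel to the range of the observations. -/
def restrictKernel (F G : Measure ℝ) (K : ℝ → ℝ → ℝ) (s t : ℝ) : ℝ :=
  (obsRange F G).indicator (fun t => (obsRange F G).indicator (fun s => K s t) s) t

lemma measurableSet_obsRange : MeasurableSet (obsRange F G) := by
  have e : obsRange F G = {t | 0 < t ∧ 0 < survLeft F t * survLeft G t} := by
    ext t; exact mem_obsRange
  rw [e]
  exact measurableSet_Ioi.inter (measurableSet_lt measurable_const
    ((measurable_survLeft F).mul (measurable_survLeft G)))

lemma restrictKernel_of_mem {s t : ℝ} (hs : s ∈ obsRange F G) (ht : t ∈ obsRange F G) :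
    restrictKernel F G K s t = K s t := by
  rw [restrictKernel, indicator_of_mem ht, indicator_of_mem hs]

lemma restrictKernel_of_notMem_left {s : ℝ} (hs : s ∉ obsRange F G) (t : ℝ) :
    restrictKernel F G K s t = 0 := by
  rw [restrictKernel]
  by_cases ht : t ∈ obsRange F G
  · rw [indicator_of_mem ht, indicator_of_notMem hs]
  · rw [indicator_of_notMem ht]

lemma restrictKernel_of_notMem_right {t : ℝ} (ht : t ∉ obsRange F G) (s : ℝ) :
    restrictKernel F G K s t = 0 := by
  rw [restrictKernel, indicator_of_notMem ht]

lemma measurable_restrictKernel (hK : Measurable (Function.uncurry K)) :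
    Measurable (Function.uncurry (restrictKernel F G K)) := by
  have e : Function.uncurry (restrictKernel F G K)
      = (obsRange F G ×ˢ obsRange F G).indicator (Function.uncurry K) := by
    ext ⟨s, t⟩
    by_cases hs : s ∈ obsRange F G
    · by_cases ht : t ∈ obsRange F G
      · rw [indicator_of_mem (mk_mem_prod hs ht)]
        exact restrictKernel_of_mem hs ht
      · rw [indicator_of_notMem fun h => ht h.2]
        exact restrictKernel_of_notMem_right ht s
    · rw [indicator_of_notMem fun h => hs h.1]
      exact restrictKernel_of_notMem_left hs t
  rw [e]
  exact hK.indicator (measurableSet_obsRange.prod measurableSet_obsRange)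

lemma setIntegral_restrictKernel_left {A : Set ℝ} {t : ℝ}
    (ht : t ∈ obsRange F G) :
    ∫ s in A, restrictKernel F G K s t ∂F = ∫ s in obsRange F G ∩ A, K s t ∂F := by
  have e : (fun s => restrictKernel F G K s t) = (obsRange F G).indicator fun s => K s t := by
    ext s; rw [restrictKernel, indicator_of_mem ht]
  rw [e, integral_indicator measurableSet_obsRange, Measure.restrict_restrict measurableSet_obsRange]

lemma setIntegral_restrictKernel_right {A : Set ℝ} {s : ℝ}
    (hs : s ∈ obsRange F G) :
    ∫ t in A, restrictKernel F G K s t ∂F = ∫ t in obsRange F G ∩ A, K s t ∂F := by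
  have e : (fun t => restrictKernel F G K s t) = (obsRange F G).indicator fun t => K s t := by
    ext t; rw [restrictKernel]; congr 1; ext t; rw [indicator_of_mem hs]
  rw [e, integral_indicator measurableSet_obsRange, Measure.restrict_restrict measurableSet_obsRange]

/-- Extension by zero turns integrals over (x,∞) into integrals over I_H ∩ (x,∞), while the
denominators stay those of F. The results for kernels on the whole line thus apply to the K' of the
theorem. -/
lemma twoForward_restrictKernel (hi : Integrable (Function.uncurry (restrictKernel F G K)) (F.prod F))
    {s t : ℝ} (hs : Integrable (restrictKernel F G K s) F) (hsI : s ∈ obsRange F G)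
    (htI : t ∈ obsRange F G) :
    twoForward F (restrictKernel F G K) s t = forwardKernel K F G s t := by
  rw [twoForward_eq hi hs, forwardKernel, restrictKernel_of_mem hsI htI,
    setIntegral_restrictKernel_left htI,
    setIntegral_restrictKernel_right hsI]
  congr 2
  have e : (fun u => ∫ v in Ioi t, restrictKernel F G K u v ∂F)
      = (obsRange F G).indicator fun u => ∫ v in obsTail F G t, K u v ∂F := by
    ext u
    by_cases hu : u ∈ obsRange F G
    · rw [indicator_of_mem hu, setIntegral_restrictKernel_right hu]; rfl
    · rw [indicator_of_notMem hu]
      simp [restrictKernel_of_notMem_left hu]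
  rw [e, integral_indicator measurableSet_obsRange, Measure.restrict_restrict measurableSet_obsRange]
  rfl

lemma ae_pos_law (hF : F (Iic 0) = 0) : ∀ᵐ x ∂F, 0 < x := by
  rw [ae_iff]; simpa [Iic_def] using hF

lemma survLeft_pos_of_mem {t : ℝ} (ht : t ∈ obsRange F G) : 0 < survLeft F t ∧ 0 < survLeft G t :=
  have h := (mem_obsRange.1 ht).2
  ⟨pos_of_mul_pos_left h (survLeft_nonneg G t), pos_of_mul_pos_right h (survLeft_nonneg F t)⟩

lemma lintegral_weight_sq_restrictKernel :
    ∫⁻ t, extInvSurv G t * ∫⁻ s, extInvSurv G s *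
        ENNReal.ofReal (restrictKernel F G K s t ^ 2) ∂F ∂F
      = ∫⁻ y in obsRange F G, ∫⁻ x in obsRange F G,
        ENNReal.ofReal (K x y ^ 2 / (survLeft G x * survLeft G y)) ∂F ∂F := by
  rw [← lintegral_indicator measurableSet_obsRange]
  refine lintegral_congr fun t => ?_
  by_cases ht : t ∈ obsRange F G
  · have hGt := (survLeft_pos_of_mem ht).2
    rw [indicator_of_mem ht, ← lintegral_indicator measurableSet_obsRange, extInvSurv_eq hGt,
      ← lintegral_const_mul' _ _ ENNReal.ofReal_ne_top]
    refine lintegral_congr fun s => ?_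
    by_cases hs : s ∈ obsRange F G
    · rw [indicator_of_mem hs, restrictKernel_of_mem hs ht, extInvSurv_eq (survLeft_pos_of_mem hs).2,
        ← ENNReal.ofReal_mul (invSurv_nonneg s), ← ENNReal.ofReal_mul (invSurv_nonneg t), invSurv,
        invSurv]
      congr 1
      have := (survLeft_pos_of_mem hs).2
      field_simp
    · rw [indicator_of_notMem hs, restrictKernel_of_notMem_left hs]
      simp
  · rw [indicator_of_notMem ht]
    simp [restrictKernel_of_notMem_right ht]

/-- The square condition is preserved exactly. On the diagonal, 1 - H(t-) = S(t-)(1 - G(t-))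
identifies the two weights, and the energy weight vanishes at positive t outside I_H. -/
lemma admissible_restrictKernel (hF : F (Iic 0) = 0) (hK : Measurable (Function.uncurry K))
    (hsymm : ∀ x y, 0 < x → 0 < y → K x y = K y x) (hcond : DegenerateCondition K F G) :
    Admissible F G (restrictKernel F G K) := by
  have hm := measurable_restrictKernel (F := F) (G := G) hK
  have hsq := hcond.1.ne
  rw [← lintegral_weight_sq_restrictKernel] at hsq
  have hi := integrable_of_weight_sq hm hsq
  refine ⟨hm, fun s t => ?_, fun s t h => ?_, hsq, ?_⟩
  · by_cases hs : s ∈ obsRange F G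
    · by_cases ht : t ∈ obsRange F G
      · rw [restrictKernel_of_mem hs ht, restrictKernel_of_mem ht hs, hsymm s t hs.1 ht.1]
      · rw [restrictKernel_of_notMem_right ht, restrictKernel_of_notMem_left ht]
    · rw [restrictKernel_of_notMem_left hs, restrictKernel_of_notMem_right hs]
  · by_contra hcon
    exact h (restrictKernel_of_notMem_left (fun hs => hcon (mem_obsRange.1 hs).2) t)
  · refine ne_of_eq_of_ne ?_ hcond.2.ne
    rw [diagEnergy, ← lintegral_indicator measurableSet_obsRange]
    refine lintegral_congr_ae ?_
    filter_upwards [ae_pos_law hF, hi.prod_right_ae] with t ht hti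
    by_cases htI : t ∈ obsRange F G
    · rw [indicator_of_mem htI, twoForward_restrictKernel hi hti htI htI, energyWeight, invSurv,
        survLeft_obsLaw]
      congr 1
      have h1 := (survLeft_pos_of_mem htI).1
      have h2 := (survLeft_pos_of_mem htI).2
      field_simp
    · rw [indicator_of_notMem htI]
      have : energyWeight F G t = 0 := by
        by_contra hne
        exact htI (mem_obsRange.2 ⟨ht, energyWeight_ne_zero hne⟩)
      simp [this]

end Restriction

/-! ### Identification with the quantities of the theorem -/

section Identification

variable {F G : Measure ℝ} [IsProbabilityMeasure F] [IsProbabilityMeasure G] {n : ℕ}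
  {K : ℝ → ℝ → ℝ} {ω : Fin n → Obs}

/-- The pair of observed time and censoring indicator. -/
def obsPair (z : Obs) : ℝ × ℝ := (z.1, if z.2 then 1 else 0)

lemma jumpPart_obsPair {z : Obs} (hz : z.1 ∈ obsRange F G) :
    jumpPart F G (obsPair z) = jumpMeasure z := by
  have e : ENNReal.ofReal (obsPair z).2 • Measure.dirac (obsPair z).1 = jumpMeasure z := by
    rw [jumpMeasure, obsPair]
    split_ifs <;> simp
  rw [jumpPart, e]
  refine Measure.restrict_eq_self_of_ae_mem ?_
  rw [jumpMeasure]
  split_ifs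
  · exact (ae_dirac_iff (p := (· ∈ obsRange F G)) measurableSet_obsRange).2 hz
  · simp

/-- I_H is an interval with left end 0, so below one of its points it imposes no condition but
positivity. -/
lemma obsRange_inter_Iic {x : ℝ} (hx : x ∈ obsRange F G) : obsRange F G ∩ Iic x = Ioc 0 x := by
  ext s
  refine ⟨fun h => ⟨h.1.1, h.2⟩, fun h => ⟨mem_obsRange.2 ⟨h.1, ?_⟩, h.2⟩⟩
  exact mul_pos ((survLeft_pos_of_mem hx).1.trans_le (survLeft_antitone F h.2))
    ((survLeft_pos_of_mem hx).2.trans_le (survLeft_antitone G h.2))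

lemma compensatorPart_obsPair (hF : F (Iic 0) = 0) {z : Obs} (hz : z.1 ∈ obsRange F G) :
    compensatorPart F G (obsPair z) = (hazard F).restrict (Iic z.1) := by
  rw [compensatorPart, show (obsPair z).1 = z.1 from rfl, obsRange_inter_Iic hz]
  refine Measure.restrict_congr_set ?_
  have h0 : ∀ᵐ s ∂(hazard F), 0 < s := (hazard_absolutelyContinuous hF).ae_le (ae_pos_law hF)
  filter_upwards [h0] with s hs
  exact propext ⟨fun h => h.2, fun h => ⟨hs, h⟩⟩

lemma RegularSample.mem_obsRange (hω : RegularSample F G K ω) (i : Fin n) :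
    (ω i).1 ∈ obsRange F G :=
  KaplanMeier.mem_obsRange.2 ⟨hω.pos i, mul_pos (hω.surv i) (hω.cens i)⟩

/-- It transfers properties valid F-almost everywhere and at the jump times to the measures against
which the V-statistic kernel is integrated. -/
lemma RegularSample.totalMeasure_absolutelyContinuous (hF : F (Iic 0) = 0) (i : Fin n) :
    totalMeasure (hazard F) (ω i) ≪ F + jumpSum ω := by
  rw [totalMeasure, Measure.AbsolutelyContinuous.add_left_iff]
  refine ⟨?_, ?_⟩
  · exact (Measure.absolutelyContinuous_of_le (jumpMeasure_le ω i)).trans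
      (Measure.absolutelyContinuous_of_le (Measure.le_add_left le_rfl))
  · exact (Measure.absolutelyContinuous_of_le Measure.restrict_le_self).trans
      ((hazard_absolutelyContinuous hF).trans
        (Measure.absolutelyContinuous_of_le (Measure.le_add_right le_rfl)))

lemma RegularSample.ae_mem_obsRange (hF : F (Iic 0) = 0) (hω : RegularSample F G K ω) (i : Fin n) :
    ∀ᵐ s ∂(totalMeasure (hazard F) (ω i)), s ∈ obsRange F G := by
  have h0 : ∀ᵐ s ∂(totalMeasure (hazard F) (ω i)), 0 < s := by
    suffices h1 : ∀ᵐ s ∂(F + jumpSum ω), 0 < s by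
      exact (RegularSample.totalMeasure_absolutelyContinuous hF i).ae_le h1
    rw [ae_add_measure_iff]
    refine ⟨ae_pos_law hF, ?_⟩
    rw [jumpSum, ae_finsetSum_measure_iff]
    intro j _
    unfold jumpMeasure
    split_ifs
    · rw [ae_dirac_iff measurableSet_Ioi]; exact hω.pos j
    · simp
  filter_upwards [h0, ae_totalMeasure_le (ω i)] with s h1 h2
  have h3 : s ∈ obsRange F G ∩ Iic (ω i).1 := by
    rw [obsRange_inter_Iic (hω.mem_obsRange i)]; exact ⟨h1, h2⟩
  exact h3.1

lemma RegularSample.ae_integrable (hF : F (Iic 0) = 0) (hω : RegularSample F G K ω) (i : Fin n) :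
    ∀ᵐ s ∂(totalMeasure (hazard F) (ω i)), Integrable (K s) F := by
  refine (RegularSample.totalMeasure_absolutelyContinuous hF i).ae_le ?_
  filter_upwards [hω.int.prod_right_ae] with s hs
  exact hs.mono_measure (Measure.le_add_right le_rfl)

lemma weightedKernel_eq (hi : Integrable (Function.uncurry (restrictKernel F G K)) (F.prod F))
    {s t : ℝ} (hs : Integrable (restrictKernel F G K s) F) (hsI : s ∈ obsRange F G)
    (htI : t ∈ obsRange F G) :
    weightedKernel K F G s t
      = invSurv G s * invSurv G t * twoForward F (restrictKernel F G K) s t := by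
  rw [twoForward_restrictKernel hi hs hsI htI, weightedKernel, invSurv, invSurv]
  have h1 := (survLeft_pos_of_mem hsI).2
  have h2 := (survLeft_pos_of_mem htI).2
  field_simp

lemma RegularSample.integrable_weightedKernel (hF : F (Iic 0) = 0)
    (hK : Admissible F G (restrictKernel F G K)) (hω : RegularSample F G (restrictKernel F G K) ω)
    (i j : Fin n) : Integrable (Function.uncurry (weightedKernel K F G))
      ((jumpPart F G (obsPair (ω i)) + compensatorPart F G (obsPair (ω i))).prod
        (jumpPart F G (obsPair (ω j)) + compensatorPart F G (obsPair (ω j)))) := by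
  have e : ∀ i, jumpPart F G (obsPair (ω i)) + compensatorPart F G (obsPair (ω i))
      = totalMeasure (hazard F) (ω i) := fun i => by
    rw [jumpPart_obsPair (hω.mem_obsRange i), compensatorPart_obsPair hF (hω.mem_obsRange i)]; rfl
  rw [e, e]
  have hQ : ∀ s, |invSurv G s| ≤ 1 * invSurv G s := fun s => by
    rw [abs_of_nonneg (invSurv_nonneg s), one_mul]
  have h := hω.integrable_mul hF hK.meas zero_le_one measurable_invSurv measurable_invSurv hQ hQ i j
  refine h.congr ?_
  filter_upwards [Measure.quasiMeasurePreserving_fst.ae (hω.ae_mem_obsRange hF i),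
    Measure.quasiMeasurePreserving_fst.ae (hω.ae_integrable hF i),
    Measure.quasiMeasurePreserving_snd.ae (hω.ae_mem_obsRange hF j)] with q h1 h2 h3
  exact (weightedKernel_eq hK.integrable h2 h1 h3).symm

lemma RegularSample.sum_vKernel (hF : F (Iic 0) = 0)
    (hK : Admissible F G (restrictKernel F G K)) (hω : RegularSample F G (restrictKernel F G K) ω) :
    ∑ i, ∑ j, vKernel K F G (obsPair (ω i)) (obsPair (ω j)) = doubleInt (hazard F)
      (fun s t => invSurv G s * invSurv G t * twoForward F (restrictKernel F G K) s t) ω := by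
  rw [Finset.sum_comm, doubleInt]
  refine Finset.sum_congr rfl fun j _ => Finset.sum_congr rfl fun i _ => ?_
  rw [vKernel, jumpPart_obsPair (hω.mem_obsRange i), compensatorPart_obsPair hF (hω.mem_obsRange i),
    jumpPart_obsPair (hω.mem_obsRange j), compensatorPart_obsPair hF (hω.mem_obsRange j)]
  simp_rw [← mart_eq_integralDiff]
  refine mart_congr_ae ?_
  filter_upwards [hω.ae_mem_obsRange hF j] with t ht
  refine mart_congr_ae ?_
  filter_upwards [hω.ae_mem_obsRange hF i, hω.ae_integrable hF i] with s h1 h2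
  exact weightedKernel_eq hK.integrable h2 h1 ht

lemma integralDiff_restrict {μ ν : Measure ℝ} {A : Set ℝ} (hA : MeasurableSet A) (f : ℝ → ℝ) :
    integralDiff (μ.restrict A) (ν.restrict A) f = integralDiff μ ν (A.indicator f) := by
  rw [integralDiff, integralDiff, integral_indicator hA, integral_indicator hA]

lemma secondOrderError_eq (ω : Fin n → Obs) : secondOrderError K F G (obsX ω) (obsD ω)
    = integralDiff (kmMeasure ω) F fun v => integralDiff (kmMeasure ω) F fun u =>
      restrictKernel F G K u v := by
  have e : estimator (obsX ω) (obsD ω) = kmMeasure ω := estimator_eq ω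
  rw [secondOrderError, e, integralDiff_restrict measurableSet_obsRange]
  congr 1
  ext v
  by_cases hv : v ∈ obsRange F G
  · rw [indicator_of_mem hv, integralDiff_restrict measurableSet_obsRange]
    congr 1
    ext u
    rw [restrictKernel, indicator_of_mem hv]
  · rw [indicator_of_notMem hv]
    simp [restrictKernel_of_notMem_right hv, integralDiff]

lemma RegularSample.scaledRemainder_eq (hF : F (Iic 0) = 0)
    (hK : Admissible F G (restrictKernel F G K)) (hω : RegularSample F G (restrictKernel F G K) ω) :
    (n : ℝ) * (secondOrderError K F G (obsX ω) (obsD ω) - 1 / (n : ℝ) ^ 2 *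
        ∑ i, ∑ j, vKernel K F G (obsPair (ω i)) (obsPair (ω j)))
      = scaledRemainder F G (restrictKernel F G K) ω := by
  rw [secondOrderError_eq, hω.sum_vKernel hF hK, scaledRemainder]

lemma RegularSample.integrable_kernel (hω : RegularSample F G (restrictKernel F G K) ω) :
    Integrable (Function.uncurry K)
      (((estimator (obsX ω) (obsD ω) + F).restrict (obsRange F G)).prod
        ((estimator (obsX ω) (obsD ω) + F).restrict (obsRange F G))) := by
  have e : estimator (obsX ω) (obsD ω) = kmMeasure ω := estimator_eq ω
  have hle : kmMeasure ω + F ≤ F + jumpSum ω := by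
    rw [add_comm]; exact add_le_add le_rfl (kmMeasure_le ω)
  have hle' := (Measure.restrict_le_self (μ := kmMeasure ω + F) (s := obsRange F G)).trans hle
  rw [e]
  refine (hω.int.mono_measure (Measure.prod_mono hle' hle')).congr ?_
  have h := ae_restrict_mem (μ := kmMeasure ω + F) (measurableSet_obsRange (F := F) (G := G))
  filter_upwards [Measure.quasiMeasurePreserving_fst.ae h, Measure.quasiMeasurePreserving_snd.ae h]
    with q h1 h2
  exact restrictKernel_of_mem h1 h2

end Identification

/-! ### Transfer to the underlying probability space -/

section Law

variable {Ω : Type*} [MeasurableSpace Ω] {P : Measure Ω} [IsProbabilityMeasure P]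
  {F G : Measure ℝ} [IsProbabilityMeasure F] [IsProbabilityMeasure G]

/-- The first `n` censored observations. -/
def sample (T C : ℕ → Ω → ℝ) (n : ℕ) (ω : Ω) : Fin n → Obs := fun i => censor (T i ω, C i ω)

lemma measurable_sample {T C : ℕ → Ω → ℝ} (hT : ∀ i, Measurable (T i)) (hC : ∀ i, Measurable (C i))
    (n : ℕ) : Measurable (sample T C n) :=
  measurable_pi_iff.2 fun i => measurable_censor.comp ((hT i).prodMk (hC i))

/-- The censored observations are independent with the law of the model. -/
lemma map_sample {T C : ℕ → Ω → ℝ} (hTm : ∀ i, Measurable (T i)) (hCm : ∀ i, Measurable (C i))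
    (hTF : ∀ i, P.map (T i) = F) (hCG : ∀ i, P.map (C i) = G) (hT : iIndepFun T P)
    (hC : iIndepFun C P) (hTC : IndepFun (fun ω i => T i ω) (fun ω i => C i ω) P) (n : ℕ) :
    P.map (sample T C n) = Measure.pi fun _ : Fin n => obsModel F G := by
  have hTn : Measurable fun ω (i : Fin n) => T i ω := measurable_pi_iff.2 fun i => hTm i
  have hCn : Measurable fun ω (i : Fin n) => C i ω := measurable_pi_iff.2 fun i => hCm i
  have h1 : P.map (fun ω (i : Fin n) => T i ω) = Measure.pi fun _ : Fin n => F := by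
    have := (iIndepFun_iff_map_fun_eq_pi_map fun i : Fin n => (hTm i).aemeasurable).1
      (hT.precomp Fin.val_injective)
    simpa only [hTF] using this
  have h2 : P.map (fun ω (i : Fin n) => C i ω) = Measure.pi fun _ : Fin n => G := by
    have := (iIndepFun_iff_map_fun_eq_pi_map fun i : Fin n => (hCm i).aemeasurable).1
      (hC.precomp Fin.val_injective)
    simpa only [hCG] using this
  have hr : Measurable fun (x : ℕ → ℝ) (i : Fin n) => x i :=
    measurable_pi_iff.2 fun i => measurable_pi_apply _
  have h3 : IndepFun (fun ω (i : Fin n) => T i ω) (fun ω (i : Fin n) => C i ω) P := hTC.comp hr hr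
  have h4 := (indepFun_iff_map_prod_eq_prod_map_map hTn.aemeasurable hCn.aemeasurable).1 h3
  rw [h1, h2] at h4
  -- The pair of independent vectors is regrouped into a vector of independent pairs.
  have h5 := (measurePreserving_arrowProdEquivProdArrow ℝ ℝ (Fin n) (fun _ => F) fun _ => G).symm
  have h6 : P.map (fun ω (i : Fin n) => (T i ω, C i ω)) = Measure.pi fun _ : Fin n => F.prod G := by
    rw [← h5.map_eq, ← h4, Measure.map_map (MeasurableEquiv.measurable _) (hTn.prodMk hCn)]
    rfl
  have h7 : (Measure.pi fun _ : Fin n => F.prod G).map (fun x i => censor (x i))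
      = Measure.pi fun _ : Fin n => obsModel F G := by
    have : ∀ _ : Fin n, SigmaFinite ((F.prod G).map censor) := fun _ => by
      change SigmaFinite (obsModel F G); infer_instance
    exact Measure.pi_map_pi (f := fun _ => censor) fun _ => measurable_censor.aemeasurable
  have hcm : Measurable fun (x : Fin n → ℝ × ℝ) i => censor (x i) :=
    measurable_pi_iff.2 fun i => measurable_censor.comp (measurable_pi_apply i)
  have hTC' : Measurable fun ω (i : Fin n) => (T i ω, C i ω) :=
    measurable_pi_iff.2 fun i => (hTm i).prodMk (hCm i)
  rw [← h7, ← h6, Measure.map_map hcm hTC']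
  rfl

end Law

section Observed

variable {Ω : Type*} {T C X Δ : ℕ → Ω → ℝ}

lemma obsX_sample (hX : ∀ i ω, X i ω = obsTime (T i ω) (C i ω)) (n : ℕ) (ω : Ω) :
    obsX (sample T C n ω) = fun i : Fin n => X i ω :=
  funext fun i => (hX i ω).symm

lemma obsD_sample (hΔ : ∀ i ω, Δ i ω = obsInd (T i ω) (C i ω)) (n : ℕ) (ω : Ω) :
    obsD (sample T C n ω) = fun i : Fin n => Δ i ω :=
  funext fun i => by
    rw [hΔ, obsInd, obsD, sample, censor]
    by_cases h : T i ω ≤ C i ω <;> simp [h]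

lemma obsPair_sample (hX : ∀ i ω, X i ω = obsTime (T i ω) (C i ω))
    (hΔ : ∀ i ω, Δ i ω = obsInd (T i ω) (C i ω)) {n : ℕ} (ω : Ω) (i : Fin n) :
    obsPair (sample T C n ω i) = (X i ω, Δ i ω) :=
  Prod.ext (congrFun (obsX_sample hX n ω) i) (congrFun (obsD_sample hΔ n ω) i)

end Observed

end

end KaplanMeier

/-! ### The asymptotic V-statistic representation -/

theorem mainTheorem3 {Ω : Type*} [MeasurableSpace Ω] (P : Measure Ω) [IsProbabilityMeasure P]
    (F G : Measure ℝ) (hF : F (Iic 0) = 0) (hG : G (Iic 0) = 0)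
    (T C : ℕ → Ω → ℝ)
    (hTm : ∀ i, Measurable (T i)) (hCm : ∀ i, Measurable (C i))
    (hTF : ∀ i, P.map (T i) = F) (hCG : ∀ i, P.map (C i) = G)
    (hT : iIndepFun T P) (hC : iIndepFun C P)
    (hTC : IndepFun (fun ω i => T i ω) (fun ω i => C i ω) P)
    (X Δ : ℕ → Ω → ℝ)
    (hX : ∀ i ω, X i ω = KaplanMeier.obsTime (T i ω) (C i ω))
    (hΔ : ∀ i ω, Δ i ω = KaplanMeier.obsInd (T i ω) (C i ω))
    (K : ℝ → ℝ → ℝ) (hK : Measurable (Function.uncurry K))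
    (hKsymm : ∀ x y, 0 < x → 0 < y → K x y = K y x)
    (hcond : KaplanMeier.DegenerateCondition K F G) :
    -- the double integral that defines the error converges absolutely, almost surely
    (∀ n : ℕ, ∀ᵐ ω ∂P, Integrable (Function.uncurry K)
      (((KaplanMeier.estimator (fun i : Fin n => X i ω) (fun i : Fin n => Δ i ω) + F).restrict
          (KaplanMeier.obsRange F G)).prod
        ((KaplanMeier.estimator (fun i : Fin n => X i ω) (fun i : Fin n => Δ i ω) + F).restrict
          (KaplanMeier.obsRange F G)))) ∧
    -- the double integrals that define the V-statistic converge absolutely, almost surely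
    (∀ i j : ℕ, ∀ᵐ ω ∂P, Integrable (Function.uncurry (KaplanMeier.weightedKernel K F G))
      ((KaplanMeier.jumpPart F G (X i ω, Δ i ω) +
          KaplanMeier.compensatorPart F G (X i ω, Δ i ω)).prod
        (KaplanMeier.jumpPart F G (X j ω, Δ j ω) +
          KaplanMeier.compensatorPart F G (X j ω, Δ j ω)))) ∧
    -- the error is the V-statistic plus a remainder that is `o_P(1 / n)`
    TendstoInMeasure P
      (fun (n : ℕ) ω => (n : ℝ) *
        (KaplanMeier.secondOrderError K F G (fun i : Fin n => X i ω) (fun i : Fin n => Δ i ω) -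
          1 / (n : ℝ) ^ 2 * ∑ i : Fin n, ∑ j : Fin n,
            KaplanMeier.vKernel K F G (X i ω, Δ i ω) (X j ω, Δ j ω)))
      atTop (fun _ => (0 : ℝ)) := by
  have hPF : IsProbabilityMeasure F :=
    hTF 0 ▸ Measure.isProbabilityMeasure_map (hTm 0).aemeasurable
  have hPG : IsProbabilityMeasure G :=
    hCG 0 ▸ Measure.isProbabilityMeasure_map (hCm 0).aemeasurable
  have hA := KaplanMeier.admissible_restrictKernel hF hK hKsymm hcond
  have hlaw := KaplanMeier.map_sample hTm hCm hTF hCG hT hC hTC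
  have hm := KaplanMeier.measurable_sample hTm hCm
  have hreg : ∀ n, ∀ᵐ ω ∂P, KaplanMeier.RegularSample F G (KaplanMeier.restrictKernel F G K)
      (KaplanMeier.sample T C n ω) := fun n => by
    refine ae_of_ae_map (hm n).aemeasurable ?_
    rw [hlaw]
    exact KaplanMeier.ae_regularSample hF hG hA
  have eX := KaplanMeier.obsX_sample hX
  have eD := KaplanMeier.obsD_sample hΔ
  refine ⟨fun n => ?_, fun i j => ?_, ?_⟩
  · filter_upwards [hreg n] with ω hω
    have h := hω.integrable_kernel
    rwa [eX, eD] at h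
  -- The first max(i, j) + 1 observations contain both indices.
  · filter_upwards [hreg (max i j + 1)] with ω hω
    have h := hω.integrable_weightedKernel hF hA
      ⟨i, Nat.lt_succ_of_le (le_max_left i j)⟩ ⟨j, Nat.lt_succ_of_le (le_max_right i j)⟩
    rwa [KaplanMeier.obsPair_sample hX hΔ, KaplanMeier.obsPair_sample hX hΔ] at h
  · rw [tendstoInMeasure_iff_dist]
    intro ε hε
    -- The threshold ε/2 passes from the event with ≤ to the one with a strict inequality.
    refine tendsto_of_tendsto_of_tendsto_of_le_of_le tendsto_const_nhds
      (KaplanMeier.tendsto_measure_scaledRemainder hF hG hA (half_pos hε)) (fun n => zero_le)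
      fun n => ?_
    simp only
    rw [← hlaw n]
    -- No measurability of the event is needed: the measure of a preimage is at most the image
    -- measure of the set.
    refine le_trans (measure_mono_ae ?_) (Measure.le_map_apply (hm n).aemeasurable _)
    filter_upwards [hreg n] with ω hω h
    have h1 := hω.scaledRemainder_eq hF hA
    simp only [eX, eD, KaplanMeier.obsPair_sample hX hΔ] at h1
    have h2 : ε ≤ |KaplanMeier.scaledRemainder F G (KaplanMeier.restrictKernel F G K)
        (KaplanMeier.sample T C n ω)| := by
      rw [← h1, ← Real.norm_eq_abs, ← dist_zero_right]
      exact h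
    exact (half_lt_self hε).trans_le h2
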